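/- Conventions. A manifold with corners is a second countable Hausdorff space with a smooth atlas valued in open subsets of $[0,\infty)^n$, all of whose boundary hypersurfaces (closures of connected components of the set of points of codimension one) are embedded. A p-submanifold of $M$ is a closed subset $P\subset M$ (possibly empty or disconnected) such that around each of its points there are coordinates of $M$, each valued in $\mathbb R$ or in $[0,\infty)$, in which $P$ is given by the vanishing of some of the coordinates. Two p-submanifolds $P,Q$ intersect cleanly if $P\cap Q$ is a p-submanifold with $T_p(P\cap Q)=T_pP\cap T_pQ$ for all $p\in P\cap Q$. The blow-up $[M;P]=(M\setminus P)\cup S_+P$, where $S_+P$ is the inward-pointing spherical normal bundle of $P$, has the smooth structure given by the projective coordinates normal to $P$, and comes with the blow-down map $\beta:[M;P]\to M$. The lift of $S\subset M$ to $[M;P]$ is $\beta^{-1}(S)$ if $S\subset P$, and the closure of $\beta^{-1}(S\setminus P)$ otherwise. The iterated blow-up $[M;P_1,\dots,P_N]=[\cdots[[M;P_1];P_2];\cdots;P_N]$ is obtained by successively blowing up the lifts of $P_1,\dots,P_N$; it is defined if each $P_k$ lifts to a p-submanifold of $[M;P_1,\dots,P_{k-1}]$. A b-map $f:X\to Y$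 is a smooth map such that for every boundary hypersurface $H$ of $Y$ with boundary defining function $\rho_H$ one has $f^*\rho_H=a\prod_{H'}\rho_{H'}^{e_{HH'}}$ with $0<a\in C^\infty(X)$ and $e_{HH'}\in\mathbb N_0$, the product being over the boundary hypersurfaces $H'$ of $X$ (if there are infinitely many of these, the formula is required near each point $x$, over those $H'$ that contain $x$, with the same exponents for all $x$). Theorem. Let $M$ be a manifold with corners, and let $\mathcal P$ be a finite set of p-submanifolds of $M$ which intersect pairwise cleanly, and such that $P\cap Q\in\mathcal P$ whenever $P,Q\in\mathcal P$ and $P\cap Q\neq\emptyset$. A size order on $\mathcal P$ is a total order $P_1<\dots<P_N$ of the elements of $\mathcal P$ that extends the partial order by inclusion. (i) For every size order $P_1<\dots<P_N$ on $\mathcal P$ the iterated blow-up $[M;P_1,\dots,P_N]$ is defined, and the iterated blow-ups for any two size orders on $\mathcal P$ are canonically diffeomorphic: there is a unique diffeomorphism between them that commutes with the blow-down maps to $M$. Write $[M;\mathcal P]$ for the result. (ii) Let $\mathcal Q\subset\mathcal P$ be such that $P\cap Q\in\mathcal Q$ whenever $P,Q\in\mathcal Q$ and $P\cap Q\neq\emptyset$.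 Then there is a unique b-map $[M;\mathcal P]\to[M;\mathcal Q]$ whose composition with the blow-down map $[M;\mathcal Q]\to M$ is the blow-down map $[M;\mathcal P]\to M$. -/

import Mathlib

open scoped Manifold ContDiff Topology
open Set

universe u

/-! ### Manifolds with corners -/

/-- The model with corners `[0, ∞)^n ⊆ ℝ^n`. -/
abbrev QM (n : ℕ) : ModelWithCorners ℝ (EuclideanSpace ℝ (Fin n)) (EuclideanQuadrant n) :=
  modelWithCornersEuclideanQuadrant n

section Corners

variable {n : ℕ} {M : Type u} [TopologicalSpace M] [ChartedSpace (EuclideanQuadrant n) M]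

variable (n) in
/-- The codimension of a point: the number of its coordinates (in a chart) that vanish. -/
noncomputable def cornerCodim (p : M) : ℕ :=
  {i : Fin n | (chartAt (EuclideanQuadrant n) p p).1 i = 0}.ncard

variable (n) in
/-- A boundary hypersurface: the closure of a connected component of the set of points of
codimension one. -/
def IsBoundaryHypersurface (H : Set M) : Prop :=
  ∃ p : M, cornerCodim n p = 1 ∧ H = closure (connectedComponentIn {q : M | cornerCodim n q = 1} p)

variable (n) in
/-- `H` is embedded, i.e. has no self-intersection: near each of its points it is given by the
vanishing of a single boundary coordinate. -/
def IsEmbeddedHypersurface (H : Set M) : Prop :=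
  ∀ p ∈ H, ∃ φ ∈ IsManifold.maximalAtlas (QM n) ∞ M, p ∈ φ.source ∧
    ∃ i : Fin n, (φ p).1 i = 0 ∧ H ∩ φ.source = {q ∈ φ.source | (φ q).1 i = 0}

end Corners

/-- An `n`-dimensional manifold with corners: a second countable Hausdorff space with a smooth
atlas valued in `[0, ∞)^n`, all of whose boundary hypersurfaces are embedded. -/
structure CornerManifold (n : ℕ) : Type (u + 1) where
  carrier : Type u
  [topologicalSpace : TopologicalSpace carrier]
  [chartedSpace : ChartedSpace (EuclideanQuadrant n) carrier]
  [t2Space : T2Space carrier]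
  [secondCountable : SecondCountableTopology carrier]
  [isManifold : IsManifold (QM n) ∞ carrier]
  embedded : ∀ H : Set carrier, IsBoundaryHypersurface n H → IsEmbeddedHypersurface n H

instance CornerManifold.instCoeSort {n : ℕ} : CoeSort (CornerManifold.{u} n) (Type u) :=
  ⟨CornerManifold.carrier⟩

attribute [instance] CornerManifold.topologicalSpace
attribute [instance] CornerManifold.chartedSpace
attribute [instance] CornerManifold.t2Space
attribute [instance] CornerManifold.secondCountable
attribute [instance] CornerManifold.isManifold

/-! ### p-submanifolds and clean intersection -/

section PSubmanifolds

variable {n : ℕ} {M : CornerManifold.{u} n}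

/-- The smooth chart `φ` around `p` is a product-type chart for `P`: in it, `P` is given by
fixing the coordinates with index in `I`. (A coordinate `i` with `φ p i = 0` is a boundary
coordinate at `p`; one with `φ p i > 0` is an interior, `ℝ`-valued, coordinate, and
`φ q i - φ p i` is the corresponding coordinate centred at `p`.) -/
def IsAdaptedChart (P : Set M) (p : M) (φ : OpenPartialHomeomorph M (EuclideanQuadrant n))
    (I : Set (Fin n)) : Prop :=
  φ ∈ IsManifold.maximalAtlas (QM n) ∞ M ∧ p ∈ φ.source ∧
    P ∩ φ.source = {q ∈ φ.source | ∀ i ∈ I, (φ q).1 i = (φ p).1 i}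

/-- A p-submanifold: a closed set with a product-type chart around each of its points. -/
def IsPSubmanifold (P : Set M) : Prop :=
  IsClosed P ∧ ∀ p ∈ P, ∃ φ I, IsAdaptedChart P p φ I

/-- The tangent space at `p` of a subset `P`, in the preferred chart at `p`: the linear span of
the limits of secant directions. For a p-submanifold this is the usual tangent space `T_p P`,
i.e. the common kernel of the differentials of the defining coordinates. -/
noncomputable def tangentSpan (P : Set M) (p : M) : Submodule ℝ (EuclideanSpace ℝ (Fin n)) :=
  Submodule.span ℝ (tangentConeAt ℝ
    (extChartAt (QM n) p '' (P ∩ (extChartAt (QM n) p).source)) (extChartAt (QM n) p p))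

/-- `P` and `Q` intersect cleanly: `P ∩ Q` is a p-submanifold with
`T_p (P ∩ Q) = T_p P ∩ T_p Q`. -/
def IntersectCleanly (P Q : Set M) : Prop :=
  IsPSubmanifold (P ∩ Q) ∧
    ∀ p ∈ P ∩ Q, tangentSpan (P ∩ Q) p = tangentSpan P p ⊓ tangentSpan Q p

/-- Non-empty pairwise intersections of members are members. -/
def InterClosed (F : Set (Set M)) : Prop :=
  ∀ P ∈ F, ∀ Q ∈ F, (P ∩ Q).Nonempty → P ∩ Q ∈ F

/-- `F` is a family of p-submanifolds that is closed under clean intersection. -/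
structure IsCleanFamily (F : Set (Set M)) : Prop where
  isPSubmanifold : ∀ P ∈ F, IsPSubmanifold P
  clean : ∀ P ∈ F, ∀ Q ∈ F, IntersectCleanly P Q
  interClosed : InterClosed F

/-- The list `L` enumerates `F` without repetition, in an order in which `P` precedes `Q`
whenever `P ⊂ Q`. -/
structure IsSizeOrder (F : Set (Set M)) (L : List (Set M)) : Prop where
  mem_iff : ∀ P, P ∈ L ↔ P ∈ F
  nodup : L.Nodup
  pairwise : L.Pairwise fun P Q => ¬ Q ⊂ P

end PSubmanifolds

/-! ### Blow-up -/

section Blowup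

variable {n : ℕ}

/-- Projective coordinates on `X` at a point `x` over `P`. Writing `y` for the coordinates
`φ - φ (β x)` on `M`, centred at `β x`, in which `P = {y_j = 0, j ∈ I}`, the functions
`σ y_i ≥ 0`, `y_j / (σ y_i)` for `j ∈ I \ {i}`, and `φ_j` for `j ∉ I` are (up to translating
those `y_j / (σ y_i)` that are `ℝ`-valued, by `a j`) the coordinates of a chart `ψ` of `X`
around `x`. The coordinate `σ y_i` vanishes at `x`, so it defines the front face;
`y_j / (σ y_i)` is a boundary coordinate only where `y_j` is one. -/
def HasProjectiveCoords {X M : CornerManifold.{u} n} (β : X → M) (P : Set M) (x : X) : Prop :=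
  ∃ φ I, IsAdaptedChart P (β x) φ I ∧
  ∃ ψ ∈ IsManifold.maximalAtlas (QM n) ∞ X, x ∈ ψ.source ∧ MapsTo β ψ.source φ.source ∧
  ∃ i ∈ I, ∃ σ : ℝ, (σ = 1 ∨ σ = -1) ∧ ∃ a : Fin n → ℝ,
    (ψ x).1 i = 0 ∧
    (∀ j ∈ I, j ≠ i → ((φ (β x)).1 j = 0 → a j = 0) ∧ (0 < (φ (β x)).1 j → 0 < (ψ x).1 j)) ∧
    ∀ q ∈ ψ.source,
      (φ (β q)).1 i - (φ (β x)).1 i = σ * (ψ q).1 i ∧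
      (∀ j ∈ I, j ≠ i → (φ (β q)).1 j - (φ (β x)).1 j = (ψ q).1 i * ((ψ q).1 j - a j)) ∧
      ∀ j ∉ I, (φ (β q)).1 j = (ψ q).1 j

/-- `β : X → M` is the (radial) blow-up `[M; P]` of `P` in `M` with its blow-down map:
`β` is proper, restricts to a diffeomorphism from `X \ β⁻¹(P)` onto `M \ P`, and `X` has
projective coordinates at every point over `P`. Properness makes the fibre over `p ∈ P` the
whole inward-pointing unit sphere of the normal space of `P` at `p`. -/
structure IsBlowup {X M : CornerManifold.{u} n} (β : X → M) (P : Set M) : Prop where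
  isProperMap : IsProperMap β
  bijOn : BijOn β (β ⁻¹' Pᶜ) Pᶜ
  isLocalDiffeomorphAt : ∀ x, β x ∉ P → IsLocalDiffeomorphAt (QM n) (QM n) ∞ β x
  projective : ∀ x, β x ∈ P → HasProjectiveCoords β P x

open Classical in
/-- The lift (proper transform) of `S` under the blow-down map `β` of `P`. -/
noncomputable def liftSet {X M : CornerManifold.{u} n} (β : X → M) (P S : Set M) : Set X :=
  if S ⊆ P then β ⁻¹' S else closure (β ⁻¹' (S \ P))

/-- `IsIteratedBlowup M [P₁, …, P_N] X β`: `X` is the iterated blow-up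
`[⋯[[M; P₁]; P₂]; ⋯; P_N]` and `β : X → M` is its blow-down map. Each of the `P_k` is required to
lift to a p-submanifold of `[⋯[M; P₁]; ⋯; P_{k-1}]`, and it is this lift that is blown up. -/
inductive IsIteratedBlowup :
    (M : CornerManifold.{u} n) → List (Set M) → (X : CornerManifold.{u} n) → (X → M) → Prop
  | nil (M : CornerManifold.{u} n) : IsIteratedBlowup M [] M id
  | cons {M Y X : CornerManifold.{u} n} {P : Set M} {L : List (Set M)} {β : Y → M} {γ : X → Y}
      (isPSubmanifold : IsPSubmanifold P) (isBlowup : IsBlowup β P)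
      (tail : IsIteratedBlowup Y (L.map (liftSet β P)) X γ) :
      IsIteratedBlowup M (P :: L) X (β ∘ γ)

end Blowup

/-! ### b-maps -/

section BMaps

variable {n : ℕ}

/-- `ρ` is a boundary defining function of `H`: a smooth function `ρ ≥ 0` with zero set `H` and
`dρ ≠ 0` along `H`. -/
structure IsBoundaryDefining {M : CornerManifold.{u} n} (ρ : M → ℝ) (H : Set M) : Prop where
  contMDiff : ContMDiff (QM n) 𝓘(ℝ, ℝ) ∞ ρ
  nonneg : ∀ p, 0 ≤ ρ p
  zero_iff : ∀ p, ρ p = 0 ↔ p ∈ H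
  mfderiv_ne_zero : ∀ p ∈ H, mfderiv (QM n) 𝓘(ℝ, ℝ) ρ p ≠ 0

/-- An (interior) b-map: a smooth map `f : X → Y` such that, for every boundary hypersurface `H`
of `Y`, there are exponents `e_{H'} ∈ ℕ` for the boundary hypersurfaces `H'` of `X` with
`f^* ρ_H = a ∏ ρ_{H'} ^ e_{H'}`, `a > 0` smooth. As there may be infinitely many `H'`, the product
formula is stated near each point `x`, over the finitely many `H'` that contain `x` (the other
factors being positive there). -/
def IsBMap {X Y : CornerManifold.{u} n} (f : X → Y) : Prop :=
  ContMDiff (QM n) (QM n) ∞ f ∧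
  ∀ (H : Set Y) (ρ : Y → ℝ), IsBoundaryHypersurface n H → IsBoundaryDefining ρ H →
  ∃ e : Set X → ℕ,
  ∀ r : Set X → X → ℝ, (∀ H', IsBoundaryHypersurface n H' → IsBoundaryDefining (r H') H') →
  ∀ x : X, ∃ a : X → ℝ, ContMDiffAt (QM n) 𝓘(ℝ, ℝ) ∞ a x ∧ 0 < a x ∧
    ∀ᶠ y in 𝓝 x, ρ (f y) =
      a y * ∏ᶠ H' ∈ {H' : Set X | IsBoundaryHypersurface n H' ∧ x ∈ H'}, r H' y ^ e H'

end BMaps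

/-! The theorem follows from a universal property. Say that a smooth map `g : Z → M` makes `P`
principal if, near each point of `Z`, the functions vanishing on `P` pull back to the ideal
generated by one monomial in boundary coordinates (`PrincipalMonomialAt`). The blow-down map of
`[M;P]` does so, the monomial being a front face defining function, and every such `g` lifts
uniquely to `[M;P]` (`IsBlowup.exists_lift`, `IsBlowup.eq_of_comp_eq`). Indeed, if the normal
coordinates of `P` pull back to `t * w j` with some `w j` non-zero, then the projective coordinates
of the lift are quotients of the `w j`; and on the dense set where `t ≠ 0` there is no choice.

For a centre `Q` that contains `P` locally, the ideal of `Q` pulls back to `[M;P]` as `ρ` times the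
ideal of the lift of `Q`, with the same `ρ` for all such `Q` (`TotalTransformAt`). Hence a lifted
map that pulls monomials back to monomials (`LocalBMapAt`) makes the lift of `Q` principal as soon
as the original map makes `Q` principal. By induction on the list of centres, the iterated blow-up
is universal among the maps that pull monomials back to monomials and make every centre principal
(`IsIteratedBlowup.contMDiff_and_principal`, `IsIteratedBlowup.exists_lift`). This condition does
not involve the order of the centres, which gives the diffeomorphisms of (i), and it becomes weaker
for a subfamily, which gives the factorization of (ii).

That the blow-ups are defined rests on reading a clean intersection as an equation between ideals:
that of `P ∩ Q` is the sum of those of `P` and `Q` (`IntersectCleanly.cleanAt`). Dividing by the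
common factor `ρ` preserves the equation, so lifts again intersect cleanly, and they are disjoint
where `P ∩ Q` was the centre (`CleanAt.totalTransform`). The conditions that survive are collected
in `IsGoodList`. Its tags are needed because p-submanifolds may be disconnected: for `{0}, {1},
{0,1}` in the line, the third centre coincides with the second after the first blow-up, and after
the second blow-up it is a boundary hypersurface, whose blow-up changes nothing.

Two constructions complete the proof. The blow-up itself is the closure, in a product of `M` with
countably many vector spaces, of the graph of the cut-off normal directions. The global exponents of
a b-map exist because the order of vanishing along a boundary hypersurface is locally constant,
hence constant (`exists_exponents`). -/

set_option linter.unusedSectionVars false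

/-! ### Smooth parametric integrals and Hadamard's lemma on convex sets with boundary. -/

section ParametricIntegral

variable {E : Type} {G : Type} [NormedAddCommGroup E] [NormedAddCommGroup G]

theorem intervalIntegrable_of_continuousOn_prod {s : Set E} {F : E → ℝ → G}
    (hF : ContinuousOn (fun z : E × ℝ => F z.1 z.2) (s ×ˢ Icc 0 1)) {u : E} (hu : u ∈ s) :
    IntervalIntegrable (F u) MeasureTheory.volume 0 1 := by
  apply ContinuousOn.intervalIntegrable
  rw [uIcc_of_le zero_le_one]
  exact hF.comp (f := fun θ : ℝ => (u, θ)) (by fun_prop) fun θ hθ => ⟨hu, hθ⟩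

variable [NormedSpace ℝ G]

/-- Compactness of the interval makes the continuity in `u` uniform in `θ`. -/
theorem continuousOn_integral_of_continuousOn_prod {s : Set E} {F : E → ℝ → G}
    (hF : ContinuousOn (fun z : E × ℝ => F z.1 z.2) (s ×ˢ Icc 0 1)) :
    ContinuousOn (fun u => ∫ θ in (0 : ℝ)..1, F u θ) s := by
  intro u hu
  rw [ContinuousWithinAt, Metric.tendsto_nhds]
  intro c hc
  obtain ⟨v, hv, h⟩ := IsCompact.mem_uniformity_of_prod (f := F) isCompact_Icc hF hu
    (Metric.dist_mem_uniformity (half_pos hc))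
  filter_upwards [hv, self_mem_nhdsWithin] with w hw hws
  rw [dist_eq_norm, ← intervalIntegral.integral_sub
    (intervalIntegrable_of_continuousOn_prod hF hws)
      (intervalIntegrable_of_continuousOn_prod hF hu)]
  refine lt_of_le_of_lt (intervalIntegral.norm_integral_le_of_norm_le_const (C := c / 2) ?_) ?_
  · intro θ hθ
    rw [uIoc_of_le zero_le_one] at hθ
    have := h w hw θ ⟨hθ.1.le, hθ.2⟩
    rw [← dist_eq_norm]
    exact le_of_lt this
  · simp only [sub_zero, abs_one, mul_one]; linarith

variable [NormedSpace ℝ E]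

/-- By compactness of the interval, `F' x θ` is within `c` of `F' u θ` for `x` near `u`, uniformly
in `θ`. The mean value inequality on the convex set `ball ∩ s` then bounds the integrand of the
remainder by `c * ‖w - u‖`. Everything is relative to `s`, which will have corners. -/
theorem hasFDerivWithinAt_integral_of_contDiffOn_prod [CompleteSpace G] {s : Set E}
    (hs : Convex ℝ s)
    {F : E → ℝ → G} {F' : E → ℝ → E →L[ℝ] G}
    (hF : ContinuousOn (fun z : E × ℝ => F z.1 z.2) (s ×ˢ Icc 0 1))
    (hF' : ContinuousOn (fun z : E × ℝ => F' z.1 z.2) (s ×ˢ Icc 0 1))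
    (hd : ∀ u ∈ s, ∀ θ ∈ Icc (0 : ℝ) 1, HasFDerivWithinAt (fun v => F v θ) (F' u θ) s u)
    {u : E} (hu : u ∈ s) :
    HasFDerivWithinAt (fun u => ∫ θ in (0 : ℝ)..1, F u θ) (∫ θ in (0 : ℝ)..1, F' u θ) s u := by
  rw [hasFDerivWithinAt_iff_isLittleO, Asymptotics.isLittleO_iff]
  intro c hc
  obtain ⟨v, hv, h⟩ := IsCompact.mem_uniformity_of_prod (f := F') isCompact_Icc hF' hu
    (Metric.dist_mem_uniformity hc)
  obtain ⟨δ, hδ, hball⟩ := Metric.mem_nhdsWithin_iff.1 hv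
  have hmem : Metric.ball u δ ∩ s ∈ 𝓝[s] u :=
    Filter.inter_mem (mem_nhdsWithin_of_mem_nhds (Metric.ball_mem_nhds u hδ)) self_mem_nhdsWithin
  filter_upwards [hmem] with w hw
  have hi' := intervalIntegrable_of_continuousOn_prod hF' hu
  have e : (∫ θ in (0 : ℝ)..1, F w θ) - (∫ θ in (0 : ℝ)..1, F u θ)
      - (∫ θ in (0 : ℝ)..1, F' u θ) (w - u)
      = ∫ θ in (0 : ℝ)..1, (F w θ - F u θ - F' u θ (w - u)) := by
    rw [intervalIntegral.integral_sub, intervalIntegral.integral_sub,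
      ContinuousLinearMap.intervalIntegral_apply hi']
    · exact intervalIntegrable_of_continuousOn_prod hF hw.2
    · exact intervalIntegrable_of_continuousOn_prod hF hu
    · exact (intervalIntegrable_of_continuousOn_prod hF hw.2).sub
        (intervalIntegrable_of_continuousOn_prod hF hu)
    · exact intervalIntegrable_of_continuousOn_prod (F := fun x θ => F' x θ (w - u))
        (hF'.clm_apply continuousOn_const) hu
  rw [e]
  refine (intervalIntegral.norm_integral_le_of_norm_le_const (C := c * ‖w - u‖) ?_).trans
    (by simp)
  intro θ hθ
  rw [uIoc_of_le zero_le_one] at hθ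
  have hθ' : θ ∈ Icc (0 : ℝ) 1 := ⟨hθ.1.le, hθ.2⟩
  refine Convex.norm_image_sub_le_of_norm_hasFDerivWithin_le'
    (f := fun v => F v θ) (f' := fun x => F' x θ) (s := Metric.ball u δ ∩ s)
    (fun x hx => (hd x hx.2 θ hθ').mono inter_subset_right) ?_
    ((convex_ball u δ).inter hs) ⟨Metric.mem_ball_self hδ, hu⟩ hw
  intro x hx
  rw [← dist_eq_norm, dist_comm]
  have := h x (hball hx) θ hθ'
  rw [dist_comm]
  exact le_of_lt this

/-- Induction on the order by differentiating under the integral. The target space `G` is quantified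
inside the induction since the derivative takes values in a space of linear maps. -/
theorem contDiffOn_integral_nat {s : Set E} (hs : Convex ℝ s) (hsu : UniqueDiffOn ℝ s) (m : ℕ) :
    ∀ {G : Type} [NormedAddCommGroup G] [NormedSpace ℝ G] [CompleteSpace G] {F : E × ℝ → G},
      ContDiffOn ℝ m F (s ×ˢ Icc 0 1) →
      ContDiffOn ℝ m (fun u => ∫ θ in (0 : ℝ)..1, F (u, θ)) s := by
  have hD : UniqueDiffOn ℝ (s ×ˢ Icc (0 : ℝ) 1) := hsu.prod (uniqueDiffOn_Icc zero_lt_one)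
  induction m with
  | zero =>
    intro G _ _ _ F hF
    simp only [CharP.cast_eq_zero, contDiffOn_zero] at hF ⊢
    exact continuousOn_integral_of_continuousOn_prod (F := fun u θ => F (u, θ)) hF
  | succ m ih =>
    intro G _ _ _ F hF
    push_cast at hF ⊢
    rw [contDiffOn_succ_iff_fderivWithin hD] at hF
    obtain ⟨hdF, -, hF'⟩ := hF
    rw [contDiffOn_succ_iff_hasFDerivWithinAt_of_uniqueDiffOn hsu]
    refine ⟨by simp, fun u => ∫ θ in (0 : ℝ)..1,
      (fderivWithin ℝ F (s ×ˢ Icc 0 1) (u, θ)).comp (ContinuousLinearMap.inl ℝ E ℝ), ?_, ?_⟩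
    · exact ih (F := fun z => (fderivWithin ℝ F (s ×ˢ Icc 0 1) z).comp
        (ContinuousLinearMap.inl ℝ E ℝ)) (hF'.clm_comp contDiffOn_const)
    · intro u hu
      refine hasFDerivWithinAt_integral_of_contDiffOn_prod hs (F := fun u θ => F (u, θ))
        (F' := fun u θ => (fderivWithin ℝ F (s ×ˢ Icc 0 1) (u, θ)).comp
          (ContinuousLinearMap.inl ℝ E ℝ)) hdF.continuousOn
        (hF'.continuousOn.clm_comp continuousOn_const) ?_ hu
      intro v hv θ hθ
      have h1 := (hdF (v, θ) ⟨hv, hθ⟩).hasFDerivWithinAt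
      exact h1.comp v (hasFDerivAt_prodMk_left v θ).hasFDerivWithinAt
        (fun w hw => (⟨hw, hθ⟩ : (w, θ) ∈ s ×ˢ Icc (0 : ℝ) 1))

theorem contDiffOn_integral {s : Set E} (hs : Convex ℝ s) (hsu : UniqueDiffOn ℝ s)
    [CompleteSpace G] {F : E × ℝ → G} (hF : ContDiffOn ℝ ∞ F (s ×ˢ Icc 0 1)) :
    ContDiffOn ℝ ∞ (fun u => ∫ θ in (0 : ℝ)..1, F (u, θ)) s :=
  contDiffOn_infty.2 fun m => contDiffOn_integral_nat hs hsu m (contDiffOn_infty.1 hF m)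

/-- Hadamard's lemma on a convex set, relative to a smooth retraction. -/
theorem exists_contDiffOn_sub_eq_apply {s : Set E} (hs : Convex ℝ s) (hsu : UniqueDiffOn ℝ s)
    {H : E → ℝ} (hH : ContDiffOn ℝ ∞ H s) {R : E → E} (hR : ContDiff ℝ ∞ R) (hRs : MapsTo R s s) :
    ∃ C : E → E →L[ℝ] ℝ, ContDiffOn ℝ ∞ C s ∧ ∀ u ∈ s, H u - H (R u) = C u (u - R u) := by
  have hmaps : ∀ u ∈ s, ∀ θ ∈ Icc (0 : ℝ) 1, R u + θ • (u - R u) ∈ s := by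
    intro u hu θ hθ
    exact hs.add_smul_sub_mem (hRs hu) hu hθ
  have hd : ContDiffOn ℝ ∞ (fderivWithin ℝ H s) s := hH.fderivWithin hsu (by simp)
  have hl : ContDiff ℝ ∞ fun z : E × ℝ => R z.1 + z.2 • (z.1 - R z.1) := by fun_prop
  have hF : ContDiffOn ℝ ∞ (fun z : E × ℝ => fderivWithin ℝ H s (R z.1 + z.2 • (z.1 - R z.1)))
      (s ×ˢ Icc 0 1) :=
    hd.comp hl.contDiffOn fun z hz => hmaps z.1 hz.1 z.2 hz.2
  -- `C u` is the mean of the derivative of `H` over the segment from `R u` to `u`; the identity is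
  -- then the fundamental theorem of calculus.
  refine ⟨fun u => ∫ θ in (0 : ℝ)..1, fderivWithin ℝ H s (R u + θ • (u - R u)),
    contDiffOn_integral hs hsu hF, fun u hu => ?_⟩
  have hint := intervalIntegrable_of_continuousOn_prod
    (F := fun u θ => fderivWithin ℝ H s (R u + θ • (u - R u))) hF.continuousOn hu
  rw [ContinuousLinearMap.intervalIntegral_apply hint]
  have hline : Continuous fun θ : ℝ => R u + θ • (u - R u) := by fun_prop
  have key := intervalIntegral.integral_eq_sub_of_hasDerivAt_of_le
    (f := fun θ : ℝ => H (R u + θ • (u - R u)))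
    (f' := fun θ => fderivWithin ℝ H s (R u + θ • (u - R u)) (u - R u)) zero_le_one
    (hH.continuousOn.comp hline.continuousOn fun θ hθ => hmaps u hu θ hθ) ?_ ?_
  · rw [key]; simp
  · intro θ hθ
    have h1 : HasFDerivWithinAt H (fderivWithin ℝ H s (R u + θ • (u - R u))) s
        (R u + θ • (u - R u)) :=
      (hH.differentiableOn (by simp) _ (hmaps u hu θ ⟨hθ.1.le, hθ.2.le⟩)).hasFDerivWithinAt
    have h2 : HasDerivAt (fun θ : ℝ => R u + θ • (u - R u)) (u - R u) θ := by
      simpa using ((hasDerivAt_id θ).smul_const (u - R u)).const_add (R u)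
    have h3 := h1.comp_hasDerivWithinAt θ (h2.hasDerivWithinAt (s := Ioo 0 1))
      fun t ht => hmaps u hu t ⟨ht.1.le, ht.2.le⟩
    exact h3.hasDerivAt (Ioo_mem_nhds hθ.1 hθ.2)
  · have hF2 : ContinuousOn (fun z : E × ℝ => fderivWithin ℝ H s (R z.1 + z.2 • (z.1 - R z.1))
        (u - R u)) (s ×ˢ Icc 0 1) := hF.continuousOn.clm_apply continuousOn_const
    exact intervalIntegrable_of_continuousOn_prod
      (F := fun v θ => fderivWithin ℝ H s (R v + θ • (v - R v)) (u - R u)) hF2 hu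

end ParametricIntegral

/-! ### Germs of smooth functions and maps. -/

section SmoothGerms

variable {n : ℕ} {Z : Type*} [TopologicalSpace Z] [ChartedSpace (EuclideanQuadrant n) Z]
  {M : Type*} [TopologicalSpace M] [ChartedSpace (EuclideanQuadrant n) M]
  {W : Type*} [TopologicalSpace W] [ChartedSpace (EuclideanQuadrant n) W]

variable (n) in
/-- The real function `h` is smooth in a neighbourhood of `z`. -/
def SmoothNear (h : Z → ℝ) (z : Z) : Prop :=
  ∀ᶠ y in 𝓝 z, ContMDiffAt (QM n) 𝓘(ℝ, ℝ) ∞ h y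

variable (n) in
/-- The map `g` is smooth in a neighbourhood of `z`. -/
def SmoothMapNear (g : Z → M) (z : Z) : Prop :=
  ∀ᶠ y in 𝓝 z, ContMDiffAt (QM n) (QM n) ∞ g y

namespace SmoothNear

variable {f h : Z → ℝ} {z : Z}

theorem contMDiffAt (hh : SmoothNear n h z) : ContMDiffAt (QM n) 𝓘(ℝ, ℝ) ∞ h z := hh.self_of_nhds

theorem continuousAt (hh : SmoothNear n h z) : ContinuousAt h z := hh.contMDiffAt.continuousAt

/-- This openness is why smoothness is required on a neighbourhood: at order `∞`, `ContMDiffAt` lets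
the neighbourhood shrink with the order of differentiability. -/
theorem eventually (hh : SmoothNear n h z) : ∀ᶠ y in 𝓝 z, SmoothNear n h y :=
  eventually_eventually_nhds.2 hh

theorem congr (hh : SmoothNear n h z) (he : f =ᶠ[𝓝 z] h) : SmoothNear n f z := by
  filter_upwards [hh, he.eventuallyEq_nhds] with y hy hey
  exact hy.congr_of_eventuallyEq hey

theorem const (c : ℝ) : SmoothNear n (fun _ : Z => c) z :=
  Filter.Eventually.of_forall fun _ => contMDiffAt_const

theorem add (hf : SmoothNear n f z) (hh : SmoothNear n h z) :
    SmoothNear n (fun y => f y + h y) z := by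
  filter_upwards [hf, hh] with y h1 h2 using h1.add h2

theorem sub (hf : SmoothNear n f z) (hh : SmoothNear n h z) :
    SmoothNear n (fun y => f y - h y) z := by
  filter_upwards [hf, hh] with y h1 h2 using h1.sub h2

theorem mul (hf : SmoothNear n f z) (hh : SmoothNear n h z) :
    SmoothNear n (fun y => f y * h y) z := by
  filter_upwards [hf, hh] with y h1 h2 using h1.mul h2

theorem comp_contDiffAt {a : ℝ → ℝ} (hf : SmoothNear n f z)
    (ha : ∀ᶠ y in 𝓝 z, ContDiffAt ℝ ∞ a (f y)) : SmoothNear n (fun y => a (f y)) z := by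
  filter_upwards [hf, ha] with y h1 h2
  exact h2.contMDiffAt.comp y h1

theorem pow (hf : SmoothNear n f z) (m : ℕ) : SmoothNear n (fun y => f y ^ m) z :=
  hf.comp_contDiffAt (a := fun t => t ^ m)
    (Filter.Eventually.of_forall fun _ => contDiffAt_id.pow m)

theorem inv (hf : SmoothNear n f z) (h0 : f z ≠ 0) : SmoothNear n (fun y => (f y)⁻¹) z := by
  refine hf.comp_contDiffAt (a := fun t => t⁻¹) ?_
  filter_upwards [hf.continuousAt.eventually_ne h0] with y hy using contDiffAt_inv ℝ hy

theorem div (hf : SmoothNear n f z) (hh : SmoothNear n h z) (h0 : h z ≠ 0) :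
    SmoothNear n (fun y => f y / h y) z := by
  simpa only [div_eq_mul_inv] using hf.mul (hh.inv h0)

theorem sum {ι : Type*} {s : Finset ι} {F : ι → Z → ℝ} (hF : ∀ i ∈ s, SmoothNear n (F i) z) :
    SmoothNear n (fun y => ∑ i ∈ s, F i y) z := by
  classical
  induction s using Finset.induction_on with
  | empty => simpa using const 0
  | insert i s hi ih =>
    simp only [Finset.sum_insert hi]
    exact (hF i (Finset.mem_insert_self i s)).add
      (ih fun j hj => hF j (Finset.mem_insert_of_mem hj))

theorem prod {ι : Type*} {s : Finset ι} {F : ι → Z → ℝ} (hF : ∀ i ∈ s, SmoothNear n (F i) z) :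
    SmoothNear n (fun y => ∏ i ∈ s, F i y) z := by
  classical
  induction s using Finset.induction_on with
  | empty => simpa using const 1
  | insert i s hi ih =>
    simp only [Finset.prod_insert hi]
    exact (hF i (Finset.mem_insert_self i s)).mul
      (ih fun j hj => hF j (Finset.mem_insert_of_mem hj))

theorem comp {h : M → ℝ} {g : Z → M} (hh : SmoothNear n h (g z)) (hg : SmoothMapNear n g z) :
    SmoothNear n (fun y => h (g y)) z := by
  have hc : ContinuousAt g z := hg.self_of_nhds.continuousAt
  filter_upwards [hg, hc.eventually hh] with y h1 h2
  exact h2.comp y h1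

theorem eventually_pos (hf : SmoothNear n f z) (h0 : 0 < f z) : ∀ᶠ y in 𝓝 z, 0 < f y :=
  hf.continuousAt.eventually (lt_mem_nhds h0)

theorem eventually_ne (hf : SmoothNear n f z) (h0 : f z ≠ 0) : ∀ᶠ y in 𝓝 z, f y ≠ 0 :=
  hf.continuousAt.eventually_ne h0

end SmoothNear

namespace SmoothMapNear

theorem continuousAt {g : Z → M} {z : Z} (hg : SmoothMapNear n g z) : ContinuousAt g z :=
  hg.self_of_nhds.continuousAt

theorem comp {h : M → W} {g : Z → M} {z : Z} (hh : SmoothMapNear n h (g z))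
    (hg : SmoothMapNear n g z) : SmoothMapNear n (fun y => h (g y)) z := by
  filter_upwards [hg, hg.continuousAt.eventually hh] with y h1 h2
  exact h2.comp y h1

theorem congr {f g : Z → M} {z : Z} (hg : SmoothMapNear n g z) (he : f =ᶠ[𝓝 z] g) :
    SmoothMapNear n f z := by
  filter_upwards [hg, he.eventuallyEq_nhds] with y hy hey
  exact hy.congr_of_eventuallyEq hey

end SmoothMapNear

theorem ContMDiff.smoothMapNear {g : Z → M} (hg : ContMDiff (QM n) (QM n) ∞ g) (z : Z) :
    SmoothMapNear n g z := Filter.Eventually.of_forall hg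

theorem ContMDiffOn.smoothMapNear {g : Z → M} {s : Set Z} (hg : ContMDiffOn (QM n) (QM n) ∞ g s)
    (hs : IsOpen s) {z : Z} (hz : z ∈ s) : SmoothMapNear n g z := by
  filter_upwards [hs.mem_nhds hz] with y hy using hg.contMDiffAt (hs.mem_nhds hy)

theorem contMDiff_quadrant_apply (i : Fin n) :
    ContMDiff (QM n) 𝓘(ℝ, ℝ) ∞ (fun u : EuclideanQuadrant n => u.1 i) := by
  have h1 : ContMDiff (QM n) 𝓘(ℝ, EuclideanSpace ℝ (Fin n)) ∞ (QM n) := (QM n).contMDiff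
  have h2 : ContDiff ℝ ∞ fun x : EuclideanSpace ℝ (Fin n) => x i := by fun_prop
  exact h2.contMDiff.comp h1

theorem contMDiffAt_euclidean {u : Z → EuclideanSpace ℝ (Fin n)} {z : Z}
    (hu : ∀ i, ContMDiffAt (QM n) 𝓘(ℝ, ℝ) ∞ (fun y => u y i) z) :
    ContMDiffAt (QM n) 𝓘(ℝ, EuclideanSpace ℝ (Fin n)) ∞ u z := by
  have h1 : ContMDiffAt (QM n) 𝓘(ℝ, Fin n → ℝ) ∞ (fun y i => u y i) z :=
    contMDiffAt_pi_space.2 hu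
  have h2 : ContDiff ℝ ∞ fun x : Fin n → ℝ => (WithLp.toLp 2 x : EuclideanSpace ℝ (Fin n)) :=
    (EuclideanSpace.equiv (Fin n) ℝ).symm.contDiff
  exact h2.contMDiff.contMDiffAt.comp z h1

theorem contMDiffAt_quadrant {u : Z → EuclideanQuadrant n} {z : Z}
    (hu : ∀ i, ContMDiffAt (QM n) 𝓘(ℝ, ℝ) ∞ (fun y => (u y).1 i) z) :
    ContMDiffAt (QM n) (QM n) ∞ u z := by
  have h1 : ContMDiffAt (QM n) 𝓘(ℝ, EuclideanSpace ℝ (Fin n)) ∞ (fun y => (QM n) (u y)) z :=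
    contMDiffAt_euclidean hu
  have h3 : ContMDiffWithinAt 𝓘(ℝ, EuclideanSpace ℝ (Fin n)) (QM n) ∞ (QM n).symm (range (QM n))
      ((QM n) (u z)) := (QM n).contMDiffOn_symm _ ⟨u z, rfl⟩
  have h4 := h3.comp z (contMDiffWithinAt_univ.2 h1) (fun y _ => (⟨u y, rfl⟩ : _ ∈ range (QM n)))
  rw [contMDiffWithinAt_univ] at h4
  exact h4.congr_of_eventuallyEq (Filter.Eventually.of_forall fun y => ((QM n).left_inv (u y)).symm)

theorem SmoothMapNear.of_coords {u : Z → EuclideanQuadrant n} {z : Z}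
    (hu : ∀ i, SmoothNear n (fun y => (u y).1 i) z) : SmoothMapNear n u z := by
  filter_upwards [Filter.eventually_all.2 hu] with y hy using contMDiffAt_quadrant hy

section Charts

variable {φ : OpenPartialHomeomorph M (EuclideanQuadrant n)}

theorem SmoothMapNear.chart (hφ : φ ∈ IsManifold.maximalAtlas (QM n) ∞ M) {p : M}
    (hp : p ∈ φ.source) : SmoothMapNear n φ p :=
  (contMDiffOn_of_mem_maximalAtlas hφ).smoothMapNear φ.open_source hp

theorem SmoothMapNear.chart_symm (hφ : φ ∈ IsManifold.maximalAtlas (QM n) ∞ M)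
    {u : EuclideanQuadrant n} (hu : u ∈ φ.target) : SmoothMapNear n φ.symm u :=
  (contMDiffOn_symm_of_mem_maximalAtlas hφ).smoothMapNear φ.open_target hu

theorem SmoothNear.coord (hφ : φ ∈ IsManifold.maximalAtlas (QM n) ∞ M) {p : M}
    (hp : p ∈ φ.source) (i : Fin n) : SmoothNear n (fun q => (φ q).1 i) p :=
  SmoothNear.comp (h := fun u : EuclideanQuadrant n => u.1 i)
    (Filter.Eventually.of_forall (contMDiff_quadrant_apply i)) (SmoothMapNear.chart hφ hp)

/-- Lifts to blow-ups are constructed in this way, by prescribing smooth coordinates. -/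
theorem SmoothMapNear.symm_comp (hφ : φ ∈ IsManifold.maximalAtlas (QM n) ∞ M)
    {u : Z → EuclideanQuadrant n} {z : Z} (hu : ∀ i, SmoothNear n (fun y => (u y).1 i) z)
    (hz : u z ∈ φ.target) : SmoothMapNear n (fun y => φ.symm (u y)) z :=
  SmoothMapNear.comp (SmoothMapNear.chart_symm hφ hz) (SmoothMapNear.of_coords hu)

end Charts

end SmoothGerms

/-! ### Functions in charts, and Hadamard's lemma on a manifold with corners. -/

section LocalRepresentatives

variable {n : ℕ} {M : Type*} [TopologicalSpace M] [ChartedSpace (EuclideanQuadrant n) M]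
  {φ ψ : OpenPartialHomeomorph M (EuclideanQuadrant n)} {p q : M} {f h : M → ℝ}

/-- The expression of `h` in the chart `φ`. -/
noncomputable def chartRep (φ : OpenPartialHomeomorph M (EuclideanQuadrant n)) (h : M → ℝ) :
    EuclideanSpace ℝ (Fin n) → ℝ := fun x => h (φ.symm ((QM n).symm x))

theorem quadrant_symm_val (u : EuclideanQuadrant n) : (QM n).symm u.1 = u := (QM n).left_inv u

theorem quadrant_val_symm {x : EuclideanSpace ℝ (Fin n)} (hx : x ∈ range (QM n)) :
    ((QM n).symm x).1 = x := (QM n).right_inv hx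

theorem mem_range_quadrant {x : EuclideanSpace ℝ (Fin n)} :
    x ∈ range (QM n) ↔ ∀ i, 0 ≤ x i :=
  ⟨by rintro ⟨y, rfl⟩; exact y.2, fun h => ⟨⟨x, h⟩, rfl⟩⟩

theorem val_mem_range_quadrant (u : EuclideanQuadrant n) : u.1 ∈ range (QM n) := ⟨u, rfl⟩

/-- The points of the quadrant at distance less than `ε` from `x`. -/
def quadrantBall (x : EuclideanSpace ℝ (Fin n)) (ε : ℝ) : Set (EuclideanSpace ℝ (Fin n)) :=
  range (QM n) ∩ Metric.ball x ε

theorem convex_quadrantBall (x : EuclideanSpace ℝ (Fin n)) (ε : ℝ) : Convex ℝ (quadrantBall x ε) :=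
  (QM n).convex_range.inter (convex_ball x ε)

theorem uniqueDiffOn_quadrantBall (x : EuclideanSpace ℝ (Fin n)) (ε : ℝ) :
    UniqueDiffOn ℝ (quadrantBall x ε) :=
  (QM n).uniqueDiffOn.inter Metric.isOpen_ball

@[simp] theorem chartRep_val (hq : q ∈ φ.source) : chartRep φ h (φ q).1 = h q := by
  simp only [chartRep, quadrant_symm_val, φ.left_inv hq]

theorem exists_quadrantBall (hp : p ∈ φ.source) {E : M → Prop} (hE : ∀ᶠ q in 𝓝 p, E q) :
    ∃ ε > 0, ∀ x ∈ quadrantBall (φ p).1 ε,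
      (QM n).symm x ∈ φ.target ∧ E (φ.symm ((QM n).symm x)) := by
  have h1 : ∀ᶠ u in 𝓝 (φ p), u ∈ φ.target ∧ E (φ.symm u) := by
    have h2 : ContinuousAt φ.symm (φ p) := φ.continuousAt_symm (φ.map_source hp)
    have h3 : ∀ᶠ u in 𝓝 (φ p), E (φ.symm u) := by
      apply h2.eventually
      rwa [φ.left_inv hp]
    exact Filter.Eventually.and (φ.open_target.mem_nhds (φ.map_source hp)) h3
  have hc : ContinuousAt (QM n).symm (φ p).1 := (QM n).continuous_symm.continuousAt
  have h4 : ∀ᶠ x in 𝓝 (φ p).1, (QM n).symm x ∈ φ.target ∧ E (φ.symm ((QM n).symm x)) := by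
    refine hc.eventually (p := fun u => u ∈ φ.target ∧ E (φ.symm u)) ?_
    rwa [quadrant_symm_val]
  obtain ⟨ε, hε, hb⟩ := Metric.eventually_nhds_iff_ball.1 h4
  exact ⟨ε, hε, fun x hx => hb x hx.2⟩

theorem eventually_mem_quadrantBall (hp : p ∈ φ.source) {ε : ℝ} (hε : 0 < ε) :
    ∀ᶠ q in 𝓝 p, (φ q).1 ∈ quadrantBall (φ p).1 ε := by
  have hc : ContinuousAt (fun q => (φ q).1) p :=
    continuous_subtype_val.continuousAt.comp (φ.continuousAt hp)
  filter_upwards [hc.eventually (Metric.ball_mem_nhds _ hε)] with q hq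
  exact ⟨val_mem_range_quadrant _, hq⟩

theorem contDiffOn_chartRep (hφ : φ ∈ IsManifold.maximalAtlas (QM n) ∞ M)
    {s : Set (EuclideanSpace ℝ (Fin n))} (hs : s ⊆ range (QM n))
    (hst : ∀ x ∈ s, (QM n).symm x ∈ φ.target)
    (hsm : ∀ x ∈ s, ContMDiffAt (QM n) 𝓘(ℝ, ℝ) ∞ h (φ.symm ((QM n).symm x))) :
    ContDiffOn ℝ ∞ (chartRep φ h) s := by
  rw [← contMDiffOn_iff_contDiffOn]
  intro x hx
  have h1 := (contMDiffOn_symm_of_mem_maximalAtlas hφ).contMDiffAt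
    (φ.open_target.mem_nhds (hst x hx))
  have h2 : ContMDiffWithinAt 𝓘(ℝ, EuclideanSpace ℝ (Fin n)) (QM n) ∞ (QM n).symm s x :=
    ((QM n).contMDiffOn_symm _ (hs hx)).mono hs
  exact ((hsm x hx).comp _ h1).comp_contMDiffWithinAt x h2

theorem SmoothNear.exists_contDiffOn (hφ : φ ∈ IsManifold.maximalAtlas (QM n) ∞ M)
    (hp : p ∈ φ.source) (hh : SmoothNear n h p) {E : M → Prop} (hE : ∀ᶠ q in 𝓝 p, E q) :
    ∃ ε > 0, ContDiffOn ℝ ∞ (chartRep φ h) (quadrantBall (φ p).1 ε) ∧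
      ∀ x ∈ quadrantBall (φ p).1 ε,
        (QM n).symm x ∈ φ.target ∧ E (φ.symm ((QM n).symm x)) := by
  obtain ⟨ε, hε, hb⟩ := exists_quadrantBall hp (hh.and hE)
  exact ⟨ε, hε, contDiffOn_chartRep hφ inter_subset_left (fun x hx => (hb x hx).1)
    fun x hx => (hb x hx).2.1, fun x hx => ⟨(hb x hx).1, (hb x hx).2.2⟩⟩

theorem SmoothNear.of_contDiffOn (hφ : φ ∈ IsManifold.maximalAtlas (QM n) ∞ M)
    (hp : p ∈ φ.source) {ε : ℝ} (hε : 0 < ε) {C : EuclideanSpace ℝ (Fin n) → ℝ}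
    (hC : ContDiffOn ℝ ∞ C (quadrantBall (φ p).1 ε)) : SmoothNear n (fun q => C (φ q).1) p := by
  filter_upwards [(eventually_mem_quadrantBall hp hε).eventually_nhds,
    φ.open_source.mem_nhds hp] with q hq hqs
  have h1 : ContMDiffAt (QM n) 𝓘(ℝ, EuclideanSpace ℝ (Fin n)) ∞ (fun q => (QM n) (φ q)) q :=
    (QM n).contMDiff.contMDiffAt.comp q
      ((contMDiffOn_of_mem_maximalAtlas hφ).contMDiffAt (φ.open_source.mem_nhds hqs))
  have h2 : ContMDiffWithinAt 𝓘(ℝ, EuclideanSpace ℝ (Fin n)) 𝓘(ℝ, ℝ) ∞ C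
      (quadrantBall (φ p).1 ε) (φ q).1 :=
    (hC _ hq.self_of_nhds).contMDiffWithinAt
  have h3 := ContMDiffWithinAt.comp (s := {q | (φ q).1 ∈ quadrantBall (φ p).1 ε}) q h2
    h1.contMDiffWithinAt (fun y hy => hy)
  exact h3.contMDiffAt hq

/-- Hadamard's lemma: a smooth function that vanishes where the coordinates with index in `I` are
those of `p` is a combination of the centred coordinates with index in `I`. -/
theorem exists_eq_sum_of_vanish (hφ : φ ∈ IsManifold.maximalAtlas (QM n) ∞ M)
    (hp : p ∈ φ.source) (I : Set (Fin n)) (hh : SmoothNear n h p)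
    (hv : ∀ᶠ q in 𝓝 p, (∀ i ∈ I, (φ q).1 i = (φ p).1 i) → h q = 0) :
    ∃ c : Fin n → M → ℝ, (∀ i, SmoothNear n (c i) p) ∧ (∀ i ∉ I, c i = 0) ∧
      ∀ᶠ q in 𝓝 p, h q = ∑ i, c i q * ((φ q).1 i - (φ p).1 i) := by
  classical
  obtain ⟨ε, hε, hC, hb⟩ := hh.exists_contDiffOn hφ hp
    (Filter.Eventually.and hv (φ.open_source.mem_nhds hp))
  set u₀ := (φ p).1 with hu₀
  -- The retraction resets the coordinates in `I` to their values at `p`. It keeps coordinates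
  -- non-negative and does not increase the distance to `u₀`, so it preserves the quadrant ball.
  let R : EuclideanSpace ℝ (Fin n) → EuclideanSpace ℝ (Fin n) :=
    fun x => WithLp.toLp 2 fun i => if i ∈ I then u₀ i else x i
  have hRapp : ∀ x i, R x i = if i ∈ I then u₀ i else x i := fun x i => rfl
  have hR : ContDiff ℝ ∞ R := by
    apply (EuclideanSpace.equiv (Fin n) ℝ).symm.contDiff.comp
    rw [contDiff_pi]
    intro i
    by_cases hi : i ∈ I
    · simp only [hi, if_true]; exact contDiff_const
    · simp only [hi, if_false]; fun_prop
  have hRs : MapsTo R (quadrantBall u₀ ε) (quadrantBall u₀ ε) := by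
    intro x hx
    refine ⟨mem_range_quadrant.2 fun i => ?_, ?_⟩
    · rw [hRapp]
      split_ifs
      · exact (φ p).2 i
      · exact mem_range_quadrant.1 hx.1 i
    · rw [Metric.mem_ball]
      refine lt_of_le_of_lt ?_ (Metric.mem_ball.1 hx.2)
      rw [EuclideanSpace.dist_eq, EuclideanSpace.dist_eq]
      refine Real.sqrt_le_sqrt (Finset.sum_le_sum fun i _ => ?_)
      rw [hRapp]
      split_ifs
      · simp
      · exact le_rfl
  obtain ⟨C, hCs, hCe⟩ := exists_contDiffOn_sub_eq_apply (convex_quadrantBall u₀ ε)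
    (uniqueDiffOn_quadrantBall u₀ ε) hC hR hRs
  have hz : ∀ x ∈ quadrantBall u₀ ε, chartRep φ h (R x) = 0 := by
    intro x hx
    have h1 := hb _ (hRs hx)
    refine h1.2.1 fun i hi => ?_
    rw [φ.right_inv h1.1, quadrant_val_symm (hRs hx).1, hRapp, if_pos hi]
  -- Since `x - R x` only has components in `I`, the coefficients are the values of `C` on the basis
  -- vectors with index in `I`.
  refine ⟨fun i => if i ∈ I then fun q => C (φ q).1 (EuclideanSpace.single i 1) else 0,
    fun i => ?_, fun i hi => if_neg hi, ?_⟩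
  · by_cases hi : i ∈ I
    · simp only [hi, if_true]
      exact SmoothNear.of_contDiffOn (C := fun x => C x (EuclideanSpace.single i 1)) hφ hp hε
        (hCs.clm_apply contDiffOn_const)
    · simp only [hi, if_false]
      exact SmoothNear.const 0
  · filter_upwards [eventually_mem_quadrantBall hp hε, φ.open_source.mem_nhds hp] with q hq hqs
    have h1 := hCe _ hq
    rw [hz _ hq, sub_zero, chartRep_val hqs] at h1
    rw [h1]
    have h2 : (φ q).1 - R (φ q).1 = ∑ i, (if i ∈ I then (φ q).1 i - u₀ i else 0) •
        EuclideanSpace.single i (1 : ℝ) := by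
      ext j
      rw [PiLp.sub_apply, hRapp]
      simp only [WithLp.ofLp_sum, Finset.sum_apply, PiLp.smul_apply, smul_eq_mul,
        PiLp.single_apply, mul_ite, mul_one, mul_zero, Finset.sum_ite_eq,
        Finset.mem_univ, if_true]
      split_ifs <;> simp
    rw [h2, map_sum]
    refine Finset.sum_congr rfl fun i _ => ?_
    rw [map_smul, smul_eq_mul]
    split_ifs
    · ring
    · simp

end LocalRepresentatives

/-! ### Partial derivatives with respect to the coordinates of a chart. -/

section ChartDerivatives

variable {n : ℕ} {M : Type*} [TopologicalSpace M] [ChartedSpace (EuclideanQuadrant n) M]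
  {φ ψ : OpenPartialHomeomorph M (EuclideanQuadrant n)} {p q : M} {f h : M → ℝ}

/-- The differential of `h` at `q` in the chart `φ`. -/
noncomputable def chartDeriv (φ : OpenPartialHomeomorph M (EuclideanQuadrant n)) (h : M → ℝ)
    (q : M) : EuclideanSpace ℝ (Fin n) →L[ℝ] ℝ :=
  fderivWithin ℝ (chartRep φ h) (range (QM n)) (φ q).1

/-- The partial derivative of `h` at `q` with respect to the `i`-th coordinate of `φ`. -/
noncomputable def partialDeriv (φ : OpenPartialHomeomorph M (EuclideanQuadrant n)) (i : Fin n)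
    (h : M → ℝ) (q : M) : ℝ :=
  chartDeriv φ h q (EuclideanSpace.single i 1)

theorem chartDeriv_apply_eq_sum (φ : OpenPartialHomeomorph M (EuclideanQuadrant n)) (h : M → ℝ)
    (q : M) (v : EuclideanSpace ℝ (Fin n)) :
    chartDeriv φ h q v = ∑ i, v i * partialDeriv φ i h q := by
  have h2 : v = ∑ i, v i • EuclideanSpace.single i (1 : ℝ) := by
    ext j
    simp [Pi.single_apply]
  conv_lhs => rw [h2, map_sum]
  simp [partialDeriv]

theorem uniqueDiffWithinAt_val (u : EuclideanQuadrant n) :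
    UniqueDiffWithinAt ℝ (range (QM n)) u.1 :=
  (QM n).uniqueDiffOn _ (val_mem_range_quadrant u)

theorem chartDeriv_eq {L : EuclideanSpace ℝ (Fin n) →L[ℝ] ℝ}
    (hL : HasFDerivWithinAt (chartRep φ h) L (range (QM n)) (φ q).1) : chartDeriv φ h q = L :=
  hL.fderivWithin (uniqueDiffWithinAt_val _)

theorem quadrantBall_mem_nhdsWithin {x : EuclideanSpace ℝ (Fin n)} {ε : ℝ} (hε : 0 < ε) :
    quadrantBall x ε ∈ 𝓝[range (QM n)] x :=
  Filter.inter_mem self_mem_nhdsWithin (mem_nhdsWithin_of_mem_nhds (Metric.ball_mem_nhds x hε))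

theorem mem_quadrantBall_self (u : EuclideanQuadrant n) {ε : ℝ} (hε : 0 < ε) :
    u.1 ∈ quadrantBall u.1 ε := ⟨val_mem_range_quadrant u, Metric.mem_ball_self hε⟩

theorem SmoothNear.hasFDerivWithinAt (hφ : φ ∈ IsManifold.maximalAtlas (QM n) ∞ M)
    (hq : q ∈ φ.source) (hh : SmoothNear n h q) :
    HasFDerivWithinAt (chartRep φ h) (chartDeriv φ h q) (range (QM n)) (φ q).1 := by
  obtain ⟨ε, hε, hC, -⟩ := hh.exists_contDiffOn hφ hq (E := fun _ => True)
    (Filter.Eventually.of_forall fun _ => trivial)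
  have h1 : DifferentiableWithinAt ℝ (chartRep φ h) (quadrantBall (φ q).1 ε) (φ q).1 :=
    hC.differentiableOn (by simp) _ (mem_quadrantBall_self _ hε)
  have h2 : DifferentiableWithinAt ℝ (chartRep φ h) (range (QM n)) (φ q).1 := by
    refine h1.mono_of_mem_nhdsWithin (quadrantBall_mem_nhdsWithin hε)
  exact h2.hasFDerivWithinAt

theorem eventuallyEq_chartRep (hq : q ∈ φ.source) (he : f =ᶠ[𝓝 q] h) :
    chartRep φ f =ᶠ[𝓝[range (QM n)] (φ q).1] chartRep φ h := by
  obtain ⟨ε, hε, hb⟩ := exists_quadrantBall hq he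
  filter_upwards [quadrantBall_mem_nhdsWithin hε] with x hx using (hb x hx).2

theorem chartDeriv_congr (hφ : φ ∈ IsManifold.maximalAtlas (QM n) ∞ M)
    (hq : q ∈ φ.source) (he : f =ᶠ[𝓝 q] h) (hh : SmoothNear n h q) :
    chartDeriv φ f q = chartDeriv φ h q := by
  refine chartDeriv_eq ((hh.hasFDerivWithinAt hφ hq).congr_of_eventuallyEq
    (eventuallyEq_chartRep hq he) ?_)
  rw [chartRep_val hq, chartRep_val hq, he.self_of_nhds]

theorem chartDeriv_mul (hφ : φ ∈ IsManifold.maximalAtlas (QM n) ∞ M)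
    (hq : q ∈ φ.source) (hf : SmoothNear n f q) (hh : SmoothNear n h q) :
    chartDeriv φ (fun y => f y * h y) q = f q • chartDeriv φ h q + h q • chartDeriv φ f q := by
  refine chartDeriv_eq ?_
  have := (hf.hasFDerivWithinAt hφ hq).mul (hh.hasFDerivWithinAt hφ hq)
  rwa [chartRep_val hq, chartRep_val hq] at this

theorem chartDeriv_sum {ι : Type*} {s : Finset ι} {F : ι → M → ℝ}
    (hφ : φ ∈ IsManifold.maximalAtlas (QM n) ∞ M)
    (hq : q ∈ φ.source) (hF : ∀ i ∈ s, SmoothNear n (F i) q) :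
    chartDeriv φ (fun y => ∑ i ∈ s, F i y) q = ∑ i ∈ s, chartDeriv φ (F i) q := by
  refine chartDeriv_eq ?_
  exact HasFDerivWithinAt.fun_sum fun i hi => (hF i hi).hasFDerivWithinAt hφ hq

theorem chartDeriv_sub_const (hφ : φ ∈ IsManifold.maximalAtlas (QM n) ∞ M)
    (hq : q ∈ φ.source) (hh : SmoothNear n h q) (c : ℝ) :
    chartDeriv φ (fun y => h y - c) q = chartDeriv φ h q :=
  chartDeriv_eq ((hh.hasFDerivWithinAt hφ hq).sub_const c)

theorem chartDeriv_coord (hq : q ∈ φ.source) (i : Fin n) :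
    chartDeriv φ (fun y => (φ y).1 i) q = EuclideanSpace.proj i := by
  refine chartDeriv_eq ?_
  have h1 : HasFDerivWithinAt (fun x : EuclideanSpace ℝ (Fin n) => x i)
      (EuclideanSpace.proj i : EuclideanSpace ℝ (Fin n) →L[ℝ] ℝ) (range (QM n)) (φ q).1 :=
    (EuclideanSpace.proj i : EuclideanSpace ℝ (Fin n) →L[ℝ] ℝ).hasFDerivWithinAt
  obtain ⟨ε, hε, hb⟩ := exists_quadrantBall hq (E := fun _ => True)
    (Filter.Eventually.of_forall fun _ => trivial)
  refine h1.congr_of_eventuallyEq ?_ ?_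
  · filter_upwards [quadrantBall_mem_nhdsWithin hε] with x hx
    simp only [chartRep, φ.right_inv (hb x hx).1, quadrant_val_symm hx.1]
  · simp only [chartRep, quadrant_symm_val, φ.left_inv hq]

theorem partialDeriv_coord (hq : q ∈ φ.source) (i j : Fin n) :
    partialDeriv φ j (fun y => (φ y).1 i) q = if i = j then 1 else 0 := by
  rw [partialDeriv, chartDeriv_coord hq]
  simp

theorem chartDeriv_comp (hφ : φ ∈ IsManifold.maximalAtlas (QM n) ∞ M)
    (hψ : ψ ∈ IsManifold.maximalAtlas (QM n) ∞ M) (hq : q ∈ φ.source) (hq' : q ∈ ψ.source)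
    (hh : SmoothNear n h q) (v : EuclideanSpace ℝ (Fin n)) :
    chartDeriv φ h q v
      = ∑ k, partialDeriv ψ k h q * chartDeriv φ (fun y => (ψ y).1 k) q v := by
  let T : EuclideanSpace ℝ (Fin n) → EuclideanSpace ℝ (Fin n) :=
    fun x => (ψ (φ.symm ((QM n).symm x))).1
  let A : EuclideanSpace ℝ (Fin n) →L[ℝ] EuclideanSpace ℝ (Fin n) :=
    ((EuclideanSpace.equiv (Fin n) ℝ).symm : (Fin n → ℝ) →L[ℝ] EuclideanSpace ℝ (Fin n)) ∘L
      ContinuousLinearMap.pi fun k => chartDeriv φ (fun y => (ψ y).1 k) q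
  have hT : HasFDerivWithinAt T A (range (QM n)) (φ q).1 := by
    rw [hasFDerivWithinAt_euclidean]
    intro k
    exact (SmoothNear.coord hψ hq' k).hasFDerivWithinAt hφ hq
  have hTq : T (φ q).1 = (ψ q).1 := by simp only [T, quadrant_symm_val, φ.left_inv hq]
  have h1 := hh.hasFDerivWithinAt hψ hq'
  rw [← hTq] at h1
  have h2 := h1.comp (φ q).1 hT (fun x _ => val_mem_range_quadrant _)
  have h3 : chartDeriv φ h q = (chartDeriv ψ h q) ∘L A := by
    refine chartDeriv_eq (h2.congr_of_eventuallyEq ?_ ?_)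
    · obtain ⟨ε, hε, hb⟩ := exists_quadrantBall hq (ψ.open_source.mem_nhds hq')
      filter_upwards [quadrantBall_mem_nhdsWithin hε] with x hx
      simp only [Function.comp, T]
      rw [chartRep_val (hb x hx).2]
      rfl
    · simp only [Function.comp, hTq]
      rw [chartRep_val hq, chartRep_val hq']
  rw [h3, ContinuousLinearMap.comp_apply, chartDeriv_apply_eq_sum]
  refine Finset.sum_congr rfl fun k _ => ?_
  rw [mul_comm]
  rfl

/-- At `q` the function has a minimum, so its derivatives in inward directions are non-negative. The
`i`-th coordinate direction is always inward, and so is its opposite if the `i`-th coordinate is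
positive. -/
theorem partialDeriv_nonneg (hφ : φ ∈ IsManifold.maximalAtlas (QM n) ∞ M)
    (hq : q ∈ φ.source) (hh : SmoothNear n h q) (h0 : h q = 0) (hn : ∀ᶠ y in 𝓝 q, 0 ≤ h y)
    (i : Fin n) : 0 ≤ partialDeriv φ i h q ∧ (0 < (φ q).1 i → partialDeriv φ i h q = 0) := by
  have hmin : IsLocalMinOn (chartRep φ h) (range (QM n)) (φ q).1 := by
    obtain ⟨ε, hε, hb⟩ := exists_quadrantBall hq hn
    filter_upwards [quadrantBall_mem_nhdsWithin hε] with x hx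
    rw [chartRep_val hq, h0]
    exact (hb x hx).2
  have hd := hh.hasFDerivWithinAt hφ hq
  have hseg : ∀ y : EuclideanSpace ℝ (Fin n), (φ q).1 + y ∈ range (QM n) →
      0 ≤ chartDeriv φ h q y := fun y hy =>
    hmin.hasFDerivWithinAt_nonneg hd (mem_posTangentConeAt_of_segment_subset
      ((QM n).convex_range.segment_subset (val_mem_range_quadrant _) hy))
  have hpos : 0 ≤ partialDeriv φ i h q := by
    refine hseg _ (mem_range_quadrant.2 fun j => ?_)
    have := (φ q).2 j
    simp only [PiLp.add_apply, PiLp.single_apply]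
    split_ifs <;> linarith
  refine ⟨hpos, fun hi => le_antisymm ?_ hpos⟩
  -- This step makes the `i`-th coordinate exactly zero, so the segment stays in the quadrant.
  have h1 := hseg (-((φ q).1 i) • EuclideanSpace.single i 1) (mem_range_quadrant.2 fun j => ?_)
  · rw [map_smul, smul_eq_mul] at h1
    change 0 ≤ -(φ q).1 i * partialDeriv φ i h q at h1
    nlinarith
  · have := (φ q).2 j
    simp only [PiLp.add_apply, PiLp.smul_apply, PiLp.single_apply]
    split_ifs with hij
    · subst hij; simp
    · simpa using this

theorem continuousAt_partialDeriv (hφ : φ ∈ IsManifold.maximalAtlas (QM n) ∞ M)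
    (hq : q ∈ φ.source) (hh : SmoothNear n h q) (i : Fin n) :
    ContinuousAt (fun y => partialDeriv φ i h y) q := by
  obtain ⟨ε, hε, hC, -⟩ := hh.exists_contDiffOn hφ hq (E := fun _ => True)
    (Filter.Eventually.of_forall fun _ => trivial)
  have h1 : ContinuousOn (fderivWithin ℝ (chartRep φ h) (quadrantBall (φ q).1 ε))
      (quadrantBall (φ q).1 ε) :=
    hC.continuousOn_fderivWithin (uniqueDiffOn_quadrantBall _ _) (by simp)
  have h2 : ContinuousOn (fderivWithin ℝ (chartRep φ h) (range (QM n)))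
      (quadrantBall (φ q).1 ε) := by
    refine h1.congr fun x hx => ?_
    exact (fderivWithin_inter (Metric.isOpen_ball.mem_nhds hx.2)).symm
  have h3 : Filter.Tendsto (fun y => (φ y).1) (𝓝 q) (𝓝[quadrantBall (φ q).1 ε] (φ q).1) :=
    tendsto_nhdsWithin_iff.2 ⟨continuous_subtype_val.continuousAt.comp (φ.continuousAt hq),
      eventually_mem_quadrantBall hq hε⟩
  have h4 := (h2 _ (mem_quadrantBall_self _ hε)).tendsto.comp h3
  exact ((ContinuousLinearMap.apply ℝ ℝ (EuclideanSpace.single i (1 : ℝ))).continuous.tendsto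
    _).comp h4

/-- The centred coordinates vanish at `p`, so the product rule leaves only the values of the
coefficients. -/
theorem partialDeriv_of_eq_sum (hφ : φ ∈ IsManifold.maximalAtlas (QM n) ∞ M)
    (hp : p ∈ φ.source) {c : Fin n → M → ℝ} (hc : ∀ i, SmoothNear n (c i) p)
    (he : ∀ᶠ q in 𝓝 p, h q = ∑ i, c i q * ((φ q).1 i - (φ p).1 i)) (j : Fin n) :
    partialDeriv φ j h p = c j p := by
  have h1 : ∀ i, SmoothNear n (fun q => (φ q).1 i - (φ p).1 i) p := fun i =>
    (SmoothNear.coord hφ hp i).sub (SmoothNear.const _)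
  rw [partialDeriv, chartDeriv_congr hφ hp he (SmoothNear.sum fun i _ => (hc i).mul (h1 i)),
    chartDeriv_sum hφ hp fun i _ => (hc i).mul (h1 i)]
  simp only [sum_apply]
  have h2 : ∀ i, chartDeriv φ (fun q => c i q * ((φ q).1 i - (φ p).1 i)) p
      (EuclideanSpace.single j 1) = if i = j then c i p else 0 := by
    intro i
    rw [chartDeriv_mul hφ hp (hc i) (h1 i), chartDeriv_sub_const hφ hp (SmoothNear.coord hφ hp i),
      chartDeriv_coord hp]
    simp
  simp only [h2]
  simp

end ChartDerivatives

/-! ### Boundary coordinates under changes of charts. -/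

section BoundaryCoordinates

variable {n : ℕ} {M : Type*} [TopologicalSpace M] [ChartedSpace (EuclideanQuadrant n) M]
  {φ ψ : OpenPartialHomeomorph M (EuclideanQuadrant n)} {p q : M}

/-- The Jacobians `A` and `B` of the two coordinate changes are inverse to each other. By
`partialDeriv_nonneg`, a row that belongs to a vanishing coordinate is non-negative and supported on
the vanishing coordinates; inverse matrices with this property leave room for only one non-zero
entry in such a row. -/
theorem exists_partialDeriv_pos (hφ : φ ∈ IsManifold.maximalAtlas (QM n) ∞ M)
    (hψ : ψ ∈ IsManifold.maximalAtlas (QM n) ∞ M) (hq : q ∈ φ.source) (hq' : q ∈ ψ.source)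
    {k : Fin n} (hk : (ψ q).1 k = 0) :
    ∃ j, (φ q).1 j = 0 ∧ 0 < partialDeriv φ j (fun y => (ψ y).1 k) q ∧
      0 < partialDeriv ψ k (fun y => (φ y).1 j) q ∧
      ∀ l ≠ j, partialDeriv φ l (fun y => (ψ y).1 k) q = 0 := by
  set A : Fin n → Fin n → ℝ := fun k l => partialDeriv φ l (fun y => (ψ y).1 k) q
  set B : Fin n → Fin n → ℝ := fun l k => partialDeriv ψ k (fun y => (φ y).1 l) q
  have hAB : ∀ k k', ∑ l, A k l * B l k' = if k = k' then 1 else 0 := by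
    intro k k'
    have h1 := chartDeriv_comp hψ hφ hq' hq (SmoothNear.coord hψ hq' k) (EuclideanSpace.single k' 1)
    rw [← partialDeriv_coord (φ := ψ) hq' k k']
    exact h1.symm
  have hBA : ∀ l l', ∑ k, B l k * A k l' = if l = l' then 1 else 0 := by
    intro l l'
    have h1 := chartDeriv_comp hφ hψ hq hq' (SmoothNear.coord hφ hq l) (EuclideanSpace.single l' 1)
    rw [← partialDeriv_coord (φ := φ) hq l l']
    exact h1.symm
  have hA : ∀ k, (ψ q).1 k = 0 → ∀ l, 0 ≤ A k l ∧ (0 < (φ q).1 l → A k l = 0) := fun k hk l =>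
    partialDeriv_nonneg hφ hq (SmoothNear.coord hψ hq' k) hk
      (Filter.Eventually.of_forall fun y => (ψ y).2 k) l
  have hB : ∀ l, (φ q).1 l = 0 → ∀ k, 0 ≤ B l k ∧ (0 < (ψ q).1 k → B l k = 0) := fun l hl k =>
    partialDeriv_nonneg hψ hq' (SmoothNear.coord hφ hq l) hl
      (Filter.Eventually.of_forall fun y => (φ y).2 l) k
  have h0 : ∑ l, A k l * B l k ≠ 0 := by rw [hAB]; simp
  obtain ⟨j, -, hj⟩ := Finset.exists_ne_zero_of_sum_ne_zero h0
  have hzero : ∀ l, A k l ≠ 0 → (φ q).1 l = 0 := by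
    intro l hl
    by_contra hne
    exact hl ((hA k hk l).2 (lt_of_le_of_ne ((φ q).2 l) (Ne.symm hne)))
  have hj0 := hzero j (left_ne_zero_of_mul hj)
  have hBj : 0 < B j k := lt_of_le_of_ne (hB j hj0 k).1 (Ne.symm (right_ne_zero_of_mul hj))
  refine ⟨j, hj0, lt_of_le_of_ne (hA k hk j).1 (Ne.symm (left_ne_zero_of_mul hj)), hBj, ?_⟩
  intro l hl
  by_contra hne
  -- An off-diagonal entry of `B A` vanishes and all its terms are non-negative, so the term with
  -- the positive factor `B j k` must be zero.
  have h1 : ∑ k', B j k' * A k' l = 0 := by rw [hBA, if_neg (Ne.symm hl)]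
  have h2 : ∀ k' ∈ Finset.univ, 0 ≤ B j k' * A k' l := by
    intro k' _
    rcases (((ψ q).2 k').lt_or_eq) with hp | he
    · rw [(hB j hj0 k').2 hp, zero_mul]
    · exact mul_nonneg (hB j hj0 k').1 (hA k' he.symm l).1
  have h3 := (Finset.sum_eq_zero_iff_of_nonneg h2).1 h1 k (Finset.mem_univ k)
  exact (mul_ne_zero hBj.ne' hne) h3

/-- Each boundary coordinate of a chart is, up to a positive smooth factor, a boundary coordinate
of any other chart. -/
theorem exists_boundary_coord (hφ : φ ∈ IsManifold.maximalAtlas (QM n) ∞ M)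
    (hψ : ψ ∈ IsManifold.maximalAtlas (QM n) ∞ M) (hp : p ∈ φ.source) (hp' : p ∈ ψ.source)
    {k : Fin n} (hk : (ψ p).1 k = 0) :
    ∃ j, (φ p).1 j = 0 ∧ ∃ a : M → ℝ, SmoothNear n a p ∧ 0 < a p ∧
      ∀ᶠ q in 𝓝 p, (ψ q).1 k = a q * (φ q).1 j := by
  obtain ⟨j, hj, hA, hB, -⟩ := exists_partialDeriv_pos hφ hψ hp hp' hk
  -- At a zero `q` of `φ_j`, only one derivative of `φ_j` with respect to the coordinates of `ψ` is
  -- non-zero, and the corresponding coordinate of `ψ` vanishes at `q`. By continuity the derivative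
  -- with respect to `ψ_k` is still positive, so that coordinate is `ψ_k`.
  have hv : ∀ᶠ q in 𝓝 p, (∀ i ∈ ({j} : Set (Fin n)), (φ q).1 i = (φ p).1 i) → (ψ q).1 k = 0 := by
    have hc := continuousAt_partialDeriv hψ hp' (SmoothNear.coord hφ hp j) k
    filter_upwards [hc.eventually (lt_mem_nhds hB), φ.open_source.mem_nhds hp,
      ψ.open_source.mem_nhds hp'] with q hq hqs hqs' hqj
    obtain ⟨k', hk', -, -, hl⟩ := exists_partialDeriv_pos hψ hφ hqs' hqs
      (k := j) ((hqj j rfl).trans hj)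
    by_cases hkk : k = k'
    · rw [hkk]; exact hk'
    · exact absurd (hl k hkk) hq.ne'
  obtain ⟨c, hc, hc0, he⟩ := exists_eq_sum_of_vanish hφ hp {j} (SmoothNear.coord hψ hp' k) hv
  refine ⟨j, hj, c j, hc j, ?_, ?_⟩
  · rw [← partialDeriv_of_eq_sum hφ hp hc he j]
    exact hA
  · filter_upwards [he] with q hq
    rw [hq, Finset.sum_eq_single j]
    · rw [hj, sub_zero]
    · intro i _ hi
      rw [hc0 i (by simpa using hi)]
      simp
    · simp

end BoundaryCoordinates

/-! ### Nearby points with prescribed coordinates. -/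

section Paths

variable {n : ℕ} {M : Type*} [TopologicalSpace M] [ChartedSpace (EuclideanQuadrant n) M]
  {φ : OpenPartialHomeomorph M (EuclideanQuadrant n)} {q : M}

/-- A path issuing from `q` along which the coordinates change linearly, in an inward direction. -/
theorem exists_path (hq : q ∈ φ.source) {v : Fin n → ℝ} (hv : ∀ i, (φ q).1 i = 0 → 0 ≤ v i) :
    ∃ γ : ℝ → M, Filter.Tendsto γ (𝓝[>] 0) (𝓝 q) ∧
      ∀ᶠ ε in 𝓝[>] (0 : ℝ), ∀ j, (φ (γ ε)).1 j = (φ q).1 j + ε * v j := by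
  let w : ℝ → EuclideanSpace ℝ (Fin n) := fun ε => WithLp.toLp 2 fun j => (φ q).1 j + ε * v j
  have hw : Continuous w := by
    apply (EuclideanSpace.equiv (Fin n) ℝ).symm.continuous.comp
    fun_prop
  have hw0 : w 0 = (φ q).1 := by ext j; simp [w]
  have h1 : Filter.Tendsto (fun ε => (QM n).symm (w ε)) (𝓝[>] 0) (𝓝 (φ q)) := by
    have h2 : Continuous fun ε => (QM n).symm (w ε) := (QM n).continuous_symm.comp hw
    have h3 := h2.tendsto 0
    rw [hw0, quadrant_symm_val] at h3
    exact h3.mono_left nhdsWithin_le_nhds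
  have h2 : Filter.Tendsto (fun ε => φ.symm ((QM n).symm (w ε))) (𝓝[>] 0) (𝓝 q) := by
    have h3 := (φ.continuousAt_symm (φ.map_source hq)).tendsto
    rw [φ.left_inv hq] at h3
    exact h3.comp h1
  refine ⟨_, h2, ?_⟩
  have h4 : ∀ j, ∀ᶠ ε in 𝓝[>] (0 : ℝ), 0 ≤ w ε j := by
    intro j
    rcases ((φ q).2 j).eq_or_lt with h | h
    · filter_upwards [self_mem_nhdsWithin] with ε hε
      have hvj := hv j h.symm
      have hε' : (0 : ℝ) < ε := hε
      change 0 ≤ (φ q).1 j + ε * v j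
      have := mul_nonneg hε'.le hvj
      rw [← h]
      linarith
    · have h5 : Continuous fun ε => w ε j := by
        change Continuous fun ε => (φ q).1 j + ε * v j
        fun_prop
      have h6 : ∀ᶠ ε in 𝓝 (0 : ℝ), 0 < w ε j := by
        have h7 := h5.tendsto 0
        rw [hw0] at h7
        exact h7.eventually (lt_mem_nhds h)
      filter_upwards [nhdsWithin_le_nhds h6] with ε hε using hε.le
  filter_upwards [h1.eventually (φ.open_target.mem_nhds (φ.map_source hq)),
    Filter.eventually_all.2 h4] with ε hε hpos j
  rw [φ.right_inv hε, quadrant_val_symm (mem_range_quadrant.2 hpos)]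

/-- Points near `q` with the same coordinates, except that some of them are increased. -/
theorem frequently_coord_add (hq : q ∈ φ.source) {v : Fin n → ℝ}
    (hv : ∀ i, (φ q).1 i = 0 → 0 ≤ v i) :
    ∃ᶠ y in 𝓝 q, y ∈ φ.source ∧ ∃ ε > 0, ∀ j, (φ y).1 j = (φ q).1 j + ε * v j := by
  obtain ⟨γ, hγ, he⟩ := exists_path hq hv
  refine hγ.frequently (Filter.Eventually.frequently ?_)
  filter_upwards [he, self_mem_nhdsWithin, hγ.eventually (φ.open_source.mem_nhds hq)] with
    ε h1 h2 h3 using ⟨h3, ε, h2, h1⟩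

theorem frequently_coord_pos (hq : q ∈ φ.source) :
    ∃ᶠ y in 𝓝 q, y ∈ φ.source ∧ ∀ j, 0 < (φ y).1 j := by
  refine (frequently_coord_add hq (v := fun _ => 1) fun _ _ => zero_le_one).mono ?_
  rintro y ⟨hy, ε, hε, h⟩
  refine ⟨hy, fun j => ?_⟩
  rw [h]
  have := (φ q).2 j
  linarith

end Paths

/-! ### Cancelling factors with dense non-zeros. -/

section Regular

variable {n : ℕ} {Z : Type*} [TopologicalSpace Z] [ChartedSpace (EuclideanQuadrant n) Z]
  {t w w' : Z → ℝ} {z : Z}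

/-- The non-zeros of `t` are dense near `z`. -/
def RegularAt (t : Z → ℝ) (z : Z) : Prop := ∀ᶠ y in 𝓝 z, ∃ᶠ y' in 𝓝 y, t y' ≠ 0

/-- If `w` and `w'` differed at a point `y`, they would differ in a neighbourhood of `y`, and this
contains a point where `t` can be cancelled. -/
theorem RegularAt.cancel (ht : RegularAt t z) (hw : SmoothNear n w z) (hw' : SmoothNear n w' z)
    (he : ∀ᶠ y in 𝓝 z, t y * w y = t y * w' y) : ∀ᶠ y in 𝓝 z, w y = w' y := by
  filter_upwards [ht, hw, hw', he.eventually_nhds] with y h1 h2 h3 h4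
  by_contra hne
  have h5 : ∀ᶠ y' in 𝓝 y, w y' - w' y' ≠ 0 :=
    (h2.continuousAt.sub h3.continuousAt).eventually_ne (sub_ne_zero.2 hne)
  obtain ⟨y', h6, h7, h8⟩ := (h1.and_eventually (h4.and h5)).exists
  exact h8 (sub_eq_zero.2 (mul_left_cancel₀ h6 h7))

end Regular

/-! ### Monomials in boundary coordinates and their divisibility. -/

section Monomials

variable {n : ℕ} {Z : Type*} [TopologicalSpace Z] [ChartedSpace (EuclideanQuadrant n) Z]
  {ψ ψ' : OpenPartialHomeomorph Z (EuclideanQuadrant n)} {t t' w : Z → ℝ} {z : Z}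

/-- Near `z`, the function `t` is the product of a positive smooth function and of the monomial
with exponents `e` in the boundary coordinates of `ψ` at `z`. -/
def MonomialWith (ψ : OpenPartialHomeomorph Z (EuclideanQuadrant n)) (e : Fin n → ℕ) (t : Z → ℝ)
    (z : Z) : Prop :=
  (∀ k, (ψ z).1 k ≠ 0 → e k = 0) ∧ ∃ a : Z → ℝ, SmoothNear n a z ∧ 0 < a z ∧
    ∀ᶠ y in 𝓝 z, t y = a y * ∏ k, (ψ y).1 k ^ e k

variable (n) in
/-- Near `z`, the function `t` is a positive smooth function times a monomial in boundary
coordinates. -/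
def MonomialAt (t : Z → ℝ) (z : Z) : Prop :=
  ∃ ψ ∈ IsManifold.maximalAtlas (QM n) ∞ Z, z ∈ ψ.source ∧ ∃ e, MonomialWith ψ e t z

theorem MonomialWith.mul {e e' : Fin n → ℕ} (h : MonomialWith ψ e t z)
    (h' : MonomialWith ψ e' t' z) : MonomialWith ψ (e + e') (fun y => t y * t' y) z := by
  obtain ⟨h0, a, ha, hp, he⟩ := h
  obtain ⟨h0', a', ha', hp', he'⟩ := h'
  refine ⟨fun k hk => by simp [h0 k hk, h0' k hk], fun y => a y * a' y, ha.mul ha',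
    mul_pos hp hp', ?_⟩
  filter_upwards [he, he'] with y h1 h2
  rw [h1, h2]
  simp only [Pi.add_apply, pow_add, Finset.prod_mul_distrib]
  ring

theorem MonomialWith.of_pos (ht : SmoothNear n t z) (hp : 0 < t z) :
    MonomialWith ψ 0 t z :=
  ⟨fun _ _ => rfl, t, ht, hp, Filter.Eventually.of_forall fun y => by simp⟩

theorem MonomialWith.congr {e : Fin n → ℕ} (h : MonomialWith ψ e t z)
    (he : ∀ᶠ y in 𝓝 z, t' y = t y) : MonomialWith ψ e t' z := by
  obtain ⟨h0, a, ha, hp, h1⟩ := h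
  refine ⟨h0, a, ha, hp, ?_⟩
  filter_upwards [h1, he] with y h2 h3
  rw [h3, h2]

theorem monomialWith_coord {k : Fin n} (hk : (ψ z).1 k = 0) :
    MonomialWith ψ (Pi.single k 1) (fun y => (ψ y).1 k) z := by
  refine ⟨fun l hl => ?_, fun _ => 1, SmoothNear.const 1, zero_lt_one, ?_⟩
  · rw [Pi.single_apply, if_neg]
    rintro rfl
    exact hl hk
  · refine Filter.Eventually.of_forall fun y => ?_
    rw [one_mul, Finset.prod_eq_single k]
    · simp
    · intro l _ hl
      simp [hl]
    · simp

theorem exists_monomialWith_prod {ι : Type*} (s : Finset ι) {F : ι → Z → ℝ}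
    (hF : ∀ i ∈ s, ∃ e, MonomialWith ψ e (F i) z) :
    ∃ e, MonomialWith ψ e (fun y => ∏ i ∈ s, F i y) z := by
  classical
  induction s using Finset.induction_on with
  | empty => exact ⟨0, by simpa using MonomialWith.of_pos (SmoothNear.const 1) zero_lt_one⟩
  | insert i s hi ih =>
    obtain ⟨e, he⟩ := hF i (Finset.mem_insert_self i s)
    obtain ⟨e', he'⟩ := ih fun j hj => hF j (Finset.mem_insert_of_mem hj)
    refine ⟨e + e', ?_⟩
    simp only [Finset.prod_insert hi]
    exact he.mul he'

theorem exists_monomialWith_pow {e : Fin n → ℕ} (h : MonomialWith ψ e t z) (m : ℕ) :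
    ∃ e, MonomialWith ψ e (fun y => t y ^ m) z := by
  have := exists_monomialWith_prod (ψ := ψ) (z := z) (Finset.range m) (F := fun _ => t)
    fun _ _ => ⟨e, h⟩
  simpa using this

/-- Being a monomial does not depend on the chart, by `exists_boundary_coord`; two monomials can
therefore be compared in one chart. -/
theorem MonomialAt.exists_monomialWith (h : MonomialAt n t z)
    (hψ : ψ ∈ IsManifold.maximalAtlas (QM n) ∞ Z) (hz : z ∈ ψ.source) :
    ∃ e, MonomialWith ψ e t z := by
  obtain ⟨φ, hφ, hzφ, e, h0, a, ha, hp, he⟩ := h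
  have hc : ∀ k, ∃ e, MonomialWith ψ e (fun y => (φ y).1 k) z := by
    intro k
    rcases ((φ z).2 k).eq_or_lt with hk | hk
    · obtain ⟨j, hj, b, hb, hbp, hbe⟩ := exists_boundary_coord hψ hφ hz hzφ hk.symm
      exact ⟨_, ((MonomialWith.of_pos hb hbp).mul (monomialWith_coord hj)).congr hbe⟩
    · exact ⟨0, MonomialWith.of_pos (SmoothNear.coord hφ hzφ k) hk⟩
  obtain ⟨e', he'⟩ := exists_monomialWith_prod Finset.univ
    (F := fun k y => (φ y).1 k ^ e k) fun k _ => exists_monomialWith_pow (hc k).choose_spec (e k)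
  exact ⟨_, ((MonomialWith.of_pos ha hp).mul he').congr he⟩

namespace MonomialAt

theorem congr (h : MonomialAt n t z) (he : ∀ᶠ y in 𝓝 z, t' y = t y) : MonomialAt n t' z := by
  obtain ⟨ψ, hψ, hz, e, h⟩ := h
  exact ⟨ψ, hψ, hz, e, h.congr he⟩

theorem mul (h : MonomialAt n t z) (h' : MonomialAt n t' z) :
    MonomialAt n (fun y => t y * t' y) z := by
  obtain ⟨ψ, hψ, hz, e, h⟩ := h
  obtain ⟨e', h'⟩ := h'.exists_monomialWith hψ hz
  exact ⟨ψ, hψ, hz, _, h.mul h'⟩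

theorem coord (hψ : ψ ∈ IsManifold.maximalAtlas (QM n) ∞ Z) (hz : z ∈ ψ.source) (k : Fin n) :
    MonomialAt n (fun y => (ψ y).1 k) z := by
  rcases ((ψ z).2 k).eq_or_lt with hk | hk
  · exact ⟨ψ, hψ, hz, _, monomialWith_coord hk.symm⟩
  · exact ⟨ψ, hψ, hz, 0, MonomialWith.of_pos (SmoothNear.coord hψ hz k) hk⟩

theorem smoothNear (h : MonomialAt n t z) : SmoothNear n t z := by
  obtain ⟨ψ, hψ, hz, e, h0, a, ha, hp, h1⟩ := h
  exact (ha.mul (SmoothNear.prod fun k _ => (SmoothNear.coord hψ hz k).pow (e k))).congr h1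

theorem regularAt (h : MonomialAt n t z) : RegularAt t z := by
  obtain ⟨ψ, hψ, hz, e, h0, a, ha, hp, h1⟩ := h
  filter_upwards [ψ.open_source.mem_nhds hz, h1.eventually_nhds,
    (ha.eventually_pos hp).eventually_nhds] with y hy h2 h3
  refine ((frequently_coord_pos hy).and_eventually (h2.and h3)).mono ?_
  rintro y' ⟨⟨-, h4⟩, h5, h6⟩
  rw [h5]
  exact mul_ne_zero h6.ne' (Finset.prod_ne_zero_iff.2 fun k _ => pow_ne_zero _ (h4 k).ne')

theorem eventually_nonneg (h : MonomialAt n t z) : ∀ᶠ y in 𝓝 z, 0 ≤ t y := by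
  obtain ⟨ψ, hψ, hz, e, h0, a, ha, hp, h1⟩ := h
  filter_upwards [h1, ha.eventually_pos hp] with y h2 h3
  rw [h2]
  exact mul_nonneg h3.le (Finset.prod_nonneg fun k _ => pow_nonneg ((ψ y).2 k) _)

end MonomialAt

theorem MonomialAt.of_pos [IsManifold (QM n) ∞ Z] (ht : SmoothNear n t z) (hp : 0 < t z) :
    MonomialAt n t z :=
  ⟨chartAt _ z, IsManifold.chart_mem_maximalAtlas z, mem_chart_source _ z, 0,
    MonomialWith.of_pos ht hp⟩

/-- Orders of vanishing are compared at a nearby point `y` at which `ψ_k` is the only vanishing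
coordinate. If `e k < e' k`, then dividing by the `e k`-th power of `ψ_k` on a path into the
interior makes the left side tend to a positive number and the right side to zero. -/
theorem MonomialWith.le_of_eq_mul {e e' : Fin n → ℕ} (hz : z ∈ ψ.source)
    (h : MonomialWith ψ e t z) (h' : MonomialWith ψ e' t' z) (hw : SmoothNear n w z)
    (he : ∀ᶠ y in 𝓝 z, t y = t' y * w y) : e' ≤ e := by
  obtain ⟨h0, a, ha, hp, h1⟩ := h
  obtain ⟨h0', a', ha', hp', h1'⟩ := h'
  intro k
  by_contra! hlt
  have hk : (ψ z).1 k = 0 := by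
    by_contra hk
    rw [h0' k hk] at hlt
    exact absurd hlt (Nat.not_lt_zero _)
  have hev : ∀ᶠ y in 𝓝 z, ∀ᶠ x in 𝓝 y, t x = t' x * w x ∧
      t x = a x * ∏ k, (ψ x).1 k ^ e k ∧ t' x = a' x * ∏ k, (ψ x).1 k ^ e' k :=
    (he.and (h1.and h1')).eventually_nhds
  -- Raising all coordinates but the `k`-th leads to a generic point of the face `ψ_k = 0`.
  have hfr := frequently_coord_add hz (v := fun j => if j = k then 0 else 1)
    (fun i _ => by split_ifs <;> norm_num)
  obtain ⟨y, ⟨hys, ε, hε, hy⟩, h2, h3, h4, h5⟩ := (hfr.and_eventually (hev.and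
    (ha.and ((ha.eventually_pos hp).and (hw.and ha'))))).exists
  have hyk : (ψ y).1 k = 0 := by rw [hy]; simp [hk]
  have hyj : ∀ j ≠ k, 0 < (ψ y).1 j := by
    intro j hj
    rw [hy, if_neg hj]
    have := (ψ z).2 j
    linarith
  obtain ⟨γ, hγ, hγe⟩ := exists_path hys (v := fun j => if j = k then 1 else 0)
    (fun i _ => by split_ifs <;> norm_num)
  set P : (Fin n → ℕ) → ℝ := fun e => ∏ j ∈ Finset.univ.erase k, (ψ y).1 j ^ e j
  have hP : ∀ e, 0 < P e := fun e => Finset.prod_pos fun j hj =>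
    pow_pos (hyj j (Finset.ne_of_mem_erase hj)) _
  -- On the path, `ψ_k` equals `δ` and the other coordinates are constant, so their monomial is the
  -- constant `P`. The exponent `e' k - e k - 1` leaves one factor `δ` to force the limit zero.
  have hev2 : ∀ᶠ δ in 𝓝[>] (0 : ℝ),
      a (γ δ) * P e = δ * (δ ^ (e' k - e k - 1) * (a' (γ δ) * P e' * w (γ δ))) := by
    filter_upwards [hγe, hγ.eventually h2, self_mem_nhdsWithin] with δ h6 h7 hδ
    have hδ' : (0 : ℝ) < δ := hδ
    have hprod : ∀ e : Fin n → ℕ, ∏ j, (ψ (γ δ)).1 j ^ e j = δ ^ e k * P e := by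
      intro e
      rw [← Finset.mul_prod_erase _ _ (Finset.mem_univ k)]
      congr 1
      · rw [h6, hyk]; simp
      · refine Finset.prod_congr rfl fun j hj => ?_
        rw [h6, if_neg (Finset.ne_of_mem_erase hj)]; simp
    obtain ⟨h8, h9, h10⟩ := h7
    rw [h9, h10, hprod, hprod] at h8
    have hsplit : δ ^ e' k = δ ^ e k * (δ * δ ^ (e' k - e k - 1)) := by
      rw [← pow_succ', ← pow_add]
      have hlt' : e k < e' k := hlt
      congr 1
      omega
    rw [hsplit] at h8
    have h11 : δ ^ e k ≠ 0 := pow_ne_zero _ hδ'.ne'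
    apply mul_left_cancel₀ h11
    linear_combination h8
  have hlim1 : Filter.Tendsto (fun δ => a (γ δ) * P e) (𝓝[>] 0) (𝓝 (a y * P e)) :=
    ((h3.continuousAt.tendsto.comp hγ).mul_const _)
  have hid : Filter.Tendsto (fun δ : ℝ => δ) (𝓝[>] 0) (𝓝 0) := nhdsWithin_le_nhds
  have hlim2 := hid.mul ((hid.pow (e' k - e k - 1)).mul
    (((h5.2.continuousAt.tendsto.comp hγ).mul_const (P e')).mul
      (h5.1.continuousAt.tendsto.comp hγ)))
  rw [zero_mul] at hlim2
  have := tendsto_nhds_unique (hlim1.congr' hev2) hlim2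
  exact (mul_pos h4 (hP e)).ne' this

/-- The exponents can be subtracted by `MonomialWith.le_of_eq_mul`, and cancelling `t'` identifies
`w` with the quotient monomial. Coordinates of lifts and generators of lifted ideals arise as such
quotients. -/
theorem MonomialAt.of_eq_mul (h : MonomialAt n t z) (h' : MonomialAt n t' z)
    (hw : SmoothNear n w z) (he : ∀ᶠ y in 𝓝 z, t y = t' y * w y) : MonomialAt n w z := by
  have hreg := h'.regularAt
  have hsm := h'.smoothNear
  obtain ⟨ψ, hψ, hz, e, h⟩ := h
  obtain ⟨e', h'⟩ := h'.exists_monomialWith hψ hz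
  have hle := h.le_of_eq_mul hz h' hw he
  obtain ⟨h0, a, ha, hp, h1⟩ := h
  obtain ⟨h0', a', ha', hp', h1'⟩ := h'
  refine ⟨ψ, hψ, hz, e - e', fun k hk => by simp [h0 k hk], fun y => a y / a' y,
    ha.div ha' hp'.ne', div_pos hp hp', ?_⟩
  refine hreg.cancel hw ((ha.div ha' hp'.ne').mul
    (SmoothNear.prod fun k _ => (SmoothNear.coord hψ hz k).pow _)) ?_
  filter_upwards [he, h1, h1', ha'.eventually_ne hp'.ne'] with y h2 h3 h4 h5
  rw [← h2, h3, h4]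
  have h6 : ∏ k, (ψ y).1 k ^ e k = (∏ k, (ψ y).1 k ^ e' k) * ∏ k, (ψ y).1 k ^ (e - e') k := by
    rw [← Finset.prod_mul_distrib]
    refine Finset.prod_congr rfl fun k _ => ?_
    rw [← pow_add, Pi.sub_apply, Nat.add_sub_cancel' (hle k)]
  rw [h6]
  field_simp

end Monomials

/-! ### Maps that pull monomials back to monomials. -/

section LocalBMaps

variable {n : ℕ} {Z : Type*} [TopologicalSpace Z] [ChartedSpace (EuclideanQuadrant n) Z]
  {M : Type*} [TopologicalSpace M] [ChartedSpace (EuclideanQuadrant n) M]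
  {W : Type*} [TopologicalSpace W] [ChartedSpace (EuclideanQuadrant n) W]

variable (n) in
/-- `f` pulls monomials at `f z` back to monomials at `z`. -/
def LocalBMapAt (f : Z → M) (z : Z) : Prop :=
  ∀ t : M → ℝ, MonomialAt n t (f z) → MonomialAt n (fun y => t (f y)) z

theorem LocalBMapAt.comp {f : Z → M} {g : M → W} {z : Z} (hg : LocalBMapAt n g (f z))
    (hf : LocalBMapAt n f z) : LocalBMapAt n (fun y => g (f y)) z :=
  fun t ht => hf _ (hg t ht)

/-- It suffices to test the coordinates of one chart, because every monomial is a unit times a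
product of their powers. -/
theorem LocalBMapAt.of_coord [IsManifold (QM n) ∞ Z] {f : Z → M} {z : Z}
    (hf : SmoothMapNear n f z)
    {φ : OpenPartialHomeomorph M (EuclideanQuadrant n)}
    (hφ : φ ∈ IsManifold.maximalAtlas (QM n) ∞ M) (hz : f z ∈ φ.source)
    (h : ∀ j, MonomialAt n (fun y => (φ (f y)).1 j) z) : LocalBMapAt n f z := by
  intro t ht
  obtain ⟨e, h0, a, ha, hp, he⟩ := ht.exists_monomialWith hφ hz
  have hchart := IsManifold.chart_mem_maximalAtlas (I := QM n) (n := ∞) z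
  obtain ⟨e', he'⟩ := exists_monomialWith_prod (ψ := chartAt (EuclideanQuadrant n) z) (z := z)
    Finset.univ (F := fun k y => (φ (f y)).1 k ^ e k) fun k _ =>
      exists_monomialWith_pow ((h k).exists_monomialWith hchart (mem_chart_source _ z)).choose_spec
        (e k)
  refine ⟨_, hchart, mem_chart_source _ z, _, ((MonomialWith.of_pos (t := fun y => a (f y))
    (ha.comp hf) hp).mul he').congr ?_⟩
  exact hf.continuousAt.eventually he

end LocalBMaps

/-! ### Vanishing ideals, principal pull-backs, total transforms and clean intersections. -/

section VanishingIdeals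

variable {n : ℕ} {M : Type*} [TopologicalSpace M] [ChartedSpace (EuclideanQuadrant n) M]
  {X : Type*} [TopologicalSpace X] [ChartedSpace (EuclideanQuadrant n) X]
  {Z : Type*} [TopologicalSpace Z] [ChartedSpace (EuclideanQuadrant n) Z]

variable (n) in
/-- The germ of `h` at `p` belongs to the vanishing ideal of `P`. -/
def IdealAt (P : Set M) (p : M) (h : M → ℝ) : Prop :=
  SmoothNear n h p ∧ ∀ᶠ q in 𝓝 p, q ∈ P → h q = 0

theorem IdealAt.congr_set {P P' : Set M} {p : M} {h : M → ℝ} (hh : IdealAt n P p h)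
    (he : ∀ᶠ q in 𝓝 p, q ∈ P' → q ∈ P) : IdealAt n P' p h := by
  refine ⟨hh.1, ?_⟩
  filter_upwards [hh.2, he] with q h1 h2 h3 using h1 (h2 h3)

theorem IdealAt.sum_mul {ι : Type*} [Fintype ι] {P : Set M} {p : M} {c y : ι → M → ℝ}
    (hc : ∀ l, SmoothNear n (c l) p) (hy : ∀ l, IdealAt n P p (y l)) :
    IdealAt n P p (fun q => ∑ l, c l q * y l q) := by
  refine ⟨SmoothNear.sum fun l _ => (hc l).mul (hy l).1, ?_⟩
  filter_upwards [Filter.eventually_all.2 fun l => (hy l).2] with q hq hP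
  exact Finset.sum_eq_zero fun l _ => by rw [hq l hP, mul_zero]

variable (n) in
/-- The functions `y` generate the vanishing ideal of `P` at `p`, and `P` is their zero set near
`p`. -/
structure GensAt {ι : Type} [Fintype ι] (P : Set M) (p : M) (y : ι → M → ℝ) : Prop where
  smoothNear : ∀ l, SmoothNear n (y l) p
  mem_iff : ∀ᶠ q in 𝓝 p, q ∈ P ↔ ∀ l, y l q = 0
  exists_eq_sum : ∀ h, IdealAt n P p h → ∃ c : ι → M → ℝ, (∀ l, SmoothNear n (c l) p) ∧
    ∀ᶠ q in 𝓝 p, h q = ∑ l, c l q * y l q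

theorem GensAt.idealAt {ι : Type} [Fintype ι] {P : Set M} {p : M} {y : ι → M → ℝ}
    (hy : GensAt n P p y) (l : ι) : IdealAt n P p (y l) :=
  ⟨hy.smoothNear l, hy.mem_iff.mono fun _ hq hP => hq.1 hP l⟩

/-- Off `P` the vanishing ideal consists of all germs, so a unit among the functions generates it.
This covers points that the lift of a centre does not meet. -/
theorem GensAt.of_unit {ι : Type} [Fintype ι] {P : Set M} {p : M} {y : ι → M → ℝ}
    (hP : ∀ᶠ q in 𝓝 p, q ∉ P) (hy : ∀ l, SmoothNear n (y l) p) {i : ι} (hi : y i p ≠ 0) :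
    GensAt n P p y := by
  classical
  refine ⟨hy, ?_, fun h hh => ⟨fun l q => if l = i then h q / y i q else 0, fun l => ?_, ?_⟩⟩
  · filter_upwards [hP, (hy i).eventually_ne hi] with q h1 h2
    exact ⟨fun h => absurd h h1, fun h => absurd (h i) h2⟩
  · by_cases hl : l = i
    · simpa only [hl, if_true] using hh.1.div (hy i) hi
    · simpa only [hl, if_false] using SmoothNear.const 0
  · filter_upwards [(hy i).eventually_ne hi] with q h2
    rw [Finset.sum_eq_single i]
    · simp [h2]
    · intro l _ hl
      simp [hl]
    · simp

/-- The centred coordinates of `φ` with index in `I` (and zero for the other indices). -/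
noncomputable def adaptedFun (φ : OpenPartialHomeomorph M (EuclideanQuadrant n)) (I : Set (Fin n))
    (p : M) (i : Fin n) (q : M) : ℝ :=
  open Classical in if i ∈ I then (φ q).1 i - (φ p).1 i else 0

/-- This is Hadamard's lemma `exists_eq_sum_of_vanish` in terms of ideals. -/
theorem gensAt_adaptedFun {P : Set M} {p : M}
    {φ : OpenPartialHomeomorph M (EuclideanQuadrant n)} {I : Set (Fin n)}
    (hφ : φ ∈ IsManifold.maximalAtlas (QM n) ∞ M) (hp : p ∈ φ.source)
    (hP : ∀ᶠ q in 𝓝 p, q ∈ P ↔ ∀ i ∈ I, (φ q).1 i = (φ p).1 i) :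
    GensAt n P p (adaptedFun φ I p) := by
  refine ⟨fun i => ?_, ?_, fun h hh => ?_⟩
  · by_cases hi : i ∈ I
    · have h1 : adaptedFun φ I p i = fun q => (φ q).1 i - (φ p).1 i := by
        funext q; simp only [adaptedFun, hi, if_true]
      rw [h1]
      exact (SmoothNear.coord hφ hp i).sub (SmoothNear.const _)
    · have h1 : adaptedFun φ I p i = fun _ => 0 := by
        funext q; simp only [adaptedFun, hi, if_false]
      rw [h1]
      exact SmoothNear.const 0
  · filter_upwards [hP] with q hq
    rw [hq]
    refine ⟨fun h i => ?_, fun h i hi => ?_⟩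
    · simp only [adaptedFun]
      split_ifs with hi
      · rw [h i hi, sub_self]
      · rfl
    · have := h i
      simp only [adaptedFun, hi, if_true] at this
      linarith
  · have hv : ∀ᶠ q in 𝓝 p, (∀ i ∈ I, (φ q).1 i = (φ p).1 i) → h q = 0 := by
      filter_upwards [hh.2, hP] with q h1 h2 h3 using h1 (h2.2 h3)
    obtain ⟨c, hc, hc0, he⟩ := exists_eq_sum_of_vanish hφ hp I hh.1 hv
    refine ⟨c, hc, ?_⟩
    filter_upwards [he] with q hq
    rw [hq]
    refine Finset.sum_congr rfl fun i _ => ?_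
    simp only [adaptedFun]
    split_ifs with hi
    · rfl
    · simp [hc0 i hi]

variable (n) in
/-- The pull-back under `g` of the vanishing ideal of `P` is generated by `t` near `z`. -/
structure PrincipalAt (g : Z → M) (P : Set M) (t : Z → ℝ) (z : Z) : Prop where
  dvd : ∀ h, IdealAt n P (g z) h →
    ∃ w, SmoothNear n w z ∧ ∀ᶠ y in 𝓝 z, h (g y) = t y * w y
  exists_unit : ∃ h, IdealAt n P (g z) h ∧
    ∃ w, SmoothNear n w z ∧ w z ≠ 0 ∧ ∀ᶠ y in 𝓝 z, h (g y) = t y * w y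

variable (n) in
/-- The pull-back under `g` of the vanishing ideal of `P` is generated by a monomial near `z`. -/
def PrincipalMonomialAt (g : Z → M) (P : Set M) (z : Z) : Prop :=
  ∃ t, MonomialAt n t z ∧ PrincipalAt n g P t z

/-- Some member of the ideal pulls back to `t * u` with a unit `u`. Writing it through the
generators and cancelling `t` gives `u` as a combination of the `w l`, which therefore cannot all
vanish at `z`. -/
theorem PrincipalAt.exists_gens {ι : Type} [Fintype ι] {g : Z → M} {P : Set M} {t : Z → ℝ} {z : Z}
    (h : PrincipalAt n g P t z) (hg : SmoothMapNear n g z) (ht : RegularAt t z)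
    {y : ι → M → ℝ} (hy : GensAt n P (g z) y) :
    ∃ w : ι → Z → ℝ, (∀ l, SmoothNear n (w l) z) ∧ (∃ l, w l z ≠ 0) ∧
      ∀ l, ∀ᶠ x in 𝓝 z, y l (g x) = t x * w l x := by
  choose w hw hwe using fun l => h.dvd (y l) (hy.idealAt l)
  refine ⟨w, hw, ?_, hwe⟩
  obtain ⟨k, hk, u, hu, hu0, hue⟩ := h.exists_unit
  obtain ⟨c, hc, hce⟩ := hy.exists_eq_sum k hk
  have hs : SmoothNear n (fun x => ∑ l, c l (g x) * w l x) z :=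
    SmoothNear.sum fun l _ => ((hc l).comp hg).mul (hw l)
  have h1 := ht.cancel hu hs (by
    filter_upwards [hue, hg.continuousAt.eventually hce, Filter.eventually_all.2 hwe] with
      x h2 h3 h4
    rw [← h2, h3, Finset.mul_sum]
    refine Finset.sum_congr rfl fun l _ => ?_
    rw [h4 l]
    ring)
  by_contra! h0
  apply hu0
  rw [h1.self_of_nhds]
  exact Finset.sum_eq_zero fun l _ => by rw [h0 l, mul_zero]

theorem PrincipalAt.of_gens {ι : Type} [Fintype ι] {g : Z → M} {P : Set M} {t : Z → ℝ} {z : Z}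
    (hg : SmoothMapNear n g z) {y : ι → M → ℝ} (hy : GensAt n P (g z) y)
    {w : ι → Z → ℝ} (hw : ∀ l, SmoothNear n (w l) z) (h0 : ∃ l, w l z ≠ 0)
    (hwe : ∀ l, ∀ᶠ x in 𝓝 z, y l (g x) = t x * w l x) : PrincipalAt n g P t z := by
  constructor
  · intro h hh
    obtain ⟨c, hc, hce⟩ := hy.exists_eq_sum h hh
    refine ⟨fun x => ∑ l, c l (g x) * w l x,
      SmoothNear.sum fun l _ => ((hc l).comp hg).mul (hw l), ?_⟩
    filter_upwards [hg.continuousAt.eventually hce, Filter.eventually_all.2 hwe] with x h3 h4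
    rw [h3, Finset.mul_sum]
    refine Finset.sum_congr rfl fun l _ => ?_
    rw [h4 l]
    ring
  · obtain ⟨l, hl⟩ := h0
    exact ⟨y l, hy.idealAt l, w l, hw l, hl, hwe l⟩

theorem PrincipalAt.comp {β : X → M} {γ : Z → X} {P : Set M} {ρ : X → ℝ} {z : Z}
    (h : PrincipalAt n β P ρ (γ z)) (hγ : SmoothMapNear n γ z) :
    PrincipalAt n (fun y => β (γ y)) P (fun y => ρ (γ y)) z := by
  constructor
  · intro k hk
    obtain ⟨w, hw, he⟩ := h.dvd k hk
    exact ⟨_, hw.comp hγ, hγ.continuousAt.eventually he⟩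
  · obtain ⟨k, hk, w, hw, h0, he⟩ := h.exists_unit
    exact ⟨k, hk, _, hw.comp hγ, h0, hγ.continuousAt.eventually he⟩

theorem PrincipalAt.congr_set {g : Z → M} {P P' : Set M} {t : Z → ℝ} {z : Z}
    (h : PrincipalAt n g P t z) (he : ∀ᶠ q in 𝓝 (g z), q ∈ P' ↔ q ∈ P) :
    PrincipalAt n g P' t z := by
  constructor
  · exact fun k hk => h.dvd k (hk.congr_set (he.mono fun q hq => hq.2))
  · obtain ⟨k, hk, hw⟩ := h.exists_unit
    exact ⟨k, hk.congr_set (he.mono fun q hq => hq.1), hw⟩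

theorem principalAt_one {g : Z → M} {P : Set M} {z : Z}
    (hP : ∀ᶠ q in 𝓝 (g z), q ∉ P) (hg : SmoothMapNear n g z) :
    PrincipalAt n g P (fun _ => 1) z := by
  constructor
  · exact fun k hk => ⟨fun y => k (g y), hk.1.comp hg, Filter.Eventually.of_forall fun y => by simp⟩
  · exact ⟨fun _ => 1, ⟨SmoothNear.const 1, hP.mono fun q h1 h2 => absurd h2 h1⟩, fun _ => 1,
      SmoothNear.const 1, one_ne_zero, Filter.Eventually.of_forall fun y => by simp⟩

theorem PrincipalMonomialAt.of_not_mem [IsManifold (QM n) ∞ Z] {g : Z → M} {P : Set M} {z : Z}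
    (hP : ∀ᶠ q in 𝓝 (g z), q ∉ P) (hg : SmoothMapNear n g z) : PrincipalMonomialAt n g P z :=
  ⟨_, MonomialAt.of_pos (SmoothNear.const 1) zero_lt_one, principalAt_one hP hg⟩

/-- The two generators divide each other, and the product of the quotients is `1` after
cancellation. -/
theorem PrincipalAt.exists_eq_unit_mul {g : Z → M} {P : Set M} {t t' : Z → ℝ} {z : Z}
    (h : PrincipalAt n g P t z) (h' : PrincipalAt n g P t' z) (ht : RegularAt t z)
    (hs : SmoothNear n t z) (hs' : SmoothNear n t' z) :
    ∃ u, SmoothNear n u z ∧ u z ≠ 0 ∧ ∀ᶠ y in 𝓝 z, t' y = t y * u y := by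
  have key : ∀ {t t' : Z → ℝ}, PrincipalAt n g P t z → PrincipalAt n g P t' z →
      SmoothNear n t z → SmoothNear n t' z →
      ∃ u, SmoothNear n u z ∧ ∀ᶠ y in 𝓝 z, t y = t' y * u y := by
    intro t t' h h' hs hs'
    obtain ⟨k, hk, w, hw, hw0, hwe⟩ := h.exists_unit
    obtain ⟨v, hv, hve⟩ := h'.dvd k hk
    refine ⟨fun y => v y / w y, hv.div hw hw0, ?_⟩
    filter_upwards [hwe, hve, hw.eventually_ne hw0] with y h1 h2 h3
    rw [h1] at h2
    field_simp
    linarith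
  obtain ⟨a, ha, hae⟩ := key h h' hs hs'
  obtain ⟨b, hb, hbe⟩ := key h' h hs' hs
  refine ⟨b, hb, ?_, hbe⟩
  have h1 := ht.cancel (hb.mul ha) (SmoothNear.const 1) (by
    filter_upwards [hae, hbe] with y h2 h3
    rw [mul_one, ← mul_assoc, ← h3, ← h2])
  exact left_ne_zero_of_mul (h1.self_of_nhds ▸ one_ne_zero)

variable (n) in
/-- Near `x`, the total transform under `β` of the vanishing ideal of `Q` is `ρ` times the
vanishing ideal of `Q'`. -/
def TotalTransformAt (β : X → M) (Q : Set M) (Q' : Set X) (ρ : X → ℝ) (x : X) : Prop :=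
  ∃ (ι : Type) (_ : Fintype ι) (y : ι → M → ℝ) (w : ι → X → ℝ), GensAt n Q (β x) y ∧
    GensAt n Q' x w ∧ ∀ l, ∀ᶠ x' in 𝓝 x, y l (β x') = ρ x' * w l x'

/-- The exceptional factor may be changed by a unit, which allows one factor to be used for all
centres at once. -/
theorem TotalTransformAt.unit_mul {β : X → M} {Q : Set M} {Q' : Set X} {ρ ρ' u : X → ℝ} {x : X}
    (h : TotalTransformAt n β Q Q' ρ x) (hu : SmoothNear n u x) (hu0 : u x ≠ 0)
    (he : ∀ᶠ y in 𝓝 x, ρ y = ρ' y * u y) : TotalTransformAt n β Q Q' ρ' x := by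
  obtain ⟨ι, _, y, w, hy, hw, hyw⟩ := h
  refine ⟨ι, _, y, fun l q => u q * w l q, hy,
    ⟨fun l => hu.mul (hw.smoothNear l), ?_, fun h hh => ?_⟩, fun l => ?_⟩
  · filter_upwards [hw.mem_iff, hu.eventually_ne hu0] with q h1 h2
    rw [h1]
    simp [h2]
  · obtain ⟨c, hc, hce⟩ := hw.exists_eq_sum h hh
    refine ⟨fun l q => c l q / u q, fun l => (hc l).div hu hu0, ?_⟩
    filter_upwards [hce, hu.eventually_ne hu0] with q h1 h2
    rw [h1]
    refine Finset.sum_congr rfl fun l _ => ?_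
    field_simp
  · filter_upwards [hyw l, he] with q h1 h2
    rw [h1, h2]
    ring

theorem TotalTransformAt.exists_idealAt {β : X → M} {Q : Set M} {Q' : Set X} {ρ : X → ℝ} {x : X}
    (h : TotalTransformAt n β Q Q' ρ x) (hβ : SmoothMapNear n β x) {k : M → ℝ}
    (hk : IdealAt n Q (β x) k) :
    ∃ k', IdealAt n Q' x k' ∧ ∀ᶠ x' in 𝓝 x, k (β x') = ρ x' * k' x' := by
  obtain ⟨ι, _, y, w, hy, hw, hyw⟩ := h
  obtain ⟨c, hc, hce⟩ := hy.exists_eq_sum k hk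
  refine ⟨_, IdealAt.sum_mul (fun l => (hc l).comp hβ) hw.idealAt, ?_⟩
  filter_upwards [hβ.continuousAt.eventually hce, Filter.eventually_all.2 hyw] with q h1 h2
  rw [h1, Finset.mul_sum]
  refine Finset.sum_congr rfl fun l _ => ?_
  rw [h2 l]
  ring

/-- The generator downstairs is the exceptional factor times the generator for the lifted centre. -/
theorem TotalTransformAt.principalAt_comp {β : X → M} {γ : Z → X} {Q : Set M} {Q' : Set X}
    {ρ : X → ℝ} {t : Z → ℝ} {z : Z} (h : TotalTransformAt n β Q Q' ρ (γ z))
    (hβ : SmoothMapNear n β (γ z)) (hγ : SmoothMapNear n γ z) (ht : RegularAt t z)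
    (hp : PrincipalAt n γ Q' t z) :
    PrincipalAt n (fun y => β (γ y)) Q (fun y => ρ (γ y) * t y) z := by
  obtain ⟨ι, _, y, w, hy, hw, hyw⟩ := h
  obtain ⟨v, hv, hv0, hve⟩ := hp.exists_gens hγ ht hw
  refine PrincipalAt.of_gens (hβ.comp hγ) hy hv hv0 fun l => ?_
  filter_upwards [hve l, hγ.continuousAt.eventually (hyw l)] with x h1 h2
  rw [h2, h1, mul_assoc]

/-- The converse passage from a centre to its lift. At an index `i` with `v i z ≠ 0` the generator
`t` is `ρ ∘ g` times `(w i ∘ g) / v i`, so the latter is a quotient of monomials, hence a monomial,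
and it generates the pull-back of the lifted ideal. -/
theorem TotalTransformAt.principalMonomialAt {β : X → M} {g : Z → X} {Q : Set M} {Q' : Set X}
    {ρ : X → ℝ} {z : Z} (h : TotalTransformAt n β Q Q' ρ (g z))
    (hρ : MonomialAt n ρ (g z))
    (hβ : SmoothMapNear n β (g z)) (hg : SmoothMapNear n g z) (hb : LocalBMapAt n g z)
    (hp : PrincipalMonomialAt n (fun y => β (g y)) Q z) : PrincipalMonomialAt n g Q' z := by
  obtain ⟨ι, _, y, w, hy, hw, hyw⟩ := h
  obtain ⟨t, ht, hp⟩ := hp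
  obtain ⟨v, hv, ⟨i, hi⟩, hve⟩ := hp.exists_gens (hβ.comp hg) ht.regularAt hy
  have hr := hb ρ hρ
  have hwg : ∀ l, SmoothNear n (fun x => w l (g x)) z := fun l => (hw.smoothNear l).comp hg
  have he : ∀ l, ∀ᶠ x in 𝓝 z, ρ (g x) * w l (g x) = t x * v l x := by
    intro l
    filter_upwards [hve l, hg.continuousAt.eventually (hyw l)] with x h1 h2
    rw [← h1, h2]
  have hs : SmoothNear n (fun x => w i (g x) / v i x) z := (hwg i).div (hv i) hi
  have hts : ∀ᶠ x in 𝓝 z, t x = ρ (g x) * (w i (g x) / v i x) := by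
    filter_upwards [he i, (hv i).eventually_ne hi] with x h1 h2
    field_simp
    linarith
  refine ⟨_, ht.of_eq_mul hr hs hts, PrincipalAt.of_gens hg hw hv ⟨i, hi⟩ fun l => ?_⟩
  refine hr.regularAt.cancel (hwg l) (hs.mul (hv l)) ?_
  filter_upwards [he l, hts] with x h1 h2
  rw [h1, h2]
  ring

variable (n) in
/-- Near `p`, `R` is the intersection of `P` and `Q`, and this intersection is clean. -/
def CleanAt (R P Q : Set M) (p : M) : Prop :=
  (∀ᶠ q in 𝓝 p, q ∈ R ↔ q ∈ P ∧ q ∈ Q) ∧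
    ∀ h, IdealAt n R p h → ∃ h₁ h₂, IdealAt n P p h₁ ∧ IdealAt n Q p h₂ ∧
      ∀ᶠ q in 𝓝 p, h q = h₁ q + h₂ q

/-- The sum decomposition of the ideal of `R` is pulled back and divided by `ρ`. It is essential
that the three transforms have the same factor. With `R' = ∅` the conclusion says that the lifts of
`P` and `Q` are disjoint near `x`. -/
theorem CleanAt.totalTransform {β : X → M} {R P Q : Set M} {R' P' Q' : Set X} {ρ : X → ℝ} {x : X}
    (h : CleanAt n R P Q (β x)) (hβ : SmoothMapNear n β x) (hρ : RegularAt ρ x)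
    (hR : TotalTransformAt n β R R' ρ x) (hP : TotalTransformAt n β P P' ρ x)
    (hQ : TotalTransformAt n β Q Q' ρ x) : CleanAt n R' P' Q' x := by
  obtain ⟨ι, _, y, w, hy, hw, hyw⟩ := id hR
  have hsplit : ∀ l, ∃ k₁ k₂, IdealAt n P' x k₁ ∧ IdealAt n Q' x k₂ ∧
      ∀ᶠ q in 𝓝 x, w l q = k₁ q + k₂ q := by
    intro l
    obtain ⟨h₁, h₂, hh₁, hh₂, he⟩ := h.2 (y l) (hy.idealAt l)
    obtain ⟨k₁, hk₁, he₁⟩ := hP.exists_idealAt hβ hh₁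
    obtain ⟨k₂, hk₂, he₂⟩ := hQ.exists_idealAt hβ hh₂
    refine ⟨k₁, k₂, hk₁, hk₂, hρ.cancel (hw.smoothNear l) (hk₁.1.add hk₂.1) ?_⟩
    filter_upwards [hyw l, hβ.continuousAt.eventually he, he₁, he₂] with q a1 a2 a3 a4
    rw [← a1, a2, a3, a4, mul_add]
  choose k₁ k₂ hk₁ hk₂ hke using hsplit
  -- An inclusion of sets passes to the lifts: the generators for `S` lie in the ideal of `R`, so
  -- after division by `ρ` they lie in the ideal of `R'`.
  have hsub : ∀ {S : Set M} {S' : Set X}, TotalTransformAt n β S S' ρ x →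
      (∀ᶠ q in 𝓝 (β x), q ∈ R → q ∈ S) → ∀ᶠ q in 𝓝 x, q ∈ R' → q ∈ S' := by
    rintro S S' ⟨κ, _, yS, wS, hyS, hwS, hywS⟩ hRS
    have h1 : ∀ l, ∀ᶠ q in 𝓝 x, q ∈ R' → wS l q = 0 := by
      intro l
      obtain ⟨k, hk, hkS⟩ := hR.exists_idealAt hβ ((hyS.idealAt l).congr_set hRS)
      have h2 := hρ.cancel (hwS.smoothNear l) hk.1 (by
        filter_upwards [hywS l, hkS] with q a1 a2
        rw [← a1, a2])
      filter_upwards [h2, hk.2] with q a1 a2 a3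
      rw [a1, a2 a3]
    filter_upwards [Filter.eventually_all.2 h1, hwS.mem_iff] with q a1 a2 a3
    exact a2.2 fun l => a1 l a3
  refine ⟨?_, fun k hk => ?_⟩
  · filter_upwards [hsub hP (h.1.mono fun q hq hR => (hq.1 hR).1),
      hsub hQ (h.1.mono fun q hq hR => (hq.1 hR).2), hw.mem_iff,
      Filter.eventually_all.2 hke, Filter.eventually_all.2 fun l => (hk₁ l).2,
      Filter.eventually_all.2 fun l => (hk₂ l).2] with q a1 a2 a3 a4 a5 a6
    refine ⟨fun hq => ⟨a1 hq, a2 hq⟩, fun hq => a3.2 fun l => ?_⟩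
    rw [a4 l, a5 l hq.1, a6 l hq.2, add_zero]
  · obtain ⟨c, hc, hce⟩ := hw.exists_eq_sum k hk
    refine ⟨_, _, IdealAt.sum_mul hc hk₁, IdealAt.sum_mul hc hk₂, ?_⟩
    filter_upwards [hce, Filter.eventually_all.2 hke] with q a1 a2
    rw [a1, ← Finset.sum_add_distrib]
    refine Finset.sum_congr rfl fun l _ => ?_
    rw [a2 l, mul_add]

end VanishingIdeals

/-! ### Adapted charts near a point. -/

section AdaptedCharts

variable {n : ℕ} {M : Type*} [TopologicalSpace M] [ChartedSpace (EuclideanQuadrant n) M]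

/-- Near `p`, the set `P` is given by fixing the coordinates of `φ` with index in `I`. -/
structure AdaptedNear (P : Set M) (p : M) (φ : OpenPartialHomeomorph M (EuclideanQuadrant n))
    (I : Set (Fin n)) : Prop where
  mem_maximalAtlas : φ ∈ IsManifold.maximalAtlas (QM n) ∞ M
  mem_source : p ∈ φ.source
  mem_iff : ∀ᶠ q in 𝓝 p, q ∈ P ↔ ∀ i ∈ I, (φ q).1 i = (φ p).1 i

theorem AdaptedNear.gensAt {P : Set M} {p : M}
    {φ : OpenPartialHomeomorph M (EuclideanQuadrant n)} {I : Set (Fin n)}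
    (h : AdaptedNear P p φ I) : GensAt n P p (adaptedFun φ I p) :=
  gensAt_adaptedFun h.mem_maximalAtlas h.mem_source h.mem_iff

theorem AdaptedNear.congr_set {P P' : Set M} {p : M}
    {φ : OpenPartialHomeomorph M (EuclideanQuadrant n)} {I : Set (Fin n)}
    (h : AdaptedNear P p φ I) (he : ∀ᶠ q in 𝓝 p, q ∈ P' ↔ q ∈ P) : AdaptedNear P' p φ I := by
  refine ⟨h.1, h.2, ?_⟩
  filter_upwards [h.3, he] with q h1 h2
  rw [h2, h1]

theorem adaptedFun_of_mem {φ : OpenPartialHomeomorph M (EuclideanQuadrant n)} {I : Set (Fin n)}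
    {p : M} {i : Fin n} (hi : i ∈ I) : adaptedFun φ I p i = fun q => (φ q).1 i - (φ p).1 i := by
  funext q
  simp only [adaptedFun, hi, if_true]

theorem adaptedFun_of_notMem {φ : OpenPartialHomeomorph M (EuclideanQuadrant n)} {I : Set (Fin n)}
    {p : M} {i : Fin n} (hi : i ∉ I) : adaptedFun φ I p i = fun _ => 0 := by
  funext q
  simp only [adaptedFun, hi, if_false]

end AdaptedCharts

theorem IsAdaptedChart.adaptedNear {n : ℕ} {M : CornerManifold.{u} n} {P : Set M} {p : M}
    {φ : OpenPartialHomeomorph M (EuclideanQuadrant n)} {I : Set (Fin n)}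
    (h : IsAdaptedChart P p φ I) : AdaptedNear P p φ I := by
  refine ⟨h.1, h.2.1, ?_⟩
  filter_upwards [φ.open_source.mem_nhds h.2.1] with q hq
  have h1 := Set.ext_iff.1 h.2.2 q
  simp only [mem_inter_iff, hq, and_true, mem_ofPred_eq, true_and] at h1
  exact h1

/-! ### Tangent spaces and differentials of vanishing functions. -/

section TangentSpans

variable {n : ℕ} {M : CornerManifold.{u} n} {p : M}

theorem hasFDerivWithinAt_transition {φ ψ : OpenPartialHomeomorph M (EuclideanQuadrant n)}
    (hφ : φ ∈ IsManifold.maximalAtlas (QM n) ∞ M)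
    (hψ : ψ ∈ IsManifold.maximalAtlas (QM n) ∞ M) (hq : p ∈ φ.source) (hq' : p ∈ ψ.source) :
    ∃ A : EuclideanSpace ℝ (Fin n) →L[ℝ] EuclideanSpace ℝ (Fin n),
      HasFDerivWithinAt (fun x => (ψ (φ.symm ((QM n).symm x))).1) A (range (QM n)) (φ p).1 ∧
      ∀ v k, A v k = chartDeriv φ (fun y => (ψ y).1 k) p v := by
  refine ⟨((EuclideanSpace.equiv (Fin n) ℝ).symm : (Fin n → ℝ) →L[ℝ] EuclideanSpace ℝ (Fin n)) ∘L
      ContinuousLinearMap.pi fun k => chartDeriv φ (fun y => (ψ y).1 k) p, ?_, fun v k => rfl⟩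
  rw [hasFDerivWithinAt_euclidean]
  intro k
  exact (SmoothNear.coord hψ hq' k).hasFDerivWithinAt hφ hq

/-- A vector killed by the differentials of the defining coordinates is a combination of the
coordinate vectors of `φ` with index `j ∉ I`. Each of these is tangent, as `P` contains the segment
along which `φ_j` increases from `p`; this direction is inward even for a boundary coordinate. -/
theorem mem_tangentSpan_of_adaptedNear {P : Set M}
    {φ : OpenPartialHomeomorph M (EuclideanQuadrant n)} {I : Set (Fin n)}
    (h : AdaptedNear P p φ I) {v : EuclideanSpace ℝ (Fin n)}
    (hv : ∀ i, chartDeriv (chartAt (EuclideanQuadrant n) p) (adaptedFun φ I p i) p v = 0) :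
    v ∈ tangentSpan P p := by
  set c := chartAt (EuclideanQuadrant n) p with hc
  have hcm : c ∈ IsManifold.maximalAtlas (QM n) ∞ M := IsManifold.chart_mem_maximalAtlas p
  have hcs : p ∈ c.source := mem_chart_source _ p
  obtain ⟨A, hA, hAk⟩ := hasFDerivWithinAt_transition h.1 hcm h.2 hcs
  have hsum : v = ∑ j, chartDeriv c (fun y => (φ y).1 j) p v •
      A (EuclideanSpace.single j 1) := by
    ext k
    have h1 := chartDeriv_comp hcm h.1 hcs h.2 (SmoothNear.coord hcm hcs k) v
    rw [chartDeriv_coord hcs] at h1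
    simp only [WithLp.ofLp_sum, Finset.sum_apply, PiLp.smul_apply, smul_eq_mul, hAk]
    rw [← show EuclideanSpace.proj k v = v k from rfl, h1]
    exact Finset.sum_congr rfl fun j _ => mul_comm _ _
  rw [hsum]
  refine Submodule.sum_mem _ fun j _ => ?_
  by_cases hj : j ∈ I
  · have h1 := hv j
    rw [adaptedFun_of_mem hj,
      chartDeriv_sub_const hcm hcs (SmoothNear.coord h.1 h.2 j)] at h1
    rw [h1, zero_smul]
    exact Submodule.zero_mem _
  refine Submodule.smul_mem _ _ ?_
  obtain ⟨ε, hε, hb⟩ := exists_quadrantBall h.2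
    (Filter.Eventually.and h.3 (c.open_source.mem_nhds hcs))
  set S : Set (EuclideanSpace ℝ (Fin n)) :=
    quadrantBall (φ p).1 ε ∩ {x | ∀ i ∈ I, x i = (φ p).1 i} with hS
  have hSconv : Convex ℝ S := by
    refine (convex_quadrantBall _ _).inter ?_
    intro x hx y hy a b ha hb hab i hi
    simp only [PiLp.add_apply, PiLp.smul_apply, smul_eq_mul, hx i hi, hy i hi]
    rw [← add_mul, hab, one_mul]
  have hpS : (φ p).1 ∈ S := ⟨mem_quadrantBall_self _ hε, fun _ _ => rfl⟩
  have hδ : (0 : ℝ) < ε / 2 := half_pos hε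
  have hyS : (φ p).1 + (ε / 2) • EuclideanSpace.single j (1 : ℝ) ∈ S := by
    refine ⟨⟨mem_range_quadrant.2 fun i => ?_, ?_⟩, fun i hi => ?_⟩
    · have := (φ p).2 i
      simp only [PiLp.add_apply, PiLp.smul_apply, PiLp.single_apply, smul_eq_mul]
      split_ifs <;> linarith
    · rw [Metric.mem_ball, dist_eq_norm, add_sub_cancel_left, norm_smul,
        PiLp.norm_single, Real.norm_eq_abs, abs_of_pos hδ]
      simp
      linarith
    · have hij : i ≠ j := by rintro rfl; exact hj hi
      simp [hij]
  have h1 := mem_tangentConeAt_of_segment_subset (hSconv.segment_subset hpS hyS)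
  rw [add_sub_cancel_left] at h1
  have h2 := (hA.mono (inter_subset_left.trans inter_subset_left : S ⊆ _)).mapsTo_tangent_cone h1
  have h3 : A ((ε / 2) • EuclideanSpace.single j (1 : ℝ)) ∈ tangentSpan P p := by
    refine Submodule.subset_span ?_
    have hx : (c (φ.symm ((QM n).symm (φ p).1))).1 = extChartAt (QM n) p p := by
      rw [quadrant_symm_val, φ.left_inv h.2]
      rfl
    have h2' := h2
    rw [hx] at h2'
    refine tangentConeAt_mono ?_ h2'
    rintro _ ⟨x, hx, rfl⟩
    obtain ⟨hxt, hxP, hxc⟩ := hb x hx.1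
    refine ⟨φ.symm ((QM n).symm x), ⟨hxP.2 fun i hi => ?_, ?_⟩, rfl⟩
    · rw [φ.right_inv hxt, quadrant_val_symm hx.1.1]
      exact hx.2 i hi
    · rw [extChartAt_source]
      exact hxc
  rw [map_smul] at h3
  exact (Submodule.smul_mem_iff _ hδ.ne').1 h3

/-- Relative to `R`, the function has both its own differential and `0` as derivative, and two such
derivatives agree on the tangent cone. -/
theorem chartDeriv_eq_zero_of_mem_tangentSpan {R : Set M} {h : M → ℝ} (hh : IdealAt n R p h)
    {v : EuclideanSpace ℝ (Fin n)} (hR : p ∈ R) (hv : v ∈ tangentSpan R p) :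
    chartDeriv (chartAt (EuclideanQuadrant n) p) h p v = 0 := by
  set c := chartAt (EuclideanQuadrant n) p with hc
  have hcm : c ∈ IsManifold.maximalAtlas (QM n) ∞ M := IsManifold.chart_mem_maximalAtlas p
  have hcs : p ∈ c.source := mem_chart_source _ p
  suffices hle : tangentSpan R p ≤ (chartDeriv c h p : EuclideanSpace ℝ (Fin n) →ₗ[ℝ] ℝ).ker from
    LinearMap.mem_ker.1 (hle hv)
  refine Submodule.span_le.2 fun w hw => ?_
  obtain ⟨ε, hε, hb⟩ := exists_quadrantBall hcs hh.2
  set K := extChartAt (QM n) p '' (R ∩ (extChartAt (QM n) p).source)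
  have hpx : extChartAt (QM n) p p = (c p).1 := rfl
  rw [hpx] at hw
  have hw' : w ∈ tangentConeAt ℝ (K ∩ Metric.ball (c p).1 ε) (c p).1 := by
    refine tangentConeAt_mono_nhds ?_ hw
    exact le_inf inf_le_left (Filter.le_principal_iff.2 (Filter.inter_mem self_mem_nhdsWithin
      (mem_nhdsWithin_of_mem_nhds (Metric.ball_mem_nhds _ hε)))) |>.trans le_rfl
  have hKr : K ∩ Metric.ball (c p).1 ε ⊆ range (QM n) := by
    rintro _ ⟨⟨q, -, rfl⟩, -⟩
    exact ⟨c q, rfl⟩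
  have h1 := (hh.1.hasFDerivWithinAt hcm hcs).mono hKr
  have hzero : ∀ x ∈ K ∩ Metric.ball (c p).1 ε, chartRep c h x = 0 := by
    rintro x ⟨⟨q, ⟨hqR, hqs⟩, rfl⟩, hqb⟩
    rw [extChartAt_source] at hqs
    have h3 := hb (c q).1 ⟨⟨c q, rfl⟩, hqb⟩
    rw [quadrant_symm_val, c.left_inv hqs] at h3
    exact (chartRep_val hqs).trans (h3.2 hqR)
  have h2 : HasFDerivWithinAt (chartRep c h) (0 : EuclideanSpace ℝ (Fin n) →L[ℝ] ℝ)
      (K ∩ Metric.ball (c p).1 ε) (c p).1 := by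
    refine (hasFDerivWithinAt_const (0 : ℝ) _ _).congr hzero ?_
    rw [chartRep_val hcs]
    exact hh.2.self_of_nhds hR
  exact h1.unique_on h2 hw'

end TangentSpans

/-! ### Clean intersection as a sum of ideals. -/

section CleanIntersections

theorem smoothNear_det {n : ℕ} {M : Type*} [TopologicalSpace M]
    [ChartedSpace (EuclideanQuadrant n) M] {p : M} {ι : Type} [Fintype ι] [DecidableEq ι]
    {A : M → Matrix ι ι ℝ} (hA : ∀ i j, SmoothNear n (fun q => A q i j) p) :
    SmoothNear n (fun q => (A q).det) p := by
  simp only [Matrix.det_apply, Units.smul_def, zsmul_eq_mul]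
  exact SmoothNear.sum fun σ _ => (SmoothNear.const _).mul (SmoothNear.prod fun i _ => hA _ _)

variable {n : ℕ} {M : CornerManifold.{u} n} {p : M}

/-- Dually to the equation of tangent spaces, the differentials at `p` of the functions `z k`
defining `P ∩ Q` are combinations of those of functions defining `P` and `Q`. The same combinations
`Y k` of these functions satisfy `Y = C z` with a matrix `C` that is the identity at `p`. Inverting
`C` near `p` puts the `z k` into the sum of the two ideals. -/
theorem IntersectCleanly.cleanAt {P Q : Set M} (hP : IsPSubmanifold P) (hQ : IsPSubmanifold Q)
    (h : IntersectCleanly P Q) (hp : p ∈ P ∩ Q) : CleanAt n (P ∩ Q) P Q p := by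
  classical
  obtain ⟨φ, I, hφ⟩ := hP.2 p hp.1
  obtain ⟨ψ, J, hψ⟩ := hQ.2 p hp.2
  obtain ⟨χ, K, hχ⟩ := h.1.2 p hp
  replace hφ := hφ.adaptedNear
  replace hψ := hψ.adaptedNear
  replace hχ := hχ.adaptedNear
  refine ⟨Filter.Eventually.of_forall fun q => Iff.rfl, ?_⟩
  set c := chartAt (EuclideanQuadrant n) p with hc
  have hcm : c ∈ IsManifold.maximalAtlas (QM n) ∞ M := IsManifold.chart_mem_maximalAtlas p
  have hcs : p ∈ c.source := mem_chart_source _ p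
  let Split : (M → ℝ) → Prop := fun k => ∃ h₁ h₂, IdealAt n P p h₁ ∧ IdealAt n Q p h₂ ∧
      ∀ᶠ q in 𝓝 p, k q = h₁ q + h₂ q
  have split_sum : ∀ {ι : Type} [Fintype ι] {a y : ι → M → ℝ} {k : M → ℝ},
      (∀ l, SmoothNear n (a l) p) → (∀ l, Split (y l)) →
      (∀ᶠ q in 𝓝 p, k q = ∑ l, a l q * y l q) → Split k := by
    intro ι _ a y k ha hy hk
    choose h₁ h₂ hh₁ hh₂ he using hy
    refine ⟨_, _, IdealAt.sum_mul ha hh₁, IdealAt.sum_mul ha hh₂, ?_⟩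
    filter_upwards [hk, Filter.eventually_all.2 he] with q h1 h2
    rw [h1, ← Finset.sum_add_distrib]
    exact Finset.sum_congr rfl fun l _ => by rw [h2 l, mul_add]
  have zero_ideal : ∀ S : Set M, IdealAt n S p (fun _ => 0) := fun S =>
    ⟨SmoothNear.const 0, Filter.Eventually.of_forall fun _ _ => rfl⟩
  let y : Fin n ⊕ Fin n → M → ℝ := Sum.elim (adaptedFun φ I p) (adaptedFun ψ J p)
  have hySplit : ∀ l, Split (y l) := by
    rintro (l | l)
    · exact ⟨_, _, hφ.gensAt.idealAt l, zero_ideal Q,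
        Filter.Eventually.of_forall fun q => (add_zero _).symm⟩
    · exact ⟨_, _, zero_ideal P, hψ.gensAt.idealAt l,
        Filter.Eventually.of_forall fun q => (zero_add _).symm⟩
  have hyR : ∀ l, IdealAt n (P ∩ Q) p (y l) := by
    rintro (l | l)
    · exact (hφ.gensAt.idealAt l).congr_set (Filter.Eventually.of_forall fun q hq => hq.1)
    · exact (hψ.gensAt.idealAt l).congr_set (Filter.Eventually.of_forall fun q hq => hq.2)
  let z : K → M → ℝ := fun k => adaptedFun χ K p k
  have hzR : ∀ k, IdealAt n (P ∩ Q) p (z k) := fun k => hχ.gensAt.idealAt k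
  -- A functional that vanishes on the common kernel of finitely many functionals is a combination
  -- of them; the common kernel lies in both tangent spaces, hence in that of `P ∩ Q`.
  have hspan : ∀ k, ∃ b : Fin n ⊕ Fin n → ℝ,
      chartDeriv c (z k) p = ∑ l, b l • chartDeriv c (y l) p := by
    intro k
    have h1 : (chartDeriv c (z k) p : EuclideanSpace ℝ (Fin n) →ₗ[ℝ] ℝ) ∈
        Submodule.span ℝ (range fun l =>
          (chartDeriv c (y l) p : EuclideanSpace ℝ (Fin n) →ₗ[ℝ] ℝ)) := by
      refine mem_span_of_iInf_ker_le_ker fun v hv => ?_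
      simp only [Submodule.mem_iInf, LinearMap.mem_ker] at hv ⊢
      refine chartDeriv_eq_zero_of_mem_tangentSpan (hzR k) hp ?_
      rw [h.2 p hp]
      exact ⟨mem_tangentSpan_of_adaptedNear hφ fun i => hv (Sum.inl i),
        mem_tangentSpan_of_adaptedNear hψ fun i => hv (Sum.inr i)⟩
    obtain ⟨b, hb⟩ := (Submodule.mem_span_range_iff_exists_fun ℝ).1 h1
    refine ⟨b, ?_⟩
    ext v
    have h2 := congrArg (fun f => f v) hb
    simp only [LinearMap.sum_apply, LinearMap.smul_apply] at h2
    simp only [sum_apply]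
    exact h2.symm
  choose b hb using hspan
  let Y : K → M → ℝ := fun k q => ∑ l, b k l * y l q
  have hYs : ∀ k, IdealAt n (P ∩ Q) p (Y k) := fun k =>
    IdealAt.sum_mul (fun l => SmoothNear.const (b k l)) hyR
  have hYSplit : ∀ k, Split (Y k) := fun k =>
    split_sum (fun l => SmoothNear.const (b k l)) hySplit (Filter.Eventually.of_forall fun _ => rfl)
  have hdY : ∀ k, chartDeriv c (Y k) p = chartDeriv c (z k) p := by
    intro k
    rw [hb, chartDeriv_sum hcm hcs fun l _ => (SmoothNear.const (b k l)).mul (hyR l).1]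
    refine Finset.sum_congr rfl fun l _ => ?_
    rw [chartDeriv_mul hcm hcs (SmoothNear.const (b k l)) (hyR l).1]
    have : chartDeriv c (fun _ => b k l) p = 0 :=
      chartDeriv_eq (hasFDerivWithinAt_const _ _ _)
    rw [this, smul_zero, add_zero]
  have hexp : ∀ k, ∃ a : Fin n → M → ℝ, (∀ i, SmoothNear n (a i) p) ∧ (∀ i ∉ K, a i = 0) ∧
      ∀ᶠ q in 𝓝 p, Y k q = ∑ i, a i q * ((χ q).1 i - (χ p).1 i) := by
    intro k
    refine exists_eq_sum_of_vanish hχ.1 hχ.2 K (hYs k).1 ?_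
    filter_upwards [(hYs k).2, hχ.3] with q h1 h2 h3 using h1 (h2.2 h3)
  choose a ha ha0 hae using hexp
  let C : M → Matrix K K ℝ := fun q => Matrix.of fun k m => a k m q
  have hCs : ∀ k m, SmoothNear n (fun q => C q k m) p := fun k m => ha k m
  have hYz : ∀ᶠ q in 𝓝 p, ∀ k, Y k q = ∑ m, C q k m * z m q := by
    refine Filter.eventually_all.2 fun k => ?_
    filter_upwards [hae k] with q hq
    rw [hq, ← Finset.sum_subset (Finset.subset_univ K.toFinset)]
    · rw [← Finset.sum_coe_sort K.toFinset]
      refine Fintype.sum_equiv (Equiv.subtypeEquivRight fun i => mem_toFinset) _ _ ?_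
      rintro ⟨i, hi⟩
      have hi' : i ∈ K := mem_toFinset.1 hi
      simp only [C, z, Matrix.of_apply, Equiv.subtypeEquivRight_apply_coe, adaptedFun_of_mem hi']
    · intro i _ hi
      rw [ha0 k i (by simpa using hi)]
      simp
  -- By `partialDeriv_of_eq_sum` the entries of `C p` are partial derivatives of the `Y k`, which
  -- has the same differential at `p` as the coordinate `z k`.
  have hC1 : C p = 1 := by
    ext k m
    have h1 := partialDeriv_of_eq_sum hχ.1 hχ.2 (ha k) (hae k) m
    have h2 : partialDeriv χ m (Y k) p = partialDeriv χ m (z k) p := by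
      rw [partialDeriv, partialDeriv, chartDeriv_comp hχ.1 hcm hχ.2 hcs (hYs k).1,
        chartDeriv_comp hχ.1 hcm hχ.2 hcs (hzR k).1]
      simp only [partialDeriv, hdY]
    have h3 : partialDeriv χ m (z k) p = if k = m then 1 else 0 := by
      simp only [z, adaptedFun_of_mem k.2]
      rw [partialDeriv, chartDeriv_sub_const hχ.1 hχ.2 (SmoothNear.coord hχ.1 hχ.2 _)]
      have := partialDeriv_coord (φ := χ) hχ.2 k m
      rw [partialDeriv] at this
      rw [this]
      simp only [Subtype.ext_iff]
    change a k m p = _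
    rw [← h1, h2, h3, Matrix.one_apply]
  have hdet : SmoothNear n (fun q => (C q).det) p := smoothNear_det hCs
  have hdet0 : (C p).det ≠ 0 := by rw [hC1]; simp
  have hadj : ∀ m k, SmoothNear n (fun q => (C q).adjugate m k) p := by
    intro m k
    simp only [Matrix.adjugate_apply]
    refine smoothNear_det fun i j => ?_
    by_cases hi : i = k
    · subst hi
      simp only [Matrix.updateRow_self]
      exact SmoothNear.const _
    · simp only [Matrix.updateRow_ne hi]
      exact hCs i j
  -- Cramer's rule: the inverse of `C` is its adjugate over its determinant, so its entries are
  -- smooth near `p`.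
  have hzSplit : ∀ m, Split (z m) := by
    intro m
    refine split_sum (a := fun k q => (C q).adjugate m k / (C q).det) (y := Y)
      (fun k => (hadj m k).div hdet hdet0) hYSplit ?_
    filter_upwards [hYz, hdet.eventually_ne hdet0] with q h1 h2
    have h3 : (C q).adjugate.mulVec (fun k => Y k q) = (C q).det • fun k => z k q := by
      have : (fun k => Y k q) = (C q).mulVec fun k => z k q := by
        funext k
        exact h1 k
      rw [this, Matrix.mulVec_mulVec, Matrix.adjugate_mul, Matrix.smul_mulVec, Matrix.one_mulVec]
    have h4 := congrFun h3 m
    simp only [Matrix.mulVec, dotProduct, Pi.smul_apply, smul_eq_mul] at h4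
    rw [eq_comm]
    have h5 : ∀ k, (C q).adjugate m k / (C q).det * Y k q
        = ((C q).det)⁻¹ * ((C q).adjugate m k * Y k q) := fun k => by ring
    simp only [h5]
    rw [← Finset.mul_sum, h4, inv_mul_cancel_left₀ h2]
  intro k hk
  obtain ⟨d, hd, hde⟩ := hχ.gensAt.exists_eq_sum k hk
  refine split_sum hd (y := adaptedFun χ K p) (fun i => ?_) hde
  by_cases hi : i ∈ K
  · exact hzSplit ⟨i, hi⟩
  · rw [adaptedFun_of_notMem hi]
    exact ⟨_, _, zero_ideal P, zero_ideal Q, Filter.Eventually.of_forall fun q => by simp⟩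

end CleanIntersections

/-! ### Smoothness of inverse maps on sets with boundary. -/

section InverseFunction

variable {E : Type} [NormedAddCommGroup E] [NormedSpace ℝ E] [CompleteSpace E]

/-- A continuous right inverse of a smooth map with invertible differentials is smooth, relative
to sets with unique differentials. -/
theorem contDiffOn_of_right_inverse {s t : Set E} {f g : E → E} (hs : UniqueDiffOn ℝ s)
    (ht : UniqueDiffOn ℝ t) (hf : ContDiffOn ℝ ∞ f s) (hg : ContinuousOn g t) (hgs : MapsTo g t s)
    (hfg : ∀ y ∈ t, f (g y) = y)
    (he : ∀ x ∈ s, ∃ e : E ≃L[ℝ] E, fderivWithin ℝ f s x = e) : ContDiffOn ℝ ∞ g t := by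
  have hd : ∀ y ∈ t, HasFDerivWithinAt g (fderivWithin ℝ f s (g y)).inverse t y := by
    intro y hy
    obtain ⟨e, h1⟩ := he (g y) (hgs hy)
    have h2 : HasFDerivWithinAt f (e : E →L[ℝ] E) s (g y) := by
      rw [← h1]
      exact (hf.differentiableOn (by simp) _ (hgs hy)).hasFDerivWithinAt
    rw [h1, ContinuousLinearMap.inverse_equiv]
    refine h2.of_local_left_inverse ?_ hy ?_
    · exact (hg y hy).tendsto_nhdsWithin hgs
    · filter_upwards [self_mem_nhdsWithin] with z hz using hfg z hz
  rw [contDiffOn_infty]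
  intro m
  induction m with
  | zero => simpa using hg
  | succ m ih =>
    push_cast
    rw [contDiffOn_succ_iff_hasFDerivWithinAt_of_uniqueDiffOn ht]
    refine ⟨by simp, _, ?_, hd⟩
    -- Bootstrapping: the derivative of `g` is the inverse of that of `f` along `g`, so it is as
    -- differentiable as `g` is already known to be.
    have h1 : ContDiffOn ℝ m (fun y => fderivWithin ℝ f s (g y)) t :=
      ((hf.fderivWithin hs (m := ∞) (by simp)).of_le (by exact_mod_cast le_top)).comp ih hgs
    intro y hy
    obtain ⟨e, h2⟩ := he (g y) (hgs hy)
    have h3 : ContDiffAt ℝ m ContinuousLinearMap.inverse (fderivWithin ℝ f s (g y)) := by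
      rw [h2]
      exact contDiffAt_map_inverse e
    exact h3.comp_contDiffWithinAt y (h1 y hy)

end InverseFunction

/-! ### Replacing an interior coordinate of a chart. -/

section ReplaceCoordinate

variable {n : ℕ}

/-- The linear map that replaces the `k`-th coordinate by the value of the functional `L`. -/
noncomputable def replaceCoord (k : Fin n) (L : EuclideanSpace ℝ (Fin n) →L[ℝ] ℝ) :
    EuclideanSpace ℝ (Fin n) →L[ℝ] EuclideanSpace ℝ (Fin n) :=
  ((EuclideanSpace.equiv (Fin n) ℝ).symm : (Fin n → ℝ) →L[ℝ] EuclideanSpace ℝ (Fin n)) ∘L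
    ContinuousLinearMap.pi fun l => if l = k then L else EuclideanSpace.proj l

theorem replaceCoord_apply (k : Fin n) (L : EuclideanSpace ℝ (Fin n) →L[ℝ] ℝ)
    (v : EuclideanSpace ℝ (Fin n)) (l : Fin n) :
    replaceCoord k L v l = if l = k then L v else v l := by
  change (if l = k then L else EuclideanSpace.proj l) v = _
  split_ifs <;> rfl

/-- The matrix is the identity except in row `k`, whose diagonal entry is non-zero. -/
theorem exists_equiv_replaceCoord {k : Fin n} {L : EuclideanSpace ℝ (Fin n) →L[ℝ] ℝ}
    (hL : L (EuclideanSpace.single k 1) ≠ 0) :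
    ∃ e : EuclideanSpace ℝ (Fin n) ≃L[ℝ] EuclideanSpace ℝ (Fin n),
      replaceCoord k L = (e : EuclideanSpace ℝ (Fin n) →L[ℝ] EuclideanSpace ℝ (Fin n)) := by
  have hinj : Function.Injective
      (replaceCoord k L : EuclideanSpace ℝ (Fin n) →ₗ[ℝ] EuclideanSpace ℝ (Fin n)) := by
    rw [injective_iff_map_eq_zero]
    intro v hv
    have h1 : ∀ l, (if l = k then L v else v l) = 0 := by
      intro l
      rw [← replaceCoord_apply]
      exact congrArg (fun w : EuclideanSpace ℝ (Fin n) => w l) hv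
    have h2 : v = v k • EuclideanSpace.single k (1 : ℝ) := by
      ext l
      by_cases hl : l = k
      · subst hl; simp
      · have := h1 l
        rw [if_neg hl] at this
        simp [hl, this]
    have h3 := h1 k
    rw [if_pos rfl, h2, map_smul, smul_eq_mul] at h3
    have h4 : v k = 0 := by
      rcases mul_eq_zero.1 h3 with h | h
      · exact h
      · exact absurd h hL
    rw [h2, h4, zero_smul]
  refine ⟨(LinearEquiv.ofInjectiveEndo _ hinj).toContinuousLinearEquiv, ?_⟩
  ext v
  rfl

/-- The retraction of Euclidean space onto the quadrant. -/
noncomputable def quadrantRetract (x : EuclideanSpace ℝ (Fin n)) : EuclideanSpace ℝ (Fin n) :=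
  ((QM n).symm x).1

theorem quadrantRetract_apply (x : EuclideanSpace ℝ (Fin n)) (i : Fin n) :
    quadrantRetract x i = max (x i) 0 := rfl

theorem norm_quadrantRetract_sub_le (x y : EuclideanSpace ℝ (Fin n)) :
    ‖quadrantRetract x - quadrantRetract y‖ ≤ ‖x - y‖ := by
  rw [EuclideanSpace.norm_eq, EuclideanSpace.norm_eq]
  refine Real.sqrt_le_sqrt (Finset.sum_le_sum fun i _ => ?_)
  simp only [PiLp.sub_apply, quadrantRetract_apply, Real.norm_eq_abs, sq_abs]
  have h1 := abs_max_sub_max_le_abs (x i) (y i) 0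
  rw [← sq_abs, ← sq_abs (x i - y i)]
  exact pow_le_pow_left₀ (abs_nonneg _) h1 2

/-- The point `u₀` may lie on the boundary, so `f` is extended to a full neighbourhood as `F`, by
adding the linear map `e` on the displacement from the retraction to the quadrant. `F` is close
enough to `e` to be a local homeomorphism. Only the `k`-th coordinate changes, and it is positive
before and after, so `F` and its inverse respect the quadrant; smoothness of the inverse comes from
`contDiffOn_of_right_inverse`. -/
theorem exists_local_inverse_replace {u₀ : EuclideanQuadrant n} {k : Fin n}
    {H : EuclideanSpace ℝ (Fin n) → ℝ} {ε : ℝ} (hε : 0 < ε)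
    (hH : ContDiffOn ℝ ∞ H (quadrantBall u₀.1 ε))
    (hk : fderivWithin ℝ H (quadrantBall u₀.1 ε) u₀.1 (EuclideanSpace.single k 1) ≠ 0)
    (hku : 0 < u₀.1 k) (hHu : 0 < H u₀.1) :
    ∃ G : OpenPartialHomeomorph (EuclideanQuadrant n) (EuclideanQuadrant n), u₀ ∈ G.source ∧
      (∀ u ∈ G.source, u.1 ∈ quadrantBall u₀.1 ε ∧ (G u).1 k = H u.1 ∧ ∀ l ≠ k,
        (G u).1 l = u.1 l) ∧
      ContMDiffOn (QM n) (QM n) ∞ G.symm G.target := by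
  set f : EuclideanSpace ℝ (Fin n) → EuclideanSpace ℝ (Fin n) :=
    fun x => WithLp.toLp 2 fun l => if l = k then H x else x l with hfdef
  have hfapp : ∀ x l, f x l = if l = k then H x else x l := fun _ _ => rfl
  have hdf : ∀ δ, 0 < δ → δ ≤ ε → ∀ x ∈ quadrantBall u₀.1 δ,
      HasFDerivWithinAt f (replaceCoord k (fderivWithin ℝ H (quadrantBall u₀.1 ε) x))
        (quadrantBall u₀.1 δ) x := by
    intro δ hδ hδε x hx
    have hsub : quadrantBall u₀.1 δ ⊆ quadrantBall u₀.1 ε :=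
      inter_subset_inter_right _ (Metric.ball_subset_ball hδε)
    rw [hasFDerivWithinAt_euclidean]
    intro l
    by_cases hl : l = k
    · subst hl
      have h1 := ((hH.differentiableOn (by simp) x (hsub hx)).hasFDerivWithinAt).mono hsub
      have h2 : PiLp.proj 2 (fun _ : Fin n => ℝ) l ∘L
          replaceCoord l (fderivWithin ℝ H (quadrantBall u₀.1 ε) x)
          = fderivWithin ℝ H (quadrantBall u₀.1 ε) x := by
        ext v
        exact (replaceCoord_apply l _ v l).trans (if_pos rfl)
      rw [h2]
      simpa only [hfapp, if_true] using h1
    · have h1 : HasFDerivWithinAt (fun x : EuclideanSpace ℝ (Fin n) => x l)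
        (EuclideanSpace.proj l : EuclideanSpace ℝ (Fin n) →L[ℝ] ℝ) (quadrantBall u₀.1 δ) x :=
        (EuclideanSpace.proj l : EuclideanSpace ℝ (Fin n) →L[ℝ] ℝ).hasFDerivWithinAt
      have h2 : PiLp.proj 2 (fun _ : Fin n => ℝ) l ∘L
          replaceCoord k (fderivWithin ℝ H (quadrantBall u₀.1 ε) x)
          = (EuclideanSpace.proj l : EuclideanSpace ℝ (Fin n) →L[ℝ] ℝ) := by
        ext v
        exact (replaceCoord_apply k _ v l).trans (if_neg hl)
      rw [h2]
      simpa only [hfapp, hl, if_false] using h1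
  set L := fderivWithin ℝ H (quadrantBall u₀.1 ε) u₀.1 with hLdef
  obtain ⟨e, he⟩ := exists_equiv_replaceCoord hk
  have hcont : ContinuousOn (fderivWithin ℝ H (quadrantBall u₀.1 ε)) (quadrantBall u₀.1 ε) :=
    hH.continuousOn_fderivWithin (uniqueDiffOn_quadrantBall _ _) (by simp)
  have hu₀ := mem_quadrantBall_self u₀ hε
  -- the size of the neighbourhood
  obtain ⟨c, hc0, hc⟩ : ∃ c : NNReal, 0 < c ∧ (Subsingleton (EuclideanSpace ℝ (Fin n)) ∨
      c < ‖(e.symm : EuclideanSpace ℝ (Fin n) →L[ℝ] EuclideanSpace ℝ (Fin n))‖₊⁻¹) := by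
    rcases e.subsingleton_or_nnnorm_symm_pos with h | h
    · exact ⟨1, one_pos, Or.inl h⟩
    · exact ⟨_, half_pos (inv_pos.2 h), Or.inr (half_lt_self (inv_pos.2 h))⟩
  have hev : ∀ᶠ x in 𝓝[quadrantBall u₀.1 ε] u₀.1,
      ‖fderivWithin ℝ H (quadrantBall u₀.1 ε) x - L‖ < c ∧
      fderivWithin ℝ H (quadrantBall u₀.1 ε) x (EuclideanSpace.single k 1) ≠ 0 := by
    have h1 := hcont _ hu₀
    refine Filter.Eventually.and ?_ ?_
    · have h2 := (h1.sub (continuousWithinAt_const (b := L))).norm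
      refine h2.tendsto.eventually (gt_mem_nhds ?_)
      simpa [hLdef] using hc0
    · exact (h1.clm_apply continuousWithinAt_const).tendsto.eventually_ne hk
  obtain ⟨δ', hδ', hδb⟩ := Metric.mem_nhdsWithin_iff.1 hev
  set δ := min δ' ε
  have hδ : 0 < δ := lt_min hδ' hε
  have hδε : δ ≤ ε := min_le_right _ _
  have hsub : quadrantBall u₀.1 δ ⊆ quadrantBall u₀.1 ε :=
    inter_subset_inter_right _ (Metric.ball_subset_ball hδε)
  have hgood : ∀ x ∈ quadrantBall u₀.1 δ,
      ‖fderivWithin ℝ H (quadrantBall u₀.1 ε) x - L‖ < c ∧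
      fderivWithin ℝ H (quadrantBall u₀.1 ε) x (EuclideanSpace.single k 1) ≠ 0 := fun x hx =>
    hδb ⟨Metric.ball_subset_ball (min_le_left _ _) hx.2, hsub hx⟩
  -- extension to a full neighbourhood
  set F : EuclideanSpace ℝ (Fin n) → EuclideanSpace ℝ (Fin n) :=
    fun x => f (quadrantRetract x) + e (x - quadrantRetract x) with hFdef
  have heapp : ∀ v l, e v l = if l = k then L v else v l := by
    intro v l
    rw [← replaceCoord_apply, he]
    rfl
  have hFf : ∀ x ∈ range (QM n), F x = f x := by
    intro x hx
    have : quadrantRetract x = x := quadrant_val_symm hx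
    simp [hFdef, this]
  have hFl : ∀ x, ∀ l ≠ k, F x l = x l := by
    intro x l hl
    simp only [hFdef, PiLp.add_apply, hfapp, if_neg hl, heapp, PiLp.sub_apply]
    ring
  have hret : ∀ x ∈ Metric.ball u₀.1 δ, quadrantRetract x ∈ quadrantBall u₀.1 δ := by
    intro x hx
    refine ⟨val_mem_range_quadrant _, ?_⟩
    have h1 := norm_quadrantRetract_sub_le x u₀.1
    rw [show quadrantRetract u₀.1 = u₀.1 from congrArg Subtype.val (quadrant_symm_val u₀)] at h1
    rw [Metric.mem_ball, dist_eq_norm] at hx ⊢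
    exact lt_of_le_of_lt h1 hx
  have happrox : ApproximatesLinearOn F
      (e : EuclideanSpace ℝ (Fin n) →L[ℝ] EuclideanSpace ℝ (Fin n)) (Metric.ball u₀.1 δ) c := by
    intro x hx y hy
    -- The added linear part cancels, so the error only involves points of the convex quadrant ball,
    -- where the mean value inequality applies. The retraction is 1-Lipschitz.
    have h1 : F x - F y - e (x - y) = f (quadrantRetract x) - f (quadrantRetract y)
        - e (quadrantRetract x - quadrantRetract y) := by
      simp only [hFdef, map_sub]
      abel
    have h2 : f (quadrantRetract x) - f (quadrantRetract y)
        - e (quadrantRetract x - quadrantRetract y) = EuclideanSpace.single k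
          (H (quadrantRetract x) - H (quadrantRetract y)
            - L (quadrantRetract x - quadrantRetract y)) := by
      ext l
      simp only [PiLp.sub_apply, hfapp, heapp, PiLp.single_apply]
      split_ifs <;> simp
    have h3 : ‖H (quadrantRetract x) - H (quadrantRetract y)
            - L (quadrantRetract x - quadrantRetract y)‖
        ≤ c * ‖quadrantRetract x - quadrantRetract y‖ := by
      refine Convex.norm_image_sub_le_of_norm_hasFDerivWithin_le' (s := quadrantBall u₀.1 δ)
        (f' := fun z => fderivWithin ℝ H (quadrantBall u₀.1 ε) z) (fun z hz => ?_)
        (fun z hz => (hgood z hz).1.le) (convex_quadrantBall _ _) (hret y hy) (hret x hx)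
      exact ((hH.differentiableOn (by simp) z (hsub hz)).hasFDerivWithinAt).mono hsub
    change ‖F x - F y - e (x - y)‖ ≤ _
    rw [h1, h2, PiLp.norm_single]
    exact h3.trans (mul_le_mul_of_nonneg_left (norm_quadrantRetract_sub_le x y) c.2)
  set Φ := happrox.toOpenPartialHomeomorph F (Metric.ball u₀.1 δ) hc Metric.isOpen_ball with hΦ
  have hΦF : ∀ x, Φ x = F x := fun _ => rfl
  have hΦs : Φ.source = Metric.ball u₀.1 δ := rfl
  have hck : Continuous fun x : EuclideanSpace ℝ (Fin n) => x k := by fun_prop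
  -- The coordinates other than the `k`-th are preserved, so positivity of the `k`-th one is all
  -- that is needed for the inverse to land in the quadrant.
  set O := {y | y ∈ Φ.target ∧ 0 < Φ.symm y k} with hO
  have hOopen : IsOpen O :=
    (hck.comp_continuousOn Φ.continuousOn_symm).isOpen_inter_preimage Φ.open_target isOpen_Ioi
  have hsymm_mem : ∀ y ∈ range (QM n) ∩ O, Φ.symm y ∈ quadrantBall u₀.1 δ := by
    rintro y ⟨hyr, hyt, hyk⟩
    refine ⟨mem_range_quadrant.2 fun l => ?_, Φ.map_target hyt⟩
    by_cases hl : l = k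
    · rw [hl]; exact hyk.le
    · rw [← hFl _ l hl, ← hΦF, Φ.right_inv hyt]
      exact mem_range_quadrant.1 hyr l
  have hsmooth : ContDiffOn ℝ ∞ Φ.symm (range (QM n) ∩ O) := by
    refine contDiffOn_of_right_inverse (s := quadrantBall u₀.1 δ) (f := f)
      (uniqueDiffOn_quadrantBall _ _) ((QM n).uniqueDiffOn.inter hOopen) ?_
      (Φ.continuousOn_symm.mono fun y hy => hy.2.1) hsymm_mem ?_ ?_
    · rw [contDiffOn_euclidean]
      intro l
      by_cases hl : l = k
      · simpa only [hfapp, hl, if_true] using hH.mono hsub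
      · simp only [hfapp, hl, if_false]
        fun_prop
    · intro y hy
      rw [← hFf _ (hsymm_mem y hy).1, ← hΦF, Φ.right_inv hy.2.1]
    · intro x hx
      obtain ⟨e', he'⟩ := exists_equiv_replaceCoord (hgood x hx).2
      exact ⟨e', by rw [(hdf δ hδ hδε x hx).fderivWithin (uniqueDiffOn_quadrantBall _ _ x hx), he']⟩
  have hval : Continuous (fun u : EuclideanQuadrant n => u.1) := continuous_subtype_val
  set S : Set (EuclideanQuadrant n) := {u | u.1 ∈ Metric.ball u₀.1 δ ∧ 0 < u.1 k ∧ 0 < F u.1 k}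
  set T : Set (EuclideanQuadrant n) := {v | v.1 ∈ O ∧ 0 < v.1 k}
  have hFS : ∀ u ∈ S, F u.1 ∈ range (QM n) := by
    rintro u ⟨h1, h2, h3⟩
    refine mem_range_quadrant.2 fun l => ?_
    by_cases hl : l = k
    · rw [hl]; exact h3.le
    · rw [hFl _ l hl]; exact u.2 l
  have hSopen : IsOpen S := by
    have h1 : IsOpen (Metric.ball u₀.1 δ ∩ (fun x => F x k) ⁻¹' Ioi 0) :=
      (hck.comp_continuousOn happrox.continuousOn).isOpen_inter_preimage Metric.isOpen_ball
        isOpen_Ioi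
    have h2 : S = (fun u : EuclideanQuadrant n => u.1) ⁻¹'
        (Metric.ball u₀.1 δ ∩ (fun x => F x k) ⁻¹' Ioi 0) ∩ {u | 0 < u.1 k} := by
      ext u
      simp only [S, mem_ofPred_eq, mem_inter_iff, mem_preimage, mem_Ioi]
      tauto
    rw [h2]
    exact (h1.preimage hval).inter (isOpen_lt continuous_const (hck.comp hval))
  let G : OpenPartialHomeomorph (EuclideanQuadrant n) (EuclideanQuadrant n) :=
    { toFun := fun u => (QM n).symm (F u.1)
      invFun := fun v => (QM n).symm (Φ.symm v.1)
      source := S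
      target := T
      map_source' := by
        intro u hu
        have h1 := quadrant_val_symm (hFS u hu)
        refine ⟨?_, ?_⟩
        · rw [h1]
          refine ⟨Φ.map_source hu.1, ?_⟩
          rw [← hΦF, Φ.left_inv hu.1]
          exact hu.2.1
        · rw [h1]
          exact hu.2.2
      map_target' := by
        intro v hv
        have h0 := hsymm_mem v.1 ⟨val_mem_range_quadrant v, hv.1⟩
        have h1 := quadrant_val_symm h0.1
        refine ⟨?_, ?_, ?_⟩
        · rw [h1]; exact h0.2
        · rw [h1]; exact hv.1.2
        · rw [h1, ← hΦF, Φ.right_inv hv.1.1]; exact hv.2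
      left_inv' := by
        intro u hu
        simp only [quadrant_val_symm (hFS u hu)]
        rw [← hΦF, Φ.left_inv hu.1, quadrant_symm_val]
      right_inv' := by
        intro v hv
        have h0 := hsymm_mem v.1 ⟨val_mem_range_quadrant v, hv.1⟩
        simp only [quadrant_val_symm h0.1]
        rw [← hΦF, Φ.right_inv hv.1.1, quadrant_symm_val]
      open_source := hSopen
      open_target := (hOopen.preimage hval).inter (isOpen_lt continuous_const (hck.comp hval))
      continuousOn_toFun := (QM n).continuous_symm.comp_continuousOn
        (happrox.continuousOn.comp hval.continuousOn fun u hu => hu.1)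
      continuousOn_invFun := (QM n).continuous_symm.comp_continuousOn
        (Φ.continuousOn_symm.comp hval.continuousOn fun v hv => hv.1.1) }
  refine ⟨G, ⟨Metric.mem_ball_self hδ, hku, ?_⟩, ?_, ?_⟩
  · rw [hFf _ (val_mem_range_quadrant u₀), hfapp, if_pos rfl]
    exact hHu
  · intro u hu
    have h1 : (G u).1 = F u.1 := quadrant_val_symm (hFS u hu)
    refine ⟨⟨val_mem_range_quadrant u, Metric.ball_subset_ball hδε hu.1⟩, ?_, fun l hl => ?_⟩
    · rw [h1, hFf _ (val_mem_range_quadrant u), hfapp, if_pos rfl]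
    · rw [h1, hFl _ l hl]
  · have h1 : ContMDiffOn (QM n) 𝓘(ℝ, EuclideanSpace ℝ (Fin n)) ∞
        (fun v : EuclideanQuadrant n => Φ.symm v.1) T := by
      have h2 := contMDiffOn_iff_contDiffOn.2 hsmooth
      exact h2.comp (QM n).contMDiff.contMDiffOn fun v hv => ⟨val_mem_range_quadrant v, hv.1⟩
    exact (QM n).contMDiffOn_symm.comp h1 fun v hv =>
      (hsymm_mem v.1 ⟨val_mem_range_quadrant v, hv.1⟩).1

variable {M : Type*} [TopologicalSpace M] [ChartedSpace (EuclideanQuadrant n) M]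
  [IsManifold (QM n) ∞ M]

/-- An interior coordinate of a chart can be replaced by a function with non-zero partial
derivative. -/
theorem exists_chart_replace {ψ : OpenPartialHomeomorph M (EuclideanQuadrant n)} {p : M}
    {k : Fin n} {h : M → ℝ} (hψ : ψ ∈ IsManifold.maximalAtlas (QM n) ∞ M) (hp : p ∈ ψ.source)
    (hh : SmoothNear n h p) (hk : partialDeriv ψ k h p ≠ 0) (hkp : 0 < (ψ p).1 k)
    (hhp : 0 < h p) :
    ∃ χ ∈ IsManifold.maximalAtlas (QM n) ∞ M, p ∈ χ.source ∧ ∀ q ∈ χ.source,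
      (χ q).1 k = h q ∧ ∀ l ≠ k, (χ q).1 l = (ψ q).1 l := by
  obtain ⟨ε, hε, hC, hb⟩ := hh.exists_contDiffOn hψ hp hh
  have hk' : fderivWithin ℝ (chartRep ψ h) (quadrantBall (ψ p).1 ε) (ψ p).1
      (EuclideanSpace.single k 1) ≠ 0 := by
    rw [quadrantBall, fderivWithin_inter (Metric.ball_mem_nhds _ hε)]
    exact hk
  obtain ⟨G, hG, hGu, hGs⟩ := exists_local_inverse_replace hε hC hk' hkp
    (by rwa [chartRep_val hp])
  have hcoord : ∀ q ∈ (ψ.trans G).source,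
      (ψ.trans G q).1 k = h q ∧ ∀ l ≠ k, (ψ.trans G q).1 l = (ψ q).1 l := by
    intro q hq
    rw [OpenPartialHomeomorph.trans_source] at hq
    obtain ⟨-, h2, h3⟩ := hGu _ hq.2
    refine ⟨?_, h3⟩
    rw [OpenPartialHomeomorph.coe_trans, Function.comp, h2, chartRep_val hq.1]
  refine ⟨ψ.trans G, ?_, ?_, hcoord⟩
  · rw [IsManifold.mem_maximalAtlas_iff_contMDiffOn]
    constructor
    · intro q hq
      refine ContMDiffAt.contMDiffWithinAt (contMDiffAt_quadrant fun l => ?_)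
      have hq' := hq
      rw [OpenPartialHomeomorph.trans_source] at hq'
      have hnear : ∀ᶠ y in 𝓝 q, y ∈ (ψ.trans G).source := (ψ.trans G).open_source.mem_nhds hq
      by_cases hl : l = k
      · subst hl
        have h1 := (hb _ (hGu _ hq'.2).1).2
        rw [quadrant_symm_val, ψ.left_inv hq'.1] at h1
        refine h1.congr_of_eventuallyEq ?_
        filter_upwards [hnear] with y hy using (hcoord y hy).1
      · refine (SmoothNear.coord hψ hq'.1 l).contMDiffAt.congr_of_eventuallyEq ?_
        filter_upwards [hnear] with y hy using (hcoord y hy).2 l hl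
    · rw [OpenPartialHomeomorph.trans_target, OpenPartialHomeomorph.coe_trans_symm]
      exact (contMDiffOn_symm_of_mem_maximalAtlas hψ).comp (hGs.mono inter_subset_left)
        fun v hv => hv.2
  · rw [OpenPartialHomeomorph.trans_source]
    exact ⟨hp, hG⟩

end ReplaceCoordinate

/-! ### Charts adapted to two nested p-submanifolds. -/

section JointCharts

variable {n : ℕ} {M : Type*} [TopologicalSpace M] [ChartedSpace (EuclideanQuadrant n) M]
  {P Q : Set M} {p : M} {φ ψ : OpenPartialHomeomorph M (EuclideanQuadrant n)} {I J : Set (Fin n)}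

/-- Raising a coordinate with index in `J` but not in `I` would stay in `P` and leave `Q`. -/
theorem AdaptedNear.subset_of_subset (hP : AdaptedNear P p φ I) (hQ : AdaptedNear Q p φ J)
    (hPQ : ∀ᶠ q in 𝓝 p, q ∈ P → q ∈ Q) : J ⊆ I := by
  intro j hj
  by_contra hI
  obtain ⟨q, ⟨-, ε, hε, hq⟩, h1, h2, h3⟩ := ((frequently_coord_add hP.2
    (v := fun i => if i = j then 1 else 0) fun i _ => by split_ifs <;> norm_num).and_eventually
    (hPQ.and (hP.3.and hQ.3))).exists
  have hqP : q ∈ P := h2.2 fun i hi => by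
    have hij : i ≠ j := by rintro rfl; exact hI hi
    rw [hq, if_neg hij, mul_zero, add_zero]
  have h4 := h3.1 (h1 hqP) j hj
  rw [hq, if_pos rfl] at h4
  linarith

variable [IsManifold (QM n) ∞ M]

/-- The interior coordinates of `φ` that define `Q` are built one by one into the chart adapted to
`P`. Each is constant on `P`, so it is a combination of the coordinates defining `P`, and it can
take the place of one of these. -/
theorem exists_chart_interior_coords (hQ : AdaptedNear Q p φ J) (hP : AdaptedNear P p ψ I)
    (hPQ : ∀ᶠ q in 𝓝 p, q ∈ P → q ∈ Q) (S : Finset (Fin n))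
    (hS : ∀ j ∈ S, j ∈ J ∧ 0 < (φ p).1 j) :
    ∃ (χ : OpenPartialHomeomorph M (EuclideanQuadrant n)) (κ : Fin n → Fin n),
      AdaptedNear P p χ I ∧ ∀ j ∈ S, ∀ᶠ q in 𝓝 p, (χ q).1 (κ j) = (φ q).1 j := by
  classical
  induction S using Finset.induction_on with
  | empty => exact ⟨ψ, id, hP, by simp⟩
  | insert j S hjS ih =>
    obtain ⟨χ, κ, hχ, hκ⟩ := ih fun i hi => hS i (Finset.mem_insert_of_mem hi)
    obtain ⟨hjJ, hjp⟩ := hS j (Finset.mem_insert_self j S)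
    have hφj := SmoothNear.coord hQ.1 hQ.2 j
    have hv : ∀ᶠ q in 𝓝 p, (∀ i ∈ I, (χ q).1 i = (χ p).1 i) → (φ q).1 j - (φ p).1 j = 0 := by
      filter_upwards [hPQ, hχ.3, hQ.3] with q h1 h2 h3 h4
      rw [h3.1 (h1 (h2.2 h4)) j hjJ, sub_self]
    obtain ⟨c, hc, hc0, hce⟩ := exists_eq_sum_of_vanish hχ.1 hχ.2 I
      (hφj.sub (SmoothNear.const _)) hv
    have hcp : ∀ i, partialDeriv χ i (fun y => (φ y).1 j) p = c i p := by
      intro i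
      rw [← partialDeriv_of_eq_sum hχ.1 hχ.2 hc hce i, partialDeriv, partialDeriv,
        chartDeriv_sub_const hχ.1 hχ.2 hφj]
    have hchain := chartDeriv_comp hQ.1 hχ.1 hQ.2 hχ.2 hφj (EuclideanSpace.single j 1)
    have h1 : chartDeriv φ (fun y => (φ y).1 j) p (EuclideanSpace.single j 1) = 1 := by
      have := partialDeriv_coord (φ := φ) hQ.2 j j
      rwa [if_pos rfl] at this
    rw [h1] at hchain
    -- The chain rule writes `1 = ∂φ_j/∂φ_j` as a sum over `k`. In a non-zero term, the factor
    -- `∂φ_j/∂χ_k` shows `k ∈ I`, while `∂χ_k/∂φ_j` shows that `χ_k` is an interior coordinate and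
    -- has not been replaced before.
    obtain ⟨k, -, hk⟩ := Finset.exists_ne_zero_of_sum_ne_zero (hchain ▸ one_ne_zero)
    rw [hcp] at hk
    have hck : c k p ≠ 0 := left_ne_zero_of_mul hk
    have hdk : partialDeriv φ j (fun y => (χ y).1 k) p ≠ 0 := right_ne_zero_of_mul hk
    have hkI : k ∈ I := by
      by_contra hkI
      exact hck (by rw [hc0 k hkI]; rfl)
    have hkp : 0 < (χ p).1 k := by
      rcases ((χ p).2 k).eq_or_lt with h | h
      · exact absurd ((partialDeriv_nonneg hQ.1 hQ.2 (SmoothNear.coord hχ.1 hχ.2 k) h.symm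
          (Filter.Eventually.of_forall fun y => (χ y).2 k) j).2 hjp) hdk
      · exact h
    have hkκ : ∀ i ∈ S, κ i ≠ k := by
      rintro i hi rfl
      apply hdk
      rw [partialDeriv, chartDeriv_congr hQ.1 hQ.2 (hκ i hi) (SmoothNear.coord hQ.1 hQ.2 i)]
      have h2 := partialDeriv_coord (φ := φ) hQ.2 i j
      rw [if_neg (by rintro rfl; exact hjS hi)] at h2
      exact h2
    obtain ⟨χ', hχ', hpχ', hcoord⟩ := exists_chart_replace hχ.1 hχ.2 hφj
      (by rw [hcp]; exact hck) hkp hjp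
    have hmem := χ'.open_source.mem_nhds hpχ'
    refine ⟨χ', fun i => if i = j then k else κ i, ⟨hχ', hpχ', ?_⟩, ?_⟩
    · filter_upwards [hχ.3, hmem, hce, (hc k).eventually_ne hck] with q h2 h3 h4 h5
      rw [h2]
      have hoff : ∀ i ≠ k, ((χ' q).1 i = (χ' p).1 i ↔ (χ q).1 i = (χ p).1 i) := fun i hi => by
        rw [(hcoord q h3).2 i hi, (hcoord p hpχ').2 i hi]
      -- Where the other coordinates in `I` are fixed, the new and the old centred coordinate differ
      -- by the unit `c k`, so the index set `I` still describes `P`.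
      have hred : (∀ i ∈ I, i ≠ k → (χ q).1 i = (χ p).1 i) →
          (φ q).1 j - (φ p).1 j = c k q * ((χ q).1 k - (χ p).1 k) := by
        intro h6
        rw [h4, Finset.sum_eq_single k]
        · intro i _ hi
          by_cases hiI : i ∈ I
          · rw [h6 i hiI hi, sub_self, mul_zero]
          · rw [hc0 i hiI]; simp
        · simp
      constructor
      · intro h6 i hi
        by_cases hik : i = k
        · subst hik
          rw [(hcoord q h3).1, (hcoord p hpχ').1, ← sub_eq_zero, hred fun i hi _ => h6 i hi,
            h6 i hi, sub_self, mul_zero]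
        · exact (hoff i hik).2 (h6 i hi)
      · intro h6 i hi
        have h7 : ∀ i ∈ I, i ≠ k → (χ q).1 i = (χ p).1 i := fun i hi hik =>
          (hoff i hik).1 (h6 i hi)
        by_cases hik : i = k
        · subst hik
          have h8 := h6 i hi
          rw [(hcoord q h3).1, (hcoord p hpχ').1, ← sub_eq_zero, hred h7] at h8
          rcases mul_eq_zero.1 h8 with h | h
          · exact absurd h h5
          · linarith
        · exact h7 i hi hik
    · intro i hi
      by_cases hij : i = j
      · subst hij
        filter_upwards [hmem] with q hq
        simpa using (hcoord q hq).1
      · have hiS : i ∈ S := (Finset.mem_insert.1 hi).resolve_left hij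
        filter_upwards [hmem, hκ i hiS] with q hq h2
        simp only [hij, if_false]
        rw [(hcoord q hq).2 _ (hkκ i hiS), h2]

/-- Two nested p-submanifolds are given by coordinates of a common chart. -/
theorem exists_joint_chart (hQ : AdaptedNear Q p φ J) (hP : AdaptedNear P p ψ I)
    (hPQ : ∀ᶠ q in 𝓝 p, q ∈ P → q ∈ Q) :
    ∃ (χ : OpenPartialHomeomorph M (EuclideanQuadrant n)) (K : Set (Fin n)),
      AdaptedNear P p χ I ∧ AdaptedNear Q p χ K ∧ K ⊆ I := by
  classical
  obtain ⟨χ, κ, hχ, hκ⟩ := exists_chart_interior_coords hQ hP hPQ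
    (Finset.univ.filter fun j => j ∈ J ∧ 0 < (φ p).1 j) (fun j hj => (Finset.mem_filter.1 hj).2)
  -- Boundary coordinates need no replacement: each has the same zeros as some boundary coordinate
  -- of `χ`.
  have hb : ∀ j, ∃ l, j ∈ J → (∀ᶠ q in 𝓝 p, (φ q).1 j = (φ p).1 j ↔ (χ q).1 l = (χ p).1 l) := by
    intro j
    by_cases hj : j ∈ J
    · rcases ((φ p).2 j).eq_or_lt with h | h
      · obtain ⟨l, hl, a, ha, hap, hae⟩ := exists_boundary_coord hχ.1 hQ.1 hχ.2 hQ.2 h.symm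
        refine ⟨l, fun _ => ?_⟩
        filter_upwards [hae, ha.eventually_pos hap] with q h1 h2
        rw [← h, hl, h1, mul_eq_zero]
        exact ⟨fun h3 => h3.resolve_left h2.ne', fun h3 => Or.inr h3⟩
      · refine ⟨κ j, fun _ => ?_⟩
        have h1 := hκ j (Finset.mem_filter.2 ⟨Finset.mem_univ j, hj, h⟩)
        have h2 := h1.self_of_nhds
        filter_upwards [h1] with q h3
        rw [h3, h2]
    · exact ⟨j, fun h => absurd h hj⟩
  choose l hl using hb
  have hK : AdaptedNear Q p χ (l '' J) := by
    refine ⟨hχ.1, hχ.2, ?_⟩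
    have h1 : ∀ᶠ q in 𝓝 p, ∀ j, j ∈ J → ((φ q).1 j = (φ p).1 j ↔
        (χ q).1 (l j) = (χ p).1 (l j)) := by
      refine Filter.eventually_all.2 fun j => ?_
      by_cases hj : j ∈ J
      · filter_upwards [hl j hj] with q hq _ using hq
      · exact Filter.Eventually.of_forall fun q h => absurd h hj
    filter_upwards [hQ.3, h1] with q h2 h3
    rw [h2]
    constructor
    · rintro h4 _ ⟨j, hj, rfl⟩
      exact (h3 j hj).1 (h4 j hj)
    · intro h4 j hj
      exact (h3 j hj).2 (h4 _ ⟨j, hj, rfl⟩)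
  exact ⟨χ, l '' J, hχ, hK, hχ.subset_of_subset hK hPQ⟩

end JointCharts

theorem AdaptedNear.exists_isAdaptedChart {n : ℕ} {M : CornerManifold.{u} n} {P : Set M} {p : M}
    {φ : OpenPartialHomeomorph M (EuclideanQuadrant n)} {I : Set (Fin n)}
    (h : AdaptedNear P p φ I) {U : Set M} (hU : U ∈ 𝓝 p) :
    ∃ ψ : OpenPartialHomeomorph M (EuclideanQuadrant n), IsAdaptedChart P p ψ I ∧
      ψ.source ⊆ U ∧ ψ.source ⊆ φ.source ∧ ∀ q, ψ q = φ q := by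
  obtain ⟨V, hV, hVo, hpV⟩ := mem_nhds_iff.1 (Filter.inter_mem h.3 hU)
  refine ⟨φ.restr V, ⟨?_, ?_, ?_⟩, ?_, ?_, fun q => rfl⟩
  · exact restr_mem_maximalAtlas _ h.1 hVo
  · rw [φ.restr_source' V hVo]
    exact ⟨h.2, hpV⟩
  · rw [φ.restr_source' V hVo]
    ext q
    constructor
    · rintro ⟨h1, h2⟩
      exact ⟨h2, (hV h2.2).1.1 h1⟩
    · rintro ⟨h1, h2⟩
      exact ⟨(hV h1.2).1.2 h2, h1⟩
  · rw [φ.restr_source' V hVo]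
    exact fun q hq => (hV hq.2).2
  · rw [φ.restr_source' V hVo]
    exact inter_subset_left

/-- The point of the quadrant with coordinates `max (v i) 0`. -/
noncomputable def quadrantOf {n : ℕ} (v : Fin n → ℝ) : EuclideanQuadrant n :=
  ⟨WithLp.toLp 2 fun i => max (v i) 0, fun _ => le_max_right _ _⟩

theorem quadrantOf_apply {n : ℕ} (v : Fin n → ℝ) (i : Fin n) :
    (quadrantOf v).1 i = max (v i) 0 := rfl

theorem quadrantOf_apply_of_nonneg {n : ℕ} {v : Fin n → ℝ} {i : Fin n} (hi : 0 ≤ v i) :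
    (quadrantOf v).1 i = v i := max_eq_left hi

theorem quadrant_ext {n : ℕ} {u v : EuclideanQuadrant n} (h : ∀ i, u.1 i = v.1 i) : u = v :=
  Subtype.ext (PiLp.ext h)

theorem continuous_quadrantOf {n : ℕ} : Continuous (quadrantOf (n := n)) := by
  refine Continuous.subtype_mk ?_ _
  exact (PiLp.continuous_toLp 2 _).comp (by fun_prop)

/-! ### Projective coordinates and local lifts. -/

section Projective

variable {n : ℕ} {M : Type*} [TopologicalSpace M] [ChartedSpace (EuclideanQuadrant n) M]
  {X : Type*} [TopologicalSpace X] [ChartedSpace (EuclideanQuadrant n) X]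
  {Z : Type*} [TopologicalSpace Z] [ChartedSpace (EuclideanQuadrant n) Z]

/-- `ψ` consists of the projective coordinates at `x` that correspond to the chart `φ` at `β x`,
for the blow-up of `{φ_j = const, j ∈ I}`, with `i ∈ I` the index of the coordinate used as a
front face defining function, `σ` the sign, and `a` the translations. -/
structure ProjectiveAt (β : X → M) (x : X) (φ : OpenPartialHomeomorph M (EuclideanQuadrant n))
    (I : Set (Fin n)) (ψ : OpenPartialHomeomorph X (EuclideanQuadrant n)) (i : Fin n) (σ : ℝ)
    (a : Fin n → ℝ) : Prop where
  mem_maximalAtlas : ψ ∈ IsManifold.maximalAtlas (QM n) ∞ X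
  mem_source : x ∈ ψ.source
  mapsTo : MapsTo β ψ.source φ.source
  mem : i ∈ I
  sign : σ = 1 ∨ σ = -1
  eq_zero : (ψ x).1 i = 0
  translation : ∀ j ∈ I, j ≠ i →
    ((φ (β x)).1 j = 0 → a j = 0) ∧ (0 < (φ (β x)).1 j → 0 < (ψ x).1 j)
  coord_self : ∀ q ∈ ψ.source, (φ (β q)).1 i - (φ (β x)).1 i = σ * (ψ q).1 i
  coord_mem : ∀ q ∈ ψ.source, ∀ j ∈ I, j ≠ i →
    (φ (β q)).1 j - (φ (β x)).1 j = (ψ q).1 i * ((ψ q).1 j - a j)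
  coord_notMem : ∀ q ∈ ψ.source, ∀ j ∉ I, (φ (β q)).1 j = (ψ q).1 j

variable {β : X → M} {x : X} {φ : OpenPartialHomeomorph M (EuclideanQuadrant n)}
  {I : Set (Fin n)} {ψ : OpenPartialHomeomorph X (EuclideanQuadrant n)} {i : Fin n} {σ : ℝ}
  {a : Fin n → ℝ}

theorem ProjectiveAt.sign_mul_sign (h : ProjectiveAt β x φ I ψ i σ a) : σ * σ = 1 := by
  rcases h.sign with h | h <;> rw [h] <;> norm_num

theorem ProjectiveAt.sign_ne_zero (h : ProjectiveAt β x φ I ψ i σ a) : σ ≠ 0 := by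
  rcases h.sign with h | h <;> rw [h] <;> norm_num

theorem ProjectiveAt.smoothNear_coord_comp (h : ProjectiveAt β x φ I ψ i σ a) (j : Fin n) :
    SmoothNear n (fun q => (φ (β q)).1 j) x := by
  have hs : ∀ᶠ q in 𝓝 x, q ∈ ψ.source := ψ.open_source.mem_nhds h.mem_source
  have hc := fun l => SmoothNear.coord h.mem_maximalAtlas h.mem_source l
  by_cases hj : j ∈ I
  · by_cases hji : j = i
    · subst hji
      refine ((SmoothNear.const ((φ (β x)).1 j)).add ((SmoothNear.const σ).mul (hc j))).congr ?_
      filter_upwards [hs] with q hq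
      have := h.coord_self q hq
      linarith
    · refine ((SmoothNear.const ((φ (β x)).1 j)).add ((hc i).mul ((hc j).sub
        (SmoothNear.const (a j))))).congr ?_
      filter_upwards [hs] with q hq
      have := h.coord_mem q hq j hj hji
      linarith
  · exact (hc j).congr (by filter_upwards [hs] with q hq using h.coord_notMem q hq j hj)

theorem ProjectiveAt.smoothMapNear (h : ProjectiveAt β x φ I ψ i σ a)
    (hφ : φ ∈ IsManifold.maximalAtlas (QM n) ∞ M) : SmoothMapNear n β x := by
  have h1 : SmoothMapNear n (fun q => φ.symm (φ (β q))) x :=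
    SmoothMapNear.symm_comp hφ h.smoothNear_coord_comp (φ.map_source (h.mapsTo h.mem_source))
  refine h1.congr ?_
  filter_upwards [ψ.open_source.mem_nhds h.mem_source] with q hq
  rw [φ.left_inv (h.mapsTo hq)]

/-- A lift of `g` along a sequence (filter) extends to a smooth local lift, provided that the
pull-back by `g` of the ideal of the centre of the blow-up is principal. -/
theorem ProjectiveAt.exists_local_lift [IsManifold (QM n) ∞ Z] (h : ProjectiveAt β x φ I ψ i σ a)
    {P : Set M} (hP : AdaptedNear P (β x) φ I) {g : Z → M} {z : Z} (hg : SmoothMapNear n g z)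
    (hz : g z = β x) {t : Z → ℝ} (ht : MonomialAt n t z) (hp : PrincipalAt n g P t z)
    {F : Filter Z} [F.NeBot] (hF : F ≤ 𝓝 z) {s : Z → X} (hs : Filter.Tendsto s F (𝓝 x))
    (hsg : ∀ᶠ y in F, β (s y) = g y ∧ g y ∉ P) :
    ∃ G : Z → X, SmoothMapNear n G z ∧ G z = x ∧ (∀ᶠ y in 𝓝 z, β (G y) = g y) ∧
      (LocalBMapAt n g z → LocalBMapAt n G z) := by
  obtain ⟨w, hw, ⟨l₀, hl₀⟩, hwe⟩ := hp.exists_gens hg ht.regularAt (by rw [hz]; exact hP.gensAt)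
  have hψc := fun l => SmoothNear.coord h.mem_maximalAtlas h.mem_source l
  have hσσ := h.sign_mul_sign
  have hwall := Filter.eventually_all.2 hwe
  have hmem : ∀ᶠ y in 𝓝 z, g y ∈ P ↔ ∀ l ∈ I, (φ (g y)).1 l = (φ (β x)).1 l :=
    hg.continuousAt.eventually (by rw [hz]; exact hP.mem_iff)
  have hpos : ∀ᶠ y in 𝓝 z, 0 ≤ t y := ht.eventually_nonneg
  have hI : ∀ l ∈ I, ∀ᶠ y in 𝓝 z, (φ (g y)).1 l - (φ (β x)).1 l = t y * w l y := by
    intro l hl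
    filter_upwards [hwe l] with y hy
    rwa [adaptedFun_of_mem hl] at hy
  have hIi := hI i h.mem
  have hsrc : ∀ᶠ y in F, s y ∈ ψ.source := hs (ψ.open_source.mem_nhds h.mem_source)
  -- along the filter
  have hkey : ∀ᶠ y in F, 0 < σ * w i y ∧
      (∀ j ∈ I, j ≠ i → w j y = σ * w i y * ((ψ (s y)).1 j - a j)) ∧ ∀ j ∉ I, w j y = 0 := by
    filter_upwards [hF hwall, hF hmem, hF hpos, hsg, hsrc] with y h1 h2 h3 h4 h5
    have ht0 : 0 < t y := by
      refine lt_of_le_of_ne h3 fun h0 => h4.2 (h2.2 fun l hl => ?_)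
      have := h1 l
      rw [adaptedFun_of_mem hl, ← h0, zero_mul] at this
      linarith
    have e1 := h.coord_self _ h5
    have e2 := h1 i
    simp only [adaptedFun_of_mem h.mem] at e2
    rw [h4.1] at e1
    have e3 : (ψ (s y)).1 i = σ * (t y * w i y) := by
      rw [← e2, e1, ← mul_assoc, hσσ, one_mul]
    have e4 : (ψ (s y)).1 i ≠ 0 := by
      intro h0
      apply h4.2
      refine h2.2 fun l hl => ?_
      by_cases hli : l = i
      · subst hli; rw [h0] at e1; linarith
      · have := h.coord_mem _ h5 l hl hli
        rw [h0, h4.1] at this; linarith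
    have e5 : 0 < (ψ (s y)).1 i := lt_of_le_of_ne ((ψ (s y)).2 i) e4.symm
    refine ⟨?_, fun j hj hji => ?_, fun j hj => ?_⟩
    · rw [e3] at e5
      have : 0 < t y * (σ * w i y) := by linarith
      exact pos_of_mul_pos_right this ht0.le
    · have e6 := h.coord_mem _ h5 j hj hji
      rw [h4.1] at e6
      have e7 := h1 j
      simp only [adaptedFun_of_mem hj] at e7
      apply mul_left_cancel₀ ht0.ne'
      rw [← e7, e6, e3]; ring
    · have e7 := h1 j
      rw [adaptedFun_of_notMem hj] at e7
      exact (mul_eq_zero.1 e7.symm).resolve_left ht0.ne'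
  have hwt : ∀ l, Filter.Tendsto (w l) F (𝓝 (w l z)) := fun l => (hw l).continuousAt.mono_left hF
  have hψt : ∀ l, Filter.Tendsto (fun y => (ψ (s y)).1 l) F (𝓝 ((ψ x).1 l)) := fun l =>
    (hψc l).continuousAt.tendsto.comp hs
  -- The relations between the `w j` and the coordinates of `s y`, valid along the filter, pass to
  -- the limit at `z`.
  have hlim1 : 0 ≤ σ * w i z := ge_of_tendsto ((hwt i).const_mul σ)
    (hkey.mono fun y hy => hy.1.le)
  have hlim2 : ∀ j ∈ I, j ≠ i → w j z = σ * w i z * ((ψ x).1 j - a j) := fun j hj hji =>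
    tendsto_nhds_unique_of_eventuallyEq (hwt j) (((hwt i).const_mul σ).mul ((hψt j).sub_const _))
      (hkey.mono fun y hy => hy.2.1 j hj hji)
  have hlim3 : ∀ j ∉ I, w j z = 0 := fun j hj =>
    tendsto_nhds_unique_of_eventuallyEq (hwt j) tendsto_const_nhds
      (hkey.mono fun y hy => hy.2.2 j hj)
  -- If `w i z` were zero, the limit relations would make every `w l z` zero. Hence the index of the
  -- chart around `x` can serve as denominator for the lift.
  have hwi : 0 < σ * w i z := by
    refine lt_of_le_of_ne hlim1 fun h0 => hl₀ ?_
    by_cases hl : l₀ ∈ I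
    · by_cases hli : l₀ = i
      · rw [hli]
        exact (mul_eq_zero.1 h0.symm).resolve_left h.sign_ne_zero
      · rw [hlim2 _ hl hli, ← h0, zero_mul]
    · exact hlim3 _ hl
  have hsw : SmoothNear n (fun y => σ * w i y) z := (SmoothNear.const σ).mul (hw i)
  have hgc : ContinuousAt g z := hg.continuousAt
  have hφc : ∀ l, SmoothNear n (fun y => (φ (g y)).1 l) z := fun l =>
    (SmoothNear.coord hP.mem_maximalAtlas (by rw [hz]; exact hP.mem_source) l).comp hg
  -- the coordinates of the lift
  classical
  let v : Fin n → Z → ℝ := fun l y =>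
    if l = i then t y * (σ * w i y) else if l ∈ I then a l + w l y / (σ * w i y)
      else (φ (g y)).1 l
  have vi : v i = fun y => t y * (σ * w i y) := by funext y; simp [v]
  have vj : ∀ j ∈ I, j ≠ i → v j = fun y => a j + w j y / (σ * w i y) := by
    intro j hj hji; funext y; simp [v, hj, hji]
  have vk : ∀ j ∉ I, v j = fun y => (φ (g y)).1 j := by
    intro j hj
    have hji : j ≠ i := fun e => hj (e ▸ h.mem)
    funext y; simp [v, hj, hji]
  have hvs : ∀ l, SmoothNear n (v l) z := by
    intro l
    by_cases hl : l ∈ I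
    · by_cases hli : l = i
      · rw [hli, vi]; exact ht.smoothNear.mul hsw
      · rw [vj l hl hli]; exact (SmoothNear.const _).add ((hw l).div hsw hwi.ne')
    · rw [vk l hl]; exact hφc l
  have hi0 : t z * w i z = 0 := by
    have := hIi.self_of_nhds
    rw [hz, sub_self] at this
    exact this.symm
  have hvz : ∀ l, v l z = (ψ x).1 l := by
    intro l
    by_cases hl : l ∈ I
    · by_cases hli : l = i
      · subst hli
        rw [vi, h.eq_zero]
        linear_combination σ * hi0
      · rw [vj l hl hli]
        simp only
        rw [hlim2 l hl hli, mul_div_cancel_left₀ _ hwi.ne']; ring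
    · rw [vk l hl]
      simp only
      rw [hz, h.coord_notMem x h.mem_source l hl]
  have hbdry : ∀ j ∈ I, j ≠ i → (ψ x).1 j = 0 → (φ (β x)).1 j = 0 ∧ a j = 0 := by
    intro j hj hji h0
    have h1 : (φ (β x)).1 j = 0 := by
      by_contra hne
      exact ((h.translation j hj hji).2 (lt_of_le_of_ne ((φ (β x)).2 j) (Ne.symm hne))).ne' h0
    exact ⟨h1, (h.translation j hj hji).1 h1⟩
  have hwipos : ∀ᶠ y in 𝓝 z, 0 < σ * w i y := hsw.eventually_pos hwi
  have hvnn : ∀ l, ∀ᶠ y in 𝓝 z, 0 ≤ v l y := by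
    intro l
    by_cases hl0 : (ψ x).1 l = 0
    swap
    · have : 0 < v l z := by rw [hvz]; exact lt_of_le_of_ne ((ψ x).2 l) (Ne.symm hl0)
      exact ((hvs l).eventually_pos this).mono fun y hy => hy.le
    by_cases hl : l ∈ I
    · by_cases hli : l = i
      · rw [hli, vi]
        filter_upwards [hpos, hwipos] with y h1 h2 using mul_nonneg h1 h2.le
      · rw [vj l hl hli]
        obtain ⟨h1, h2⟩ := hbdry l hl hli hl0
        -- Here `t * w l` is a boundary coordinate of `g`, hence non-negative, and `t` is positive
        -- on a dense set; so `w l` cannot be negative anywhere near `z`.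
        filter_upwards [(hI l hl).eventually_nhds, ht.regularAt, hpos.eventually_nhds, hw l,
          hwipos] with y e1 e2 e3 e4 e5
        rw [h2, zero_add]
        refine div_nonneg ?_ e5.le
        by_contra hneg
        obtain ⟨y', f1, f2, f3, f4⟩ := (e2.and_eventually (e1.and (e3.and
          (e4.continuousAt.eventually (gt_mem_nhds (not_le.1 hneg)))))).exists
        have f5 : 0 < t y' := lt_of_le_of_ne f3 f1.symm
        rw [h1, sub_zero] at f2
        have := (φ (g y')).2 l
        rw [f2] at this
        exact absurd this (not_le.2 (mul_neg_of_pos_of_neg f5 f4))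
    · rw [vk l hl]
      exact Filter.Eventually.of_forall fun y => (φ (g y)).2 l
  let u : Z → EuclideanQuadrant n := fun y => quadrantOf fun l => v l y
  have hu : ∀ᶠ y in 𝓝 z, ∀ l, (u y).1 l = v l y := by
    filter_upwards [Filter.eventually_all.2 hvnn] with y hy l
    exact quadrantOf_apply_of_nonneg (hy l)
  have huz : u z = ψ x := quadrant_ext fun l => (hu.self_of_nhds l).trans (hvz l)
  have hus : ∀ l, SmoothNear n (fun y => (u y).1 l) z := fun l =>
    (hvs l).congr (hu.mono fun y hy => hy l)
  have hut : u z ∈ ψ.target := huz ▸ ψ.map_source h.mem_source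
  have hGs : SmoothMapNear n (fun y => ψ.symm (u y)) z :=
    SmoothMapNear.symm_comp h.mem_maximalAtlas hus hut
  have huc : ContinuousAt u z := (SmoothMapNear.of_coords hus).continuousAt
  have hGz : ψ.symm (u z) = x := by rw [huz, ψ.left_inv h.mem_source]
  refine ⟨fun y => ψ.symm (u y), hGs, hGz, ?_, fun hb => ?_⟩
  · filter_upwards [huc.eventually (ψ.open_target.mem_nhds hut), hu, hwipos,
      hgc.eventually (φ.open_source.mem_nhds (by rw [hz]; exact hP.mem_source)),
      Filter.eventually_all.2 fun l => Filter.eventually_all.2 (hI l)] with y h1 h2 h3 h4 h5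
    have hy := ψ.map_target h1
    refine φ.injOn (h.mapsTo hy) h4 (quadrant_ext fun l => ?_)
    by_cases hl : l ∈ I
    · have e3 := h5 l hl
      by_cases hli : l = i
      · subst hli
        have e1 := h.coord_self _ hy
        rw [ψ.right_inv h1, h2, vi] at e1
        linear_combination e1 - e3 + t y * w l y * hσσ
      · have e1 := h.coord_mem _ hy l hl hli
        rw [ψ.right_inv h1, h2, h2, vi, vj l hl hli] at e1
        simp only [add_sub_cancel_left] at e1
        rw [mul_assoc, mul_div_cancel₀ _ h3.ne'] at e1
        linarith
    · rw [h.coord_notMem _ hy l hl, ψ.right_inv h1, h2, vk l hl]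
  · refine LocalBMapAt.of_coord hGs h.mem_maximalAtlas (by rw [hGz]; exact h.mem_source)
      fun l => ?_
    have hcongr : ∀ᶠ y in 𝓝 z, (ψ (ψ.symm (u y))).1 l = v l y := by
      filter_upwards [huc.eventually (ψ.open_target.mem_nhds hut), hu] with y h1 h2
      rw [ψ.right_inv h1, h2]
    refine MonomialAt.congr ?_ hcongr
    by_cases hl0 : (ψ x).1 l = 0
    swap
    · exact MonomialAt.of_pos (hvs l)
        (by rw [hvz]; exact lt_of_le_of_ne ((ψ x).2 l) (Ne.symm hl0))
    have hφl : MonomialAt n (fun y => (φ (g y)).1 l) z :=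
      hb _ (MonomialAt.coord hP.mem_maximalAtlas (by rw [hz]; exact hP.mem_source) l)
    by_cases hl : l ∈ I
    · by_cases hli : l = i
      · rw [hli, vi]
        exact ht.mul (MonomialAt.of_pos hsw hwi)
      · obtain ⟨h1, h2⟩ := hbdry l hl hli hl0
        -- `w l` is the smooth quotient of the monomial `φ_l ∘ g` by the monomial `t`.
        have e1 : MonomialAt n (w l) z := by
          refine MonomialAt.of_eq_mul hφl ht (hw l) ?_
          filter_upwards [hI l hl] with y hy
          rw [← hy, h1, sub_zero]
        have e2 : MonomialAt n (fun y => (σ * w i y)⁻¹) z :=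
          MonomialAt.of_pos (hsw.inv hwi.ne') (inv_pos.2 hwi)
        refine (e1.mul e2).congr (Filter.Eventually.of_forall fun y => ?_)
        rw [vj l hl hli]
        simp only
        rw [h2, zero_add, div_eq_mul_inv]
    · rwa [vk l hl]

end Projective

/-! ### Pulling back charts by local diffeomorphisms. -/

section LocalDiffeo

variable {n : ℕ} {M : Type*} [TopologicalSpace M] [ChartedSpace (EuclideanQuadrant n) M]
  [IsManifold (QM n) ∞ M]
  {X : Type*} [TopologicalSpace X] [ChartedSpace (EuclideanQuadrant n) X] [IsManifold (QM n) ∞ X]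

/-- Charts can be pulled back under local diffeomorphisms. -/
theorem IsLocalDiffeomorphAt.exists_chart {β : X → M} {x : X}
    (h : IsLocalDiffeomorphAt (QM n) (QM n) ∞ β x)
    {φ : OpenPartialHomeomorph M (EuclideanQuadrant n)}
    (hφ : φ ∈ IsManifold.maximalAtlas (QM n) ∞ M) (hx : β x ∈ φ.source) :
    ∃ ψ ∈ IsManifold.maximalAtlas (QM n) ∞ X, x ∈ ψ.source ∧ MapsTo β ψ.source φ.source ∧
      ∀ q ∈ ψ.source, ψ q = φ (β q) := by
  obtain ⟨Φ, hΦx, hΦ⟩ := h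
  let Φ' : OpenPartialHomeomorph X M := Φ.toOpenPartialHomeomorph
  have hΦ' : ∀ q ∈ Φ'.source, Φ' q = β q := fun q hq => (hΦ hq).symm
  have hsrc : ∀ q ∈ (Φ'.trans φ).source, q ∈ Φ'.source ∧ β q ∈ φ.source := by
    intro q hq
    rw [OpenPartialHomeomorph.trans_source] at hq
    exact ⟨hq.1, by rw [← hΦ' q hq.1]; exact hq.2⟩
  refine ⟨Φ'.trans φ, ?_, ?_, fun q hq => (hsrc q hq).2, fun q hq => ?_⟩
  · rw [IsManifold.mem_maximalAtlas_iff_contMDiffOn]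
    constructor
    · rw [OpenPartialHomeomorph.trans_source, OpenPartialHomeomorph.coe_trans]
      exact (contMDiffOn_of_mem_maximalAtlas hφ).comp
        (Φ.contMDiffOn_toFun.mono inter_subset_left) fun q hq => hq.2
    · rw [OpenPartialHomeomorph.trans_target, OpenPartialHomeomorph.coe_trans_symm]
      exact Φ.contMDiffOn_invFun.comp
        ((contMDiffOn_symm_of_mem_maximalAtlas hφ).mono inter_subset_left) fun q hq => hq.2
  · rw [OpenPartialHomeomorph.trans_source]
    exact ⟨hΦx, by rw [mem_preimage, hΦ' x hΦx]; exact hx⟩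
  · rw [OpenPartialHomeomorph.coe_trans, Function.comp, hΦ' q (hsrc q hq).1]

end LocalDiffeo

/-! ### The universal property of the blow-up. -/

section GlobalLift

variable {n : ℕ} {X M Z : CornerManifold.{u} n} {β : X → M} {P : Set M}

theorem HasProjectiveCoords.exists_projectiveAt {x : X} (h : HasProjectiveCoords β P x) :
    ∃ φ I ψ i σ a, IsAdaptedChart P (β x) φ I ∧ ProjectiveAt β x φ I ψ i σ a := by
  obtain ⟨φ, I, hφ, ψ, hψ, hx, hm, i, hi, σ, hσ, a, h0, ha, hq⟩ := h
  exact ⟨φ, I, ψ, i, σ, a, hφ, hψ, hx, hm, hi, hσ, h0, ha, fun q hqs => (hq q hqs).1,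
    fun q hqs => (hq q hqs).2.1, fun q hqs => (hq q hqs).2.2⟩

theorem ProjectiveAt.hasProjectiveCoords {x : X}
    {φ : OpenPartialHomeomorph M (EuclideanQuadrant n)}
    {I : Set (Fin n)} {ψ : OpenPartialHomeomorph X (EuclideanQuadrant n)} {i : Fin n} {σ : ℝ}
    {a : Fin n → ℝ} (h : ProjectiveAt β x φ I ψ i σ a) (hφ : IsAdaptedChart P (β x) φ I) :
    HasProjectiveCoords β P x :=
  ⟨φ, I, hφ, ψ, h.mem_maximalAtlas, h.mem_source, h.mapsTo, i, h.mem, σ, h.sign, a, h.eq_zero,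
    h.translation, fun q hq => ⟨h.coord_self q hq, h.coord_mem q hq, h.coord_notMem q hq⟩⟩

theorem IsBlowup.contMDiff (h : IsBlowup β P) : ContMDiff (QM n) (QM n) ∞ β := by
  intro x
  by_cases hx : β x ∈ P
  · obtain ⟨φ, I, ψ, i, σ, a, h1, h2⟩ := (h.projective x hx).exists_projectiveAt
    exact (h2.smoothMapNear h1.1).self_of_nhds
  · exact (h.isLocalDiffeomorphAt x hx).contMDiffAt

/-- Some defining function of `P` pulls back to `t` times a unit, and the non-zeros of `t` are
dense. This density is what makes lifts unique. -/
theorem PrincipalMonomialAt.frequently_notMem {g : Z → M} {z : Z} (hP : IsPSubmanifold P)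
    (hg : SmoothMapNear n g z) (h : PrincipalMonomialAt n g P z) : ∃ᶠ y in 𝓝 z, g y ∉ P := by
  obtain ⟨t, ht, hp⟩ := h
  by_cases hz : g z ∈ P
  swap
  · exact (hg.continuousAt.eventually (hP.1.isOpen_compl.mem_nhds hz)).frequently
  obtain ⟨φ, I, hφ⟩ := hP.2 _ hz
  have hga := hφ.adaptedNear.gensAt
  obtain ⟨w, hw, ⟨l, hl⟩, hwe⟩ := hp.exists_gens hg ht.regularAt hga
  refine (ht.regularAt.self_of_nhds.and_eventually ((hwe l).and (((hw l).eventually_ne hl).and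
    (hg.continuousAt.eventually hga.mem_iff)))).mono ?_
  rintro y ⟨h1, h2, h3, h4⟩ h5
  rw [h4.1 h5 l] at h2
  exact mul_ne_zero h1 h3 h2.symm

/-- The universal property of the blow-up. -/
theorem IsBlowup.exists_lift (h : IsBlowup β P) (hP : IsPSubmanifold P) {g : Z → M}
    (hg : ContMDiff (QM n) (QM n) ∞ g) (hp : ∀ z, PrincipalMonomialAt n g P z) :
    ∃ G : Z → X, ContMDiff (QM n) (QM n) ∞ G ∧ β ∘ G = g ∧
      ∀ z, LocalBMapAt n g z → LocalBMapAt n G z := by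
  have hbij : ∀ z, ∃ x, g z ∉ P → β x = g z := by
    intro z
    by_cases hz : g z ∈ P
    · obtain ⟨y, hy⟩ := ((hp z).frequently_notMem hP (hg.smoothMapNear z)).exists
      obtain ⟨x, -, -⟩ := h.bijOn.surjOn hy
      exact ⟨x, fun h => absurd hz h⟩
    · obtain ⟨x, -, hx⟩ := h.bijOn.surjOn hz
      exact ⟨x, fun _ => hx⟩
  choose s hs using hbij
  -- Off the preimage of `P` the lift must be `s`. Over `P` its candidate values are limits of `s`
  -- along ultrafilters that avoid this preimage; they exist because `β` is proper.
  let Lim : Z → X → Prop := fun z x => β x = g z ∧ ∃ F : Ultrafilter Z, (F : Filter Z) ≤ 𝓝 z ∧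
    (∀ᶠ y in F, g y ∉ P) ∧ Filter.Tendsto s F (𝓝 x)
  have hLim : ∀ z, ∃ x, Lim z x := by
    intro z
    have hfr := (hp z).frequently_notMem hP (hg.smoothMapNear z)
    have hne : (𝓝 z ⊓ Filter.principal {y | g y ∉ P}).NeBot := by
      rw [Filter.inf_principal_neBot_iff]
      intro U hU
      obtain ⟨y, hy, hyU⟩ := (hfr.and_eventually hU).exists
      exact ⟨y, hyU, hy⟩
    let F := Ultrafilter.of (𝓝 z ⊓ Filter.principal {y | g y ∉ P})
    have hF : (F : Filter Z) ≤ 𝓝 z ⊓ Filter.principal {y | g y ∉ P} := Ultrafilter.of_le _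
    have hF1 : (F : Filter Z) ≤ 𝓝 z := hF.trans inf_le_left
    have hF2 : ∀ᶠ y in F, g y ∉ P := hF.trans inf_le_right (Filter.mem_principal_self _)
    have ht : Filter.Tendsto β (F.map s) (𝓝 (g z)) := by
      have h1 : Filter.Tendsto g F (𝓝 (g z)) := (hg.continuous.tendsto z).mono_left hF1
      rw [Ultrafilter.coe_map, Filter.tendsto_map'_iff]
      exact h1.congr' (hF2.mono fun y hy => (hs y hy).symm)
    obtain ⟨x, hx, hx'⟩ := (isProperMap_iff_ultrafilter.1 h.isProperMap).2 ht
    exact ⟨x, hx, F, hF1, hF2, hx'⟩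
  have hloc : ∀ z x, Lim z x → ∃ G : Z → X, SmoothMapNear n G z ∧ G z = x ∧
      (∀ᶠ y in 𝓝 z, β (G y) = g y) ∧ (LocalBMapAt n g z → LocalBMapAt n G z) := by
    rintro z x ⟨hx, F, hF1, hF2, hFx⟩
    by_cases hxP : β x ∈ P
    · obtain ⟨φ, I, ψ, i, σ, a, h1, h2⟩ := (h.projective x hxP).exists_projectiveAt
      obtain ⟨t, ht, hpt⟩ := hp z
      exact h2.exists_local_lift h1.adaptedNear (hg.smoothMapNear z) hx.symm ht hpt hF1 hFx
        (hF2.mono fun y hy => ⟨hs y hy, hy⟩)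
    · have hc := IsManifold.chart_mem_maximalAtlas (I := QM n) (n := ∞) (β x)
      obtain ⟨ψ, hψ, hxψ, hm, he⟩ := (h.isLocalDiffeomorphAt x hxP).exists_chart hc
        (mem_chart_source _ _)
      set φ := chartAt (EuclideanQuadrant n) (β x)
      have hzs : g z ∈ φ.source := hx ▸ mem_chart_source _ _
      have hus : ∀ l, SmoothNear n (fun y => (φ (g y)).1 l) z := fun l =>
        (SmoothNear.coord hc hzs l).comp (hg.smoothMapNear z)
      have huz : φ (g z) = ψ x := by rw [he x hxψ, hx]
      have hut : φ (g z) ∈ ψ.target := huz ▸ ψ.map_source hxψ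
      have hGs : SmoothMapNear n (fun y => ψ.symm (φ (g y))) z :=
        SmoothMapNear.symm_comp hψ (u := fun y => φ (g y)) hus hut
      have hGz : ψ.symm (φ (g z)) = x := by rw [huz, ψ.left_inv hxψ]
      have hev : ∀ᶠ y in 𝓝 z, φ (g y) ∈ ψ.target ∧ g y ∈ φ.source :=
        ((SmoothMapNear.of_coords hus).continuousAt.eventually
          (ψ.open_target.mem_nhds hut)).and
          (hg.continuous.continuousAt.eventually (φ.open_source.mem_nhds hzs))
      refine ⟨fun y => ψ.symm (φ (g y)), hGs, hGz, ?_, fun hb => ?_⟩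
      · filter_upwards [hev] with y hy
        refine φ.injOn (hm (ψ.map_target hy.1)) hy.2 ?_
        rw [← he _ (ψ.map_target hy.1), ψ.right_inv hy.1]
      · refine LocalBMapAt.of_coord hGs hψ (by rw [hGz]; exact hxψ) fun l => ?_
        refine (hb _ (MonomialAt.coord hc hzs l)).congr ?_
        filter_upwards [hev] with y hy
        rw [ψ.right_inv hy.1]
  choose G hG using hLim
  have hGs : ∀ y, g y ∉ P → G y = s y := fun y hy =>
    h.bijOn.injOn (by rw [mem_preimage, (hG y).1]; exact hy)
      (by rw [mem_preimage, hs y hy]; exact hy) ((hG y).1.trans (hs y hy).symm)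
  -- The pointwise choices fit together: near `z`, both `G` and the smooth local lift are limits of
  -- `s` along ultrafilters, hence equal.
  have heq : ∀ z, ∃ G' : Z → X, SmoothMapNear n G' z ∧
      (LocalBMapAt n g z → LocalBMapAt n G' z) ∧ ∀ᶠ y in 𝓝 z, G y = G' y := by
    intro z
    obtain ⟨G', h1, h2, h3, h4⟩ := hloc z _ (hG z)
    refine ⟨G', h1, h4, ?_⟩
    filter_upwards [h1, h3.eventually_nhds] with y e1 e2
    obtain ⟨-, F, hF1, hF2, hF3⟩ := hG y
    refine tendsto_nhds_unique hF3 ((e1.continuousAt.tendsto.mono_left hF1).congr' ?_)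
    filter_upwards [hF2, hF1 e2] with q q1 q2
    exact h.bijOn.injOn (by rw [mem_preimage, q2]; exact q1)
      (by rw [mem_preimage, hs q q1]; exact q1) (q2.trans (hs q q1).symm)
  refine ⟨G, fun z => ?_, funext fun z => (hG z).1, fun z hb => ?_⟩
  · obtain ⟨G', h1, -, h2⟩ := heq z
    exact (Filter.Eventually.self_of_nhds h1).congr_of_eventuallyEq h2
  · obtain ⟨G', -, h1, h2⟩ := heq z
    intro t ht
    rw [h2.self_of_nhds] at ht
    refine (h1 hb t ht).congr ?_
    filter_upwards [h2] with y hy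
    rw [hy]

end GlobalLift

/-! ### Construction of the blow-up: the closure of the graph of normal directions. -/

section UnitVector

variable {n : ℕ}

/-- The unit vector in the direction of `w`. -/
noncomputable def unitVec (w : Fin n → ℝ) : EuclideanSpace ℝ (Fin n) :=
  ‖(WithLp.toLp 2 w : EuclideanSpace ℝ (Fin n))‖⁻¹ • WithLp.toLp 2 w

theorem unitVec_apply (w : Fin n → ℝ) (j : Fin n) :
    unitVec w j = ‖(WithLp.toLp 2 w : EuclideanSpace ℝ (Fin n))‖⁻¹ * w j := rfl

theorem norm_toLp_pos {w : Fin n → ℝ} (hw : w ≠ 0) :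
    0 < ‖(WithLp.toLp 2 w : EuclideanSpace ℝ (Fin n))‖ :=
  norm_pos_iff.2 fun h => hw (by simpa using congrArg WithLp.ofLp h)

theorem norm_unitVec {w : Fin n → ℝ} (hw : w ≠ 0) : ‖unitVec w‖ = 1 := by
  rw [unitVec, norm_smul, norm_inv, norm_norm, inv_mul_cancel₀ (norm_toLp_pos hw).ne']

theorem unitVec_mul {t : ℝ} (ht : 0 < t) (w : Fin n → ℝ) :
    unitVec (fun j => t * w j) = unitVec w := by
  have h : (WithLp.toLp 2 (fun j => t * w j) : EuclideanSpace ℝ (Fin n)) =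
      t • (WithLp.toLp 2 w : EuclideanSpace ℝ (Fin n)) := rfl
  rw [unitVec, unitVec, h, norm_smul, smul_smul, Real.norm_of_nonneg ht.le, mul_inv,
    mul_right_comm, inv_mul_cancel₀ ht.ne', one_mul]

theorem continuousAt_unitVec {w : Fin n → ℝ} (hw : w ≠ 0) : ContinuousAt (unitVec (n := n)) w := by
  have h : Continuous fun w : Fin n → ℝ => (WithLp.toLp 2 w : EuclideanSpace ℝ (Fin n)) :=
    PiLp.continuous_toLp 2 _
  exact (h.norm.continuousAt.inv₀ (norm_toLp_pos hw).ne').smul h.continuousAt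

end UnitVector

/-- A countable family of adapted charts and of cut-off functions, from which the blow-up of `P`
is constructed. -/
structure BlowupData {n : ℕ} (M : CornerManifold.{u} n) (P : Set M) where
  ι : Type u
  [countable : Countable ι]
  chart : ι → OpenPartialHomeomorph M (EuclideanQuadrant n)
  idx : ι → Set (Fin n)
  center : ι → Fin n → ℝ
  cutoff : ι → M → ℝ
  isClosed : IsClosed P
  mem_maximalAtlas : ∀ k, chart k ∈ IsManifold.maximalAtlas (QM n) ∞ M
  mem_iff : ∀ k, ∀ q ∈ (chart k).source,
    q ∈ P ↔ ∀ j ∈ idx k, ((chart k) q).1 j = center k j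
  center_nonneg : ∀ k j, 0 ≤ center k j
  coord_pos : ∀ k, ∀ j ∈ idx k, 0 < center k j → ∀ q ∈ (chart k).source, 0 < ((chart k) q).1 j
  cutoff_continuous : ∀ k, Continuous (cutoff k)
  cutoff_nonneg : ∀ k q, 0 ≤ cutoff k q
  cutoff_le_one : ∀ k q, cutoff k q ≤ 1
  tsupport_cutoff : ∀ k, tsupport (cutoff k) ⊆ (chart k).source
  cover : ∀ p ∈ P, ∃ k, 0 < cutoff k p

namespace BlowupData

attribute [instance] BlowupData.countable

variable {n : ℕ} {M : CornerManifold.{u} n} {P : Set M} (D : BlowupData M P) {k : D.ι} {q : M}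

open Classical in
/-- The coordinates normal to `P`, centred at `P`. -/
noncomputable def normal (k : D.ι) (q : M) (j : Fin n) : ℝ :=
  if j ∈ D.idx k then (D.chart k q).1 j - D.center k j else 0

/-- The normal direction, with the cut-off function as norm. -/
noncomputable def dir (k : D.ι) (q : M) : EuclideanSpace ℝ (Fin n) :=
  D.cutoff k q • unitVec (D.normal k q)

/-- The graph of the normal directions. -/
noncomputable def graph (q : M) : M × (D.ι → EuclideanSpace ℝ (Fin n)) := (q, fun k => D.dir k q)

/-- The space underlying the blow-up: the closure of the graph of the normal directions. -/
def Space : Type u := {x : M × (D.ι → EuclideanSpace ℝ (Fin n)) // x ∈ closure (D.graph '' Pᶜ)}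

noncomputable instance instTopologicalSpaceSpace : TopologicalSpace D.Space :=
  instTopologicalSpaceSubtype

variable {D}

/-- The blow-down map. -/
def Space.proj (x : D.Space) : M := x.1.1

/-- The limiting normal direction in the chart with index `k`. -/
def Space.vec (x : D.Space) (k : D.ι) : EuclideanSpace ℝ (Fin n) := x.1.2 k

theorem continuous_proj : Continuous (Space.proj (D := D)) :=
  continuous_fst.comp continuous_subtype_val

theorem continuous_vec (k : D.ι) (j : Fin n) : Continuous fun x : D.Space => x.vec k j :=
  (EuclideanSpace.proj j).continuous.comp
    ((continuous_apply k).comp (continuous_snd.comp continuous_subtype_val))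

theorem continuous_vec' (k : D.ι) : Continuous fun x : D.Space => x.vec k :=
  (continuous_apply k).comp (continuous_snd.comp continuous_subtype_val)

theorem Space.ext' {x y : D.Space} (h1 : x.proj = y.proj) (h2 : ∀ k, x.vec k = y.vec k) : x = y :=
  Subtype.ext (Prod.ext h1 (funext h2))

theorem locallyCompactSpace (M : CornerManifold.{u} n) : LocallyCompactSpace M :=
  haveI : LocallyCompactSpace (EuclideanQuadrant n) := (QM n).locallyCompactSpace
  ChartedSpace.locallyCompactSpace (EuclideanQuadrant n) M

instance instT2SpaceSpace : T2Space D.Space := inferInstanceAs (T2Space (Subtype _))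

instance instSecondCountableSpace : SecondCountableTopology D.Space :=
  inferInstanceAs (SecondCountableTopology (Subtype _))

theorem smoothNear_normal (hq : q ∈ (D.chart k).source) (j : Fin n) :
    SmoothNear n (fun q => D.normal k q j) q := by
  unfold normal
  split_ifs with hj
  · exact (SmoothNear.coord (D.mem_maximalAtlas k) hq j).sub (SmoothNear.const _)
  · exact SmoothNear.const _

theorem normal_ne_zero (hq : q ∈ (D.chart k).source) (hqP : q ∉ P) : D.normal k q ≠ 0 := by
  intro h
  refine hqP ((D.mem_iff k q hq).2 fun j hj => ?_)
  have := congrFun h j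
  simp only [normal, hj, if_true, Pi.zero_apply] at this
  linarith

theorem normal_eq_zero_iff (hq : q ∈ (D.chart k).source) : D.normal k q = 0 ↔ q ∈ P := by
  refine ⟨fun h => by_contra fun hqP => normal_ne_zero hq hqP h, fun h => funext fun j => ?_⟩
  simp only [normal, Pi.zero_apply]
  split_ifs with hj
  · rw [(D.mem_iff k q hq).1 h j hj, sub_self]
  · rfl

/-- The normal coordinates generate the ideal of `P`. -/
theorem gensAt_normal (hq : q ∈ (D.chart k).source) :
    GensAt n P q (fun j q => D.normal k q j) := by
  by_cases hqP : q ∈ P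
  · have hc := (D.mem_iff k q hq).1 hqP
    have h : AdaptedNear P q (D.chart k) (D.idx k) := by
      refine ⟨D.mem_maximalAtlas k, hq, ?_⟩
      filter_upwards [(D.chart k).open_source.mem_nhds hq] with q' hq'
      rw [D.mem_iff k q' hq']
      exact forall₂_congr fun j hj => by rw [hc j hj]
    have he : (fun j q => D.normal k q j) = adaptedFun (D.chart k) (D.idx k) q := by
      funext j q'
      by_cases hj : j ∈ D.idx k
      · simp only [normal, hj, if_true, adaptedFun_of_mem, hc j hj]
      · simp only [normal, hj, if_false, adaptedFun_of_notMem, not_false_eq_true]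
    rw [he]
    exact h.gensAt
  · obtain ⟨j, hj⟩ := Function.ne_iff.1 (normal_ne_zero hq hqP)
    exact GensAt.of_unit (D.isClosed.isOpen_compl.mem_nhds hqP) (smoothNear_normal hq) hj

theorem mem_source_of_cutoff_ne_zero (h : D.cutoff k q ≠ 0) : q ∈ (D.chart k).source :=
  D.tsupport_cutoff k (subset_tsupport _ h)

theorem continuousAt_normal (hq : q ∈ (D.chart k).source) : ContinuousAt (D.normal k) q :=
  continuousAt_pi.2 fun j => (smoothNear_normal hq j).continuousAt

theorem eventually_dir_eq_zero (hq : q ∉ (D.chart k).source) : ∀ᶠ q' in 𝓝 q, D.dir k q' = 0 := by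
  have h := notMem_tsupport_iff_eventuallyEq.1 fun h => hq (D.tsupport_cutoff k h)
  filter_upwards [h] with q' hq'
  rw [dir, hq', Pi.zero_apply, zero_smul]

/-- The unit normal only makes sense in the domain of the chart; the cut-off, supported there, lets
it be continued by zero. -/
theorem continuousAt_dir (hq : q ∉ P) : ContinuousAt (D.dir k) q := by
  by_cases hs : q ∈ (D.chart k).source
  · refine (D.cutoff_continuous k).continuousAt.smul ?_
    exact ContinuousAt.comp (g := unitVec) (continuousAt_unitVec (normal_ne_zero hs hq))
      (continuousAt_normal hs)
  · exact continuousAt_const.congr ((eventually_dir_eq_zero hs).mono fun q' hq' => hq'.symm)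

theorem continuousAt_graph (hq : q ∉ P) : ContinuousAt D.graph q :=
  continuousAt_id.prodMk (continuousAt_pi.2 fun _ => continuousAt_dir hq)

theorem norm_dir (hq : q ∉ P) : ‖D.dir k q‖ = D.cutoff k q := by
  by_cases h0 : D.cutoff k q = 0
  · rw [dir, h0, zero_smul, norm_zero]
  · rw [dir, norm_smul, norm_unitVec (normal_ne_zero (mem_source_of_cutoff_ne_zero h0) hq),
      mul_one, Real.norm_of_nonneg (D.cutoff_nonneg k q)]

/-- The point of the blow-up over a point `q ∉ P`. -/
noncomputable def lift (q : M) (hq : q ∉ P) : D.Space :=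
  ⟨D.graph q, subset_closure ⟨q, hq, rfl⟩⟩

@[simp] theorem proj_lift (hq : q ∉ P) : (lift (D := D) q hq).proj = q := rfl

@[simp] theorem vec_lift (hq : q ∉ P) : (lift (D := D) q hq).vec k = D.dir k q := rfl

/-- Off `P` the graph is that of a continuous function, so taking the closure adds no points there.
-/
theorem eq_lift (x : D.Space) (hx : x.proj ∉ P) : x = lift x.proj hx := by
  apply Subtype.ext
  have h1 : (𝓝[D.graph '' Pᶜ] x.1).NeBot := mem_closure_iff_nhdsWithin_neBot.1 x.2
  have h2 : Filter.Tendsto (fun z : M × (D.ι → EuclideanSpace ℝ (Fin n)) => D.graph z.1)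
      (𝓝[D.graph '' Pᶜ] x.1) (𝓝 (D.graph x.proj)) :=
    ((continuousAt_graph hx).tendsto.comp continuous_fst.continuousAt).mono_left
      nhdsWithin_le_nhds
  have h3 : Filter.Tendsto (fun z : M × (D.ι → EuclideanSpace ℝ (Fin n)) => D.graph z.1)
      (𝓝[D.graph '' Pᶜ] x.1) (𝓝 x.1) := by
    refine Filter.Tendsto.congr' ?_ (Filter.tendsto_id.mono_left nhdsWithin_le_nhds)
    filter_upwards [self_mem_nhdsWithin] with z hz
    obtain ⟨q, -, rfl⟩ := hz
    rfl
  exact tendsto_nhds_unique h3 h2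

theorem vec_eq_dir (x : D.Space) (hx : x.proj ∉ P) : x.vec k = D.dir k x.proj := by
  conv_lhs => rw [eq_lift x hx]
  exact vec_lift hx

theorem frequently_proj_notMem (x : D.Space) : ∃ᶠ y in 𝓝 x, y.proj ∉ P := by
  rw [frequently_nhds_iff]
  intro U hxU hU
  obtain ⟨V, hV, rfl⟩ := isOpen_induced_iff.1 hU
  obtain ⟨_, hzV, q, hq, rfl⟩ := mem_closure_iff.1 x.2 V hV hxU
  exact ⟨lift q hq, hzV, hq⟩

/-- The points off the front face are dense and their normal directions are explicit, so identities
need only be checked there; likewise for inequalities in `nonneg_of_eventually`. -/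
theorem eq_of_eventually (x : D.Space) {f g : D.Space → ℝ} (hf : ContinuousAt f x)
    (hg : ContinuousAt g x) (h : ∀ᶠ y in 𝓝 x, y.proj ∉ P → f y = g y) : f x = g x :=
  tendsto_nhds_unique_of_frequently_eq hf.tendsto hg.tendsto
    (((frequently_proj_notMem x).and_eventually h).mono fun _ hy => hy.2 hy.1)

theorem nonneg_of_eventually (x : D.Space) {f : D.Space → ℝ} (hf : ContinuousAt f x)
    (h : ∀ᶠ y in 𝓝 x, y.proj ∉ P → 0 ≤ f y) : 0 ≤ f x := by
  by_contra hneg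
  obtain ⟨y, hy, hy', hyn⟩ := ((frequently_proj_notMem x).and_eventually
    (h.and (hf.eventually (gt_mem_nhds (not_le.1 hneg))))).exists
  exact absurd (hy' hy) (not_le.2 hyn)

theorem vec_apply_eq (y : D.Space) (hy : y.proj ∉ P) (j : Fin n) :
    y.vec k j = D.cutoff k y.proj *
      (‖(WithLp.toLp 2 (D.normal k y.proj) : EuclideanSpace ℝ (Fin n))‖⁻¹ *
        D.normal k y.proj j) := by
  rw [vec_eq_dir y hy]
  rfl

theorem continuousAt_normal_proj (x : D.Space) (hx : x.proj ∈ (D.chart k).source) (l : Fin n) :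
    ContinuousAt (fun y : D.Space => D.normal k y.proj l) x :=
  ContinuousAt.comp (g := fun q => D.normal k q l) (smoothNear_normal hx l).continuousAt
    continuous_proj.continuousAt

theorem norm_vec (x : D.Space) (k : D.ι) : ‖x.vec k‖ = D.cutoff k x.proj :=
  eq_of_eventually x (f := fun y => ‖Space.vec y k‖) (g := fun y => D.cutoff k y.proj)
    (continuous_vec' k).norm.continuousAt
    ((D.cutoff_continuous k).comp continuous_proj).continuousAt
    (Filter.Eventually.of_forall fun y hy => by
      rw [vec_eq_dir y hy, norm_dir hy])

/-- The direction components have norm at most `1`, so the space is closed in the product of `M`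
with a compact product of balls. -/
theorem isProperMap_proj : IsProperMap (Space.proj (D := D)) := by
  let K : Set (D.ι → EuclideanSpace ℝ (Fin n)) := Set.pi univ fun _ => Metric.closedBall 0 1
  have hK : IsCompact K := isCompact_univ_pi fun _ => isCompact_closedBall 0 1
  have hmem : ∀ x : D.Space, x.1.2 ∈ K := by
    intro x k _
    have : ‖x.1.2 k‖ = _ := norm_vec x k
    rw [mem_closedBall_zero_iff, this]
    exact D.cutoff_le_one k _
  have : CompactSpace K := isCompact_iff_compactSpace.1 hK
  have h1 : IsProperMap (Prod.fst : M × K → M) := isProperMap_fst_of_compactSpace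
  let f : D.Space → M × K := fun x => (x.1.1, ⟨x.1.2, hmem x⟩)
  have hf : Topology.IsClosedEmbedding f := by
    have hg : Topology.IsEmbedding (fun z : M × K => (z.1, z.2.1)) :=
      Topology.IsEmbedding.id.prodMap Topology.IsEmbedding.subtypeVal
    have hf' : Topology.IsEmbedding f := by
      have hc : Continuous f := by
        refine (continuous_fst.comp continuous_subtype_val).prodMk
          (Continuous.subtype_mk (continuous_snd.comp continuous_subtype_val) _)
      have : Topology.IsEmbedding ((fun z : M × K => (z.1, z.2.1)) ∘ f) :=
        Topology.IsEmbedding.subtypeVal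
      exact this.of_comp hc hg.continuous
    refine ⟨hf', ?_⟩
    have : range f = (fun z : M × K => (z.1, z.2.1)) ⁻¹' closure (D.graph '' Pᶜ) := by
      ext z
      constructor
      · rintro ⟨x, rfl⟩
        exact x.2
      · intro hz
        exact ⟨⟨_, hz⟩, rfl⟩
    rw [this]
    exact isClosed_closure.preimage hg.continuous
  exact h1.comp hf.isProperMap

theorem normal_mul_vec (x : D.Space) (hx : x.proj ∈ (D.chart k).source) (i j : Fin n) :
    D.normal k x.proj j * x.vec k i = D.normal k x.proj i * x.vec k j := by
  refine eq_of_eventually x (f := fun y => D.normal k y.proj j * y.vec k i)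
    (g := fun y => D.normal k y.proj i * y.vec k j)
    ((continuousAt_normal_proj x hx j).mul (continuous_vec k i).continuousAt)
    ((continuousAt_normal_proj x hx i).mul (continuous_vec k j).continuousAt)
    (Filter.Eventually.of_forall fun y hy => ?_)
  simp only [vec_apply_eq y hy]
  ring

theorem normal_mul_vec_self_nonneg (x : D.Space) (hx : x.proj ∈ (D.chart k).source) (i : Fin n) :
    0 ≤ D.normal k x.proj i * x.vec k i := by
  refine nonneg_of_eventually x (f := fun y => D.normal k y.proj i * y.vec k i)
    ((continuousAt_normal_proj x hx i).mul (continuous_vec k i).continuousAt)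
    (Filter.Eventually.of_forall fun y hy => ?_)
  simp only [vec_apply_eq y hy]
  have h1 := D.cutoff_nonneg k y.proj
  have h2 := mul_self_nonneg (D.normal k y.proj i)
  have h3 := inv_nonneg.2 (norm_nonneg
    (WithLp.toLp 2 (D.normal k y.proj) : EuclideanSpace ℝ (Fin n)))
  calc (0 : ℝ) ≤ D.cutoff k y.proj * (_ * (_ * _)) := mul_nonneg h1 (mul_nonneg h3 h2)
    _ = _ := by ring

theorem vec_nonneg (x : D.Space) {j : Fin n} (hj : D.center k j = 0) : 0 ≤ x.vec k j := by
  refine nonneg_of_eventually x (f := fun y => y.vec k j) (continuous_vec k j).continuousAt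
    (Filter.Eventually.of_forall fun y hy => ?_)
  simp only [vec_apply_eq y hy, normal, hj]
  refine mul_nonneg (D.cutoff_nonneg k _) (mul_nonneg (inv_nonneg.2 (norm_nonneg _)) ?_)
  split_ifs
  · rw [sub_zero]; exact (D.chart k y.proj).2 j
  · exact le_rfl

theorem vec_of_notMem (x : D.Space) {j : Fin n} (hj : j ∉ D.idx k) : x.vec k j = 0 := by
  refine eq_of_eventually x (f := fun y => y.vec k j) (g := fun _ => 0)
    (continuous_vec k j).continuousAt continuousAt_const
    (Filter.Eventually.of_forall fun y hy => ?_)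
  simp only [vec_apply_eq y hy, normal, hj, if_false, mul_zero]

theorem mem_source_of_vec_ne_zero (x : D.Space) {j : Fin n} (hj : x.vec k j ≠ 0) :
    0 < D.cutoff k x.proj ∧ x.proj ∈ (D.chart k).source := by
  have h : x.vec k ≠ 0 := fun h => hj (by rw [h]; rfl)
  have h2 : 0 < D.cutoff k x.proj := by rw [← norm_vec]; exact norm_pos_iff.2 h
  exact ⟨h2, mem_source_of_cutoff_ne_zero h2.ne'⟩

end BlowupData

/-! ### Normal directions along maps with principal pull-backs. -/

namespace BlowupData

variable {n : ℕ} {M : CornerManifold.{u} n} {P : Set M} {D : BlowupData M P} {k : D.ι}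
  {Z : Type*} [TopologicalSpace Z] [ChartedSpace (EuclideanQuadrant n) Z]
  {g : Z → M} {z : Z} {t : Z → ℝ}

/-- Where the non-negative function `t` is non-zero, the normal coordinates are a positive multiple
of `w`, so they have the direction of `w`. As `w z ≠ 0`, this direction continues through `z`. -/
theorem exists_normal_eq_mul (hg : SmoothMapNear n g z) (ht : MonomialAt n t z)
    (hp : PrincipalAt n g P t z) (hs : g z ∈ (D.chart k).source) :
    ∃ w : Z → Fin n → ℝ, (∀ l, SmoothNear n (fun y => w y l) z) ∧ w z ≠ 0 ∧
      ∀ᶠ y in 𝓝 z, t y ≠ 0 → g y ∉ P ∧ D.dir k (g y) = D.cutoff k (g y) • unitVec (w y) := by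
  obtain ⟨w, hw, ⟨l, hl⟩, hwe⟩ := hp.exists_gens hg ht.regularAt (gensAt_normal hs)
  refine ⟨fun y l => w l y, hw, fun h => hl (congrFun h l), ?_⟩
  filter_upwards [Filter.eventually_all.2 hwe, (hw l).eventually_ne hl, ht.eventually_nonneg,
    hg.continuousAt.eventually ((D.chart k).open_source.mem_nhds hs)] with y h1 h2 h3 h4 h5
  have h6 : 0 < t y := lt_of_le_of_ne h3 h5.symm
  have h7 : D.normal k (g y) = fun j => t y * w j y := funext h1
  refine ⟨fun hP => ?_, ?_⟩
  · have := congrFun h7 l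
    rw [(normal_eq_zero_iff h4).2 hP] at this
    exact mul_ne_zero h5 h2 this.symm
  · rw [dir, h7, unitVec_mul h6]

theorem exists_tendsto_graph (hg : SmoothMapNear n g z) (ht : MonomialAt n t z)
    (hp : PrincipalAt n g P t z) :
    ∃ N, Filter.Tendsto (fun y => D.graph (g y)) (𝓝[{y | t y ≠ 0}] z) (𝓝 N) := by
  have h : ∀ k : D.ι, ∃ N, Filter.Tendsto (fun y => D.dir k (g y)) (𝓝[{y | t y ≠ 0}] z) (𝓝 N) := by
    intro k
    by_cases hs : g z ∈ (D.chart k).source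
    · obtain ⟨w, hw, hw0, hwe⟩ := exists_normal_eq_mul (D := D) hg ht hp hs
      refine ⟨D.cutoff k (g z) • unitVec (w z), Filter.Tendsto.congr' (f₁ := fun y =>
        D.cutoff k (g y) • unitVec (w y)) ?_ ?_⟩
      · filter_upwards [nhdsWithin_le_nhds hwe, self_mem_nhdsWithin] with y h1 h2
        exact (h1 h2).2.symm
      · have h1 : ContinuousAt w z := continuousAt_pi.2 fun l => (hw l).continuousAt
        have h2 : ContinuousAt (fun y => D.cutoff k (g y)) z :=
          (D.cutoff_continuous k).continuousAt.comp hg.continuousAt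
        exact (h2.smul (ContinuousAt.comp (g := unitVec) (continuousAt_unitVec hw0)
          h1)).tendsto.mono_left nhdsWithin_le_nhds
    · refine ⟨0, tendsto_const_nhds.congr' ?_⟩
      filter_upwards [nhdsWithin_le_nhds (hg.continuousAt.eventually
        (eventually_dir_eq_zero hs))] with y hy using hy.symm
  choose N hN using h
  exact ⟨(g z, N), (hg.continuousAt.tendsto.mono_left nhdsWithin_le_nhds).prodMk_nhds
    (tendsto_pi_nhds.2 hN)⟩

variable {T : Z → D.Space}

theorem exists_vec_eq (hT : ∀ᶠ y in 𝓝 z, ContinuousAt T y)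
    (hg : SmoothMapNear n (fun y => (T y).proj) z) (ht : MonomialAt n t z)
    (hp : PrincipalAt n (fun y => (T y).proj) P t z) (hs : (T z).proj ∈ (D.chart k).source) :
    ∃ w : Z → Fin n → ℝ, (∀ l, SmoothNear n (fun y => w y l) z) ∧ w z ≠ 0 ∧
      ∀ᶠ y in 𝓝 z, (T y).vec k = D.cutoff k (T y).proj • unitVec (w y) := by
  obtain ⟨w, hw, hw0, hwe⟩ := exists_normal_eq_mul (D := D) hg ht hp hs
  refine ⟨w, hw, hw0, ?_⟩
  have hwc : ContinuousAt w z := continuousAt_pi.2 fun l => (hw l).continuousAt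
  filter_upwards [ht.regularAt, hwe.eventually_nhds, hT, hwc.eventually_ne hw0,
    Filter.eventually_all.2 hw] with y h1 h2 h3 h4 h5
  have hwy : ContinuousAt w y := continuousAt_pi.2 fun l => (h5 l).continuousAt
  have c1 : ContinuousAt (fun y => (T y).vec k) y :=
    ContinuousAt.comp (g := fun x : D.Space => x.vec k) (continuous_vec' k).continuousAt h3
  have c2 : ContinuousAt (fun y => D.cutoff k (T y).proj • unitVec (w y)) y :=
    (((D.cutoff_continuous k).comp continuous_proj).continuousAt.comp h3).smul
      (ContinuousAt.comp (g := unitVec) (continuousAt_unitVec h4) hwy)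
  refine tendsto_nhds_unique_of_frequently_eq c1.tendsto c2.tendsto
    ((h1.and_eventually h2).mono fun y' hy' => ?_)
  rw [vec_eq_dir _ (hy'.2 hy'.1).1, (hy'.2 hy'.1).2]

variable (D) in
/-- A chart of the blow-up space that is smoothly compatible with the blow-down map and the normal
directions. -/
structure IsGoodChart (ψ : OpenPartialHomeomorph D.Space (EuclideanQuadrant n)) : Prop where
  smooth : ∀ u ∈ ψ.target, SmoothMapNear n (fun v => (ψ.symm v).proj) u
  principal : ∀ u ∈ ψ.target, PrincipalMonomialAt n (fun v => (ψ.symm v).proj) P u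
  coord : ∀ x ∈ ψ.source, ∀ j,
    (∃ h : M → ℝ, SmoothNear n h x.proj ∧ ∀ᶠ y in 𝓝 x, (ψ y).1 j = h y.proj) ∨
    ∃ (k : D.ι) (i l : Fin n) (σ a : ℝ), σ ≠ 0 ∧ x.vec k i ≠ 0 ∧
      ∀ᶠ y in 𝓝 x, (ψ y).1 j = y.vec k l / (σ * y.vec k i) + a

/-- The cut-offs and the norms in `vec` need not be smooth, but the coordinates of a good chart
contain only quotients of components of `vec`. In these they cancel, leaving quotients of the smooth
functions `w`. -/
theorem IsGoodChart.smoothNear_coord {ψ : OpenPartialHomeomorph D.Space (EuclideanQuadrant n)}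
    (hψ : D.IsGoodChart ψ) (hT : ∀ᶠ y in 𝓝 z, ContinuousAt T y)
    (hg : SmoothMapNear n (fun y => (T y).proj) z)
    (hp : PrincipalMonomialAt n (fun y => (T y).proj) P z) (hz : T z ∈ ψ.source) (j : Fin n) :
    SmoothNear n (fun y => (ψ (T y)).1 j) z := by
  obtain ⟨t, ht, hp⟩ := hp
  have hTz : ContinuousAt T z := hT.self_of_nhds
  rcases hψ.coord _ hz j with ⟨h, hh, he⟩ | ⟨k, i, l, σ, a, hσ, hi, he⟩
  · exact (SmoothNear.comp (g := fun y => (T y).proj) hh hg).congr (hTz.eventually he)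
  · obtain ⟨hχ, hs⟩ := mem_source_of_vec_ne_zero _ hi
    obtain ⟨w, hw, hw0, hwe⟩ := exists_vec_eq hT hg ht hp hs
    have hwi : w z i ≠ 0 := by
      intro h0
      apply hi
      rw [hwe.self_of_nhds, PiLp.smul_apply, unitVec_apply, h0, mul_zero, smul_zero]
    refine (((hw l).div ((SmoothNear.const σ).mul (hw i)) (mul_ne_zero hσ hwi)).add
      (SmoothNear.const a)).congr ?_
    have hwc : ContinuousAt w z := continuousAt_pi.2 fun l => (hw l).continuousAt
    have hcut : ∀ᶠ y in 𝓝 z, 0 < D.cutoff k (T y).proj :=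
      (((D.cutoff_continuous k).comp continuous_proj).continuousAt.comp hTz).eventually
        (lt_mem_nhds hχ)
    filter_upwards [hTz.eventually he, hwe, hwc.eventually_ne hw0, hcut] with y h1 h2 h3 h4
    rw [h1, h2]
    simp only [PiLp.smul_apply, unitVec_apply, smul_eq_mul]
    have h5 := (inv_pos.2 (norm_toLp_pos h3)).ne'
    rw [← mul_assoc, ← mul_assoc (D.cutoff k _), mul_left_comm σ,
      mul_div_mul_left _ _ (mul_ne_zero h4.ne' h5)]

end BlowupData

theorem PrincipalAt.congr_map {n : ℕ} {M : Type*} [TopologicalSpace M]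
    [ChartedSpace (EuclideanQuadrant n) M] {Z : Type*} [TopologicalSpace Z]
    [ChartedSpace (EuclideanQuadrant n) Z] {P : Set M} {g g' : Z → M} {t : Z → ℝ} {z : Z}
    (h : PrincipalAt n g P t z) (he : g' =ᶠ[𝓝 z] g) : PrincipalAt n g' P t z := by
  have h0 : g' z = g z := he.self_of_nhds
  constructor
  · intro k hk
    obtain ⟨w, hw, hwe⟩ := h.dvd k (h0 ▸ hk)
    exact ⟨w, hw, by filter_upwards [hwe, he] with y h1 h2; rw [h2, h1]⟩
  · obtain ⟨k, hk, w, hw, hw0, hwe⟩ := h.exists_unit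
    exact ⟨k, h0.symm ▸ hk, w, hw, hw0, by filter_upwards [hwe, he] with y h1 h2; rw [h2, h1]⟩

/-! ### Construction of the blow-up: projective charts and their inverses. -/

namespace BlowupData

variable {n : ℕ} {M : CornerManifold.{u} n} {P : Set M} (D : BlowupData M P)

open Classical in
/-- The translation of the projective coordinates. -/
noncomputable def shift (k : D.ι) (A : ℝ) (j : Fin n) : ℝ := if 0 < D.center k j then A else 0

open Classical in
/-- The projective coordinates, as functions on the blow-up. -/
noncomputable def projCoord (k : D.ι) (i : Fin n) (σ A : ℝ) (x : D.Space) (j : Fin n) : ℝ :=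
  if j = i then σ * D.normal k x.proj i
  else if j ∈ D.idx k then x.vec k j / (σ * x.vec k i) + D.shift k A j
  else (D.chart k x.proj).1 j

open Classical in
/-- The blow-down map in projective coordinates. -/
noncomputable def blowdownCoord (k : D.ι) (i : Fin n) (σ A : ℝ) (v : EuclideanQuadrant n)
    (j : Fin n) : ℝ :=
  if j = i then D.center k i + σ * v.1 i
  else if j ∈ D.idx k then D.center k j + v.1 i * (v.1 j - D.shift k A j)
  else v.1 j

open Classical in
/-- The normal direction in projective coordinates. -/
noncomputable def dirCoord (k : D.ι) (i : Fin n) (σ A : ℝ) (v : EuclideanQuadrant n)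
    (j : Fin n) : ℝ :=
  if j = i then σ else if j ∈ D.idx k then v.1 j - D.shift k A j else 0

/-- The blow-down map on the range of projective coordinates. -/
noncomputable def blowdown (k : D.ι) (i : Fin n) (σ A : ℝ) (v : EuclideanQuadrant n) : M :=
  (D.chart k).symm (quadrantOf (D.blowdownCoord k i σ A v))

/-- The domain of projective coordinates. -/
def projSource (k : D.ι) (i : Fin n) (σ A : ℝ) : Set D.Space :=
  {x | 0 < σ * x.vec k i ∧ ∀ j ∈ D.idx k, j ≠ i → 0 < D.center k j →
    0 < x.vec k j + A * (σ * x.vec k i)}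

/-- The range of projective coordinates. -/
def projTarget (k : D.ι) (i : Fin n) (σ A : ℝ) : Set (EuclideanQuadrant n) :=
  {v | quadrantOf (D.blowdownCoord k i σ A v) ∈ (D.chart k).target ∧
    (∀ j ∈ D.idx k, 0 < D.center k j → 0 < D.blowdownCoord k i σ A v j) ∧
    (∀ j ∈ D.idx k, j ≠ i → 0 < D.center k j → 0 < v.1 j) ∧
    0 < D.cutoff k (D.blowdown k i σ A v)}

/-- Admissible indices for projective coordinates. -/
structure Admissible (k : D.ι) (i : Fin n) (σ : ℝ) : Prop where
  mem : i ∈ D.idx k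
  sign : σ = 1 ∨ σ = -1
  eq_one : D.center k i = 0 → σ = 1

variable {D} {k : D.ι} {i : Fin n} {σ A : ℝ}

theorem isInducing_val : Topology.IsInducing fun x : D.Space => x.1 :=
  Topology.IsInducing.subtypeVal

theorem Space.ext_of_notMem {x y : D.Space} (h : x.proj = y.proj) (hy : y.proj ∉ P) : x = y :=
  Space.ext' h fun k => by rw [vec_eq_dir y hy, vec_eq_dir x (by rwa [h]), h]

theorem Admissible.mul_self (h : D.Admissible k i σ) : σ * σ = 1 := by
  rcases h.sign with h | h <;> rw [h] <;> norm_num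

theorem Admissible.ne_zero (h : D.Admissible k i σ) : σ ≠ 0 := by
  rcases h.sign with h | h <;> rw [h] <;> norm_num

theorem shift_of_pos {j : Fin n} (h : 0 < D.center k j) : D.shift k A j = A := if_pos h

theorem shift_of_eq_zero {j : Fin n} (h : D.center k j = 0) : D.shift k A j = 0 := by
  simp [shift, h]

theorem center_pos_or (k : D.ι) (j : Fin n) : 0 < D.center k j ∨ D.center k j = 0 :=
  (D.center_nonneg k j).lt_or_eq.imp_right Eq.symm

theorem continuous_quadrant_apply (j : Fin n) : Continuous fun v : EuclideanQuadrant n => v.1 j :=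
  (EuclideanSpace.proj j).continuous.comp continuous_subtype_val

theorem continuous_blowdownCoord : Continuous (D.blowdownCoord k i σ A) := by
  refine continuous_pi fun j => ?_
  have hc := fun j => continuous_quadrant_apply (n := n) j
  unfold blowdownCoord
  split_ifs
  · exact continuous_const.add (continuous_const.mul (hc i))
  · exact continuous_const.add ((hc i).mul ((hc j).sub continuous_const))
  · exact hc j

theorem continuous_dirCoord : Continuous (D.dirCoord k i σ A) := by
  refine continuous_pi fun j => ?_
  unfold dirCoord
  split_ifs
  · exact continuous_const
  · exact (continuous_quadrant_apply j).sub continuous_const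
  · exact continuous_const

theorem smoothNear_quadrant_apply (j : Fin n) (v : EuclideanQuadrant n) :
    SmoothNear n (fun v : EuclideanQuadrant n => v.1 j) v :=
  Filter.Eventually.of_forall (contMDiff_quadrant_apply j)

theorem smoothNear_blowdownCoord (j : Fin n) (v : EuclideanQuadrant n) :
    SmoothNear n (fun v => D.blowdownCoord k i σ A v j) v := by
  have hc := fun j => smoothNear_quadrant_apply (n := n) j v
  unfold blowdownCoord
  split_ifs
  · exact (SmoothNear.const _).add ((SmoothNear.const _).mul (hc i))
  · exact (SmoothNear.const _).add ((hc i).mul ((hc j).sub (SmoothNear.const _)))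
  · exact hc j

theorem smoothNear_dirCoord (j : Fin n) (v : EuclideanQuadrant n) :
    SmoothNear n (fun v => D.dirCoord k i σ A v j) v := by
  unfold dirCoord
  split_ifs
  · exact SmoothNear.const _
  · exact (smoothNear_quadrant_apply j v).sub (SmoothNear.const _)
  · exact SmoothNear.const _

theorem dirCoord_ne_zero (hi : D.Admissible k i σ) (v : EuclideanQuadrant n) :
    D.dirCoord k i σ A v ≠ 0 := fun h => hi.ne_zero (by
  have := congrFun h i
  rwa [dirCoord, if_pos rfl] at this)

theorem isOpen_projSource : IsOpen (D.projSource k i σ A) := by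
  have h : D.projSource k i σ A = {x | 0 < σ * x.vec k i} ∩ ⋂ j, {x : D.Space | j ∈ D.idx k →
      j ≠ i → 0 < D.center k j → 0 < x.vec k j + A * (σ * x.vec k i)} := by
    ext x; simp [projSource]
  rw [h]
  refine (isOpen_lt continuous_const (continuous_const.mul (continuous_vec k i))).inter
    (isOpen_iInter_of_finite fun j => ?_)
  by_cases hj : j ∈ D.idx k ∧ j ≠ i ∧ 0 < D.center k j
  · simp only [hj.1, hj.2.1, hj.2.2, true_imp_iff, ne_eq, not_false_eq_true]
    exact isOpen_lt continuous_const ((continuous_vec k j).add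
      (continuous_const.mul (continuous_const.mul (continuous_vec k i))))
  · convert isOpen_univ
    exact eq_univ_of_forall fun x h1 h2 h3 => absurd ⟨h1, h2, h3⟩ hj

theorem isOpen_projTarget : IsOpen (D.projTarget k i σ A) := by
  have hq : Continuous fun v => quadrantOf (D.blowdownCoord k i σ A v) :=
    continuous_quadrantOf.comp continuous_blowdownCoord
  have hU : IsOpen {v | quadrantOf (D.blowdownCoord k i σ A v) ∈ (D.chart k).target} :=
    (D.chart k).open_target.preimage hq
  have hb : ContinuousOn (D.blowdown k i σ A)
      {v | quadrantOf (D.blowdownCoord k i σ A v) ∈ (D.chart k).target} :=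
    (D.chart k).continuousOn_symm.comp hq.continuousOn fun v hv => hv
  have h : D.projTarget k i σ A =
      ({v | quadrantOf (D.blowdownCoord k i σ A v) ∈ (D.chart k).target} ∩
        D.blowdown k i σ A ⁻¹' {q | 0 < D.cutoff k q}) ∩
      ((⋂ j, {v | j ∈ D.idx k → 0 < D.center k j → 0 < D.blowdownCoord k i σ A v j}) ∩
      ⋂ j, {v | j ∈ D.idx k → j ≠ i → 0 < D.center k j → 0 < v.1 j}) := by
    ext v; simp only [projTarget, mem_ofPred_eq, mem_inter_iff, mem_iInter, mem_preimage]; tauto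
  rw [h]
  refine (hb.isOpen_inter_preimage hU (isOpen_lt continuous_const
    (D.cutoff_continuous k))).inter ((isOpen_iInter_of_finite fun j => ?_).inter
    (isOpen_iInter_of_finite fun j => ?_))
  · by_cases hj : j ∈ D.idx k ∧ 0 < D.center k j
    · simp only [hj.1, hj.2, true_imp_iff]
      exact isOpen_lt continuous_const ((continuous_apply j).comp continuous_blowdownCoord)
    · convert isOpen_univ
      exact eq_univ_of_forall fun x h1 h2 => absurd ⟨h1, h2⟩ hj
  · by_cases hj : j ∈ D.idx k ∧ j ≠ i ∧ 0 < D.center k j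
    · simp only [hj.1, hj.2.1, hj.2.2, true_imp_iff, ne_eq, not_false_eq_true]
      exact isOpen_lt continuous_const (continuous_quadrant_apply j)
    · convert isOpen_univ
      exact eq_univ_of_forall fun x h1 h2 h3 => absurd ⟨h1, h2, h3⟩ hj

section Target

variable {v : EuclideanQuadrant n}

/-- The truncation at zero in `quadrantOf` is inactive on `projTarget`. For a boundary coordinate
this uses that an admissible sign is then `1` and the shift is zero. -/
theorem quadrantOf_blowdownCoord (hi : D.Admissible k i σ) (hv : v ∈ D.projTarget k i σ A)
    (j : Fin n) :
    (quadrantOf (D.blowdownCoord k i σ A v)).1 j = D.blowdownCoord k i σ A v j := by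
  refine quadrantOf_apply_of_nonneg ?_
  by_cases hj : j ∈ D.idx k
  · rcases center_pos_or k j with hc | hc
    · exact (hv.2.1 j hj hc).le
    · unfold blowdownCoord
      split_ifs with hji
      · subst hji
        rw [hc, hi.eq_one hc, zero_add, one_mul]
        exact v.2 j
      · rw [hc, shift_of_eq_zero hc, zero_add, sub_zero]
        exact mul_nonneg (v.2 i) (v.2 j)
  · have hji : j ≠ i := fun e => hj (e ▸ hi.mem)
    rw [blowdownCoord, if_neg hji, if_neg hj]
    exact v.2 j

theorem blowdown_mem_source (hv : v ∈ D.projTarget k i σ A) :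
    D.blowdown k i σ A v ∈ (D.chart k).source := (D.chart k).map_target hv.1

theorem chart_blowdown (hi : D.Admissible k i σ) (hv : v ∈ D.projTarget k i σ A) (j : Fin n) :
    (D.chart k (D.blowdown k i σ A v)).1 j = D.blowdownCoord k i σ A v j := by
  rw [blowdown, (D.chart k).right_inv hv.1, quadrantOf_blowdownCoord hi hv]

theorem normal_blowdown (hi : D.Admissible k i σ) (hv : v ∈ D.projTarget k i σ A) (j : Fin n) :
    D.normal k (D.blowdown k i σ A v) j = v.1 i * D.dirCoord k i σ A v j := by
  unfold normal dirCoord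
  rw [chart_blowdown hi hv]
  unfold blowdownCoord
  by_cases hji : j = i
  · subst hji
    simp only [hi.mem, if_true]
    ring
  · by_cases hj : j ∈ D.idx k
    · simp only [hj, hji, if_true, if_false]
      ring
    · simp only [hj, hji, if_false, mul_zero]

theorem smoothMapNear_blowdown (hi : D.Admissible k i σ) (hv : v ∈ D.projTarget k i σ A) :
    SmoothMapNear n (D.blowdown k i σ A) v := by
  refine SmoothMapNear.symm_comp (D.mem_maximalAtlas k) (fun j => ?_) hv.1
  refine (smoothNear_blowdownCoord (D := D) (k := k) (i := i) (σ := σ) (A := A) j v).congr ?_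
  filter_upwards [isOpen_projTarget.mem_nhds hv] with v' hv'
  exact quadrantOf_blowdownCoord hi hv' j

theorem monomialAt_quadrant_apply (j : Fin n) (v : EuclideanQuadrant n) :
    MonomialAt n (fun v : EuclideanQuadrant n => v.1 j) v :=
  MonomialAt.coord (ψ := OpenPartialHomeomorph.refl (EuclideanQuadrant n))
    (StructureGroupoid.id_mem_maximalAtlas _) (mem_univ v) j

theorem principalAt_blowdown (hi : D.Admissible k i σ) (hv : v ∈ D.projTarget k i σ A) :
    PrincipalAt n (D.blowdown k i σ A) P (fun v => v.1 i) v := by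
  refine PrincipalAt.of_gens (smoothMapNear_blowdown hi hv)
    (gensAt_normal (blowdown_mem_source hv)) (w := fun j v => D.dirCoord k i σ A v j)
    (fun j => smoothNear_dirCoord j v) (Function.ne_iff.1 (dirCoord_ne_zero hi v)) fun j => ?_
  filter_upwards [isOpen_projTarget.mem_nhds hv] with v' hv'
  exact normal_blowdown hi hv' j

theorem blowdown_mem_iff (hi : D.Admissible k i σ) (hv : v ∈ D.projTarget k i σ A) :
    D.blowdown k i σ A v ∈ P ↔ v.1 i = 0 := by
  rw [← normal_eq_zero_iff (blowdown_mem_source hv)]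
  constructor
  · intro h
    have := normal_blowdown hi hv i
    rw [h, dirCoord, if_pos rfl] at this
    exact (mul_eq_zero.1 this.symm).resolve_right hi.ne_zero
  · intro h
    funext j
    rw [normal_blowdown hi hv, h, zero_mul]; rfl

theorem mem_closure_ne_zero (v : EuclideanQuadrant n) (i : Fin n) :
    v ∈ closure {v : EuclideanQuadrant n | v.1 i ≠ 0} :=
  mem_closure_iff_frequently.2 (monomialAt_quadrant_apply i v).regularAt.self_of_nhds

variable (D k i σ A) in
/-- The inverse of the projective coordinates, as a map to the ambient product. -/
noncomputable def paramGraph : EuclideanQuadrant n → M × (D.ι → EuclideanSpace ℝ (Fin n)) :=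
  extendFrom {v | v.1 i ≠ 0} fun v => D.graph (D.blowdown k i σ A v)

/-- Off `v i = 0` the inverse chart is the graph over the blow-down; it extends because `v i`
generates the pull-back of the ideal of `P`, so normal directions have limits. -/
theorem tendsto_paramGraph (hi : D.Admissible k i σ) (hv : v ∈ D.projTarget k i σ A) :
    Filter.Tendsto (fun v => D.graph (D.blowdown k i σ A v)) (𝓝[{v | v.1 i ≠ 0}] v)
      (𝓝 (D.paramGraph k i σ A v)) := by
  obtain ⟨N, hN⟩ := exists_tendsto_graph (D := D) (smoothMapNear_blowdown hi hv)
    (monomialAt_quadrant_apply i v) (principalAt_blowdown hi hv)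
  rwa [paramGraph, extendFrom_eq (mem_closure_ne_zero v i) hN]

theorem continuousOn_paramGraph (hi : D.Admissible k i σ) :
    ContinuousOn (D.paramGraph k i σ A) (D.projTarget k i σ A) := by
  have : LocallyCompactSpace M := locallyCompactSpace M
  exact continuousOn_extendFrom (fun v _ => mem_closure_ne_zero v i)
    fun v hv => ⟨_, tendsto_paramGraph hi hv⟩

theorem paramGraph_mem (hi : D.Admissible k i σ) (hv : v ∈ D.projTarget k i σ A) :
    D.paramGraph k i σ A v ∈ closure (D.graph '' Pᶜ) := by
  have : (𝓝[{v : EuclideanQuadrant n | v.1 i ≠ 0}] v).NeBot :=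
    mem_closure_iff_nhdsWithin_neBot.1 (mem_closure_ne_zero v i)
  refine mem_closure_of_tendsto (tendsto_paramGraph hi hv) ?_
  filter_upwards [self_mem_nhdsWithin, nhdsWithin_le_nhds (isOpen_projTarget.mem_nhds hv)]
    with v' h1 h2
  exact ⟨_, fun h => h1 ((blowdown_mem_iff hi h2).1 h), rfl⟩

open Classical in
variable (D k i σ A) in
/-- The inverse of the projective coordinates. -/
noncomputable def param (x₀ : D.Space) (v : EuclideanQuadrant n) : D.Space :=
  if h : D.paramGraph k i σ A v ∈ closure (D.graph '' Pᶜ) then ⟨_, h⟩ else x₀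

variable {x₀ : D.Space}

theorem param_val (hi : D.Admissible k i σ) (hv : v ∈ D.projTarget k i σ A) :
    (D.param k i σ A x₀ v).1 = D.paramGraph k i σ A v := by
  unfold param
  exact congrArg Subtype.val (dif_pos (paramGraph_mem hi hv))

theorem continuousOn_param (hi : D.Admissible k i σ) :
    ContinuousOn (D.param k i σ A x₀) (D.projTarget k i σ A) := by
  rw [isInducing_val.continuousOn_iff]
  exact (continuousOn_paramGraph hi).congr fun v hv => param_val hi hv

theorem proj_param (hi : D.Admissible k i σ) (hv : v ∈ D.projTarget k i σ A) :
    (D.param k i σ A x₀ v).proj = D.blowdown k i σ A v := by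
  have : (𝓝[{v : EuclideanQuadrant n | v.1 i ≠ 0}] v).NeBot :=
    mem_closure_iff_nhdsWithin_neBot.1 (mem_closure_ne_zero v i)
  rw [Space.proj, param_val hi hv]
  exact tendsto_nhds_unique (continuous_fst.continuousAt.tendsto.comp (tendsto_paramGraph hi hv))
    ((smoothMapNear_blowdown hi hv).continuousAt.tendsto.mono_left nhdsWithin_le_nhds)

theorem vec_param (hi : D.Admissible k i σ) (hv : v ∈ D.projTarget k i σ A) :
    (D.param k i σ A x₀ v).vec k =
      D.cutoff k (D.blowdown k i σ A v) • unitVec (D.dirCoord k i σ A v) := by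
  have : (𝓝[{v : EuclideanQuadrant n | v.1 i ≠ 0}] v).NeBot :=
    mem_closure_iff_nhdsWithin_neBot.1 (mem_closure_ne_zero v i)
  rw [Space.vec, param_val hi hv]
  have h1 := ((continuous_apply k).comp continuous_snd).continuousAt.tendsto.comp
    (tendsto_paramGraph hi hv)
  have h2 : ContinuousAt (fun v => D.cutoff k (D.blowdown k i σ A v) •
      unitVec (D.dirCoord k i σ A v)) v :=
    (ContinuousAt.comp (g := D.cutoff k) (D.cutoff_continuous k).continuousAt
      (smoothMapNear_blowdown hi hv).continuousAt).smul
      (ContinuousAt.comp (g := unitVec) (continuousAt_unitVec (dirCoord_ne_zero hi v))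
        continuous_dirCoord.continuousAt)
  refine tendsto_nhds_unique h1 ((h2.tendsto.mono_left nhdsWithin_le_nhds).congr' ?_)
  filter_upwards [self_mem_nhdsWithin, nhdsWithin_le_nhds (isOpen_projTarget.mem_nhds hv)]
    with v' h3 h4
  have h5 : 0 < v'.1 i := lt_of_le_of_ne (v'.2 i) (Ne.symm h3)
  have h6 : D.normal k (D.blowdown k i σ A v') = fun j => v'.1 i * D.dirCoord k i σ A v' j :=
    funext (normal_blowdown hi h4)
  simp only [Function.comp, graph, dir]
  rw [h6, unitVec_mul h5]

theorem vec_param_apply (hi : D.Admissible k i σ) (hv : v ∈ D.projTarget k i σ A) :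
    ∃ r > 0, ∀ j, (D.param k i σ A x₀ v).vec k j = r * D.dirCoord k i σ A v j := by
  refine ⟨D.cutoff k (D.blowdown k i σ A v) * _, mul_pos hv.2.2.2
    (inv_pos.2 (norm_toLp_pos (dirCoord_ne_zero (A := A) hi v))), fun j => ?_⟩
  rw [vec_param hi hv, PiLp.smul_apply, unitVec_apply, smul_eq_mul, mul_assoc]

theorem dirCoord_self : D.dirCoord k i σ A v i = σ := if_pos rfl

theorem dirCoord_of_mem {j : Fin n} (hj : j ∈ D.idx k) (hji : j ≠ i) :
    D.dirCoord k i σ A v j = v.1 j - D.shift k A j := by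
  rw [dirCoord, if_neg hji, if_pos hj]

theorem param_mem (hi : D.Admissible k i σ) (hv : v ∈ D.projTarget k i σ A) :
    D.param k i σ A x₀ v ∈ D.projSource k i σ A := by
  obtain ⟨r, hr, he⟩ := vec_param_apply (x₀ := x₀) hi hv
  have h1 : σ * (r * σ) = r := by rw [mul_left_comm, hi.mul_self, mul_one]
  refine ⟨?_, fun j hj hji hc => ?_⟩
  · rw [he, dirCoord_self, h1]; exact hr
  · rw [he, he, dirCoord_self, h1, dirCoord_of_mem hj hji, shift_of_pos hc]
    have := mul_pos hr (hv.2.2.1 j hj hji hc)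
    linarith

theorem projCoord_param (hi : D.Admissible k i σ) (hv : v ∈ D.projTarget k i σ A) (j : Fin n) :
    D.projCoord k i σ A (D.param k i σ A x₀ v) j = v.1 j := by
  obtain ⟨r, hr, he⟩ := vec_param_apply (x₀ := x₀) hi hv
  have h1 : σ * (r * σ) = r := by rw [mul_left_comm, hi.mul_self, mul_one]
  unfold projCoord
  rw [proj_param hi hv]
  split_ifs with hji hj
  · subst hji
    rw [normal_blowdown hi hv, dirCoord_self, mul_left_comm, hi.mul_self, mul_one]
  · rw [he, he, dirCoord_self, h1, dirCoord_of_mem hj hji, mul_div_cancel_left₀ _ hr.ne',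
      sub_add_cancel]
  · rw [chart_blowdown hi hv, blowdownCoord, if_neg hji, if_neg hj]

end Target

section Source

variable {x : D.Space}

theorem proj_mem_source (hx : x ∈ D.projSource k i σ A) : x.proj ∈ (D.chart k).source :=
  (mem_source_of_vec_ne_zero x (right_ne_zero_of_mul hx.1.ne')).2

theorem projCoord_nonneg (hi : D.Admissible k i σ) (hx : x ∈ D.projSource k i σ A) (j : Fin n) :
    0 ≤ D.projCoord k i σ A x j := by
  unfold projCoord
  split_ifs with hji hj
  · have h1 := normal_mul_vec_self_nonneg x (proj_mem_source hx) i
    have h2 : (σ * D.normal k x.proj i) * (σ * x.vec k i) = D.normal k x.proj i * x.vec k i := by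
      rw [mul_mul_mul_comm, hi.mul_self, one_mul]
    rw [← h2] at h1
    exact nonneg_of_mul_nonneg_left h1 hx.1
  · rcases center_pos_or k j with hc | hc
    · have := hx.2 j hj hji hc
      rw [shift_of_pos hc, div_add' _ _ _ hx.1.ne']
      exact (div_pos this hx.1).le
    · rw [shift_of_eq_zero hc, add_zero]
      exact div_nonneg (vec_nonneg x hc) hx.1.le
  · exact (D.chart k x.proj).2 j

theorem projCoord_pos (hx : x ∈ D.projSource k i σ A) {j : Fin n}
    (hj : j ∈ D.idx k) (hji : j ≠ i) (hc : 0 < D.center k j) : 0 < D.projCoord k i σ A x j := by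
  have := hx.2 j hj hji hc
  rw [projCoord, if_neg hji, if_pos hj, shift_of_pos hc, div_add' _ _ _ hx.1.ne']
  exact div_pos this hx.1

theorem quadrantOf_projCoord (hi : D.Admissible k i σ) (hx : x ∈ D.projSource k i σ A)
    (j : Fin n) : (quadrantOf (D.projCoord k i σ A x)).1 j = D.projCoord k i σ A x j :=
  quadrantOf_apply_of_nonneg (projCoord_nonneg hi hx j)

theorem blowdownCoord_projCoord (hi : D.Admissible k i σ) (hx : x ∈ D.projSource k i σ A)
    (j : Fin n) : D.blowdownCoord k i σ A (quadrantOf (D.projCoord k i σ A x)) j =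
      (D.chart k x.proj).1 j := by
  unfold blowdownCoord
  rw [quadrantOf_projCoord hi hx, quadrantOf_projCoord hi hx]
  unfold projCoord
  by_cases hji : j = i
  · subst hji
    simp only [if_true]
    rw [← mul_assoc, hi.mul_self, one_mul, normal, if_pos hi.mem]
    ring
  · by_cases hj : j ∈ D.idx k
    · simp only [hji, hj, if_true, if_false]
      have h1 := normal_mul_vec x (proj_mem_source hx) i j
      have h2 : x.vec k i ≠ 0 := right_ne_zero_of_mul hx.1.ne'
      have h3 := hi.ne_zero
      have h4 : D.normal k x.proj j = (D.chart k x.proj).1 j - D.center k j := if_pos hj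
      rw [add_sub_cancel_right]
      have h5 : σ * D.normal k x.proj i * (x.vec k j / (σ * x.vec k i)) =
          D.normal k x.proj j := by
        field_simp
        linarith
      rw [h5, h4]; ring
    · simp only [hji, hj, if_false]

theorem quadrantOf_blowdownCoord_projCoord (hi : D.Admissible k i σ)
    (hx : x ∈ D.projSource k i σ A) :
    quadrantOf (D.blowdownCoord k i σ A (quadrantOf (D.projCoord k i σ A x))) =
      D.chart k x.proj := by
  refine quadrant_ext fun j => ?_
  rw [quadrantOf_apply, blowdownCoord_projCoord hi hx]
  exact max_eq_left ((D.chart k x.proj).2 j)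

theorem blowdown_projCoord (hi : D.Admissible k i σ) (hx : x ∈ D.projSource k i σ A) :
    D.blowdown k i σ A (quadrantOf (D.projCoord k i σ A x)) = x.proj := by
  rw [blowdown, quadrantOf_blowdownCoord_projCoord hi hx,
    (D.chart k).left_inv (proj_mem_source hx)]

theorem projCoord_mem (hi : D.Admissible k i σ) (hx : x ∈ D.projSource k i σ A) :
    quadrantOf (D.projCoord k i σ A x) ∈ D.projTarget k i σ A := by
  refine ⟨?_, fun j hj hc => ?_, fun j hj hji hc => ?_, ?_⟩
  · rw [quadrantOf_blowdownCoord_projCoord hi hx]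
    exact (D.chart k).map_source (proj_mem_source hx)
  · rw [blowdownCoord_projCoord hi hx]
    exact D.coord_pos k j hj hc _ (proj_mem_source hx)
  · rw [quadrantOf_projCoord hi hx]
    exact projCoord_pos hx hj hji hc
  · rw [blowdown_projCoord hi hx]
    exact (mem_source_of_vec_ne_zero x (right_ne_zero_of_mul hx.1.ne')).1

theorem continuousOn_projCoord :
    ContinuousOn (fun x => quadrantOf (D.projCoord k i σ A x)) (D.projSource k i σ A) := by
  refine continuous_quadrantOf.comp_continuousOn (continuousOn_pi.2 fun j x hx => ?_)
  refine ContinuousAt.continuousWithinAt ?_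
  unfold projCoord
  split_ifs
  · exact continuousAt_const.mul (continuousAt_normal_proj x (proj_mem_source hx) i)
  · exact ((continuous_vec k j).continuousAt.div (continuousAt_const.mul
      (continuous_vec k i).continuousAt) hx.1.ne').add continuousAt_const
  · exact ContinuousAt.comp (g := fun q => (D.chart k q).1 j) (f := Space.proj)
      (SmoothNear.coord (D.mem_maximalAtlas k) (proj_mem_source hx) j).continuousAt
      continuous_proj.continuousAt

/-- Both sides are continuous in `x`, and off the front face a point is determined by its
projection. -/
theorem param_projCoord (hi : D.Admissible k i σ) {x₀ : D.Space}
    (hx : x ∈ D.projSource k i σ A) :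
    D.param k i σ A x₀ (quadrantOf (D.projCoord k i σ A x)) = x := by
  have h1 : ContinuousAt (fun x => D.param k i σ A x₀ (quadrantOf (D.projCoord k i σ A x))) x :=
    ContinuousAt.comp (g := D.param k i σ A x₀)
      ((continuousOn_param hi).continuousAt (isOpen_projTarget.mem_nhds (projCoord_mem hi hx)))
      ((continuousOn_projCoord).continuousAt (isOpen_projSource.mem_nhds hx))
  refine tendsto_nhds_unique_of_frequently_eq h1.tendsto (continuousAt_id (x := x)).tendsto
    (((frequently_proj_notMem x).and_eventually (isOpen_projSource.mem_nhds hx)).mono ?_)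
  rintro y ⟨hy, hys⟩
  have h2 : (D.param k i σ A x₀ (quadrantOf (D.projCoord k i σ A y))).proj = y.proj := by
    rw [proj_param hi (projCoord_mem hi hys), blowdown_projCoord hi hys]
  exact Space.ext_of_notMem h2 hy

end Source

variable (A) in
/-- The chart of the blow-up given by projective coordinates. -/
noncomputable def projChart (hi : D.Admissible k i σ) (x₀ : D.Space) :
    OpenPartialHomeomorph D.Space (EuclideanQuadrant n) where
  toFun x := quadrantOf (D.projCoord k i σ A x)
  invFun := D.param k i σ A x₀
  source := D.projSource k i σ A
  target := D.projTarget k i σ A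
  map_source' _ hx := projCoord_mem hi hx
  map_target' _ hv := param_mem hi hv
  left_inv' _ hx := param_projCoord hi hx
  right_inv' v hv := quadrant_ext fun j => by
    rw [quadrantOf_projCoord hi (param_mem hi hv), projCoord_param hi hv]
  open_source := isOpen_projSource
  open_target := isOpen_projTarget
  continuousOn_toFun := continuousOn_projCoord
  continuousOn_invFun := continuousOn_param hi

theorem isGoodChart_projChart (hi : D.Admissible k i σ) (x₀ : D.Space) :
    D.IsGoodChart (projChart A hi x₀) where
  smooth v hv := by
    refine (smoothMapNear_blowdown hi hv).congr ?_
    filter_upwards [isOpen_projTarget.mem_nhds hv] with v' hv' using proj_param hi hv'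
  principal v hv := by
    have he : (fun v => ((projChart A hi x₀).symm v).proj) =ᶠ[𝓝 v] D.blowdown k i σ A := by
      filter_upwards [isOpen_projTarget.mem_nhds hv] with v' hv' using proj_param hi hv'
    refine ⟨fun v => v.1 i, monomialAt_quadrant_apply i v, ?_⟩
    exact (principalAt_blowdown hi hv).congr_map he
  coord x hx j := by
    by_cases hji : j = i
    · refine Or.inl ⟨fun q => σ * D.normal k q i, (SmoothNear.const σ).mul
        (smoothNear_normal (proj_mem_source hx) i), ?_⟩
      filter_upwards [isOpen_projSource.mem_nhds hx] with y hy
      refine (quadrantOf_projCoord hi hy j).trans ?_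
      rw [projCoord, if_pos hji]
    · by_cases hj : j ∈ D.idx k
      · refine Or.inr ⟨k, i, j, σ, D.shift k A j, hi.ne_zero, right_ne_zero_of_mul hx.1.ne', ?_⟩
        filter_upwards [isOpen_projSource.mem_nhds hx] with y hy
        refine (quadrantOf_projCoord hi hy j).trans ?_
        rw [projCoord, if_neg hji, if_pos hj]
      · refine Or.inl ⟨fun q => (D.chart k q).1 j,
          SmoothNear.coord (D.mem_maximalAtlas k) (proj_mem_source hx) j, ?_⟩
        filter_upwards [isOpen_projSource.mem_nhds hx] with y hy
        refine (quadrantOf_projCoord hi hy j).trans ?_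
        rw [projCoord, if_neg hji, if_neg hj]

end BlowupData

/-! ### Construction of the blow-up: smooth structure and blow-down map. -/

namespace BlowupData

variable {n : ℕ} {M : CornerManifold.{u} n} {P : Set M} {D : BlowupData M P}

open Classical in
/-- The inverse of the blow-down map off `P`, with a junk value on `P`. -/
noncomputable def offSection (x₀ : D.Space) (q : M) : D.Space :=
  if h : q ∉ P then lift q h else x₀

theorem offSection_eq (x₀ : D.Space) {q : M} (h : q ∉ P) : offSection x₀ q = lift q h := by
  unfold offSection
  exact dif_pos h

theorem continuousOn_offSection (x₀ : D.Space) : ContinuousOn (offSection x₀) Pᶜ := by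
  rw [isInducing_val.continuousOn_iff]
  have h : ContinuousOn D.graph Pᶜ := fun q hq => (continuousAt_graph hq).continuousWithinAt
  refine h.congr fun q hq => ?_
  simp only [Function.comp, offSection_eq x₀ hq]
  rfl

/-- The charts of the blow-up off the front face. -/
noncomputable def offChart (φ : OpenPartialHomeomorph M (EuclideanQuadrant n)) (x₀ : D.Space) :
    OpenPartialHomeomorph D.Space (EuclideanQuadrant n) where
  toFun x := φ x.proj
  invFun v := offSection x₀ (φ.symm v)
  source := Space.proj ⁻¹' (φ.source ∩ Pᶜ)
  target := φ.target ∩ φ.symm ⁻¹' Pᶜ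
  map_source' x hx := ⟨φ.map_source hx.1, by rw [mem_preimage, φ.left_inv hx.1]; exact hx.2⟩
  map_target' v hv := by
    rw [mem_preimage, offSection_eq x₀ hv.2, proj_lift]
    exact ⟨φ.map_target hv.1, hv.2⟩
  left_inv' x hx := by
    have h : φ.symm (φ x.proj) = x.proj := φ.left_inv hx.1
    rw [h, offSection_eq x₀ hx.2]
    exact (eq_lift x hx.2).symm
  right_inv' v hv := by
    rw [offSection_eq x₀ hv.2, proj_lift, φ.right_inv hv.1]
  open_source := (φ.open_source.inter D.isClosed.isOpen_compl).preimage continuous_proj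
  open_target := φ.continuousOn_symm.isOpen_inter_preimage φ.open_target D.isClosed.isOpen_compl
  continuousOn_toFun := φ.continuousOn.comp continuous_proj.continuousOn fun x hx => hx.1
  continuousOn_invFun := (continuousOn_offSection x₀).comp
    (φ.continuousOn_symm.mono inter_subset_left) fun v hv => hv.2

theorem isGoodChart_offChart {φ : OpenPartialHomeomorph M (EuclideanQuadrant n)}
    (hφ : φ ∈ IsManifold.maximalAtlas (QM n) ∞ M) (x₀ : D.Space) :
    D.IsGoodChart (offChart φ x₀) := by
  have hsm : ∀ v ∈ (offChart φ x₀).target,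
      SmoothMapNear n (fun v => ((offChart φ x₀).symm v).proj) v := by
    intro v hv
    refine (SmoothMapNear.chart_symm hφ hv.1).congr ?_
    filter_upwards [(offChart φ x₀).open_target.mem_nhds hv] with v' hv'
    exact congrArg Space.proj (offSection_eq x₀ hv'.2)
  refine ⟨hsm, fun v hv => ?_, fun x hx j => Or.inl ⟨fun q => (φ q).1 j,
    SmoothNear.coord hφ hx.1 j, Filter.Eventually.of_forall fun y => rfl⟩⟩
  refine PrincipalMonomialAt.of_not_mem (D.isClosed.isOpen_compl.mem_nhds ?_) (hsm v hv)
  exact (((offChart φ x₀).map_target hv).2)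

theorem exists_admissible (x : D.Space) {k : D.ι} (hk : 0 < D.cutoff k x.proj) :
    ∃ i σ A, D.Admissible k i σ ∧ x ∈ D.projSource k i σ A := by
  have h0 : x.vec k ≠ 0 := norm_pos_iff.1 (by rwa [norm_vec])
  obtain ⟨i, hi⟩ : ∃ i, x.vec k i ≠ 0 := by
    by_contra! h
    exact h0 (PiLp.ext h)
  have hmem : i ∈ D.idx k := by
    by_contra h
    exact hi (vec_of_notMem x h)
  obtain ⟨σ, hσ, hσi⟩ : ∃ σ : ℝ, (σ = 1 ∨ σ = -1) ∧ 0 < σ * x.vec k i := by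
    rcases lt_or_gt_of_ne hi with h | h
    · exact ⟨-1, Or.inr rfl, by linarith⟩
    · exact ⟨1, Or.inl rfl, by linarith⟩
  -- This translation makes every `ℝ`-valued quotient positive at `x`: after multiplication by the
  -- denominator, `x.vec k j` plus `1` plus the sum of all absolute values is positive.
  refine ⟨i, σ, (1 + ∑ j, |x.vec k j|) / (σ * x.vec k i), ⟨hmem, hσ, fun hc => ?_⟩, hσi,
    fun j _ _ _ => ?_⟩
  · rcases hσ with h | h
    · exact h
    · have := vec_nonneg x hc
      rw [h] at hσi
      linarith
  · rw [div_mul_cancel₀ _ hσi.ne']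
    have h1 := Finset.single_le_sum (f := fun j => |x.vec k j|) (fun j _ => abs_nonneg _)
      (Finset.mem_univ j)
    have h2 := neg_abs_le (x.vec k j)
    simp only at h1
    linarith

theorem exists_isGoodChart (x : D.Space) : ∃ ψ, D.IsGoodChart ψ ∧ x ∈ ψ.source := by
  by_cases hx : x.proj ∈ P
  · obtain ⟨k, hk⟩ := D.cover _ hx
    obtain ⟨i, σ, A, hi, hxs⟩ := exists_admissible x hk
    exact ⟨_, isGoodChart_projChart (A := A) hi x, hxs⟩
  · exact ⟨_, isGoodChart_offChart (IsManifold.chart_mem_maximalAtlas x.proj) x,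
      mem_chart_source _ x.proj, hx⟩

noncomputable instance instChartedSpaceSpace : ChartedSpace (EuclideanQuadrant n) D.Space where
  atlas := {ψ | D.IsGoodChart ψ}
  chartAt x := (exists_isGoodChart x).choose
  mem_chart_source x := (exists_isGoodChart x).choose_spec.2
  chart_mem_atlas x := (exists_isGoodChart x).choose_spec.1

/-- The inverse of a good chart is continuous with smooth principal projection, which is the input
that `IsGoodChart.smoothNear_coord` requires. -/
theorem IsGoodChart.contMDiffOn_transition
    {ψ ψ' : OpenPartialHomeomorph D.Space (EuclideanQuadrant n)} (h : D.IsGoodChart ψ)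
    (h' : D.IsGoodChart ψ') :
    ContMDiffOn (QM n) (QM n) ∞ (ψ.symm.trans ψ') (ψ.symm.trans ψ').source := by
  intro v hv
  rw [OpenPartialHomeomorph.trans_source] at hv
  have hT : ∀ᶠ v' in 𝓝 v, ContinuousAt ψ.symm v' := by
    filter_upwards [ψ.open_target.mem_nhds hv.1] with v' hv' using ψ.continuousAt_symm hv'
  exact ContMDiffAt.contMDiffWithinAt (SmoothMapNear.of_coords fun j =>
    h'.smoothNear_coord hT (h.smooth v hv.1) (h.principal v hv.1) hv.2 j).self_of_nhds

instance instIsManifoldSpace : IsManifold (QM n) ∞ D.Space where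
  compatible := by
    intro ψ ψ' h h'
    have h1 : ψ.symm.trans ψ' ∈ IsManifold.maximalAtlas (QM n) ∞ (EuclideanQuadrant n) := by
      refine OpenPartialHomeomorph.mem_maximalAtlas_of_contMDiffOn _
        (IsGoodChart.contMDiffOn_transition h h') ?_
      exact IsGoodChart.contMDiffOn_transition h' h
    have h2 := (contDiffGroupoid ∞ (QM n)).compatible_of_mem_maximalAtlas
      ((contDiffGroupoid ∞ (QM n)).id_mem_maximalAtlas) h1
    simpa using h2

theorem IsGoodChart.mem_maximalAtlas {ψ : OpenPartialHomeomorph D.Space (EuclideanQuadrant n)}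
    (h : D.IsGoodChart ψ) : ψ ∈ IsManifold.maximalAtlas (QM n) ∞ D.Space :=
  IsManifold.subset_maximalAtlas h

theorem smoothMapNear_proj (x : D.Space) : SmoothMapNear n (Space.proj (D := D)) x := by
  obtain ⟨ψ, hψ, hx⟩ := exists_isGoodChart x
  refine ((hψ.smooth _ (ψ.map_source hx)).comp
    (SmoothMapNear.chart hψ.mem_maximalAtlas hx)).congr ?_
  filter_upwards [ψ.open_source.mem_nhds hx] with y hy
  rw [ψ.left_inv hy]

theorem smoothMapNear_offSection (x₀ : D.Space) {q : M} (hq : q ∉ P) :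
    SmoothMapNear n (offSection x₀) q := by
  have hev : ∀ᶠ q' in 𝓝 q, q' ∉ P := D.isClosed.isOpen_compl.mem_nhds hq
  have hproj : ∀ᶠ q' in 𝓝 q, (offSection x₀ q').proj = q' :=
    hev.mono fun q' hq' => by rw [offSection_eq x₀ hq', proj_lift]
  have hg : SmoothMapNear n (fun q => (offSection x₀ q).proj) q :=
    SmoothMapNear.congr (contMDiff_id.smoothMapNear q) hproj
  have hT : ∀ᶠ q' in 𝓝 q, ContinuousAt (offSection x₀) q' :=
    hev.mono fun q' hq' => (continuousOn_offSection x₀).continuousAt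
      (D.isClosed.isOpen_compl.mem_nhds hq')
  obtain ⟨ψ, hψ, hx⟩ := exists_isGoodChart (offSection x₀ q)
  have hp : PrincipalMonomialAt n (fun q => (offSection x₀ q).proj) P q := by
    refine PrincipalMonomialAt.of_not_mem (D.isClosed.isOpen_compl.mem_nhds ?_) hg
    rw [mem_compl_iff, hproj.self_of_nhds]
    exact hq
  have h1 := SmoothMapNear.symm_comp hψ.mem_maximalAtlas
    (u := fun q => ψ (offSection x₀ q))
    (fun j => hψ.smoothNear_coord hT hg hp hx j) (ψ.map_source hx)
  refine h1.congr ?_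
  filter_upwards [hT.self_of_nhds.eventually (ψ.open_source.mem_nhds hx)] with y hy
  rw [ψ.left_inv hy]

theorem isLocalDiffeomorphAt_proj (x : D.Space) (hx : x.proj ∉ P) :
    IsLocalDiffeomorphAt (QM n) (QM n) ∞ (Space.proj (D := D)) x := by
  refine ⟨{ toFun := Space.proj
            invFun := offSection x
            source := Space.proj ⁻¹' Pᶜ
            target := Pᶜ
            map_source' := fun y hy => hy
            map_target' := fun q hq => by
              rw [mem_preimage, offSection_eq x hq, proj_lift]; exact hq
            left_inv' := fun y hy => by
              rw [offSection_eq x hy]; exact (eq_lift y hy).symm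
            right_inv' := fun q hq => by rw [offSection_eq x hq, proj_lift]
            open_source := D.isClosed.isOpen_compl.preimage continuous_proj
            open_target := D.isClosed.isOpen_compl
            contMDiffOn_toFun := fun y _ =>
              (Filter.Eventually.self_of_nhds (smoothMapNear_proj y)).contMDiffWithinAt
            contMDiffOn_invFun := fun q hq => (Filter.Eventually.self_of_nhds
              (smoothMapNear_offSection x hq)).contMDiffWithinAt }, hx, fun y _ => rfl⟩

theorem bijOn_proj : BijOn (Space.proj (D := D)) (Space.proj ⁻¹' Pᶜ) Pᶜ :=
  ⟨fun _ hx => hx, fun _ _ _ hy h => Space.ext_of_notMem h hy,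
    fun q hq => ⟨lift q hq, hq, rfl⟩⟩

theorem exists_projectiveAt (x : D.Space) (hx : x.proj ∈ P) {k : D.ι}
    (hk : 0 < D.cutoff k x.proj) :
    ∃ ψ i σ a, ProjectiveAt (Space.proj (D := D)) x (D.chart k) (D.idx k) ψ i σ a := by
  obtain ⟨i, σ, A, hi, hxs⟩ := exists_admissible x hk
  have hc : ∀ j ∈ D.idx k, (D.chart k x.proj).1 j = D.center k j :=
    (D.mem_iff k _ (proj_mem_source hxs)).1 hx
  have hψ : ∀ q ∈ D.projSource k i σ A, ∀ j, (projChart A hi x q).1 j = D.projCoord k i σ A q j :=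
    fun q hq => quadrantOf_projCoord hi hq
  have hb : ∀ q ∈ D.projSource k i σ A, ∀ j,
      D.blowdownCoord k i σ A (projChart A hi x q) j = (D.chart k q.proj).1 j :=
    fun q hq => blowdownCoord_projCoord hi hq
  refine ⟨projChart A hi x, i, σ, D.shift k A, (isGoodChart_projChart hi x).mem_maximalAtlas, hxs,
    fun q hq => proj_mem_source hq, hi.mem, hi.sign, ?_, fun j hj hji => ⟨fun h => ?_, fun h => ?_⟩,
    fun q hq => ?_, fun q hq j hj hji => ?_, fun q hq j hj => ?_⟩
  · rw [hψ x hxs, projCoord, if_pos rfl, (normal_eq_zero_iff (proj_mem_source hxs)).2 hx]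
    exact mul_zero σ
  · rw [hc j hj] at h
    exact shift_of_eq_zero h
  · rw [hc j hj] at h
    rw [hψ x hxs]
    exact projCoord_pos hxs hj hji h
  · rw [← hb q hq, hc i hi.mem, blowdownCoord, if_pos rfl, add_sub_cancel_left]
  · rw [← hb q hq, hc j hj, blowdownCoord, if_neg hji, if_pos hj, add_sub_cancel_left]
  · have hji : j ≠ i := fun e => hj (e ▸ hi.mem)
    rw [← hb q hq, blowdownCoord, if_neg hji, if_neg hj]

end BlowupData

/-! ### Choice of countably many charts and cut-offs. -/

section Existence

variable {n : ℕ} {M : CornerManifold.{u} n} {P : Set M}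

theorem IsAdaptedChart.mem {p : M} {φ : OpenPartialHomeomorph M (EuclideanQuadrant n)}
    {I : Set (Fin n)} (h : IsAdaptedChart P p φ I) : p ∈ P := by
  have h1 : p ∈ {q ∈ φ.source | ∀ i ∈ I, (φ q).1 i = (φ p).1 i} := ⟨h.2.1, fun i _ => rfl⟩
  rw [← h.2.2] at h1
  exact h1.1

theorem exists_cutoff {p : M} {U : Set M} (hU : U ∈ 𝓝 p) :
    ∃ χ : M → ℝ, Continuous χ ∧ (∀ q, 0 ≤ χ q) ∧ (∀ q, χ q ≤ 1) ∧ tsupport χ ⊆ U ∧ 0 < χ p := by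
  have : LocallyCompactSpace M := BlowupData.locallyCompactSpace M
  obtain ⟨K, hK, hKU, hKc⟩ := local_compact_nhds hU
  have hpK : p ∈ interior K := mem_interior_iff_mem_nhds.2 hK
  obtain ⟨f, hf1, hf0, -, hf⟩ := exists_continuous_one_zero_of_isCompact
    (isCompact_singleton (x := p)) (isOpen_interior (s := K)).isClosed_compl
    (disjoint_singleton_left.2 fun h => h hpK)
  refine ⟨f, f.continuous, fun q => (hf q).1, fun q => (hf q).2, ?_, ?_⟩
  · refine (closure_minimal (fun q hq => ?_) hKc.isClosed).trans hKU
    by_contra h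
    exact hq (hf0 fun h' => h (interior_subset h'))
  · have := hf1 (mem_singleton p)
    simp only [Pi.one_apply] at this
    rw [this]
    exact one_pos

/-- Second countability provides a countable subcover of `P`. The set `S` forces prescribed charts
into the family; it is later a single point, to show that every adapted chart yields projective
coordinates. -/
theorem exists_blowupData (hP : IsClosed P) (Φ : M → OpenPartialHomeomorph M (EuclideanQuadrant n))
    (J : M → Set (Fin n)) (hΦ : ∀ p ∈ P, IsAdaptedChart P p (Φ p) (J p)) {S : Set M}
    (hS : S.Countable) (hSP : S ⊆ P) :
    ∃ D : BlowupData M P, ∀ p ∈ S, ∃ k, 0 < D.cutoff k p ∧ D.idx k = J p ∧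
      (D.chart k).source ⊆ (Φ p).source ∧ ∀ q, D.chart k q = Φ p q := by
  have h1 : ∀ p, ∃ ψ : OpenPartialHomeomorph M (EuclideanQuadrant n), p ∈ P →
      IsAdaptedChart P p ψ (J p) ∧ ψ.source ⊆ (Φ p).source ∧ (∀ q, ψ q = Φ p q) ∧
      ∀ j, 0 < (Φ p p).1 j → ∀ q ∈ ψ.source, 0 < (ψ q).1 j := by
    intro p
    by_cases hp : p ∈ P
    swap
    · exact ⟨Φ p, fun h => absurd h hp⟩
    have hU : ∀ᶠ q in 𝓝 p, ∀ j, 0 < (Φ p p).1 j → 0 < (Φ p q).1 j := by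
      refine Filter.eventually_all.2 fun j => ?_
      by_cases hj : 0 < (Φ p p).1 j
      · exact ((SmoothNear.coord (hΦ p hp).1 (hΦ p hp).2.1 j).eventually_pos hj).mono
          fun q hq _ => hq
      · exact Filter.Eventually.of_forall fun q h => absurd h hj
    obtain ⟨ψ, h1, h2, h3, h4⟩ := (hΦ p hp).adaptedNear.exists_isAdaptedChart hU
    exact ⟨ψ, fun _ => ⟨h1, h3, h4, fun j hj q hq => by rw [h4]; exact h2 hq j hj⟩⟩
  choose ψ hψ' using h1
  have hψ := fun p hp => (hψ' p hp).1
  have hψs := fun p hp => (hψ' p hp).2.1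
  have hψe := fun p hp => (hψ' p hp).2.2.1
  have hψp := fun p hp => (hψ' p hp).2.2.2
  have h2 : ∀ p ∈ P, ∃ χ : M → ℝ, Continuous χ ∧ (∀ q, 0 ≤ χ q) ∧ (∀ q, χ q ≤ 1) ∧
      tsupport χ ⊆ (ψ p).source ∧ 0 < χ p := fun p hp =>
    exists_cutoff ((ψ p).open_source.mem_nhds (hψ p hp).2.1)
  choose! χ hχ using h2
  obtain ⟨T, hTP, hT, hcov⟩ := TopologicalSpace.countable_cover_nhdsWithin
    (f := fun p => {q | 0 < χ p q}) (s := P) fun p hp => mem_nhdsWithin_of_mem_nhds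
      ((isOpen_lt continuous_const (hχ p hp).1).mem_nhds (hχ p hp).2.2.2.2)
  have hmem : ∀ k : ↥(S ∪ T), (k : M) ∈ P := fun k => k.2.elim (fun h => hSP h) fun h => hTP h
  refine ⟨{ ι := ↥(S ∪ T)
            countable := (hS.union hT).to_subtype
            chart := fun k => ψ k
            idx := fun k => J k
            center := fun k j => (ψ k k).1 j
            cutoff := fun k => χ k
            isClosed := hP
            mem_maximalAtlas := fun k => (hψ k (hmem k)).1
            mem_iff := fun k q hq => ?_
            center_nonneg := fun k j => (ψ k k).2 j
            coord_pos := fun k j _ hj q hq => hψp k (hmem k) j (by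
              rwa [hψe k (hmem k)] at hj) q hq
            cutoff_continuous := fun k => (hχ k (hmem k)).1
            cutoff_nonneg := fun k => (hχ k (hmem k)).2.1
            cutoff_le_one := fun k => (hχ k (hmem k)).2.2.1
            tsupport_cutoff := fun k => (hχ k (hmem k)).2.2.2.1
            cover := fun p hp => ?_ }, fun p hp => ⟨⟨p, Or.inl hp⟩, (hχ p (hSP hp)).2.2.2.2, rfl,
              hψs p (hSP hp), hψe p (hSP hp)⟩⟩
  · have h := Set.ext_iff.1 (hψ k (hmem k)).2.2 q
    exact ⟨fun h' => (h.1 ⟨h', hq⟩).2, fun h' => (h.2 ⟨hq, h'⟩).1⟩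
  · obtain ⟨k, hk, hpk⟩ := mem_iUnion₂.1 (hcov hp)
    exact ⟨⟨k, Or.inr hk⟩, hpk⟩

end Existence

/-! ### Sheets of the boundary and embeddedness of boundary hypersurfaces. -/

section Sheets

variable {n : ℕ} {M : Type*} [TopologicalSpace M] [ChartedSpace (EuclideanQuadrant n) M]
  [IsManifold (QM n) ∞ M] {φ ψ : OpenPartialHomeomorph M (EuclideanQuadrant n)} {p : M}

/-- Distinct boundary coordinates of a chart do not have the same zeros. -/
theorem eq_of_zero_iff (hp : p ∈ ψ.source) {i j : Fin n} (hi : (ψ p).1 i = 0)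
    (h : ∀ᶠ q in 𝓝 p, (ψ q).1 i = 0 → (ψ q).1 j = 0) (hj : (ψ p).1 j = 0) : i = j := by
  classical
  by_contra hij
  obtain ⟨y, ⟨-, ε, hε, hy⟩, h2⟩ := ((frequently_coord_add hp (v := fun l => if l = i then 0 else 1)
    (fun l _ => by split_ifs <;> norm_num)).and_eventually h).exists
  have h3 := hy i
  have h4 := hy j
  rw [if_pos rfl, hi, mul_zero, add_zero] at h3
  rw [if_neg (Ne.symm hij), hj, mul_one, zero_add, h2 h3] at h4
  exact hε.ne h4

theorem exists_zero_iff (hφ : φ ∈ IsManifold.maximalAtlas (QM n) ∞ M)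
    (hψ : ψ ∈ IsManifold.maximalAtlas (QM n) ∞ M) (hp : p ∈ φ.source) (hp' : p ∈ ψ.source)
    {k : Fin n} (hk : (ψ p).1 k = 0) :
    ∃ j, (φ p).1 j = 0 ∧ ∀ᶠ q in 𝓝 p, (ψ q).1 k = 0 ↔ (φ q).1 j = 0 := by
  obtain ⟨j, hj, a, ha, hap, he⟩ := exists_boundary_coord hφ hψ hp hp' hk
  refine ⟨j, hj, ?_⟩
  filter_upwards [he, ha.eventually_pos hap] with q h1 h2
  rw [h1, mul_eq_zero]
  exact or_iff_right h2.ne'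

/-- The indices of the coordinates that vanish at `p`. -/
def zeroSet (ψ : OpenPartialHomeomorph M (EuclideanQuadrant n)) (p : M) : Set (Fin n) :=
  {i | (ψ p).1 i = 0}

theorem ncard_zeroSet_le (hφ : φ ∈ IsManifold.maximalAtlas (QM n) ∞ M)
    (hψ : ψ ∈ IsManifold.maximalAtlas (QM n) ∞ M) (hp : p ∈ φ.source) (hp' : p ∈ ψ.source) :
    (zeroSet ψ p).ncard ≤ (zeroSet φ p).ncard := by
  have h : ∀ k ∈ zeroSet ψ p, ∃ j ∈ zeroSet φ p, ∀ᶠ q in 𝓝 p, (ψ q).1 k = 0 ↔ (φ q).1 j = 0 :=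
    fun k hk => exists_zero_iff hφ hψ hp hp' hk
  choose! f hf hfe using h
  refine ncard_le_ncard_of_injOn f hf (fun k hk l hl hkl => ?_) (toFinite _)
  refine eq_of_zero_iff hp' hk ?_ hl
  filter_upwards [hfe k hk, hfe l hl] with q h1 h2 h3
  rw [h2, ← hkl, ← h1]
  exact h3

theorem cornerCodim_eq (hψ : ψ ∈ IsManifold.maximalAtlas (QM n) ∞ M) (hp : p ∈ ψ.source) :
    cornerCodim n p = (zeroSet ψ p).ncard :=
  le_antisymm (ncard_zeroSet_le hψ (IsManifold.chart_mem_maximalAtlas p) hp (mem_chart_source _ p))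
    (ncard_zeroSet_le (IsManifold.chart_mem_maximalAtlas p) hψ (mem_chart_source _ p) hp)

theorem cornerCodim_eq_one_iff (hψ : ψ ∈ IsManifold.maximalAtlas (QM n) ∞ M) (hp : p ∈ ψ.source) :
    cornerCodim n p = 1 ↔ ∃ i, ∀ j, (ψ p).1 j = 0 ↔ j = i := by
  rw [cornerCodim_eq hψ hp, ncard_eq_one]
  simp only [zeroSet, Set.ext_iff, mem_ofPred_eq, mem_singleton_iff]

variable (n M) in
/-- No connected set of points of codimension one meets two different sheets of the boundary near
a point. -/
def NoSelfIntersection : Prop :=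
  ∀ T : Set M, IsPreconnected T → (∀ q ∈ T, cornerCodim n q = 1) →
    ∀ (p : M) (ψ : OpenPartialHomeomorph M (EuclideanQuadrant n)),
      ψ ∈ IsManifold.maximalAtlas (QM n) ∞ M → p ∈ ψ.source →
      ∀ i j, (ψ p).1 i = 0 → (ψ p).1 j = 0 → (∃ᶠ q in 𝓝 p, q ∈ T ∧ (ψ q).1 i = 0) →
        (∃ᶠ q in 𝓝 p, q ∈ T ∧ (ψ q).1 j = 0) → i = j

/-- The connected set lies in a single component, whose closure is given by one coordinate near `p`,
so both sheets are the zero set of that coordinate. In this form the property can be transported by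
blow-down maps, since these carry connected sets to connected sets. -/
theorem noSelfIntersection_of_embedded
    (h : ∀ H : Set M, IsBoundaryHypersurface n H → IsEmbeddedHypersurface n H) :
    NoSelfIntersection n M := by
  intro T hT hT1 p ψ hψ hp i j hi hj hfi hfj
  obtain ⟨q₀, hq₀, -⟩ := hfi.exists
  set C := connectedComponentIn {q : M | cornerCodim n q = 1} q₀
  have hTC : T ⊆ C := hT.subset_connectedComponentIn hq₀ hT1
  have hpC : p ∈ closure C := mem_closure_iff_frequently.2 (hfi.mono fun q hq => hTC hq.1)
  obtain ⟨χ, hχ, hpχ, m, hm, hmH⟩ := h (closure C) ⟨q₀, hT1 _ hq₀, rfl⟩ p hpC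
  have key : ∀ l, (ψ p).1 l = 0 → (∃ᶠ q in 𝓝 p, q ∈ T ∧ (ψ q).1 l = 0) →
      ∀ᶠ q in 𝓝 p, (ψ q).1 l = 0 ↔ (χ q).1 m = 0 := by
    intro l hl hfl
    obtain ⟨m', hm', hme⟩ := exists_zero_iff hχ hψ hpχ hp hl
    obtain ⟨q, ⟨hqT, hql⟩, hqe, hqχ⟩ :=
      (hfl.and_eventually (hme.and (χ.open_source.mem_nhds hpχ))).exists
    obtain ⟨r, hr⟩ := (cornerCodim_eq_one_iff hχ hqχ).1 (hT1 q hqT)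
    have h1 : q ∈ {q ∈ χ.source | (χ q).1 m = 0} := hmH ▸ ⟨subset_closure (hTC hqT), hqχ⟩
    have h2 : m' = m := ((hr m').1 (hqe.1 hql)).trans ((hr m).1 h1.2).symm
    rwa [h2] at hme
  refine eq_of_zero_iff hp hi ?_ hj
  filter_upwards [key i hi hfi, key j hj hfj] with q h1 h2 h3
  exact h2.2 (h1.1 h3)

/-- The absence of self-intersections can be checked in one chart at each point. -/
theorem noSelfIntersection_of_charts
    (h : ∀ T : Set M, IsPreconnected T → (∀ q ∈ T, cornerCodim n q = 1) → ∀ p : M,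
      ∃ ψ ∈ IsManifold.maximalAtlas (QM n) ∞ M, p ∈ ψ.source ∧
        ∀ i j, (ψ p).1 i = 0 → (ψ p).1 j = 0 → (∃ᶠ q in 𝓝 p, q ∈ T ∧ (ψ q).1 i = 0) →
        (∃ᶠ q in 𝓝 p, q ∈ T ∧ (ψ q).1 j = 0) → i = j) : NoSelfIntersection n M := by
  intro T hT hT1 p ψ hψ hp i j hi hj hfi hfj
  obtain ⟨χ, hχ, hpχ, hc⟩ := h T hT hT1 p
  obtain ⟨i', hi', hie⟩ := exists_zero_iff hχ hψ hpχ hp hi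
  obtain ⟨j', hj', hje⟩ := exists_zero_iff hχ hψ hpχ hp hj
  have := hc i' j' hi' hj' ((hfi.and_eventually hie).mono fun q hq => ⟨hq.1.1, hq.2.1 hq.1.2⟩)
    ((hfj.and_eventually hje).mono fun q hq => ⟨hq.1.1, hq.2.1 hq.1.2⟩)
  refine eq_of_zero_iff hp hi ?_ hj
  filter_upwards [hie, hje] with q h1 h2 h3
  rw [h2, ← this, ← h1]
  exact h3

/-- A sheet of the boundary near `p`, without its boundary. -/
theorem isPreconnected_sheet {ε : ℝ}
    (hb : ∀ x ∈ quadrantBall (ψ p).1 ε, (QM n).symm x ∈ ψ.target) (i : Fin n) :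
    IsPreconnected {q ∈ ψ.source | (ψ q).1 ∈ quadrantBall (ψ p).1 ε ∧
      ∀ j, (ψ q).1 j = 0 ↔ j = i} := by
  -- In coordinates the open sheet is convex, hence connected.
  set s : Set (EuclideanSpace ℝ (Fin n)) :=
    quadrantBall (ψ p).1 ε ∩ ({x | x i = 0} ∩ ⋂ j, {x | j ≠ i → 0 < x j}) with hs
  have hconv : Convex ℝ s := by
    refine (convex_quadrantBall _ _).inter (Convex.inter ?_ (convex_iInter fun j => ?_))
    · intro x hx y hy a b _ _ _
      change a * x i + b * y i = 0
      rw [show x i = 0 from hx, show y i = 0 from hy]; ring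
    · intro x hx y hy a b ha hb hab hji
      have h1 := hx hji
      have h2 := hy hji
      change 0 < a * x j + b * y j
      rcases ha.lt_or_eq with h | h
      · exact add_pos_of_pos_of_nonneg (mul_pos h h1) (mul_nonneg hb h2.le)
      · rw [← h] at hab ⊢
        rw [zero_add] at hab
        rw [hab]; linarith
  have himg : {q ∈ ψ.source | (ψ q).1 ∈ quadrantBall (ψ p).1 ε ∧ ∀ j, (ψ q).1 j = 0 ↔ j = i} =
      (fun x => ψ.symm ((QM n).symm x)) '' s := by
    ext q
    constructor
    · rintro ⟨hq, hqb, hqi⟩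
      refine ⟨(ψ q).1, ⟨hqb, (hqi i).2 rfl, mem_iInter.2 fun j hj => ?_⟩, ?_⟩
      · exact lt_of_le_of_ne ((ψ q).2 j) fun h => hj ((hqi j).1 h.symm)
      · simp only [quadrant_symm_val, ψ.left_inv hq]
    · rintro ⟨x, ⟨hxb, hxi, hxj⟩, rfl⟩
      have h1 : (ψ (ψ.symm ((QM n).symm x))).1 = x := by
        rw [ψ.right_inv (hb x hxb), quadrant_val_symm hxb.1]
      refine ⟨ψ.map_target (hb x hxb), by rw [h1]; exact hxb, fun j => ?_⟩
      rw [h1]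
      refine ⟨fun h => by_contra fun hj => ?_, fun h => h ▸ hxi⟩
      exact ((mem_iInter.1 hxj j) hj).ne' h
  rw [himg]
  refine hconv.isPreconnected.image _ ?_
  exact ψ.continuousOn_symm.comp (QM n).continuous_symm.continuousOn fun x hx => hb x hx.1

/-- Near `p` the points of codimension one form connected sheets, one for each vanishing coordinate.
A sheet that meets the component lies in it, and by hypothesis only one sheet does; its closure near
`p` is the zero set of one coordinate. -/
theorem NoSelfIntersection.isEmbeddedHypersurface (h : NoSelfIntersection n M) {H : Set M}
    (hH : IsBoundaryHypersurface n H) : IsEmbeddedHypersurface n H := by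
  obtain ⟨p₀, hp₀, rfl⟩ := hH
  set S : Set M := {q | cornerCodim n q = 1}
  set C := connectedComponentIn S p₀ with hC
  have hCS : C ⊆ S := connectedComponentIn_subset S p₀
  intro p hp
  set ψ := chartAt (EuclideanQuadrant n) p
  have hψ : ψ ∈ IsManifold.maximalAtlas (QM n) ∞ M := IsManifold.chart_mem_maximalAtlas p
  have hpψ : p ∈ ψ.source := mem_chart_source _ p
  have hev : ∀ᶠ q in 𝓝 p, q ∈ ψ.source ∧ ∀ j, (ψ p).1 j ≠ 0 → (ψ q).1 j ≠ 0 := by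
    refine Filter.Eventually.and (ψ.open_source.mem_nhds hpψ) (Filter.eventually_all.2 fun j => ?_)
    by_cases hj : (ψ p).1 j = 0
    · exact Filter.Eventually.of_forall fun q h => absurd hj h
    · exact ((SmoothNear.coord hψ hpψ j).eventually_ne hj).mono fun q hq _ => hq
  obtain ⟨ε, hε, hb⟩ := exists_quadrantBall hpψ hev
  set U : Set M := {q ∈ ψ.source | (ψ q).1 ∈ quadrantBall (ψ p).1 ε}
  have hUev : ∀ᶠ q in 𝓝 p, q ∈ U :=
    Filter.Eventually.and (ψ.open_source.mem_nhds hpψ) (eventually_mem_quadrantBall hpψ hε)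
  have hUopen : IsOpen U := by
    have : U = ψ.source ∩ ψ ⁻¹' ((fun u : EuclideanQuadrant n => u.1) ⁻¹'
        Metric.ball (ψ p).1 ε) := by
      ext q
      exact ⟨fun hq => ⟨hq.1, hq.2.2⟩, fun hq => ⟨hq.1, val_mem_range_quadrant _, hq.2⟩⟩
    rw [this]
    exact ψ.continuousOn.isOpen_inter_preimage ψ.open_source
      (Metric.isOpen_ball.preimage continuous_subtype_val)
  have hUne : ∀ q ∈ U, ∀ j, (ψ q).1 j = 0 → (ψ p).1 j = 0 := by
    intro q hq j hj
    by_contra hne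
    have := (hb _ hq.2).2.2 j hne
    rw [quadrant_symm_val, ψ.left_inv hq.1] at this
    exact this hj
  let sheet : Fin n → Set M := fun i => {q ∈ ψ.source | (ψ q).1 ∈ quadrantBall (ψ p).1 ε ∧
      ∀ j, (ψ q).1 j = 0 ↔ j = i}
  have hsheet : ∀ i q, q ∈ C → q ∈ sheet i → sheet i ⊆ C := by
    intro i q hqC hqi
    rw [hC, connectedComponentIn_eq hqC]
    refine (isPreconnected_sheet (fun x hx => (hb x hx).1) i).subset_connectedComponentIn hqi ?_
    exact fun q' hq' => (cornerCodim_eq_one_iff hψ hq'.1).2 ⟨i, hq'.2.2⟩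
  have hCU : ∀ q ∈ C, q ∈ U → ∃ i, q ∈ sheet i := by
    intro q hqC hqU
    obtain ⟨i, hi⟩ := (cornerCodim_eq_one_iff hψ hqU.1).1 (hCS hqC)
    exact ⟨i, hqU.1, hqU.2, hi⟩
  -- points of the closure of a sheet
  have hclos : ∀ i, ∀ q ∈ U, (ψ q).1 i = 0 → ∃ᶠ q' in 𝓝 q, q' ∈ sheet i := by
    classical
    intro i q hqU hqi
    refine ((frequently_coord_add hqU.1 (v := fun l => if l = i then 0 else 1)
      (fun l _ => by split_ifs <;> norm_num)).and_eventually (hUopen.mem_nhds hqU)).mono ?_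
    rintro q' ⟨⟨-, δ, hδ, he⟩, hq'⟩
    refine ⟨hq'.1, hq'.2, fun j => ?_⟩
    rw [he j]
    by_cases hji : j = i
    · subst hji
      simp [hqi]
    · simp only [hji, if_false, mul_one, iff_false]
      exact (add_pos_of_nonneg_of_pos ((ψ q).2 j) hδ).ne'
  obtain ⟨q₁, hq₁C, hq₁U⟩ := ((mem_closure_iff_frequently.1 hp).and_eventually hUev).exists
  obtain ⟨i, hi⟩ := hCU q₁ hq₁C hq₁U
  have hip : (ψ p).1 i = 0 := hUne q₁ hq₁U i ((hi.2.2 i).2 rfl)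
  have hpU : p ∈ U := hUev.self_of_nhds
  have huniq : ∀ j q, q ∈ C → q ∈ sheet j → j = i := by
    intro j q hqC hqj
    have hjp : (ψ p).1 j = 0 := hUne q ⟨hqj.1, hqj.2.1⟩ j ((hqj.2.2 j).2 rfl)
    exact h C isPreconnected_connectedComponentIn hCS p ψ hψ hpψ j i hjp hip
      ((hclos j p hpU hjp).mono fun q' hq' => ⟨hsheet j q hqC hqj hq', (hq'.2.2 j).2 rfl⟩)
      ((hclos i p hpU hip).mono fun q' hq' => ⟨hsheet i q₁ hq₁C hi hq', (hq'.2.2 i).2 rfl⟩)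
  refine ⟨ψ.restr U, restr_mem_maximalAtlas (contDiffGroupoid ∞ (QM n)) hψ hUopen, ?_, i, hip, ?_⟩
  · rw [ψ.restr_source' U hUopen]
    exact ⟨hpψ, hpU⟩
  · rw [ψ.restr_source' U hUopen]
    ext q
    constructor
    · rintro ⟨hqC, hqs, hqU⟩
      refine ⟨⟨hqs, hqU⟩, ?_⟩
      have hc : ContinuousAt (fun q => (ψ q).1 i) q := (SmoothNear.coord hψ hqs i).continuousAt
      refine tendsto_nhds_unique_of_frequently_eq hc.tendsto tendsto_const_nhds
        (((mem_closure_iff_frequently.1 hqC).and_eventually (hUopen.mem_nhds hqU)).mono ?_)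
      rintro q' ⟨h1, h2⟩
      obtain ⟨j, hj⟩ := hCU q' h1 h2
      have := huniq j q' h1 hj
      exact (hj.2.2 i).2 this.symm
    · rintro ⟨⟨hqs, hqU⟩, hqi⟩
      refine ⟨mem_closure_iff_frequently.2 ((hclos i q hqU hqi).mono fun q' hq' => ?_), hqs, hqU⟩
      exact hsheet i q₁ hq₁C hi hq'

end Sheets

/-! ### Boundary hypersurfaces of a blow-up are embedded. -/

section NoSelf

variable {n : ℕ} {M : CornerManifold.{u} n} {P : Set M}
  {X : Type*} [TopologicalSpace X] [ChartedSpace (EuclideanQuadrant n) X] [IsManifold (QM n) ∞ X]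
  {β : X → M}

theorem ProjectiveAt.of_chart_eq {M : Type*} [TopologicalSpace M]
    [ChartedSpace (EuclideanQuadrant n) M] {β : X → M} {x : X}
    {φ φ' : OpenPartialHomeomorph M (EuclideanQuadrant n)}
    {I : Set (Fin n)} {ψ : OpenPartialHomeomorph X (EuclideanQuadrant n)} {i : Fin n} {σ : ℝ}
    {a : Fin n → ℝ} (h : ProjectiveAt β x φ I ψ i σ a) (hs : φ.source ⊆ φ'.source)
    (he : ∀ q, φ q = φ' q) : ProjectiveAt β x φ' I ψ i σ a := by
  refine ⟨h.mem_maximalAtlas, h.mem_source, fun q hq => hs (h.mapsTo hq), h.mem, h.sign,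
    h.eq_zero, ?_, ?_, ?_, ?_⟩ <;> simp only [← he]
  · exact h.translation
  · exact h.coord_self
  · exact h.coord_mem
  · exact h.coord_notMem

theorem IsAdaptedChart.mem_iff {p : M} {φ : OpenPartialHomeomorph M (EuclideanQuadrant n)}
    {I : Set (Fin n)} (h : IsAdaptedChart P p φ I) {q : M} (hq : q ∈ φ.source) :
    q ∈ P ↔ ∀ i ∈ I, (φ q).1 i = (φ p).1 i := by
  have h1 := Set.ext_iff.1 h.2.2 q
  exact ⟨fun h' => (h1.1 ⟨h', hq⟩).2, fun h' => (h1.2 ⟨hq, h'⟩).1⟩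

theorem ProjectiveAt.mem_iff {x : X} {φ : OpenPartialHomeomorph M (EuclideanQuadrant n)}
    {I : Set (Fin n)} {ψ : OpenPartialHomeomorph X (EuclideanQuadrant n)} {i : Fin n} {σ : ℝ}
    {a : Fin n → ℝ} (h : ProjectiveAt β x φ I ψ i σ a) (hφ : IsAdaptedChart P (β x) φ I) {q : X}
    (hq : q ∈ ψ.source) : β q ∈ P ↔ (ψ q).1 i = 0 := by
  rw [hφ.mem_iff (h.mapsTo hq)]
  constructor
  · intro h1
    have h2 := h.coord_self q hq
    rw [h1 i h.mem, sub_self] at h2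
    exact (mul_eq_zero.1 h2.symm).resolve_left h.sign_ne_zero
  · intro h1 j hj
    by_cases hji : j = i
    · subst hji
      have h2 := h.coord_self q hq
      rw [h1, mul_zero] at h2
      linarith
    · have h2 := h.coord_mem q hq j hj hji
      rw [h1, zero_mul] at h2
      linarith

/-- If `ψ_j` is a boundary coordinate at `x`, then so is `φ_j`, and `φ_j` vanishes where `ψ_j`
does. -/
theorem ProjectiveAt.coord_eq_zero {x : X} {φ : OpenPartialHomeomorph M (EuclideanQuadrant n)}
    {I : Set (Fin n)} {ψ : OpenPartialHomeomorph X (EuclideanQuadrant n)} {i : Fin n} {σ : ℝ}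
    {a : Fin n → ℝ} (h : ProjectiveAt β x φ I ψ i σ a) {j : Fin n} (hji : j ≠ i)
    (hj : (ψ x).1 j = 0) : (φ (β x)).1 j = 0 ∧
      ∀ q ∈ ψ.source, (ψ q).1 j = 0 → (φ (β q)).1 j = 0 := by
  by_cases hjI : j ∈ I
  · have h1 : (φ (β x)).1 j = 0 := by
      by_contra hne
      exact ((h.translation j hjI hji).2 (lt_of_le_of_ne ((φ (β x)).2 j) (Ne.symm hne))).ne' hj
    refine ⟨h1, fun q hq hqj => ?_⟩
    have h2 := h.coord_mem q hq j hjI hji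
    rwa [h1, (h.translation j hjI hji).1 h1, hqj, sub_self, mul_zero, sub_zero] at h2
  · exact ⟨by rw [h.coord_notMem x h.mem_source j hjI, hj],
      fun q hq hqj => by rw [h.coord_notMem q hq j hjI, hqj]⟩

theorem IsLocalDiffeomorphAt.cornerCodim_eq {x : X}
    (h : IsLocalDiffeomorphAt (QM n) (QM n) ∞ β x) : cornerCodim n (β x) = cornerCodim n x := by
  have hc := IsManifold.chart_mem_maximalAtlas (I := QM n) (n := ∞) (β x)
  obtain ⟨ψ, hψ, hx, -, he⟩ := h.exists_chart hc (mem_chart_source _ _)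
  rw [_root_.cornerCodim_eq hψ hx, _root_.cornerCodim_eq hc (mem_chart_source _ _), zeroSet,
    zeroSet, he x hx]

/-- A connected set of points of codimension one lies in the front face or avoids it. In the first
case only the front face coordinate vanishes on it. In the second, its image in `M` is connected and
of codimension one, and the sheets that it meets come from sheets in `M`. -/
theorem noSelfIntersection_of_blowup (hP : IsClosed P) (hc : Continuous β)
    (hloc : ∀ x, β x ∉ P → IsLocalDiffeomorphAt (QM n) (QM n) ∞ β x)
    (hproj : ∀ x, β x ∈ P → ∃ φ I ψ i σ a, IsAdaptedChart P (β x) φ I ∧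
      ProjectiveAt β x φ I ψ i σ a) : NoSelfIntersection n X := by
  have hM : NoSelfIntersection n M := noSelfIntersection_of_embedded M.embedded
  refine noSelfIntersection_of_charts fun T hT hT1 p => ?_
  -- The front face is relatively clopen in `T`: near a point of `T` on it no coordinate but `ψ_i`
  -- can vanish, and codimension one makes some coordinate vanish.
  have hdich : (∀ q ∈ T, β q ∈ P) ∨ ∀ q ∈ T, β q ∉ P := by
    have := isPreconnected_iff_preconnectedSpace.1 hT
    have hclopen : IsClopen {q : T | β q ∈ P} := by
      refine ⟨hP.preimage (hc.comp continuous_subtype_val), isOpen_iff_eventually.2 ?_⟩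
      intro q hq
      obtain ⟨φ, I, ψ, i, σ, a, hφ, h⟩ := hproj q hq
      obtain ⟨r, hr⟩ := (cornerCodim_eq_one_iff h.mem_maximalAtlas h.mem_source).1 (hT1 q q.2)
      have hri : i = r := (hr i).1 h.eq_zero
      have hev : ∀ᶠ q' in 𝓝 (q : X), q' ∈ ψ.source ∧ ∀ j, j ≠ i → (ψ q').1 j ≠ 0 := by
        refine Filter.Eventually.and (ψ.open_source.mem_nhds h.mem_source)
          (Filter.eventually_all.2 fun j => ?_)
        by_cases hj : j = i
        · exact Filter.Eventually.of_forall fun q h => absurd hj h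
        · have h0 : (ψ (q : X)).1 j ≠ 0 := fun h0 => hj (((hr j).1 h0).trans hri.symm)
          exact ((SmoothNear.coord h.mem_maximalAtlas h.mem_source j).eventually_ne h0).mono
            fun q hq _ => hq
      filter_upwards [continuous_subtype_val.continuousAt.eventually hev] with q' hq'
      obtain ⟨r', hr'⟩ := (cornerCodim_eq_one_iff h.mem_maximalAtlas hq'.1).1 (hT1 q' q'.2)
      have h1 : r' = i := by
        by_contra hne
        exact hq'.2 r' hne ((hr' r').2 rfl)
      exact (h.mem_iff hφ hq'.1).2 ((hr' i).2 h1.symm)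
    rcases isClopen_iff.1 hclopen with h | h
    · exact Or.inr fun q hq hqP => Set.ext_iff.1 h ⟨q, hq⟩ |>.1 hqP
    · exact Or.inl fun q hq => Set.ext_iff.1 h ⟨q, hq⟩ |>.2 trivial
  rcases hdich with hTP | hTP
  · by_cases hp : β p ∈ P
    · obtain ⟨φ, I, ψ, i₀, σ, a, hφ, h⟩ := hproj p hp
      refine ⟨ψ, h.mem_maximalAtlas, h.mem_source, ?_⟩
      have key : ∀ i, (∃ᶠ q in 𝓝 p, q ∈ T ∧ (ψ q).1 i = 0) → i = i₀ := by
        intro i hi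
        obtain ⟨q, ⟨hq, hqi⟩, hqs⟩ :=
          (hi.and_eventually (ψ.open_source.mem_nhds h.mem_source)).exists
        obtain ⟨r, hr⟩ := (cornerCodim_eq_one_iff h.mem_maximalAtlas hqs).1 (hT1 q hq)
        exact ((hr i).1 hqi).trans ((hr i₀).1 ((h.mem_iff hφ hqs).1 (hTP q hq))).symm
      exact fun i j _ _ hi hj => (key i hi).trans (key j hj).symm
    · refine ⟨_, IsManifold.chart_mem_maximalAtlas p, mem_chart_source _ p,
        fun i j _ _ hi _ => absurd hp ?_⟩
      obtain ⟨q, hq, hqP⟩ := (hi.and_eventually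
        (hc.continuousAt.eventually (hP.isOpen_compl.mem_nhds hp))).exists
      exact absurd (hTP q hq.1) hqP
  · have hT' : IsPreconnected (β '' T) := hT.image _ hc.continuousOn
    have hT1' : ∀ q ∈ β '' T, cornerCodim n q = 1 := by
      rintro _ ⟨q, hq, rfl⟩
      rw [(hloc q (hTP q hq)).cornerCodim_eq, hT1 q hq]
    by_cases hp : β p ∈ P
    · obtain ⟨φ, I, ψ, i₀, σ, a, hφ, h⟩ := hproj p hp
      refine ⟨ψ, h.mem_maximalAtlas, h.mem_source, ?_⟩
      have hsrc : ∀ᶠ q in 𝓝 p, q ∈ ψ.source := ψ.open_source.mem_nhds h.mem_source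
      have key : ∀ i, (∃ᶠ q in 𝓝 p, q ∈ T ∧ (ψ q).1 i = 0) → i ≠ i₀ := by
        rintro i hi rfl
        obtain ⟨q, ⟨hq, hqi⟩, hqs⟩ := (hi.and_eventually hsrc).exists
        exact hTP q hq ((h.mem_iff hφ hqs).2 hqi)
      have key2 : ∀ i, (ψ p).1 i = 0 → (∃ᶠ q in 𝓝 p, q ∈ T ∧ (ψ q).1 i = 0) →
          ∃ᶠ q in 𝓝 (β p), q ∈ β '' T ∧ (φ q).1 i = 0 := by
        intro i hip hi
        refine hc.continuousAt.frequently ((hi.and_eventually hsrc).mono ?_)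
        rintro q ⟨⟨hq, hqi⟩, hqs⟩
        exact ⟨⟨q, hq, rfl⟩, (h.coord_eq_zero (key i hi) hip).2 q hqs hqi⟩
      exact fun i j hi hj hfi hfj => hM _ hT' hT1' (β p) φ hφ.1 hφ.2.1 i j
        (h.coord_eq_zero (key i hfi) hi).1 (h.coord_eq_zero (key j hfj) hj).1 (key2 i hi hfi)
        (key2 j hj hfj)
    · have hcM := IsManifold.chart_mem_maximalAtlas (I := QM n) (n := ∞) (β p)
      obtain ⟨ψ, hψ, hpψ, -, he⟩ := (hloc p hp).exists_chart hcM (mem_chart_source _ _)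
      refine ⟨ψ, hψ, hpψ, fun i j hi hj hfi hfj => ?_⟩
      have key2 : ∀ i, (∃ᶠ q in 𝓝 p, q ∈ T ∧ (ψ q).1 i = 0) →
          ∃ᶠ q in 𝓝 (β p), q ∈ β '' T ∧ (chartAt (EuclideanQuadrant n) (β p) q).1 i = 0 := by
        intro i hi
        refine hc.continuousAt.frequently ((hi.and_eventually (ψ.open_source.mem_nhds hpψ)).mono ?_)
        rintro q ⟨⟨hq, hqi⟩, hqs⟩
        exact ⟨⟨q, hq, rfl⟩, by rwa [← he q hqs]⟩
      rw [he p hpψ] at hi hj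
      exact hM _ hT' hT1' (β p) _ hcM (mem_chart_source _ _) i j hi hj (key2 i hfi) (key2 j hfj)

end NoSelf

/-! ### Existence and uniqueness of the blow-up. -/

section Blowup

variable {n : ℕ} {M X Z : CornerManifold.{u} n} {P : Set M} {β : X → M}

/-- The blow-up exists, and it has projective coordinates for prescribed charts. -/
theorem IsPSubmanifold.exists_isBlowup_projectiveAt (hP : IsClosed P)
    (Φ : M → OpenPartialHomeomorph M (EuclideanQuadrant n))
    (J : M → Set (Fin n)) (hΦ : ∀ p ∈ P, IsAdaptedChart P p (Φ p) (J p)) {S : Set M}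
    (hS : S.Countable) (hSP : S ⊆ P) :
    ∃ (X : CornerManifold.{u} n) (β : X → M), IsBlowup β P ∧ ∀ x, β x ∈ S →
      ∃ ψ i σ a, ProjectiveAt β x (Φ (β x)) (J (β x)) ψ i σ a := by
  obtain ⟨D, hD⟩ := exists_blowupData hP Φ J hΦ hS hSP
  have hadapt : ∀ (x : D.Space) k, x.proj ∈ P → 0 < D.cutoff k x.proj →
      IsAdaptedChart P x.proj (D.chart k) (D.idx k) := by
    intro x k hx hk
    have hxs := BlowupData.mem_source_of_cutoff_ne_zero hk.ne'
    have hc := (D.mem_iff k _ hxs).1 hx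
    refine ⟨D.mem_maximalAtlas k, hxs, ?_⟩
    ext q
    constructor
    · rintro ⟨hq, hqs⟩
      exact ⟨hqs, fun j hj => by rw [(D.mem_iff k q hqs).1 hq j hj, hc j hj]⟩
    · rintro ⟨hqs, hq⟩
      exact ⟨(D.mem_iff k q hqs).2 fun j hj => by rw [hq j hj, hc j hj], hqs⟩
  have hproj : ∀ x : D.Space, x.proj ∈ P → ∃ φ I ψ i σ a, IsAdaptedChart P x.proj φ I ∧
      ProjectiveAt (BlowupData.Space.proj (D := D)) x φ I ψ i σ a := by
    intro x hx
    obtain ⟨k, hk⟩ := D.cover _ hx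
    obtain ⟨ψ, i, σ, a, h⟩ := BlowupData.exists_projectiveAt x hx hk
    exact ⟨_, _, ψ, i, σ, a, hadapt x k hx hk, h⟩
  have hns : NoSelfIntersection n D.Space := noSelfIntersection_of_blowup hP
    BlowupData.continuous_proj BlowupData.isLocalDiffeomorphAt_proj hproj
  refine ⟨{ carrier := D.Space, embedded := fun H hH => hns.isEmbeddedHypersurface hH },
    BlowupData.Space.proj, ⟨BlowupData.isProperMap_proj, BlowupData.bijOn_proj,
      BlowupData.isLocalDiffeomorphAt_proj, fun x hx => ?_⟩, fun x hx => ?_⟩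
  · obtain ⟨φ, I, ψ, i, σ, a, hφ, h⟩ := hproj x hx
    exact ProjectiveAt.hasProjectiveCoords h hφ
  · obtain ⟨k, hk, hkJ, hks, hke⟩ := hD _ hx
    obtain ⟨ψ, i, σ, a, h⟩ := BlowupData.exists_projectiveAt x (hSP hx) hk
    rw [hkJ] at h
    exact ⟨ψ, i, σ, a, ProjectiveAt.of_chart_eq h hks hke⟩

theorem IsPSubmanifold.exists_isBlowup (hP : IsPSubmanifold P) :
    ∃ (X : CornerManifold.{u} n) (β : X → M), IsBlowup β P := by
  have h : ∀ p, ∃ (φ : OpenPartialHomeomorph M (EuclideanQuadrant n)) (I : Set (Fin n)), p ∈ P →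
      IsAdaptedChart P p φ I := fun p => by
    by_cases hp : p ∈ P
    · obtain ⟨φ, I, h⟩ := hP.2 p hp
      exact ⟨φ, I, fun _ => h⟩
    · exact ⟨chartAt _ p, ∅, fun h => absurd h hp⟩
  choose Φ J hΦ using h
  obtain ⟨X, β, h, -⟩ := IsPSubmanifold.exists_isBlowup_projectiveAt hP.1 Φ J hΦ countable_empty
    (empty_subset P)
  exact ⟨X, β, h⟩

theorem ProjectiveAt.principalAt {x : X} {φ : OpenPartialHomeomorph M (EuclideanQuadrant n)}
    {I : Set (Fin n)} {ψ : OpenPartialHomeomorph X (EuclideanQuadrant n)} {i : Fin n} {σ : ℝ}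
    {a : Fin n → ℝ} (h : ProjectiveAt β x φ I ψ i σ a) (hφ : AdaptedNear P (β x) φ I) :
    PrincipalAt n β P (fun q => (ψ q).1 i) x := by
  classical
  refine PrincipalAt.of_gens (h.smoothMapNear hφ.mem_maximalAtlas) hφ.gensAt
    (w := fun j q => if j = i then σ else if j ∈ I then (ψ q).1 j - a j else 0) (fun j => ?_)
    ⟨i, ?_⟩ fun j => ?_
  · by_cases hji : j = i
    · simp only [hji, if_true]; exact SmoothNear.const _
    · by_cases hj : j ∈ I
      · simp only [hji, hj, if_true, if_false]
        exact (SmoothNear.coord h.mem_maximalAtlas h.mem_source j).sub (SmoothNear.const _)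
      · simp only [hji, hj, if_false]; exact SmoothNear.const _
  · simp only [if_true]
    exact h.sign_ne_zero
  · filter_upwards [ψ.open_source.mem_nhds h.mem_source] with q hq
    by_cases hji : j = i
    · subst hji
      simp only [adaptedFun_of_mem h.mem, if_true, h.coord_self q hq, mul_comm]
    · by_cases hj : j ∈ I
      · simp only [adaptedFun_of_mem hj, hji, hj, if_true, if_false, h.coord_mem q hq j hj hji]
      · simp only [adaptedFun_of_notMem hj, hji, hj, if_false, mul_zero]

theorem IsBlowup.principalMonomialAt (h : IsBlowup β P) (hP : IsClosed P) (x : X) :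
    PrincipalMonomialAt n β P x := by
  by_cases hx : β x ∈ P
  · obtain ⟨φ, I, ψ, i, σ, a, h1, h2⟩ := (h.projective x hx).exists_projectiveAt
    exact ⟨_, MonomialAt.coord h2.mem_maximalAtlas h2.mem_source i,
      h2.principalAt h1.adaptedNear⟩
  · exact PrincipalMonomialAt.of_not_mem (hP.isOpen_compl.mem_nhds hx) (h.contMDiff.smoothMapNear x)

/-- Two lifts agree off the preimage of `P`, where `β` is injective, and these points are dense. -/
theorem IsBlowup.eq_of_comp_eq (h : IsBlowup β P) (hP : IsPSubmanifold P) {g : Z → M}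
    (hg : ContMDiff (QM n) (QM n) ∞ g) (hp : ∀ z, PrincipalMonomialAt n g P z) {G G' : Z → X}
    (hG : Continuous G) (hG' : Continuous G') (he : β ∘ G = g) (he' : β ∘ G' = g) : G = G' := by
  funext z
  refine tendsto_nhds_unique_of_frequently_eq (hG.tendsto z) (hG'.tendsto z)
    (((hp z).frequently_notMem hP (hg.smoothMapNear z)).mono fun y hy => ?_)
  have h1 : β (G y) = g y := congrFun he y
  have h2 : β (G' y) = g y := congrFun he' y
  exact h.bijOn.injOn (by rw [mem_preimage, h1]; exact hy) (by rw [mem_preimage, h2]; exact hy)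
    (h1.trans h2.symm)

/-- The blow-up is unique up to diffeomorphism. -/
theorem IsBlowup.exists_diffeomorph {X' : CornerManifold.{u} n} {β' : X' → M} (h : IsBlowup β P)
    (h' : IsBlowup β' P) (hP : IsPSubmanifold P) :
    ∃ Φ : Diffeomorph (QM n) (QM n) X X' ∞, ∀ x, β' (Φ x) = β x := by
  have hp := h.principalMonomialAt hP.1
  have hp' := h'.principalMonomialAt hP.1
  obtain ⟨G, hG, hGe, -⟩ := h'.exists_lift hP h.contMDiff hp
  obtain ⟨G', hG', hGe', -⟩ := h.exists_lift hP h'.contMDiff hp'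
  have h1 : G' ∘ G = id := h.eq_of_comp_eq hP h.contMDiff hp (hG'.continuous.comp hG.continuous)
    continuous_id (by rw [← Function.comp_assoc, hGe', hGe]) rfl
  have h2 : G ∘ G' = id := h'.eq_of_comp_eq hP h'.contMDiff hp' (hG.continuous.comp hG'.continuous)
    continuous_id (by rw [← Function.comp_assoc, hGe, hGe']) rfl
  exact ⟨⟨⟨G, G', congrFun h1, congrFun h2⟩, hG, hG'⟩, congrFun hGe⟩

/-- Every adapted chart gives rise to projective coordinates. -/
theorem IsBlowup.exists_projectiveAt (h : IsBlowup β P) (hP : IsPSubmanifold P) {x : X}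
    {φ : OpenPartialHomeomorph M (EuclideanQuadrant n)} {I : Set (Fin n)}
    (hφ : AdaptedNear P (β x) φ I) : ∃ ψ i σ a, ProjectiveAt β x φ I ψ i σ a := by
  classical
  obtain ⟨φ', h1, -, h2, h3⟩ := hφ.exists_isAdaptedChart Filter.univ_mem
  have hall : ∀ p, ∃ Φ : OpenPartialHomeomorph M (EuclideanQuadrant n) × Set (Fin n),
      (p ∈ P → IsAdaptedChart P p Φ.1 Φ.2) ∧ (p = β x → Φ = (φ', I)) := fun p => by
    by_cases hpx : p = β x
    · exact ⟨(φ', I), fun _ => hpx ▸ h1, fun _ => rfl⟩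
    by_cases hp : p ∈ P
    · obtain ⟨φ, I, h⟩ := hP.2 p hp
      exact ⟨(φ, I), fun _ => h, fun h => absurd h hpx⟩
    · exact ⟨(φ', I), fun h => absurd h hp, fun h => absurd h hpx⟩
  choose Φ hΦ hΦx using hall
  -- An auxiliary blow-up is constructed with the given chart at `β x`; its projective coordinates
  -- are carried back by the diffeomorphism between the two blow-ups.
  obtain ⟨X', β', h', hβ'⟩ := IsPSubmanifold.exists_isBlowup_projectiveAt hP.1
    (fun p => (Φ p).1) (fun p => (Φ p).2) hΦ (countable_singleton (β x))
    (singleton_subset_iff.2 h1.mem)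
  obtain ⟨G, hG⟩ := h.exists_diffeomorph h' hP
  obtain ⟨ψ, i, σ, a, hψ⟩ := hβ' (G x) (hG x)
  rw [hΦx _ (hG x)] at hψ
  obtain ⟨ψ', hψ', hx, hm, he⟩ := (G.isLocalDiffeomorph x).exists_chart hψ.mem_maximalAtlas
    hψ.mem_source
  refine ⟨ψ', i, σ, a, ProjectiveAt.of_chart_eq (φ := φ') ⟨hψ', hx, fun q hq => ?_, hψ.mem,
    hψ.sign, ?_, ?_, ?_, ?_, ?_⟩ h2 h3⟩
  · rw [← hG]
    exact hψ.mapsTo (hm hq)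
  · rw [he x hx]
    exact hψ.eq_zero
  · rw [he x hx, ← hG]
    exact hψ.translation
  · intro q hq
    rw [he q hq, ← hG, ← hG]
    exact hψ.coord_self _ (hm hq)
  · intro q hq
    rw [he q hq, ← hG, ← hG]
    exact hψ.coord_mem _ (hm hq)
  · intro q hq
    rw [he q hq, ← hG]
    exact hψ.coord_notMem _ (hm hq)

end Blowup

/-! ### Lifts of p-submanifolds and of hypersurfaces. -/

section LiftSet

variable {n : ℕ} {M X : CornerManifold.{u} n} {P Q H : Set M} {β : X → M} {x : X}

theorem isPSubmanifold_of_adaptedNear (hc : IsClosed P)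
    (h : ∀ p ∈ P, ∃ (φ : OpenPartialHomeomorph M (EuclideanQuadrant n)) (I : Set (Fin n)),
      AdaptedNear P p φ I) : IsPSubmanifold P := by
  refine ⟨hc, fun p hp => ?_⟩
  obtain ⟨φ, I, hφ⟩ := h p hp
  obtain ⟨ψ, hψ, -⟩ := hφ.exists_isAdaptedChart Filter.univ_mem
  exact ⟨ψ, I, hψ⟩

theorem IsPSubmanifold.exists_adaptedNear (h : IsPSubmanifold P) {p : M} (hp : p ∈ P) :
    ∃ (φ : OpenPartialHomeomorph M (EuclideanQuadrant n)) (I : Set (Fin n)),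
      AdaptedNear P p φ I := by
  obtain ⟨φ, I, hφ⟩ := h.2 p hp
  exact ⟨φ, I, hφ.adaptedNear⟩

/-- A closed set that is locally a sheet of the boundary. -/
def IsHypersurfaceLike (H : Set M) : Prop :=
  IsClosed H ∧ ∀ p ∈ H, ∃ (φ : OpenPartialHomeomorph M (EuclideanQuadrant n)) (l : Fin n),
    AdaptedNear H p φ {l} ∧ (φ p).1 l = 0

theorem IsHypersurfaceLike.isPSubmanifold (h : IsHypersurfaceLike H) : IsPSubmanifold H :=
  isPSubmanifold_of_adaptedNear h.1 fun p hp => by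
    obtain ⟨φ, l, hφ, -⟩ := h.2 p hp
    exact ⟨φ, {l}, hφ⟩

theorem liftSet_of_subset (h : Q ⊆ P) : liftSet β P Q = β ⁻¹' Q := if_pos h

theorem liftSet_of_not_subset (h : ¬ Q ⊆ P) : liftSet β P Q = closure (β ⁻¹' (Q \ P)) := if_neg h

theorem isClosed_liftSet (hβ : Continuous β) (hQ : IsClosed Q) : IsClosed (liftSet β P Q) := by
  by_cases h : Q ⊆ P
  · rw [liftSet_of_subset h]; exact hQ.preimage hβ
  · rw [liftSet_of_not_subset h]; exact isClosed_closure

theorem liftSet_subset_preimage (hβ : Continuous β) (hQ : IsClosed Q) :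
    liftSet β P Q ⊆ β ⁻¹' Q := by
  by_cases h : Q ⊆ P
  · rw [liftSet_of_subset h]
  · rw [liftSet_of_not_subset h]
    exact closure_minimal (preimage_mono sdiff_subset) (hQ.preimage hβ)

theorem mem_liftSet_of_mem (h1 : β x ∈ Q) (h2 : β x ∉ P) : x ∈ liftSet β P Q := by
  rw [liftSet_of_not_subset fun h => h2 (h h1)]
  exact subset_closure ⟨h1, h2⟩

theorem eventually_mem_liftSet_iff (hβ : Continuous β) (hP : IsClosed P) (hQ : IsClosed Q)
    (hx : β x ∉ P) : ∀ᶠ q in 𝓝 x, q ∈ liftSet β P Q ↔ β q ∈ Q := by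
  filter_upwards [hβ.continuousAt.eventually (hP.isOpen_compl.mem_nhds hx)] with q hq
  exact ⟨fun h => liftSet_subset_preimage hβ hQ h, fun h => mem_liftSet_of_mem h hq⟩

/-- Adapted charts can be pulled back by local diffeomorphisms. -/
theorem IsLocalDiffeomorphAt.exists_adaptedNear (h : IsLocalDiffeomorphAt (QM n) (QM n) ∞ β x)
    {φ : OpenPartialHomeomorph M (EuclideanQuadrant n)} {I : Set (Fin n)}
    (hφ : AdaptedNear Q (β x) φ I) :
    ∃ ψ, AdaptedNear (β ⁻¹' Q) x ψ I ∧ x ∈ ψ.source ∧ ∀ q ∈ ψ.source, ψ q = φ (β q) := by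
  obtain ⟨ψ, hψ, hx, hm, he⟩ := h.exists_chart hφ.mem_maximalAtlas hφ.mem_source
  refine ⟨ψ, ⟨hψ, hx, ?_⟩, hx, he⟩
  filter_upwards [h.contMDiffAt.continuousAt.eventually hφ.mem_iff, ψ.open_source.mem_nhds hx]
    with q h1 h2
  rw [mem_preimage, h1, he q h2, he x hx]

theorem totalTransformAt_of_isLocalDiffeomorphAt (h : IsLocalDiffeomorphAt (QM n) (QM n) ∞ β x)
    {φ : OpenPartialHomeomorph M (EuclideanQuadrant n)} {I : Set (Fin n)}
    (hφ : AdaptedNear Q (β x) φ I) {Q' : Set X} (hQ' : ∀ᶠ q in 𝓝 x, q ∈ Q' ↔ β q ∈ Q) :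
    TotalTransformAt n β Q Q' (fun _ => 1) x := by
  obtain ⟨ψ, hψ, hx, he⟩ := h.exists_adaptedNear hφ
  refine ⟨Fin n, inferInstance, _, _, hφ.gensAt, (hψ.congr_set hQ').gensAt, fun l => ?_⟩
  filter_upwards [ψ.open_source.mem_nhds hx] with q hq
  by_cases hl : l ∈ I
  · simp only [adaptedFun_of_mem hl, he q hq, he x hx, one_mul]
  · simp only [adaptedFun_of_notMem hl, one_mul]

theorem exists_singleton_chart {p : M} {χ φ : OpenPartialHomeomorph M (EuclideanQuadrant n)}
    {l : Fin n} (hχ : AdaptedNear H p χ {l}) (hl : (χ p).1 l = 0)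
    (hφ : φ ∈ IsManifold.maximalAtlas (QM n) ∞ M) (hp : p ∈ φ.source) :
    ∃ j, (φ p).1 j = 0 ∧ AdaptedNear H p φ {j} := by
  obtain ⟨j, hj, he⟩ := exists_zero_iff hφ hχ.mem_maximalAtlas hp hχ.mem_source hl
  refine ⟨j, hj, hφ, hp, ?_⟩
  filter_upwards [he, hχ.mem_iff] with q h1 h2
  rw [h2]
  simp only [mem_singleton_iff, forall_eq, hl, hj, h1]

/-- Points where only the coordinate `ψ_i` has been increased. -/
theorem frequently_coord_pos_of_eq {ψ : OpenPartialHomeomorph X (EuclideanQuadrant n)}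
    (hx : x ∈ ψ.source) (i : Fin n) :
    ∃ᶠ q in 𝓝 x, 0 < (ψ q).1 i ∧ ∀ j ≠ i, (ψ q).1 j = (ψ x).1 j := by
  classical
  refine (frequently_coord_add hx (v := fun l => if l = i then 1 else 0)
    (fun l _ => by split_ifs <;> norm_num)).mono ?_
  rintro q ⟨-, ε, hε, he⟩
  refine ⟨?_, fun j hj => ?_⟩
  · rw [he i, if_pos rfl, mul_one]
    exact add_pos_of_nonneg_of_pos ((ψ x).2 i) hε
  · rw [he j, if_neg hj, mul_zero, add_zero]

/-- `Q` is open in `P`, so its preimage is locally the whole front face. -/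
theorem isHypersurfaceLike_preimage_of_eq (h : IsBlowup β P) (hQ : IsClosed Q) (hQP : Q ⊆ P)
    (hPQ : ∀ p ∈ Q, ∀ᶠ q in 𝓝 p, q ∈ P → q ∈ Q) :
    IsHypersurfaceLike (β ⁻¹' Q) := by
  refine ⟨hQ.preimage h.contMDiff.continuous, fun x hx => ?_⟩
  obtain ⟨φ, I, ψ, i, σ, a, hφ, hp⟩ := (h.projective x (hQP hx)).exists_projectiveAt
  refine ⟨ψ, i, ⟨hp.mem_maximalAtlas, hp.mem_source, ?_⟩, hp.eq_zero⟩
  filter_upwards [ψ.open_source.mem_nhds hp.mem_source,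
    h.contMDiff.continuous.continuousAt.eventually (hPQ _ hx)] with q h1 h2
  simp only [mem_singleton_iff, forall_eq, hp.eq_zero]
  rw [← hp.mem_iff hφ h1]
  exact ⟨fun h => hQP h, h2⟩

/-- Over `P`, let `H` be `φ_j = 0`. If `H ⊆ P`, then `P` is `H` near the point and the lift is the
front face `ψ_i = 0`; otherwise the lift is the sheet `ψ_j = 0` with `j ≠ i`. -/
theorem IsBlowup.isHypersurfaceLike_liftSet (h : IsBlowup β P) (hP : IsPSubmanifold P)
    (hH : IsHypersurfaceLike H) : IsHypersurfaceLike (liftSet β P H) := by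
  have hβ := h.contMDiff.continuous
  refine ⟨isClosed_liftSet hβ hH.1, fun x hx => ?_⟩
  have hxH : β x ∈ H := liftSet_subset_preimage hβ hH.1 hx
  obtain ⟨χ, l, hχ, hl⟩ := hH.2 _ hxH
  by_cases hxP : β x ∈ P
  swap
  · obtain ⟨ψ, hψ, hxψ, he⟩ := (h.isLocalDiffeomorphAt x hxP).exists_adaptedNear hχ
    refine ⟨ψ, l, hψ.congr_set (eventually_mem_liftSet_iff hβ hP.1 hH.1 hxP), ?_⟩
    rw [he x hxψ, hl]
  obtain ⟨φ, I, ψ, i, σ, a, hφ, hp⟩ := (h.projective x hxP).exists_projectiveAt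
  obtain ⟨j, hj, hφH⟩ := exists_singleton_chart hχ hl hφ.1 hφ.2.1
  have hHev : ∀ᶠ q in 𝓝 x, β q ∈ H ↔ (φ (β q)).1 j = 0 := by
    filter_upwards [hβ.continuousAt.eventually hφH.mem_iff] with q hq
    rw [hq]
    simp only [mem_singleton_iff, forall_eq, hj]
  have hsrc : ∀ᶠ q in 𝓝 x, q ∈ ψ.source := ψ.open_source.mem_nhds hp.mem_source
  by_cases hHP : H ⊆ P
  · have hIj : I ⊆ {j} := hφH.subset_of_subset hφ.adaptedNear
      (Filter.Eventually.of_forall fun q hq => hHP hq)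
    have hij : i = j := hIj hp.mem
    subst hij
    rw [liftSet_of_subset hHP]
    refine ⟨ψ, i, ⟨hp.mem_maximalAtlas, hp.mem_source, ?_⟩, hp.eq_zero⟩
    filter_upwards [hHev, hsrc] with q h1 h2
    simp only [mem_preimage, h1, mem_singleton_iff, forall_eq, hp.eq_zero]
    have h3 := hp.coord_self q h2
    rw [hj, sub_zero] at h3
    rw [h3, mul_eq_zero]
    exact or_iff_right hp.sign_ne_zero
  · rw [liftSet_of_not_subset hHP] at hx ⊢
    -- Off the front face `ψ_i ≠ 0`, so `φ_j ∘ β = 0` rules out `j = i` and leaves `ψ_j = 0`.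
    have hev : ∀ᶠ q in 𝓝 x, q ∈ β ⁻¹' (H \ P) → j ≠ i ∧ 0 < (ψ q).1 i ∧ (ψ q).1 j = 0 := by
      filter_upwards [hHev, hsrc] with q h1 h2 h3
      have h4 : (ψ q).1 i ≠ 0 := fun h0 => h3.2 ((hp.mem_iff hφ h2).2 h0)
      have h5 := h1.1 h3.1
      have hji : j ≠ i := by
        rintro rfl
        have h6 := hp.coord_self q h2
        rw [h5, hj, sub_zero] at h6
        exact mul_ne_zero hp.sign_ne_zero h4 h6.symm
      refine ⟨hji, lt_of_le_of_ne ((ψ q).2 i) h4.symm, ?_⟩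
      by_cases hjI : j ∈ I
      · have h6 := hp.coord_mem q h2 j hjI hji
        rw [h5, hj, sub_zero, (hp.translation j hjI hji).1 hj, sub_zero] at h6
        exact (mul_eq_zero.1 h6.symm).resolve_left h4
      · rw [← hp.coord_notMem q h2 j hjI, h5]
    obtain ⟨q₀, hq₀, hq₀'⟩ := ((mem_closure_iff_frequently.1 hx).and_eventually hev).exists
    have hji : j ≠ i := (hq₀' hq₀).1
    have hzero : ∀ q ∈ closure (β ⁻¹' (H \ P)), (∀ᶠ q' in 𝓝 q, q' ∈ β ⁻¹' (H \ P) →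
        j ≠ i ∧ 0 < (ψ q').1 i ∧ (ψ q').1 j = 0) → q ∈ ψ.source → (ψ q).1 j = 0 := by
      intro q hq hqev hqs
      have hc := (SmoothNear.coord hp.mem_maximalAtlas hqs j).continuousAt
      exact tendsto_nhds_unique_of_frequently_eq hc.tendsto tendsto_const_nhds
        (((mem_closure_iff_frequently.1 hq).and_eventually hqev).mono fun q' h => (h.2 h.1).2.2)
    have hxj : (ψ x).1 j = 0 := hzero x hx hev hp.mem_source
    refine ⟨ψ, j, ⟨hp.mem_maximalAtlas, hp.mem_source, ?_⟩, hxj⟩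
    filter_upwards [hsrc, hev.eventually_nhds, hsrc.eventually_nhds, hHev.eventually_nhds]
      with q h1 h2 h3 h4
    simp only [mem_singleton_iff, forall_eq, hxj]
    refine ⟨fun h => hzero q h h2 h1, fun hq0 => mem_closure_iff_frequently.2 ?_⟩
    refine ((frequently_coord_pos_of_eq h1 i).and_eventually (h3.and h4)).mono ?_
    rintro q' ⟨⟨e1, e2⟩, e3, e4⟩
    have e5 : (ψ q').1 j = 0 := by rw [e2 j hji, hq0]
    exact ⟨e4.2 ((hp.coord_eq_zero hji hxj).2 q' e3 e5),
      fun h => e1.ne' ((hp.mem_iff hφ e3).1 h)⟩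

/-- The lift of a p-submanifold that locally contains the centre of the blow-up. -/
theorem IsBlowup.exists_liftSet_coords (h : IsBlowup β P) (hP : IsPSubmanifold P)
    (hQ : IsPSubmanifold Q) (hQP : ¬ Q ⊆ P) (hxP : β x ∈ P) (hxQ : β x ∈ Q)
    (hPQ : ∀ᶠ q in 𝓝 (β x), q ∈ P → q ∈ Q) :
    (∃ ρ, PrincipalAt n β P ρ x ∧ MonomialAt n ρ x ∧ TotalTransformAt n β Q (liftSet β P Q) ρ x) ∧
      (x ∈ liftSet β P Q → ∃ (ψ : OpenPartialHomeomorph X (EuclideanQuadrant n)) (K : Set (Fin n)),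
        AdaptedNear (liftSet β P Q) x ψ K) := by
  classical
  have hβ := h.contMDiff.continuous
  obtain ⟨φQ, J, hφQ⟩ := hQ.exists_adaptedNear hxQ
  obtain ⟨φP, I, hφP⟩ := hP.exists_adaptedNear hxP
  -- Projective coordinates are taken for a chart adapted to both sets, so that the functions
  -- defining `Q` are among those defining `P`.
  obtain ⟨χ, K, hχP, hχQ, hKI⟩ := exists_joint_chart hφQ hφP hPQ
  obtain ⟨ψ, i, σ, a, hp⟩ := h.exists_projectiveAt hP hχP
  have hψc := fun l => SmoothNear.coord hp.mem_maximalAtlas hp.mem_source l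
  -- The quotients by `ψ_i` of the pulled-back functions defining `Q`; the one with index `i`, if it
  -- occurs, is the unit `σ`.
  let w : Fin n → X → ℝ := fun l q =>
    if l ∈ K then (if l = i then σ else (ψ q).1 l - a l) else 0
  have hwc : ∀ l q, q ∈ ψ.source → SmoothNear n (w l) q := by
    intro l q hq
    simp only [w]
    split_ifs
    · exact SmoothNear.const _
    · exact (SmoothNear.coord hp.mem_maximalAtlas hq l).sub (SmoothNear.const _)
    · exact SmoothNear.const _
  have hw : ∀ q ∈ ψ.source, ∀ l, adaptedFun χ K (β x) l (β q) = (ψ q).1 i * w l q := by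
    intro q hq l
    by_cases hl : l ∈ K
    · simp only [adaptedFun_of_mem hl, w, hl, if_true]
      by_cases hli : l = i
      · rw [if_pos hli, hli, hp.coord_self q hq, mul_comm]
      · rw [if_neg hli, hp.coord_mem q hq l (hKI hl) hli]
    · simp only [adaptedFun_of_notMem hl, w, hl, if_false, mul_zero]
  have hsrc : ∀ᶠ q in 𝓝 x, q ∈ ψ.source := ψ.open_source.mem_nhds hp.mem_source
  have hPev : ∀ᶠ q in 𝓝 x, β q ∈ P ↔ (ψ q).1 i = 0 := by
    have hg := (hp.principalAt hχP)
    filter_upwards [hsrc, hβ.continuousAt.eventually hχP.mem_iff] with q h1 h2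
    rw [h2]
    constructor
    · intro h3
      have h4 := hp.coord_self q h1
      rw [h3 i hp.mem, sub_self] at h4
      exact (mul_eq_zero.1 h4.symm).resolve_left hp.sign_ne_zero
    · intro h3 j hj
      by_cases hji : j = i
      · have h4 := hp.coord_self q h1
        rw [h3, mul_zero] at h4
        rw [hji]; linarith
      · have h4 := hp.coord_mem q h1 j hj hji
        rw [h3, zero_mul] at h4
        linarith
  have hQev : ∀ᶠ q in 𝓝 x, β q ∈ Q ↔ ∀ l, (ψ q).1 i * w l q = 0 := by
    filter_upwards [hsrc, hβ.continuousAt.eventually hχQ.gensAt.mem_iff] with q h1 h2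
    rw [h2]
    exact forall_congr' fun l => by rw [hw q h1 l]
  have hdiff : ∀ᶠ q in 𝓝 x, q ∈ β ⁻¹' (Q \ P) ↔ 0 < (ψ q).1 i ∧ ∀ l, w l q = 0 := by
    filter_upwards [hPev, hQev] with q h1 h2
    simp only [mem_preimage, mem_sdiff, h1, h2]
    constructor
    · rintro ⟨h3, h4⟩
      exact ⟨lt_of_le_of_ne ((ψ q).2 i) (Ne.symm h4),
        fun l => (mul_eq_zero.1 (h3 l)).resolve_left h4⟩
    · rintro ⟨h3, h4⟩
      exact ⟨fun l => by rw [h4 l, mul_zero], h3.ne'⟩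
  have hmem : ∀ᶠ q in 𝓝 x, q ∈ liftSet β P Q ↔ ∀ l, w l q = 0 := by
    rw [liftSet_of_not_subset hQP]
    filter_upwards [hdiff.eventually_nhds, hsrc] with q h1 h2
    constructor
    · intro hq l
      exact tendsto_nhds_unique_of_frequently_eq (hwc l q h2).continuousAt.tendsto
        tendsto_const_nhds (((mem_closure_iff_frequently.1 hq).and_eventually h1).mono
          fun q' h => (h.2.1 h.1).2 l)
    · intro hq
      refine mem_closure_iff_frequently.2
        (((frequently_coord_pos_of_eq h2 i).and_eventually h1).mono ?_)
      rintro q' ⟨⟨e1, e2⟩, e3⟩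
      refine e3.2 ⟨e1, fun l => ?_⟩
      have e4 := hq l
      simp only [w] at e4 ⊢
      by_cases hl : l ∈ K
      · by_cases hli : l = i
        · simp only [hli, if_true] at e4 ⊢
          simp only [hli ▸ hl, if_true] at e4
          exact absurd e4 hp.sign_ne_zero
        · simp only [hl, hli, if_true, if_false] at e4 ⊢
          rw [e2 l hli, e4]
      · simp only [hl, if_false]
  have hadapt : (∀ l, w l x = 0) → AdaptedNear (liftSet β P Q) x ψ K ∧
      adaptedFun ψ K x = w := by
    intro h0
    -- At a point of the lift the unit `σ` cannot occur among the quotients, so these are centred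
    -- coordinates of `ψ` itself.
    have hiK : ∀ l ∈ K, l ≠ i := by
      rintro l hl rfl
      have := h0 l
      simp only [w, hl, if_true] at this
      exact hp.sign_ne_zero this
    have ha : ∀ l ∈ K, (ψ x).1 l = a l := by
      intro l hl
      have := h0 l
      simp only [w, hl, hiK l hl, if_true, if_false] at this
      linarith
    have he : adaptedFun ψ K x = w := by
      funext l q
      by_cases hl : l ∈ K
      · simp only [adaptedFun_of_mem hl, w, hl, hiK l hl, if_true, if_false, ha l hl]
      · simp only [adaptedFun_of_notMem hl, w, hl, if_false]
    refine ⟨⟨hp.mem_maximalAtlas, hp.mem_source, ?_⟩, he⟩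
    filter_upwards [hmem] with q hq
    rw [hq, ← he]
    refine ⟨fun h1 l hl => ?_, fun h1 l => ?_⟩
    · have := h1 l
      simp only [adaptedFun_of_mem hl] at this
      linarith
    · by_cases hl : l ∈ K
      · simp only [adaptedFun_of_mem hl, h1 l hl, sub_self]
      · simp only [adaptedFun_of_notMem hl]
  refine ⟨⟨fun q => (ψ q).1 i, hp.principalAt hχP,
    MonomialAt.coord hp.mem_maximalAtlas hp.mem_source i, Fin n, inferInstance, _, w, hχQ.gensAt,
    ?_, fun l => hsrc.mono fun q hq => hw q hq l⟩, fun hx => ⟨ψ, K, (hadapt ?_).1⟩⟩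
  · by_cases h0 : ∀ l, w l x = 0
    · rw [← (hadapt h0).2]
      exact (hadapt h0).1.gensAt
    -- Here some quotient is a unit and the lift is empty near `x`.
    · obtain ⟨l, hl⟩ := not_forall.1 h0
      refine GensAt.of_unit ?_ (fun l => hwc l x hp.mem_source) hl
      filter_upwards [hmem, (hwc l x hp.mem_source).eventually_ne hl] with q h1 h2 h3
      exact h2 (h1.1 h3 l)
  · exact hmem.self_of_nhds.1 hx

/-- The total transform of the centre of the blow-up is the exceptional divisor. -/
theorem PrincipalAt.totalTransformAt_empty {ρ : X → ℝ} (h : PrincipalAt n β P ρ x)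
    (hβ : SmoothMapNear n β x) (hρ : RegularAt ρ x) (hP : IsPSubmanifold P) (hx : β x ∈ P) :
    TotalTransformAt n β P ∅ ρ x := by
  obtain ⟨φ, I, hφ⟩ := hP.exists_adaptedNear hx
  obtain ⟨w, hw, ⟨l, hl⟩, he⟩ := h.exists_gens hβ hρ hφ.gensAt
  exact ⟨Fin n, inferInstance, _, w, hφ.gensAt,
    GensAt.of_unit (Filter.Eventually.of_forall fun _ h => h) hw hl, he⟩

/-- The total transform with respect to any exceptional function. -/
theorem IsBlowup.totalTransformAt_liftSet (h : IsBlowup β P) (hP : IsPSubmanifold P)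
    (hQ : IsPSubmanifold Q) (hQP : ¬ Q ⊆ P) (hxP : β x ∈ P) (hxQ : β x ∈ Q)
    (hPQ : ∀ᶠ q in 𝓝 (β x), q ∈ P → q ∈ Q) {ρ : X → ℝ} (hρ : PrincipalAt n β P ρ x)
    (hρm : MonomialAt n ρ x) : TotalTransformAt n β Q (liftSet β P Q) ρ x := by
  obtain ⟨⟨ρ', h1, h2, h3⟩, -⟩ := h.exists_liftSet_coords hP hQ hQP hxP hxQ hPQ
  obtain ⟨u, hu, hu0, he⟩ := hρ.exists_eq_unit_mul h1 hρm.regularAt hρm.smoothNear h2.smoothNear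
  exact h3.unit_mul hu hu0 he

/-- The ideal is generated by one boundary coordinate, which the map pulls back to a monomial.
Hypersurfaces therefore impose no further condition on maps that preserve monomials. -/
theorem IsHypersurfaceLike.principalMonomialAt {Z : CornerManifold.{u} n}
    (hH : IsHypersurfaceLike H) {g : Z → M} {z : Z} (hg : SmoothMapNear n g z)
    (hb : LocalBMapAt n g z) : PrincipalMonomialAt n g H z := by
  by_cases hz : g z ∈ H
  · obtain ⟨φ, l, hφ, hl⟩ := hH.2 _ hz
    refine ⟨_, hb _ (MonomialAt.coord hφ.mem_maximalAtlas hφ.mem_source l), ?_⟩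
    refine PrincipalAt.of_gens hg hφ.gensAt (w := fun j _ => if j = l then 1 else 0)
      (fun j => SmoothNear.const _) ⟨l, by simp⟩ fun j => Filter.Eventually.of_forall fun q => ?_
    by_cases hj : j = l
    · rw [hj]
      simp only [adaptedFun_of_mem (mem_singleton l), hl, sub_zero, if_true, mul_one]
    · simp only [adaptedFun_of_notMem (fun h => hj (mem_singleton_iff.1 h)), hj, if_false,
        mul_zero]
  · exact PrincipalMonomialAt.of_not_mem (hH.1.isOpen_compl.mem_nhds hz) hg

/-- The blow-up of a boundary hypersurface is a diffeomorphism. -/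
theorem IsBlowup.exists_diffeomorph_of_isHypersurfaceLike (h : IsBlowup β H)
    (hH : IsHypersurfaceLike H) : ∃ Φ : Diffeomorph (QM n) (QM n) X M ∞, ∀ x, Φ x = β x := by
  -- The ideal of `H` is already principal and monomial on `M`, so the identity lifts and inverts
  -- `β`.
  obtain ⟨G, hG, hGe, -⟩ := h.exists_lift hH.isPSubmanifold contMDiff_id fun p =>
    hH.principalMonomialAt (contMDiff_id.smoothMapNear p) fun _ ht => ht
  have h1 : G ∘ β = id := h.eq_of_comp_eq hH.isPSubmanifold h.contMDiff
    (h.principalMonomialAt hH.1) (hG.continuous.comp h.contMDiff.continuous) continuous_id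
    (by rw [← Function.comp_assoc, hGe, Function.id_comp]) rfl
  exact ⟨⟨⟨β, G, congrFun h1, congrFun hGe⟩, h.contMDiff, hG⟩, fun x => rfl⟩

/-- The blow-down map is a b-map. -/
theorem IsBlowup.localBMapAt (h : IsBlowup β P) (x : X) : LocalBMapAt n β x := by
  have hs := h.contMDiff.smoothMapNear x
  by_cases hx : β x ∈ P
  · obtain ⟨φ, I, ψ, i, σ, a, hφ, hp⟩ := (h.projective x hx).exists_projectiveAt
    refine LocalBMapAt.of_coord hs hφ.1 hφ.2.1 fun j => ?_
    have hsrc : ∀ᶠ q in 𝓝 x, q ∈ ψ.source := ψ.open_source.mem_nhds hp.mem_source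
    have hmon := fun l => MonomialAt.coord hp.mem_maximalAtlas hp.mem_source l
    by_cases h0 : (φ (β x)).1 j = 0
    swap
    · exact MonomialAt.of_pos ((SmoothNear.coord hφ.1 hφ.2.1 j).comp hs)
        (lt_of_le_of_ne ((φ (β x)).2 j) (Ne.symm h0))
    by_cases hj : j ∈ I
    · by_cases hji : j = i
      · subst hji
        -- `ψ_j` can increase from zero; with the sign `-1` this would make the boundary coordinate
        -- `φ_j` negative.
        have hσ : σ = 1 := by
          rcases hp.sign with h1 | h1
          · exact h1
          · exfalso
            obtain ⟨q, ⟨h2, -⟩, h3⟩ :=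
              ((frequently_coord_pos_of_eq hp.mem_source j).and_eventually hsrc).exists
            have h4 := hp.coord_self q h3
            rw [h1, h0] at h4
            have h5 := (φ (β q)).2 j
            linarith
        refine (hmon j).congr ?_
        filter_upwards [hsrc] with q hq
        have h4 := hp.coord_self q hq
        rwa [hσ, one_mul, h0, sub_zero] at h4
      · refine ((hmon i).mul (hmon j)).congr ?_
        filter_upwards [hsrc] with q hq
        have h4 := hp.coord_mem q hq j hj hji
        rwa [h0, sub_zero, (hp.translation j hj hji).1 h0, sub_zero] at h4
    · exact (hmon j).congr (hsrc.mono fun q hq => hp.coord_notMem q hq j hj)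
  · have hc := IsManifold.chart_mem_maximalAtlas (I := QM n) (n := ∞) (β x)
    obtain ⟨ψ, hψ, hxψ, -, he⟩ := (h.isLocalDiffeomorphAt x hx).exists_chart hc
      (mem_chart_source _ _)
    refine LocalBMapAt.of_coord hs hc (mem_chart_source _ _) fun j => ?_
    refine (MonomialAt.coord hψ hxψ j).congr ?_
    filter_upwards [ψ.open_source.mem_nhds hxψ] with q hq
    rw [he q hq]

end LiftSet

/-! ### Lists of centres that can be blown up successively. -/

section GoodLists

variable {n : ℕ} {M X : CornerManifold.{u} n} {P Q : Set M} {β : X → M} {b : Bool}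
  {L : List (Set M × Bool)}

/-- Lists of p-submanifolds which can be blown up in the given order. The tag `true` marks centres
that are boundary hypersurfaces, the blow-up of which has no effect. -/
structure IsGoodList (L : List (Set M × Bool)) : Prop where
  isPSubmanifold : ∀ x ∈ L, IsPSubmanifold x.1
  isHypersurfaceLike : ∀ x ∈ L, x.2 = true → IsHypersurfaceLike x.1
  clean : ∀ (i j : ℕ) (P Q : Set M), i < j → L[i]? = some (P, false) → L[j]? = some (Q, false) →
    ∀ p ∈ P ∩ Q, ∃ k ≤ i, ∃ R : Set M, L[k]? = some (R, false) ∧ CleanAt n R P Q p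
  subset_closure : ∀ (i j : ℕ) (P Q : Set M), i < j → L[i]? = some (P, true) →
    L[j]? = some (Q, false) → Q ⊆ closure (Q \ P)

open Classical in
/-- The lift of a tagged set. -/
noncomputable def liftTagged (β : X → M) (P : Set M) (x : Set M × Bool) : Set X × Bool :=
  (liftSet β P x.1, x.2 || decide (x.1 ⊆ P))

theorem liftTagged_snd_eq_false {x : Set M × Bool} :
    (liftTagged β P x).2 = false ↔ x.2 = false ∧ ¬ x.1 ⊆ P := by
  simp [liftTagged]

theorem getElem?_map_liftTagged_eq_false {i : ℕ} {Q' : Set X}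
    (h : (L.map (liftTagged β P))[i]? = some (Q', false)) :
    ∃ Q, L[i]? = some (Q, false) ∧ ¬ Q ⊆ P ∧ Q' = liftSet β P Q := by
  rw [List.getElem?_map, Option.map_eq_some_iff] at h
  obtain ⟨⟨Q, c⟩, h1, h2⟩ := h
  have h3 := liftTagged_snd_eq_false.1 (congrArg Prod.snd h2)
  exact ⟨Q, by rw [h1, ← h3.1], h3.2, (congrArg Prod.fst h2).symm⟩

namespace IsGoodList

/-- The clean intersection of the head with `Q` must not occur later than the head, so it is the
head itself. -/
theorem head_subset (h : IsGoodList ((P, false) :: L)) (hQ : (Q, false) ∈ L) {p : M} (hp : p ∈ P)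
    (hpQ : p ∈ Q) : ∀ᶠ q in 𝓝 p, q ∈ P → q ∈ Q := by
  obtain ⟨j, hj⟩ := List.mem_iff_getElem?.1 hQ
  obtain ⟨k, hk, R, hR, hc⟩ := h.clean 0 (j + 1) P Q (Nat.succ_pos j) rfl
    (by rw [List.getElem?_cons_succ]; exact hj) p ⟨hp, hpQ⟩
  obtain rfl : k = 0 := Nat.le_zero.1 hk
  have hRP : P = R := congrArg Prod.fst (Option.some.inj hR)
  subst hRP
  exact hc.1.mono fun q hq h => (hq.1 h).2

theorem subset_closure_head (h : IsGoodList ((P, true) :: L)) (hQ : (Q, false) ∈ L) :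
    Q ⊆ closure (Q \ P) := by
  obtain ⟨j, hj⟩ := List.mem_iff_getElem?.1 hQ
  exact h.subset_closure 0 (j + 1) P Q (Nat.succ_pos j) rfl
    (by rw [List.getElem?_cons_succ]; exact hj)

theorem not_subset_head (h : IsGoodList ((P, true) :: L)) (hQ : (Q, false) ∈ L) {p : M}
    (hp : p ∈ Q) : ¬ Q ⊆ P := fun hQP => by
  have h1 := h.subset_closure_head hQ hp
  rw [sdiff_eq_empty.2 hQP, closure_empty] at h1
  exact h1

theorem psub_head (h : IsGoodList ((P, b) :: L)) : IsPSubmanifold P :=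
  h.isPSubmanifold _ List.mem_cons_self

theorem psub_tail (h : IsGoodList ((P, b) :: L)) {c : Bool} (hQ : (Q, c) ∈ L) : IsPSubmanifold Q :=
  h.isPSubmanifold _ (List.mem_cons_of_mem _ hQ)

/-- Blowing up a tagged centre is a diffeomorphism. Because `Q \ P` is dense in `Q`, taking the
closure in the definition of the lift loses nothing. -/
theorem eventually_mem_liftSet_of_tagged (h : IsGoodList ((P, true) :: L)) (hβ : IsBlowup β P)
    (hQ : (Q, false) ∈ L) (q : X) : q ∈ liftSet β P Q ↔ β q ∈ Q := by
  have hQc := (h.psub_tail hQ).1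
  obtain ⟨Φ, hΦ⟩ := hβ.exists_diffeomorph_of_isHypersurfaceLike
    (h.isHypersurfaceLike _ List.mem_cons_self rfl)
  refine ⟨fun hq => liftSet_subset_preimage hβ.contMDiff.continuous hQc hq, fun hq => ?_⟩
  rw [liftSet_of_not_subset (h.not_subset_head hQ hq)]
  have h1 : β = Φ.toHomeomorph := funext fun x => (hΦ x).symm
  rw [h1, ← Φ.toHomeomorph.preimage_closure, mem_preimage, ← h1]
  exact h.subset_closure_head hQ hq

theorem isLocalDiffeomorphAt_of_tagged (h : IsGoodList ((P, true) :: L)) (hβ : IsBlowup β P)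
    (x : X) : IsLocalDiffeomorphAt (QM n) (QM n) ∞ β x := by
  obtain ⟨Φ, hΦ⟩ := hβ.exists_diffeomorph_of_isHypersurfaceLike
    (h.isHypersurfaceLike _ List.mem_cons_self rfl)
  have h1 : β = Φ := funext fun x => (hΦ x).symm
  rw [h1]
  exact Φ.isLocalDiffeomorph x

/-- Off the untagged centres, the blow-down map is a local diffeomorphism, and lifts are
preimages. -/
theorem eventually_mem_liftSet (h : IsGoodList ((P, b) :: L)) (hβ : IsBlowup β P)
    (hQ : (Q, false) ∈ L) {x : X} (hx : ¬ (b = false ∧ β x ∈ P)) :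
    IsLocalDiffeomorphAt (QM n) (QM n) ∞ β x ∧ ∀ᶠ q in 𝓝 x, q ∈ liftSet β P Q ↔ β q ∈ Q := by
  cases b with
  | true => exact ⟨h.isLocalDiffeomorphAt_of_tagged hβ x,
      Filter.Eventually.of_forall (h.eventually_mem_liftSet_of_tagged hβ hQ)⟩
  | false =>
    have hx' : β x ∉ P := fun hP => hx ⟨rfl, hP⟩
    exact ⟨hβ.isLocalDiffeomorphAt x hx', eventually_mem_liftSet_iff hβ.contMDiff.continuous
      h.psub_head.1 (h.psub_tail hQ).1 hx'⟩

/-- There is one function that is the exceptional factor of the total transforms of all untagged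
centres. -/
theorem exists_totalTransformAt (h : IsGoodList ((P, b) :: L)) (hβ : IsBlowup β P) (x : X) :
    ∃ ρ, MonomialAt n ρ x ∧ (b = false → β x ∈ P → PrincipalAt n β P ρ x) ∧
      ∀ Q, (Q, false) ∈ L → ¬ Q ⊆ P → β x ∈ Q → TotalTransformAt n β Q (liftSet β P Q) ρ x := by
  by_cases hx : b = false ∧ β x ∈ P
  · obtain ⟨rfl, hxP⟩ := hx
    obtain ⟨ρ, hρ, hp⟩ := hβ.principalMonomialAt h.psub_head.1 x
    exact ⟨ρ, hρ, fun _ _ => hp, fun Q hQ hQP hxQ => hβ.totalTransformAt_liftSet h.psub_head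
      (h.psub_tail hQ) hQP hxP hxQ (h.head_subset hQ hxP hxQ) hp hρ⟩
  · refine ⟨fun _ => 1, MonomialAt.of_pos (SmoothNear.const 1) one_pos,
      fun h1 h2 => absurd ⟨h1, h2⟩ hx, fun Q hQ _ hxQ => ?_⟩
    obtain ⟨φ, I, hφ⟩ := (h.psub_tail hQ).exists_adaptedNear hxQ
    obtain ⟨h1, h2⟩ := h.eventually_mem_liftSet hβ hQ hx
    exact totalTransformAt_of_isLocalDiffeomorphAt h1 hφ h2

theorem isPSubmanifold_liftSet (h : IsGoodList ((P, b) :: L)) (hβ : IsBlowup β P)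
    (hQ : (Q, false) ∈ L) (hQP : ¬ Q ⊆ P) : IsPSubmanifold (liftSet β P Q) := by
  have hc := hβ.contMDiff.continuous
  refine isPSubmanifold_of_adaptedNear (isClosed_liftSet hc (h.psub_tail hQ).1) fun x hx => ?_
  have hxQ : β x ∈ Q := liftSet_subset_preimage hc (h.psub_tail hQ).1 hx
  by_cases hxb : b = false ∧ β x ∈ P
  · obtain ⟨rfl, hxP⟩ := hxb
    exact (hβ.exists_liftSet_coords h.psub_head (h.psub_tail hQ) hQP hxP hxQ
      (h.head_subset hQ hxP hxQ)).2 hx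
  · obtain ⟨φ, I, hφ⟩ := (h.psub_tail hQ).exists_adaptedNear hxQ
    obtain ⟨h1, h2⟩ := h.eventually_mem_liftSet hβ hQ hxb
    obtain ⟨ψ, hψ, -⟩ := h1.exists_adaptedNear hφ
    exact ⟨ψ, I, hψ.congr_set h2⟩

/-- A centre gets its tag when it is contained in the head. For an untagged head, it also contains
the head near each of its points, so its preimage is part of the front face; for a tagged head, an
untagged `Q ⊆ P` is empty. -/
theorem isHypersurfaceLike_liftSet (h : IsGoodList ((P, b) :: L)) (hβ : IsBlowup β P) {c : Bool}
    (hQ : (Q, c) ∈ L) (hc : c = true ∨ Q ⊆ P) : IsHypersurfaceLike (liftSet β P Q) := by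
  cases c with
  | true =>
    exact hβ.isHypersurfaceLike_liftSet h.psub_head
      (h.isHypersurfaceLike _ (List.mem_cons_of_mem _ hQ) rfl)
  | false =>
    have hQP : Q ⊆ P := hc.resolve_left (by simp)
    rw [liftSet_of_subset hQP]
    cases b with
    | true => exact isHypersurfaceLike_preimage_of_eq hβ (h.psub_tail hQ).1 hQP fun p hp =>
        absurd hQP (h.not_subset_head hQ hp)
    | false => exact isHypersurfaceLike_preimage_of_eq hβ (h.psub_tail hQ).1 hQP fun p hp =>
        h.head_subset hQ (hQP hp) hp

/-- The lifts of a good list form a good list. -/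
theorem lift (h : IsGoodList ((P, b) :: L)) (hβ : IsBlowup β P) :
    IsGoodList (L.map (liftTagged β P)) where
  isPSubmanifold := by
    intro x hx
    obtain ⟨⟨Q, c⟩, hQ, rfl⟩ := List.mem_map.1 hx
    by_cases hc : c = true ∨ Q ⊆ P
    · exact (h.isHypersurfaceLike_liftSet hβ hQ hc).isPSubmanifold
    · rw [not_or, Bool.not_eq_true] at hc
      rw [hc.1] at hQ
      exact h.isPSubmanifold_liftSet hβ hQ hc.2
  isHypersurfaceLike := by
    intro x hx hx2
    obtain ⟨⟨Q, c⟩, hQ, rfl⟩ := List.mem_map.1 hx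
    refine h.isHypersurfaceLike_liftSet hβ hQ ?_
    simpa [liftTagged] using hx2
  clean := by
    intro i j P' Q' hij hP' hQ' x hx
    obtain ⟨A, hA, hAP, rfl⟩ := getElem?_map_liftTagged_eq_false hP'
    obtain ⟨B, hB, hBP, rfl⟩ := getElem?_map_liftTagged_eq_false hQ'
    have hAL := List.mem_of_getElem? hA
    have hBL := List.mem_of_getElem? hB
    have hc := hβ.contMDiff.continuous
    have hxA : β x ∈ A := liftSet_subset_preimage hc (h.psub_tail hAL).1 hx.1
    have hxB : β x ∈ B := liftSet_subset_preimage hc (h.psub_tail hBL).1 hx.2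
    obtain ⟨k, hk, R, hR, hclean⟩ := h.clean (i + 1) (j + 1) A B (Nat.succ_lt_succ hij)
      (by rw [List.getElem?_cons_succ]; exact hA) (by rw [List.getElem?_cons_succ]; exact hB)
      (β x) ⟨hxA, hxB⟩
    have hxR : β x ∈ R := hclean.1.self_of_nhds.2 ⟨hxA, hxB⟩
    obtain ⟨ρ, hρ, hρP, hρT⟩ := h.exists_totalTransformAt hβ x
    have hTA := hρT A hAL hAP hxA
    have hTB := hρT B hBL hBP hxB
    have hs := hβ.contMDiff.smoothMapNear x
    -- If the centre itself is the clean intersection of `A` and `B`, its ideal divided by `ρ` is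
    -- the unit ideal, so the lifts of `A` and `B` cannot meet at `x`.
    have hbad : b = false → β x ∈ P → CleanAt n P A B (β x) → False := by
      intro hb hxP hcl
      have h1 := hcl.totalTransform hs hρ.regularAt ((hρP hb hxP).totalTransformAt_empty hs
        hρ.regularAt h.psub_head hxP) hTA hTB
      exact h1.1.self_of_nhds.2 hx
    cases k with
    | zero =>
      have h1 := Option.some.inj hR
      have h2 : P = R := congrArg Prod.fst h1
      have h3 : b = false := congrArg Prod.snd h1
      subst h2
      exact (hbad h3 hxR hclean).elim
    | succ k =>
      rw [List.getElem?_cons_succ] at hR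
      have hRL := List.mem_of_getElem? hR
      -- If `R ⊆ P`, then `R` and `P` agree near `β x` by `head_subset`, and the intersection is
      -- again the centre. Otherwise `R` lifts to an untagged member at the shifted index.
      by_cases hRP : R ⊆ P
      · cases b with
        | true => exact absurd hRP (h.not_subset_head hRL hxR)
        | false =>
          refine (hbad rfl (hRP hxR) ⟨?_, fun k hk => hclean.2 k ?_⟩).elim
          · filter_upwards [hclean.1, h.head_subset hRL (hRP hxR) hxR] with q h1 h2
            exact ⟨fun h => h1.1 (h2 h), fun h => hRP (h1.2 h)⟩
          · exact hk.congr_set (Filter.Eventually.of_forall fun q hq => hRP hq)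
      · refine ⟨k, Nat.le_of_succ_le_succ hk, liftSet β P R, ?_, hclean.totalTransform hs
          hρ.regularAt (hρT R hRL hRP hxR) hTA hTB⟩
        rw [List.getElem?_map, hR, Option.map_some]
        exact congrArg some (Prod.ext rfl (liftTagged_snd_eq_false.2 ⟨rfl, hRP⟩))
  subset_closure := by
    intro i j P' Q' hij hP' hQ'
    obtain ⟨B, hB, hBP, rfl⟩ := getElem?_map_liftTagged_eq_false hQ'
    rw [List.getElem?_map, Option.map_eq_some_iff] at hP'
    obtain ⟨⟨A, c⟩, hA, hAe⟩ := hP'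
    obtain rfl : liftSet β P A = P' := congrArg Prod.fst hAe
    have hAL := List.mem_of_getElem? hA
    have hc := hβ.contMDiff.continuous
    have hAc := (h.psub_tail hAL).1
    -- The lift of `B` is the closure of its part off `P`, where `β` is a local diffeomorphism and
    -- density carries over.
    suffices h1 : β ⁻¹' (B \ P) ⊆ closure (liftSet β P B \ liftSet β P A) by
      conv_lhs => rw [liftSet_of_not_subset hBP]
      exact closure_minimal h1 isClosed_closure
    rintro x ⟨hxB, hxP⟩
    have hxB' : x ∈ liftSet β P B := mem_liftSet_of_mem hxB hxP
    by_cases hxA : β x ∈ A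
    swap
    · exact _root_.subset_closure ⟨hxB', fun h => hxA (liftSet_subset_preimage hc hAc h)⟩
    have hct : c = true := by
      by_contra hcf
      rw [Bool.not_eq_true] at hcf
      have h2 : (liftTagged β P (A, c)).2 ≠ false := by rw [hAe]; simp
      refine h2 (liftTagged_snd_eq_false.2 ⟨hcf, fun hAP => hxP (hAP hxA)⟩)
    subst hct
    have h2 : β x ∈ closure (B \ A) := h.subset_closure (i + 1) (j + 1) A B (Nat.succ_lt_succ hij)
      (by rw [List.getElem?_cons_succ]; exact hA) (by rw [List.getElem?_cons_succ]; exact hB) hxB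
    obtain ⟨Φ, hΦx, hΦ⟩ := hβ.isLocalDiffeomorphAt x hxP
    let Φ' : OpenPartialHomeomorph X M := Φ.toOpenPartialHomeomorph
    have hΦ' : ∀ q ∈ Φ'.source, Φ' q = β q := fun q hq => (hΦ hq).symm
    have hxt : β x ∈ Φ'.target := by rw [← hΦ' x hΦx]; exact Φ'.map_source hΦx
    have hsymm : Φ'.symm (β x) = x := by rw [← hΦ' x hΦx, Φ'.left_inv hΦx]
    have hcs : ContinuousAt Φ'.symm (β x) := Φ'.continuousAt_symm hxt
    have h3 := (mem_closure_iff_frequently.1 h2).and_eventually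
      (Filter.Eventually.and (Φ'.open_target.mem_nhds hxt)
        (h.psub_head.1.isOpen_compl.mem_nhds hxP))
    refine mem_closure_iff_frequently.2 ?_
    have h4 := hcs.frequently (p := fun q => q ∈ liftSet β P B \ liftSet β P A) (h3.mono ?_)
    · rwa [hsymm] at h4
    rintro q ⟨⟨hqB, hqA⟩, hqt, hqP⟩
    have h5 : β (Φ'.symm q) = q := by rw [← hΦ' _ (Φ'.map_target hqt), Φ'.right_inv hqt]
    exact ⟨mem_liftSet_of_mem (by rw [h5]; exact hqB) (by rw [h5]; exact hqP),
      fun h => hqA (by rw [← h5]; exact liftSet_subset_preimage hc hAc h)⟩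

end IsGoodList

/-- A clean family in a size order is a good list. -/
theorem IsSizeOrder.isGoodList {F : Set (Set M)} {L : List (Set M)} (hF : IsCleanFamily F)
    (hL : IsSizeOrder F L) : IsGoodList (L.map fun P => (P, false)) where
  isPSubmanifold := by
    intro x hx
    obtain ⟨P, hP, rfl⟩ := List.mem_map.1 hx
    exact hF.isPSubmanifold P ((hL.mem_iff P).1 hP)
  isHypersurfaceLike := by
    intro x hx hx2
    obtain ⟨P, hP, rfl⟩ := List.mem_map.1 hx
    exact absurd hx2 (by simp)
  clean := by
    intro i j P Q hij hP hQ p hp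
    have h1 : ∀ {i : ℕ} {P}, (L.map fun P => (P, false))[i]? = some (P, false) →
        L[i]? = some P := by
      intro i P h
      rw [List.getElem?_map, Option.map_eq_some_iff] at h
      obtain ⟨P', h1, h2⟩ := h
      rw [h1, show P' = P from congrArg Prod.fst h2]
    have hP' := h1 hP
    have hQ' := h1 hQ
    have hPF := (hL.mem_iff P).1 (List.mem_of_getElem? hP')
    have hQF := (hL.mem_iff Q).1 (List.mem_of_getElem? hQ')
    have hR := (hL.mem_iff _).2 (hF.interClosed P hPF Q hQF ⟨p, hp⟩)
    obtain ⟨k, hk⟩ := List.mem_iff_getElem?.1 hR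
    refine ⟨k, ?_, P ∩ Q, by rw [List.getElem?_map, hk]; rfl,
      IntersectCleanly.cleanAt (hF.isPSubmanifold P hPF) (hF.isPSubmanifold Q hQF)
        (hF.clean P hPF Q hQF) hp⟩
    -- If `P ∩ Q` came after `P`, the size order would force `P ∩ Q = P`, and then one set would
    -- occur at two indices.
    by_contra hki
    rw [not_le] at hki
    obtain ⟨hi, hiP⟩ := List.getElem?_eq_some_iff.1 hP'
    obtain ⟨hk', hkR⟩ := List.getElem?_eq_some_iff.1 hk
    have h2 := List.pairwise_iff_getElem.1 hL.pairwise i k hi hk' hki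
    rw [hiP, hkR] at h2
    have h3 : P ∩ Q = P := by
      by_contra hne
      exact h2 (inter_subset_left.ssubset_of_ne hne)
    have h4 := (List.Nodup.getElem_inj_iff hL.nodup (hi := hk') (hj := hi)).1
      (by rw [hiP, hkR, h3])
    exact hki.ne' h4
  subset_closure := by
    intro i j P Q _ hP
    rw [List.getElem?_map, Option.map_eq_some_iff] at hP
    obtain ⟨P', -, h2⟩ := hP
    exact absurd (congrArg Prod.snd h2) (by simp)

end GoodLists

/-! ### The universal property of iterated blow-ups. -/

section IteratedBlowups

variable {n : ℕ} {M X Y Z : CornerManifold.{u} n} {P : Set M} {b : Bool} {F : Set (Set M)}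

/-- Maps lifted to the blow-up of the first centre pull the lifts of the other centres back to
principal monomial ideals. -/
theorem IsGoodList.principalMonomialAt_lift {β : X → M} {T : List (Set M × Bool)}
    (h : IsGoodList ((P, b) :: T)) (hβ : IsBlowup β P) {G : Z → X}
    (hG : ContMDiff (QM n) (QM n) ∞ G) (hb : ∀ z, LocalBMapAt n G z)
    (hp : ∀ Q ∈ T, ∀ z, PrincipalMonomialAt n (β ∘ G) Q.1 z) :
    ∀ Q ∈ T.map (liftTagged β P), ∀ z, PrincipalMonomialAt n G Q.1 z := by
  intro Q' hQ' z
  have hGz := hG.smoothMapNear z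
  cases hc : Q'.2 with
  | true => exact ((h.lift hβ).isHypersurfaceLike Q' hQ' hc).principalMonomialAt hGz (hb z)
  | false =>
    obtain ⟨⟨Q, c⟩, hQ, rfl⟩ := List.mem_map.1 hQ'
    obtain ⟨h1, hQP⟩ := liftTagged_snd_eq_false.1 hc
    obtain rfl : c = false := h1
    by_cases hz : β (G z) ∈ Q
    · obtain ⟨ρ, hρ, -, hT⟩ := h.exists_totalTransformAt hβ (G z)
      exact (hT Q hQ hQP hz).principalMonomialAt hρ (hβ.contMDiff.smoothMapNear _) hGz (hb z)
        (hp _ hQ z)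
    · have hQc := (h.psub_tail hQ).1
      refine PrincipalMonomialAt.of_not_mem
        ((isClosed_liftSet hβ.contMDiff.continuous hQc).isOpen_compl.mem_nhds fun hm => hz ?_) hGz
      exact liftSet_subset_preimage hβ.contMDiff.continuous hQc hm

theorem map_fst_map_liftTagged (β : X → M) (P : Set M) (T : List (Set M × Bool)) :
    (T.map (liftTagged β P)).map Prod.fst = (T.map Prod.fst).map (liftSet β P) := by
  rw [List.map_map, List.map_map]
  rfl

/-- The centres of a good list can be blown up successively. -/
theorem IsGoodList.exists_isIteratedBlowup (T : List (Set M × Bool)) (h : IsGoodList T) :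
    ∃ (X : CornerManifold.{u} n) (β : X → M), IsIteratedBlowup M (T.map Prod.fst) X β := by
  -- The lifted list lives in another manifold, so the induction runs over the length with `M`
  -- variable.
  induction hk : T.length generalizing M with
  | zero =>
    rw [List.length_eq_zero_iff.1 hk]
    exact ⟨M, id, .nil M⟩
  | succ k ih =>
    obtain ⟨⟨P, b⟩, T, rfl⟩ := List.exists_cons_of_length_eq_add_one hk
    obtain ⟨Y, β, hβ⟩ := h.psub_head.exists_isBlowup
    obtain ⟨X, γ, hγ⟩ := ih _ (h.lift hβ) (by simpa using hk)
    rw [map_fst_map_liftTagged] at hγ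
    exact ⟨X, β ∘ γ, .cons h.psub_head hβ hγ⟩

/-- The blow-down map of an iterated blow-up pulls monomials back to monomials and the ideals of
all centres back to principal monomial ideals. -/
theorem IsIteratedBlowup.contMDiff_and_principal {L : List (Set M)} {β : X → M}
    (hX : IsIteratedBlowup M L X β) {T : List (Set M × Bool)} (hT : IsGoodList T)
    (hTL : T.map Prod.fst = L) :
    ContMDiff (QM n) (QM n) ∞ β ∧ (∀ z, LocalBMapAt n β z) ∧
      ∀ Q ∈ T, ∀ z, PrincipalMonomialAt n β Q.1 z := by
  induction hX with
  | nil M =>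
    obtain rfl := List.map_eq_nil_iff.1 hTL
    exact ⟨contMDiff_id, fun z t ht => ht, by simp⟩
  | @cons M Y X P L β γ hP hβ hγ ih =>
    obtain ⟨⟨P', b⟩, T, rfl, hP', hT'⟩ := List.map_eq_cons_iff.1 hTL
    obtain rfl : P' = P := hP'
    subst hT'
    obtain ⟨hs, hb, hp⟩ := ih (hT.lift hβ) (map_fst_map_liftTagged β P' T)
    have hbc : ∀ z, LocalBMapAt n (β ∘ γ) z := fun z => (hβ.localBMapAt (γ z)).comp (hb z)
    have hsc := hβ.contMDiff.comp hs
    have hhead : ∀ z, ∀ ρ, MonomialAt n ρ (γ z) → PrincipalAt n β P' ρ (γ z) →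
        PrincipalMonomialAt n (β ∘ γ) P' z := fun z ρ hρ h =>
      ⟨_, hb z ρ hρ, h.comp (hs.smoothMapNear z)⟩
    refine ⟨hsc, hbc, fun Q hQ z => ?_⟩
    obtain ⟨ρ₀, hρ₀, hp₀⟩ := hβ.principalMonomialAt hP.1 (γ z)
    rcases List.mem_cons.1 hQ with rfl | hQT
    · exact hhead z ρ₀ hρ₀ hp₀
    obtain ⟨Q, c⟩ := Q
    cases c with
    | true =>
      exact (hT.isHypersurfaceLike _ hQ rfl).principalMonomialAt (hsc.smoothMapNear z) (hbc z)
    | false =>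
      by_cases hz : β (γ z) ∈ Q
      swap
      · exact PrincipalMonomialAt.of_not_mem ((hT.psub_tail hQT).1.isOpen_compl.mem_nhds hz)
          (hsc.smoothMapNear z)
      -- A centre inside an untagged head coincides with it locally, so it has the same ideal.
      by_cases hQP : Q ⊆ P'
      · cases b with
        | true => exact absurd hQP (hT.not_subset_head hQT hz)
        | false =>
          obtain ⟨t, ht, h1⟩ := hhead z ρ₀ hρ₀ hp₀
          refine ⟨t, ht, h1.congr_set ?_⟩
          filter_upwards [hT.head_subset hQT (hQP hz) hz] with q hq
          exact ⟨fun h => hQP h, hq⟩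
      -- The generator is `ρ ∘ γ` times the generator that the later blow-ups provide for the lift
      -- of `Q`.
      · obtain ⟨ρ, hρ, -, h1⟩ := hT.exists_totalTransformAt hβ (γ z)
        obtain ⟨t, ht, h2⟩ := hp _ (List.mem_map_of_mem hQT) z
        exact ⟨_, (hb z ρ hρ).mul ht, (h1 Q hQT hQP hz).principalAt_comp
          (hβ.contMDiff.smoothMapNear _) (hs.smoothMapNear z) ht.regularAt h2⟩

/-- The universal property of iterated blow-ups. -/
theorem IsIteratedBlowup.exists_lift {L : List (Set M)} {β : X → M}
    (hX : IsIteratedBlowup M L X β) {T : List (Set M × Bool)} (hT : IsGoodList T)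
    (hTL : T.map Prod.fst = L) {g : Z → M} (hg : ContMDiff (QM n) (QM n) ∞ g)
    (hb : ∀ z, LocalBMapAt n g z) (hp : ∀ Q ∈ T, ∀ z, PrincipalMonomialAt n g Q.1 z) :
    ∃ G : Z → X, ContMDiff (QM n) (QM n) ∞ G ∧ (∀ z, LocalBMapAt n G z) ∧ β ∘ G = g ∧
      ∀ G' : Z → X, Continuous G' → β ∘ G' = g → G' = G := by
  induction hX with
  | nil M => exact ⟨g, hg, hb, rfl, fun G' _ h => h⟩
  | @cons M Y X P L β γ hP hβ hγ ih =>
    obtain ⟨⟨P', b⟩, T, rfl, hP', hT'⟩ := List.map_eq_cons_iff.1 hTL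
    obtain rfl : P' = P := hP'
    subst hT'
    have hpP := hp _ List.mem_cons_self
    obtain ⟨g₁, hg₁, he₁, hb₁⟩ := hβ.exists_lift hP hg hpP
    have hb₁' := fun z => hb₁ z (hb z)
    obtain ⟨G, hG, hbG, he, huniq⟩ := ih (hT.lift hβ) (map_fst_map_liftTagged β P' T) hg₁ hb₁'
      (hT.principalMonomialAt_lift hβ hg₁ hb₁' fun Q hQ z => by
        rw [he₁]
        exact hp _ (List.mem_cons_of_mem _ hQ) z)
    have hγs : Continuous γ := (hγ.contMDiff_and_principal (hT.lift hβ)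
      (map_fst_map_liftTagged β P' T)).1.continuous
    refine ⟨G, hG, hbG, by rw [Function.comp_assoc, he, he₁], fun G' hG' h' => huniq G' hG' ?_⟩
    exact hβ.eq_of_comp_eq hP hg hpP (hγs.comp hG') hg₁.continuous h' he₁

theorem map_fst_map_false (L : List (Set M)) : (L.map fun P => (P, false)).map Prod.fst = L := by
  rw [List.map_map]
  exact List.map_id L

/-- The iterated blow-up of a clean family factors through that of a clean subfamily. -/
theorem IsIteratedBlowup.exists_factorization {G : Set (Set M)} (hF : IsCleanFamily F)
    (hG : IsCleanFamily G) (hGF : G ⊆ F) {L L' : List (Set M)} (hL : IsSizeOrder F L)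
    (hL' : IsSizeOrder G L') {β : X → M} {β' : Y → M} (hX : IsIteratedBlowup M L X β)
    (hY : IsIteratedBlowup M L' Y β') :
    ∃ f : X → Y, ContMDiff (QM n) (QM n) ∞ f ∧ (∀ z, LocalBMapAt n f z) ∧ β' ∘ f = β ∧
      ∀ f' : X → Y, Continuous f' → β' ∘ f' = β → f' = f := by
  obtain ⟨hs, hb, hp⟩ := hX.contMDiff_and_principal (hL.isGoodList hF) (map_fst_map_false L)
  -- The condition for lifting concerns the centres one by one; their order in `L` and `L'` plays no
  -- role.
  refine hY.exists_lift (hL'.isGoodList hG) (map_fst_map_false L') hs hb fun Q hQ z => ?_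
  obtain ⟨P, hP, rfl⟩ := List.mem_map.1 hQ
  exact hp _ (List.mem_map.2 ⟨P, (hL.mem_iff P).2 (hGF ((hL'.mem_iff P).1 hP)), rfl⟩) z

/-- The factorizations in both directions are inverse to each other, by uniqueness of the
factorization of a blow-up through itself. -/
theorem IsIteratedBlowup.existsUnique_diffeomorph (hF : IsCleanFamily F) {L L' : List (Set M)}
    (hL : IsSizeOrder F L) (hL' : IsSizeOrder F L') {β : X → M} {β' : Y → M}
    (hX : IsIteratedBlowup M L X β) (hY : IsIteratedBlowup M L' Y β') :
    ∃! Φ : Diffeomorph (QM n) (QM n) X Y ∞, β' ∘ Φ = β := by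
  obtain ⟨f, hf, -, hfe, hfu⟩ := hX.exists_factorization hF hF Subset.rfl hL hL' hY
  obtain ⟨g, hg, -, hge, -⟩ := hY.exists_factorization hF hF Subset.rfl hL' hL hX
  obtain ⟨_, -, -, -, hu⟩ := hX.exists_factorization hF hF Subset.rfl hL hL hX
  obtain ⟨_, -, -, -, hu'⟩ := hY.exists_factorization hF hF Subset.rfl hL' hL' hY
  have h1 : g ∘ f = id := (hu _ (hg.continuous.comp hf.continuous)
    (by rw [← Function.comp_assoc, hge, hfe])).trans (hu _ continuous_id rfl).symm
  have h2 : f ∘ g = id := (hu' _ (hf.continuous.comp hg.continuous)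
    (by rw [← Function.comp_assoc, hfe, hge])).trans (hu' _ continuous_id rfl).symm
  refine ⟨⟨⟨f, g, congrFun h1, congrFun h2⟩, hf, hg⟩, hfe, fun Φ hΦ => ?_⟩
  exact DFunLike.coe_injective (hfu Φ Φ.contMDiff.continuous hΦ)

theorem IsCleanFamily.mono {G : Set (Set M)} (hF : IsCleanFamily F) (hGF : G ⊆ F)
    (hG : InterClosed G) : IsCleanFamily G :=
  ⟨fun P hP => hF.isPSubmanifold P (hGF hP), fun P hP Q hQ => hF.clean P (hGF hP) Q (hGF hQ), hG⟩

end IteratedBlowups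

/-! ### From local b-maps to b-maps: exponents along boundary hypersurfaces. -/

section Hypersurfaces

variable {n : ℕ} {X Y : CornerManifold.{u} n} {H H' : Set X} {x q : X} {t : X → ℝ}
  {ψ : OpenPartialHomeomorph X (EuclideanQuadrant n)} {m m' : ℕ}

/-- Boundary defining functions are positive multiples of boundary coordinates. -/
theorem IsBoundaryDefining.exists_eq_mul {ρ : X → ℝ} (h : IsBoundaryDefining ρ H)
    (hψ : ψ ∈ IsManifold.maximalAtlas (QM n) ∞ X) (hx : x ∈ ψ.source) {k : Fin n}
    (hk : (ψ x).1 k = 0) (hH : ∀ᶠ q in 𝓝 x, q ∈ H ↔ (ψ q).1 k = 0) :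
    ∃ a, SmoothNear n a x ∧ 0 < a x ∧ ∀ᶠ q in 𝓝 x, ρ q = a q * (ψ q).1 k := by
  have hs : SmoothNear n ρ x := Filter.Eventually.of_forall fun q => h.contMDiff q
  have hv : ∀ᶠ q in 𝓝 x, (∀ i ∈ ({k} : Set (Fin n)), (ψ q).1 i = (ψ x).1 i) → ρ q = 0 := by
    filter_upwards [hH] with q hq hi
    exact (h.zero_iff q).2 (hq.2 ((hi k rfl).trans hk))
  obtain ⟨c, hc, hc0, he⟩ := exists_eq_sum_of_vanish hψ hx {k} hs hv
  have he' : ∀ᶠ q in 𝓝 x, ρ q = c k q * (ψ q).1 k := by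
    filter_upwards [he] with q hq
    rw [hq, Finset.sum_eq_single k]
    · rw [hk, sub_zero]
    · intro i _ hi
      rw [hc0 i (by simpa using hi)]
      simp
    · simp
  -- The factor is not negative because `ρ ≥ 0` at nearby interior points, and not zero because the
  -- differential of `ρ` would vanish at `x`.
  refine ⟨c k, hc k, lt_of_le_of_ne ?_ fun h0 => ?_, he'⟩
  · by_contra! hneg
    obtain ⟨y, ⟨-, h1⟩, h2, h3⟩ := ((frequently_coord_pos hx).and_eventually
      (he'.and ((hc k).continuousAt.eventually (gt_mem_nhds hneg)))).exists
    exact absurd (h.nonneg y) (not_le.2 (h2 ▸ mul_neg_of_neg_of_pos h3 (h1 k)))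
  · refine h.mfderiv_ne_zero x (hH.self_of_nhds.2 hk) ?_
    have hch : chartAt _ x ∈ IsManifold.maximalAtlas (QM n) ∞ X :=
      IsManifold.chart_mem_maximalAtlas x
    have h1 : mfderiv (QM n) 𝓘(ℝ, ℝ) ρ x = chartDeriv (chartAt _ x) ρ x :=
      ((h.contMDiff x).mdifferentiableAt (by simp)).mfderiv
    have h2 : chartDeriv (chartAt (EuclideanQuadrant n) x) ρ x = 0 := by
      rw [chartDeriv_congr hch (mem_chart_source _ x) he'
        ((hc k).mul (SmoothNear.coord hψ hx k)),
        chartDeriv_mul hch (mem_chart_source _ x) (hc k) (SmoothNear.coord hψ hx k), ← h0, hk]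
      simp
    exact h1.trans h2

/-- The sheet of the boundary near `x` that is given by a boundary coordinate. -/
theorem exists_sheet (hx : x ∈ ψ.source) {i : Fin n} (hi : (ψ x).1 i = 0) :
    ∃ S : Set X, IsPreconnected S ∧ (∀ q ∈ S, q ∈ ψ.source ∧ ∀ j, (ψ q).1 j = 0 ↔ j = i) ∧
      (∀ᶠ q in 𝓝 x, (∀ j, (ψ q).1 j = 0 ↔ j = i) → q ∈ S) ∧ ∃ᶠ q in 𝓝 x, q ∈ S := by
  classical
  obtain ⟨ε, hε, hb⟩ := exists_quadrantBall hx (E := fun _ => True)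
    (Filter.Eventually.of_forall fun _ => trivial)
  have hev : ∀ᶠ q in 𝓝 x, q ∈ ψ.source ∧ (ψ q).1 ∈ quadrantBall (ψ x).1 ε :=
    Filter.Eventually.and (ψ.open_source.mem_nhds hx) (eventually_mem_quadrantBall hx hε)
  refine ⟨_, isPreconnected_sheet (fun y hy => (hb y hy).1) i, fun q hq => ⟨hq.1, hq.2.2⟩,
    hev.mono fun q hq h => ⟨hq.1, hq.2, h⟩, ?_⟩
  refine ((frequently_coord_add hx (v := fun l => if l = i then 0 else 1)
    (fun l _ => by split_ifs <;> norm_num)).and_eventually hev).mono ?_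
  rintro q ⟨⟨-, δ, hδ, he⟩, hq⟩
  refine ⟨hq.1, hq.2, fun j => ?_⟩
  rw [he j]
  by_cases hji : j = i
  · subst hji
    simp [hi]
  · simp only [hji, if_false, mul_one, iff_false]
    exact (add_pos_of_nonneg_of_pos ((ψ x).2 j) hδ).ne'

theorem IsBoundaryHypersurface.exists_coord (hH : IsBoundaryHypersurface n H) (hxH : x ∈ H)
    (hψ : ψ ∈ IsManifold.maximalAtlas (QM n) ∞ X) (hx : x ∈ ψ.source) :
    ∃ k, (ψ x).1 k = 0 ∧ ∀ᶠ q in 𝓝 x, q ∈ H ↔ (ψ q).1 k = 0 := by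
  obtain ⟨χ, hχ, hxχ, l, hl, he⟩ := X.embedded H hH x hxH
  obtain ⟨k, hk, hke⟩ := exists_zero_iff hψ hχ hx hxχ hl
  refine ⟨k, hk, ?_⟩
  filter_upwards [hke, χ.open_source.mem_nhds hxχ] with q h1 h2
  rw [← h1]
  have h3 := Set.ext_iff.1 he q
  exact ⟨fun h => (h3.1 ⟨h, h2⟩).2, fun h => (h3.2 ⟨h2, h⟩).1⟩

/-- A component of the set of points of codimension one, the closure of which contains `x`, meets
the corresponding sheet of the boundary near `x`. -/
theorem frequently_mem_component (hψ : ψ ∈ IsManifold.maximalAtlas (QM n) ∞ X)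
    (hx : x ∈ ψ.source) {p : X}
    (hxp : x ∈ closure (connectedComponentIn {q : X | cornerCodim n q = 1} p)) {k : Fin n}
    (hk : ∀ᶠ q in 𝓝 x, q ∈ closure (connectedComponentIn {q : X | cornerCodim n q = 1} p) →
      (ψ q).1 k = 0) :
    ∃ᶠ q in 𝓝 x, q ∈ connectedComponentIn {q : X | cornerCodim n q = 1} p ∧
      ∀ j, (ψ q).1 j = 0 ↔ j = k := by
  refine ((mem_closure_iff_frequently.1 hxp).and_eventually
    (Filter.Eventually.and hk (ψ.open_source.mem_nhds hx))).mono ?_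
  rintro q ⟨h1, h2, h3⟩
  have hq1 : q ∈ {q : X | cornerCodim n q = 1} := connectedComponentIn_subset _ _ h1
  obtain ⟨i, hi⟩ := (cornerCodim_eq_one_iff hψ h3).1 hq1
  obtain rfl := (hi k).1 (h2 (subset_closure h1))
  exact ⟨h1, hi⟩

theorem connectedComponentIn_eq_of_sheet (hψ : ψ ∈ IsManifold.maximalAtlas (QM n) ∞ X) {S : Set X}
    (hS : IsPreconnected S) {k : Fin n} (hSk : ∀ q ∈ S, q ∈ ψ.source ∧ ∀ j, (ψ q).1 j = 0 ↔ j = k)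
    {p : X} (hqp : q ∈ connectedComponentIn {q : X | cornerCodim n q = 1} p) (hq : q ∈ S) :
    S ⊆ connectedComponentIn {q : X | cornerCodim n q = 1} p := by
  rw [connectedComponentIn_eq hqp]
  exact hS.subset_connectedComponentIn hq fun y hy =>
    (cornerCodim_eq_one_iff hψ (hSk y hy).1).2 ⟨k, (hSk y hy).2⟩

/-- Both generating components meet, hence contain, the connected sheet on which only `ψ_k`
vanishes. -/
theorem IsBoundaryHypersurface.eq_of_coord (hH : IsBoundaryHypersurface n H)
    (hH' : IsBoundaryHypersurface n H') (hxH : x ∈ H) (hxH' : x ∈ H')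
    (hψ : ψ ∈ IsManifold.maximalAtlas (QM n) ∞ X) (hx : x ∈ ψ.source) {k : Fin n}
    (hk : ∀ᶠ q in 𝓝 x, q ∈ H ↔ (ψ q).1 k = 0) (hk' : ∀ᶠ q in 𝓝 x, q ∈ H' ↔ (ψ q).1 k = 0) :
    H = H' := by
  obtain ⟨p, hp, rfl⟩ := hH
  obtain ⟨p', hp', rfl⟩ := hH'
  obtain ⟨S, hS, hSk, hS', -⟩ := exists_sheet hx (hk.self_of_nhds.1 hxH)
  obtain ⟨q, ⟨hq, hqk⟩, hqS⟩ := ((frequently_mem_component hψ hx hxH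
    (hk.mono fun q h => h.1)).and_eventually hS').exists
  obtain ⟨q', ⟨hq', hqk'⟩, hqS'⟩ := ((frequently_mem_component hψ hx hxH'
    (hk'.mono fun q h => h.1)).and_eventually hS').exists
  have h1 := connectedComponentIn_eq_of_sheet hψ hS hSk hq (hqS hqk) (hqS' hqk')
  rw [connectedComponentIn_eq h1, connectedComponentIn_eq hq']

theorem exists_isBoundaryHypersurface (hψ : ψ ∈ IsManifold.maximalAtlas (QM n) ∞ X)
    (hx : x ∈ ψ.source) {k : Fin n} (hk : (ψ x).1 k = 0) :
    ∃ H : Set X, IsBoundaryHypersurface n H ∧ x ∈ H ∧ ∀ᶠ q in 𝓝 x, q ∈ H ↔ (ψ q).1 k = 0 := by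
  obtain ⟨S, hS, hSk, -, hSx⟩ := exists_sheet hx hk
  obtain ⟨p, hp⟩ := hSx.exists
  have hp1 : cornerCodim n p = 1 := (cornerCodim_eq_one_iff hψ (hSk p hp).1).2 ⟨k, (hSk p hp).2⟩
  have hSC := connectedComponentIn_eq_of_sheet hψ hS hSk
    (mem_connectedComponentIn (F := {q : X | cornerCodim n q = 1}) hp1) hp
  have hH : IsBoundaryHypersurface n
      (closure (connectedComponentIn {q : X | cornerCodim n q = 1} p)) := ⟨p, hp1, rfl⟩
  have hxH := mem_closure_iff_frequently.2 (hSx.mono fun q hq => hSC hq)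
  obtain ⟨l, hl, hle⟩ := hH.exists_coord hxH hψ hx
  obtain ⟨q, hq, hql⟩ := (hSx.and_eventually hle).exists
  obtain rfl : l = k := ((hSk q hq).2 l).1 (hql.1 (subset_closure (hSC hq)))
  exact ⟨_, hH, hxH, hle⟩

theorem prod_pow_single (f : Fin n → ℝ) (l : Fin n) (m : ℕ) :
    ∏ k, f k ^ (Pi.single l m : Fin n → ℕ) k = f l ^ m := by
  rw [Finset.prod_eq_single l]
  · rw [Pi.single_eq_same]
  · intro k _ hk
    rw [Pi.single_eq_of_ne hk, pow_zero]
  · simp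

/-- At the point `q` of codimension one, `t` is a positive multiple of the `m`-th power of the
boundary coordinate. -/
def HasOrderAt (t : X → ℝ) (q : X) (m : ℕ) : Prop :=
  ∃ ψ ∈ IsManifold.maximalAtlas (QM n) ∞ X, q ∈ ψ.source ∧
    ∃ i, (∀ j, (ψ q).1 j = 0 ↔ j = i) ∧ MonomialWith ψ (Pi.single i m) t q

theorem MonomialWith.hasOrderAt {e : Fin n → ℕ} (hψ : ψ ∈ IsManifold.maximalAtlas (QM n) ∞ X)
    (hq : q ∈ ψ.source) {i : Fin n} (hi : ∀ j, (ψ q).1 j = 0 ↔ j = i) {a : X → ℝ}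
    (ha : SmoothNear n a q) (hp : 0 < a q)
    (he : ∀ᶠ y in 𝓝 q, t y = a y * ∏ k, (ψ y).1 k ^ e k) : HasOrderAt t q (e i) := by
  refine ⟨ψ, hψ, hq, i, hi, fun k hk => ?_,
    fun y => a y * ∏ k ∈ Finset.univ.erase i, (ψ y).1 k ^ e k,
    ha.mul (SmoothNear.prod fun k _ => (SmoothNear.coord hψ hq k).pow _), mul_pos hp
      (Finset.prod_pos fun k hk => pow_pos (lt_of_le_of_ne ((ψ q).2 k) fun h => ?_) _), ?_⟩
  · rw [Pi.single_apply, if_neg]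
    exact fun h => hk ((hi k).2 h)
  · exact Finset.ne_of_mem_erase hk ((hi k).1 h.symm)
  · filter_upwards [he] with y hy
    rw [hy, prod_pow_single, ← Finset.mul_prod_erase _ _ (Finset.mem_univ i)]
    ring

theorem MonomialAt.exists_hasOrderAt (h : MonomialAt n t q) (hq : cornerCodim n q = 1) :
    ∃ m, HasOrderAt t q m := by
  obtain ⟨ψ, hψ, hqψ, e, -, a, ha, hp, he⟩ := h
  obtain ⟨i, hi⟩ := (cornerCodim_eq_one_iff hψ hqψ).1 hq
  exact ⟨e i, MonomialWith.hasOrderAt hψ hqψ hi ha hp he⟩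

/-- At a point of codimension one the only boundary coordinates of the two charts differ by a unit,
so the exponents can be compared in one chart. -/
theorem HasOrderAt.le (h : HasOrderAt t q m) (h' : HasOrderAt t q m') : m ≤ m' := by
  obtain ⟨ψ, hψ, hq, i, hi, -, a, ha, hp, he⟩ := h
  obtain ⟨ψ', hψ', hq', i', hi', hm'⟩ := h'
  obtain ⟨j, hj, b, hb, hbp, hbe⟩ := exists_boundary_coord hψ' hψ hq' hq ((hi i).2 rfl)
  obtain rfl := (hi' j).1 hj
  have hm : MonomialWith ψ' (Pi.single j m) t q := by
    refine ⟨fun k hk => ?_, fun y => a y * b y ^ m, ha.mul (hb.pow m),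
      mul_pos hp (pow_pos hbp m), ?_⟩
    · rw [Pi.single_apply, if_neg]
      exact fun h => hk ((hi' k).2 h)
    · filter_upwards [he, hbe] with y h1 h2
      rw [h1, prod_pow_single, prod_pow_single, h2]
      ring
  have h1 := hm'.le_of_eq_mul hq' hm (SmoothNear.const 1)
    (Filter.Eventually.of_forall fun y => by simp) j
  simpa using h1

theorem HasOrderAt.eq (h : HasOrderAt t q m) (h' : HasOrderAt t q m') : m = m' :=
  le_antisymm (h.le h') (h'.le h)

theorem HasOrderAt.eventually (h : HasOrderAt t q m) :
    ∀ᶠ y in 𝓝 q, cornerCodim n y = 1 → HasOrderAt t y m := by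
  obtain ⟨ψ, hψ, hq, i, hi, -, a, ha, hp, he⟩ := h
  have h0 : ∀ᶠ y in 𝓝 q, ∀ j, (ψ y).1 j = 0 → j = i := by
    refine Filter.eventually_all.2 fun j => ?_
    by_cases hj : j = i
    · exact Filter.Eventually.of_forall fun _ _ => hj
    · filter_upwards [(SmoothNear.coord hψ hq j).eventually_ne fun h => hj ((hi j).1 h)] with y hy h
      exact absurd h hy
  filter_upwards [h0, ψ.open_source.mem_nhds hq, ha.eventually, ha.eventually_pos hp,
    he.eventually_nhds] with y h1 h2 h3 h4 h5 hy
  obtain ⟨k, hk⟩ := (cornerCodim_eq_one_iff hψ h2).1 hy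
  obtain rfl := h1 k ((hk k).2 rfl)
  have h6 := MonomialWith.hasOrderAt hψ h2 hk h3 h4 h5
  rwa [Pi.single_eq_same] at h6

/-- By `HasOrderAt.eventually` the order is locally constant on points of codimension one, hence
constant on connected sets of them. -/
theorem HasOrderAt.of_isPreconnected (ht : ∀ x, MonomialAt n t x) {C : Set X}
    (hC : IsPreconnected C) (hC1 : ∀ q ∈ C, cornerCodim n q = 1) {p : X} (hp : p ∈ C) (hq : q ∈ C)
    (h : HasOrderAt t p m) : HasOrderAt t q m := by
  -- Connectedness is tested with open sets of `X`, so the condition on the order is stated on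
  -- neighbourhoods and only at their points of codimension one.
  let U (A : ℕ → Prop) : Set X :=
    {y | ∀ᶠ z in 𝓝 y, cornerCodim n z = 1 → ∃ k, A k ∧ HasOrderAt t z k}
  have hU : ∀ A, IsOpen (U A) := fun A => isOpen_iff_mem_nhds.2 fun y hy =>
    (Filter.Eventually.eventually_nhds hy)
  have hmem : ∀ (A : ℕ → Prop) (y : X) (k : ℕ), A k → HasOrderAt t y k → y ∈ U A :=
    fun A y k hA hy => hy.eventually.mono fun z hz h1 => ⟨k, hA, hz h1⟩
  obtain ⟨l, hl⟩ := (ht q).exists_hasOrderAt (hC1 q hq)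
  by_cases hlm : l = m
  · rwa [← hlm]
  obtain ⟨y, hy, h1, h2⟩ := hC (U fun k => k = m) (U fun k => k ≠ m) (hU _) (hU _)
    (fun y hy => by
      obtain ⟨k, hk⟩ := (ht y).exists_hasOrderAt (hC1 y hy)
      by_cases hkm : k = m
      · exact Or.inl (hmem _ y k hkm hk)
      · exact Or.inr (hmem _ y k hkm hk))
    ⟨p, hp, hmem _ p m rfl h⟩ ⟨q, hq, hmem _ q l hlm hl⟩
  obtain ⟨k, hk, hk'⟩ := Filter.Eventually.self_of_nhds h1 (hC1 y hy)
  obtain ⟨k', hk1, hk1'⟩ := Filter.Eventually.self_of_nhds h2 (hC1 y hy)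
  exact absurd (hk1'.eq (hk ▸ hk')) hk1

theorem IsBoundaryDefining.monomialAt {ρ : X → ℝ} (h : IsBoundaryDefining ρ H)
    (hH : IsBoundaryHypersurface n H) (x : X) : MonomialAt n ρ x := by
  have hch : chartAt _ x ∈ IsManifold.maximalAtlas (QM n) ∞ X :=
    IsManifold.chart_mem_maximalAtlas x
  by_cases hx : x ∈ H
  · obtain ⟨k, hk, he⟩ := hH.exists_coord hx hch (mem_chart_source _ x)
    obtain ⟨a, ha, hp, hae⟩ := h.exists_eq_mul hch (mem_chart_source _ x) hk he
    exact ((MonomialAt.of_pos ha hp).mul (MonomialAt.coord hch (mem_chart_source _ x) k)).congr hae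
  · exact MonomialAt.of_pos (Filter.Eventually.of_forall fun q => h.contMDiff q)
      (lt_of_le_of_ne (h.nonneg x) fun h0 => hx ((h.zero_iff x).1 h0.symm))

/-- A function that is locally a positive function times a monomial is near each point a positive
function times a product of powers of boundary defining functions, with global exponents. -/
theorem exists_exponents (ht : ∀ x, MonomialAt n t x) : ∃ e : Set X → ℕ,
    ∀ r : Set X → X → ℝ, (∀ H', IsBoundaryHypersurface n H' → IsBoundaryDefining (r H') H') →
    ∀ x : X, ∃ a : X → ℝ, ContMDiffAt (QM n) 𝓘(ℝ, ℝ) ∞ a x ∧ 0 < a x ∧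
      ∀ᶠ y in 𝓝 x, t y =
        a y * ∏ᶠ H' ∈ {H' : Set X | IsBoundaryHypersurface n H' ∧ x ∈ H'}, r H' y ^ e H' := by
  classical
  have hex : ∀ H : Set X, ∃ m, IsBoundaryHypersurface n H → ∃ p : X, cornerCodim n p = 1 ∧
      H = closure (connectedComponentIn {q : X | cornerCodim n q = 1} p) ∧ HasOrderAt t p m := by
    intro H
    by_cases hH : IsBoundaryHypersurface n H
    · obtain ⟨p, hp, hpH⟩ := id hH
      obtain ⟨m, hm⟩ := (ht p).exists_hasOrderAt hp
      exact ⟨m, fun _ => ⟨p, hp, hpH, hm⟩⟩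
    · exact ⟨0, fun h => absurd h hH⟩
  -- The exponent of a hypersurface is the order of `t` at one chosen point of the component
  -- generating it.
  choose e he using hex
  refine ⟨e, fun r hr x => ?_⟩
  obtain ⟨ψ, hψ, hx, c, hc0, a, ha, hap, hae⟩ := ht x
  have hHk : ∀ k, ∃ H : Set X, (ψ x).1 k = 0 → IsBoundaryHypersurface n H ∧ x ∈ H ∧
      ∀ᶠ q in 𝓝 x, q ∈ H ↔ (ψ q).1 k = 0 := by
    intro k
    by_cases hk : (ψ x).1 k = 0
    · obtain ⟨H, hH⟩ := exists_isBoundaryHypersurface hψ hx hk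
      exact ⟨H, fun _ => hH⟩
    · exact ⟨∅, fun h => absurd h hk⟩
  choose H hH using hHk
  -- The component generating `H k` has points near `x` where only `ψ_k` vanishes. There the order
  -- is the local exponent `c k`, and it equals the order at the chosen point.
  have hexp : ∀ k, (ψ x).1 k = 0 → e (H k) = c k := by
    intro k hk
    obtain ⟨hHb, hxH, hHe⟩ := hH k hk
    obtain ⟨p, hp, hpH, hm⟩ := he _ hHb
    rw [hpH] at hxH hHe
    obtain ⟨q, ⟨hqC, hqk⟩, h1, h2, h3, h4⟩ := ((frequently_mem_component hψ hx hxH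
      (hHe.mono fun q h => h.1)).and_eventually (Filter.Eventually.and (ψ.open_source.mem_nhds hx)
        (ha.eventually.and ((ha.eventually_pos hap).and hae.eventually_nhds)))).exists
    exact (HasOrderAt.of_isPreconnected ht isPreconnected_connectedComponentIn
      (connectedComponentIn_subset _ _) (mem_connectedComponentIn hp) hqC hm).eq
      (MonomialWith.hasOrderAt hψ h1 hqk h2 h3 h4)
  have hu : ∀ k, ∃ u : X → ℝ, SmoothNear n u x ∧ 0 < u x ∧
      ((ψ x).1 k = 0 → ∀ᶠ q in 𝓝 x, r (H k) q = u q * (ψ q).1 k) := by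
    intro k
    by_cases hk : (ψ x).1 k = 0
    · obtain ⟨hHb, -, hHe⟩ := hH k hk
      obtain ⟨u, hu, hup, hue⟩ := (hr _ hHb).exists_eq_mul hψ hx hk hHe
      exact ⟨u, hu, hup, fun _ => hue⟩
    · exact ⟨fun _ => 1, SmoothNear.const 1, one_pos, fun h => absurd h hk⟩
  choose u hu hup hue using hu
  set s : Finset (Fin n) := Finset.univ.filter fun k => (ψ x).1 k = 0 with hs
  have hset : {H' : Set X | IsBoundaryHypersurface n H' ∧ x ∈ H'} = H '' (s : Set (Fin n)) := by
    ext H'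
    constructor
    · rintro ⟨h1, h2⟩
      obtain ⟨k, hk, hke⟩ := h1.exists_coord h2 hψ hx
      exact ⟨k, by simp [hs, hk], (hH k hk).1.eq_of_coord h1 (hH k hk).2.1 h2 hψ hx
        (hH k hk).2.2 hke⟩
    · rintro ⟨k, hk, rfl⟩
      have hk' : (ψ x).1 k = 0 := by simpa [hs] using hk
      exact ⟨(hH k hk').1, (hH k hk').2.1⟩
  have hinj : InjOn H (s : Set (Fin n)) := by
    intro k hk l hl hkl
    have hk' : (ψ x).1 k = 0 := by simpa [hs] using hk
    have hl' : (ψ x).1 l = 0 := by simpa [hs] using hl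
    refine eq_of_zero_iff hx hk' ?_ hl'
    filter_upwards [(hH k hk').2.2, (hH l hl').2.2] with q h1 h2 h3
    rw [← h2, ← hkl, h1]
    exact h3
  have hU : SmoothNear n (fun y => ∏ k ∈ s, u k y ^ c k) x :=
    SmoothNear.prod fun k _ => (hu k).pow _
  have hUp : 0 < ∏ k ∈ s, u k x ^ c k := Finset.prod_pos fun k _ => pow_pos (hup k) _
  refine ⟨fun y => a y / ∏ k ∈ s, u k y ^ c k, (ha.div hU hUp.ne').contMDiffAt,
    div_pos hap hUp, ?_⟩
  rw [hset]
  have hue' : ∀ᶠ q in 𝓝 x, ∀ k ∈ s, r (H k) q = u k q * (ψ q).1 k :=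
    (Filter.eventually_all_finset s).2 fun k hk => hue k (by simpa [hs] using hk)
  filter_upwards [hae, hue', hU.eventually_ne hUp.ne'] with y h1 h2 h3
  rw [finprod_mem_image hinj, finprod_mem_coe_finset, h1]
  have h4 : ∏ k, (ψ y).1 k ^ c k = ∏ k ∈ s, (ψ y).1 k ^ c k := by
    refine (Finset.prod_subset (Finset.subset_univ s) fun k _ hk => ?_).symm
    rw [hc0 k (by simpa [hs] using hk), pow_zero]
  have h5 : ∏ k ∈ s, r (H k) y ^ e (H k) = (∏ k ∈ s, u k y ^ c k) * ∏ k ∈ s, (ψ y).1 k ^ c k := by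
    rw [← Finset.prod_mul_distrib]
    refine Finset.prod_congr rfl fun k hk => ?_
    rw [h2 k hk, hexp k (by simpa [hs] using hk), mul_pow]
  rw [h4, h5]
  field_simp

theorem isBMap_of_localBMapAt {f : X → Y} (hf : ContMDiff (QM n) (QM n) ∞ f)
    (hb : ∀ x, LocalBMapAt n f x) : IsBMap f :=
  ⟨hf, fun _ ρ hH hρ => exists_exponents (t := fun x => ρ (f x)) fun x =>
    hb x ρ (hρ.monomialAt hH (f x))⟩

end Hypersurfaces

theorem theorem3p2 {n : ℕ} (M : CornerManifold.{u} n) (F : Set (Set M)) (hfin : F.Finite)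
    (hF : IsCleanFamily F) :
    -- (i) the iterated blow-up is defined in every size order
    (∀ L : List (Set M), IsSizeOrder F L →
      ∃ (X : CornerManifold.{u} n) (β : X → M), IsIteratedBlowup M L X β) ∧
    -- and any two of them are canonically diffeomorphic
    (∀ L L' : List (Set M), IsSizeOrder F L → IsSizeOrder F L' →
      ∀ (X X' : CornerManifold.{u} n) (β : X → M) (β' : X' → M),
        IsIteratedBlowup M L X β → IsIteratedBlowup M L' X' β' →
        ∃! Φ : Diffeomorph (QM n) (QM n) X X' ∞, β' ∘ Φ = β) ∧
    -- (ii) factorization of the blow-down map through the blow-up of a subfamily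
    (∀ G : Set (Set M), G ⊆ F → InterClosed G →
      ∀ L L' : List (Set M), IsSizeOrder F L → IsSizeOrder G L' →
      ∀ (X Y : CornerManifold.{u} n) (β : X → M) (β' : Y → M),
        IsIteratedBlowup M L X β → IsIteratedBlowup M L' Y β' →
        ∃! f : X → Y, IsBMap f ∧ β' ∘ f = β) := by
  refine ⟨fun L hL => ?_, fun L L' hL hL' X X' β β' hX hX' =>
    hX.existsUnique_diffeomorph hF hL hL' hX', fun G hGF hG L L' hL hL' X Y β β' hX hY => ?_⟩
  · obtain ⟨X, β, h⟩ := IsGoodList.exists_isIteratedBlowup _ (hL.isGoodList hF)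
    rw [map_fst_map_false] at h
    exact ⟨X, β, h⟩
  · obtain ⟨f, hf, hb, he, hu⟩ :=
      hX.exists_factorization hF (hF.mono hGF hG) hGF hL hL' hY
    exact ⟨f, ⟨isBMap_of_localBMapAt hf hb, he⟩, fun f' hf' => hu f' hf'.1.1.continuous hf'.2⟩
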